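/- Let $\mathbf k$ be a field and let $A$ be a differential graded open Frobenius $\mathbf k$-algebra of degree $m\in\mathbb Z$: a $\mathbb Z$-graded unital associative algebra with a differential $d$ of degree $+1$ ($d^2=0$, $d(ab)=(da)b+(-1)^{|a|}a\,db$) and a linear map $\delta:A\to A\otimes A$, $\delta x=\sum x'\otimes x''$, of degree $m$, which (with Koszul signs for an operation of degree $m$) commutes with the differentials, is coassociative and cocommutative, and is a left and right $A$-module map: $$\delta d=(-1)^m(d\otimes 1+1\otimes d)\delta,\quad (\delta\otimes 1)\delta=(-1)^m(1\otimes\delta)\delta,\quad \tau\delta=(-1)^m\delta,$$ $$\delta(xy)=(-1)^{m|x|}\sum_{(y)} xy'\otimes y''=\sum_{(x)} x'\otimes x''y,$$ where $\tau(x\otimes y)=(-1)^{|x||y|}y\otimes x$ and $(1\otimes f)(x\otimes y)=(-1)^{|f||x|}x\otimes f(y)$. Let $\bar A=A/\mathbf k 1$ and let $C_*(A,A)=A\otimes T(s\bar A)$ be the normalized Hochschild chain complex, $a_0[a_1,\dots,a_n]$ having degree $|a_0|+\sum_{i\ge1}(|a_i|-1)$. Put $\eta_i=|a_0|+\sum_{1\le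 j\le i}(|a_j|-1)$. The differential $D$, of degree $+1$, is $$\begin{aligned}D(a_0[a_1,\dots,a_n])={}&da_0[a_1,\dots,a_n]-\sum_{i=1}^n(-1)^{\eta_{i-1}}a_0[\dots,da_i,\dots]+(-1)^{|a_0|}a_0a_1[a_2,\dots,a_n]\\&+\sum_{i=1}^{n-1}(-1)^{\eta_i}a_0[\dots,a_ia_{i+1},\dots]-(-1)^{(|a_n|-1)\eta_{n-1}}a_na_0[a_1,\dots,a_{n-1}].\end{aligned}$$ Connes' operator, of degree $-1$, is $$B(a_0[a_1,\dots,a_n])=\sum_{i=1}^{n+1}(-1)^{\varepsilon_i}\,1[a_i,\dots,a_n,a_0,\dots,a_{i-1}],\qquad \varepsilon_i=\Big(\sum_{j<i}(|a_j|-1)\Big)\Big(\sum_{j\ge i}(|a_j|-1)\Big),$$ and the coproduct is $$\theta(a_0[a_1,\dots,a_n])=\sum_{(a_0)}\sum_{i=0}^{n}(-1)^{|a_0''|\sum_{1\le j\le i}(|a_j|-1)}\,a_0'[a_1,\dots,a_i]\otimes a_0''[a_{i+1},\dots,a_n].$$ **(1)** Regrade $C_*(A,A)$ by lowering degrees by $m$,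 and let $\theta_m(x)=\sum(-1)^{m|x'|}x'\otimes x''$, where $\theta(x)=\sum x'\otimes x''$ and $|x'|$ is the original degree; $\theta_m$ has degree $0$ for the new grading. Then $(C_*(A,A),D,\theta_m,B)$ is a homotopy coBV coalgebra. That is, with all Koszul signs taken for the new grading: $D^2=0$; $\theta_m$ is a chain map and is strictly coassociative; $B^2=0$ and $DB+BD=0$; there is a homogeneous chain homotopy $\theta_m\simeq\tau\theta_m$; and there is a homogeneous chain homotopy of maps $C_*(A,A)\to C_*(A,A)^{\otimes3}$ $$\begin{aligned}\theta^{(3)}B\simeq{}&(\theta_m B\otimes1)\theta_m+(1\otimes\theta_m B)\theta_m+\tau_{12}(1\otimes\theta_m B)\theta_m\\&-(B\otimes1\otimes1+1\otimes B\otimes1+1\otimes1\otimes B)\theta^{(3)},\qquad \theta^{(3)}=(1\otimes\theta_m)\theta_m,\end{aligned}$$ where $\tau_{12}$ exchanges the first two factors. **(2)** Let $C^*(A,A^\vee)=\operatorname{Hom}(A\otimes T(s\bar A),\mathbf k)$ be the graded dual complex, $C^n$ consisting of the functionals supported in chain degree $-n$, with differential $f\mapsto\pm f\circ D$, and let $HH^*(A,A^\vee)$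 be its cohomology. For $f\in C^p$ and $g\in C^q$ put $$(f\cup g)(x)=(-1)^{(p+m)q}\sum f(x')\,g(x''),\quad \theta(x)=\sum x'\otimes x'',\qquad B^\vee f=(-1)^{p}f\circ B .$$ Then $\cup$ and $B^\vee$ send cocycles to cocycles and induce well-defined operations on $HH^*(A,A^\vee)$, and the graded space $H$ with $H^n=HH^{-n-m}(A,A^\vee)$ (the classes of functionals on $C_*(A,A)$ supported in degree $n$ for the grading lowered by $m$, so that $B^\vee$, which lowers the degree of cochains by one, has degree $+1$ on $H$), with product $\cup$ and $\Delta=B^\vee$, is a BV-algebra: $\cup$ is a (not necessarily unital) associative and graded commutative product of degree $0$ on $H^*$, $\Delta$ has degree $+1$, $\Delta^2=0$, and the seven-term relation holds: $$\begin{aligned}\Delta(abc)={}&\Delta(ab)c+(-1)^{|a|}a\Delta(bc)+(-1)^{(|a|-1)|b|}b\Delta(ac)\\&-\Delta(a)bc-(-1)^{|a|}a\Delta(b)c-(-1)^{|a|+|b|}ab\Delta(c).\end{aligned}$$ -/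

import Mathlib

open scoped TensorProduct DirectSum

noncomputable section

namespace HochBV

section Graded

/-- The sign `(-1)^n` as a scalar. -/
def sg (k : Type*) [Field k] (n : ℤ) : k := ((n.negOnePow : ℤˣ) : ℤ)

variable {k : Type*} [Field k]
variable {X : Type*} [AddCommGroup X] [Module k X]
variable {Y : Type*} [AddCommGroup Y] [Module k Y]

theorem units_smul_eq (u : ℤˣ) (x : X) : u • x = (((u : ℤˣ) : ℤ) : k) • x := by
  rw [Units.smul_def, Int.cast_smul_eq_zsmul]

/-- The sign operator `x ↦ (-1)^{|x|} x` of a graded vector space. -/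
def sgn (𝒳 : ℤ → Submodule k X) [DirectSum.Decomposition 𝒳] : X →ₗ[k] X :=
  DirectSum.toModule k ℤ X (fun n => sg k n • (𝒳 n).subtype) ∘ₗ
    (DirectSum.decomposeLinearEquiv 𝒳).toLinearMap

theorem sgn_of_mem (𝒳 : ℤ → Submodule k X) [DirectSum.Decomposition 𝒳] {n : ℤ} {x : X}
    (hx : x ∈ 𝒳 n) : sgn 𝒳 x = sg k n • x := by
  lift x to 𝒳 n using hx
  simp [sgn]

/-- The Koszul symmetry `x ⊗ y ↦ (-1)^{|x||y|} y ⊗ x`. -/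
def koszul (𝒳 : ℤ → Submodule k X) (𝒴 : ℤ → Submodule k Y)
    [DirectSum.Decomposition 𝒳] [DirectSum.Decomposition 𝒴] : X ⊗[k] Y →ₗ[k] Y ⊗[k] X :=
  TensorProduct.map (DirectSum.decomposeLinearEquiv 𝒴).symm.toLinearMap
      (DirectSum.decomposeLinearEquiv 𝒳).symm.toLinearMap ∘ₗ
    (TensorProduct.gradedComm k (fun n => 𝒳 n) (fun n => 𝒴 n)).toLinearMap ∘ₗ
    TensorProduct.map (DirectSum.decomposeLinearEquiv 𝒳).toLinearMap
      (DirectSum.decomposeLinearEquiv 𝒴).toLinearMap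

theorem koszul_tmul (𝒳 : ℤ → Submodule k X) (𝒴 : ℤ → Submodule k Y)
    [DirectSum.Decomposition 𝒳] [DirectSum.Decomposition 𝒴] {i j : ℤ} {x : X} {y : Y}
    (hx : x ∈ 𝒳 i) (hy : y ∈ 𝒴 j) :
    koszul 𝒳 𝒴 (x ⊗ₜ y) = sg k (i * j) • (y ⊗ₜ[k] x) := by
  lift x to 𝒳 i using hx
  lift y to 𝒴 j using hy
  simp only [koszul, LinearMap.comp_apply, TensorProduct.map_tmul, LinearEquiv.coe_coe,
    DirectSum.decomposeLinearEquiv_apply_coe, TensorProduct.gradedComm_of_tmul_of]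
  rw [mul_comm j i, Units.smul_def, ← Int.cast_smul_eq_zsmul k, map_smul]
  simp only [TensorProduct.map_tmul, LinearEquiv.coe_coe, DirectSum.decomposeLinearEquiv_symm_lof]
  rfl

/-- The total grading of a tensor product. -/
def tensorGrading (𝒳 : ℤ → Submodule k X) (𝒴 : ℤ → Submodule k Y) (n : ℤ) :
    Submodule k (X ⊗[k] Y) :=
  Submodule.span k {z | ∃ i j : ℤ, i + j = n ∧ ∃ x ∈ 𝒳 i, ∃ y ∈ 𝒴 j, z = x ⊗ₜ[k] y}

theorem tmul_mem_tensorGrading (𝒳 : ℤ → Submodule k X) (𝒴 : ℤ → Submodule k Y) {i j : ℤ}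
    {x : X} {y : Y} (hx : x ∈ 𝒳 i) (hy : y ∈ 𝒴 j) :
    x ⊗ₜ[k] y ∈ tensorGrading 𝒳 𝒴 (i + j) :=
  Submodule.subset_span ⟨i, j, rfl, x, hx, y, hy, rfl⟩

/-- A grading by spans, with a linear map that sorts the spanning vectors by degree. -/
@[reducible]
def decompositionOfSpan (𝒳 : ℤ → Submodule k X) (f : X →ₗ[k] ⨁ n, 𝒳 n)
    (h1 : ∀ x, DirectSum.coeLinearMap 𝒳 (f x) = x)
    (s : ℤ → Set X) (hs : ∀ n, 𝒳 n = Submodule.span k (s n))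
    (h2 : ∀ (n : ℤ) (x : 𝒳 n), (x : X) ∈ s n → f x = DirectSum.lof k ℤ (fun n => 𝒳 n) n x) :
    DirectSum.Decomposition 𝒳 :=
  DirectSum.Decomposition.ofLinearMap 𝒳 f (LinearMap.ext h1) (by
    refine DirectSum.linearMap_ext k fun n => LinearMap.ext fun x => ?_
    have key : ∀ (y : X) (hy : y ∈ Submodule.span k (s n)),
        f y = DirectSum.lof k ℤ (fun n => 𝒳 n) n ⟨y, (hs n).symm ▸ hy⟩ := by
      intro y hy
      induction hy using Submodule.span_induction with
      | mem y hy => exact h2 n ⟨y, _⟩ hy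
      | zero => rw [map_zero]; exact (map_zero _).symm
      | add y z hy hz ihy ihz => rw [map_add, ihy, ihz, ← map_add]; rfl
      | smul c y hy ih => rw [map_smul, ih, ← map_smul]; rfl
    have := key x.1 ((hs n) ▸ x.2)
    simpa using this)

/-- The map sorting a tensor by total degree. -/
def tensorSort (𝒳 : ℤ → Submodule k X) (𝒴 : ℤ → Submodule k Y)
    [DirectSum.Decomposition 𝒳] [DirectSum.Decomposition 𝒴] :
    X ⊗[k] Y →ₗ[k] ⨁ n, tensorGrading 𝒳 𝒴 n :=
  DirectSum.toModule k (ℤ × ℤ) _ (fun p =>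
      DirectSum.lof k ℤ (fun n => tensorGrading 𝒳 𝒴 n) (p.1 + p.2) ∘ₗ
        (TensorProduct.mapIncl (𝒳 p.1) (𝒴 p.2)).codRestrict _ (by
          intro z
          induction z using TensorProduct.induction_on with
          | zero => rw [map_zero]; exact zero_mem _
          | tmul x y => exact tmul_mem_tensorGrading 𝒳 𝒴 x.2 y.2
          | add x y hx hy => rw [map_add]; exact add_mem hx hy)) ∘ₗ
    (TensorProduct.directSum k k (fun n => 𝒳 n) (fun n => 𝒴 n)).toLinearMap ∘ₗ
      TensorProduct.map (DirectSum.decomposeLinearEquiv 𝒳).toLinearMap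
        (DirectSum.decomposeLinearEquiv 𝒴).toLinearMap

theorem tensorSort_tmul (𝒳 : ℤ → Submodule k X) (𝒴 : ℤ → Submodule k Y)
    [DirectSum.Decomposition 𝒳] [DirectSum.Decomposition 𝒴] {i j : ℤ} {x : X} {y : Y}
    (hx : x ∈ 𝒳 i) (hy : y ∈ 𝒴 j) :
    tensorSort 𝒳 𝒴 (x ⊗ₜ y) = DirectSum.lof k ℤ (fun n => tensorGrading 𝒳 𝒴 n) (i + j)
      ⟨x ⊗ₜ y, tmul_mem_tensorGrading 𝒳 𝒴 hx hy⟩ := by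
  lift x to 𝒳 i using hx
  lift y to 𝒴 j using hy
  simp only [tensorSort, LinearMap.comp_apply, TensorProduct.map_tmul, LinearEquiv.coe_coe,
    DirectSum.decomposeLinearEquiv_apply_coe, TensorProduct.directSum_lof_tmul_lof,
    DirectSum.toModule_lof]
  rfl

instance tensorDecomposition (𝒳 : ℤ → Submodule k X) (𝒴 : ℤ → Submodule k Y)
    [DirectSum.Decomposition 𝒳] [DirectSum.Decomposition 𝒴] :
    DirectSum.Decomposition (tensorGrading 𝒳 𝒴) :=
  decompositionOfSpan _ (tensorSort 𝒳 𝒴)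
    (by
      intro z
      induction z using TensorProduct.induction_on with
      | zero => simp
      | add x y hx hy => rw [map_add, map_add, hx, hy]
      | tmul x y =>
        induction x using DirectSum.Decomposition.inductionOn 𝒳 with
        | zero => simp
        | add x x' hx hx' => rw [TensorProduct.add_tmul, map_add, map_add, hx, hx']
        | homogeneous x =>
          induction y using DirectSum.Decomposition.inductionOn 𝒴 with
          | zero => simp
          | add y y' hy hy' => rw [TensorProduct.tmul_add, map_add, map_add, hy, hy']
          | homogeneous y => rw [tensorSort_tmul 𝒳 𝒴 x.2 y.2, DirectSum.coeLinearMap_lof])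
    _ (fun _ => rfl)
    (by
      rintro n ⟨_, hz⟩ ⟨i, j, rfl, x, hx, y, hy, rfl⟩
      exact tensorSort_tmul 𝒳 𝒴 hx hy)

/-- The shifted grading `n ↦ 𝒳 (n + m)`: degrees are lowered by `m`. -/
def shift (𝒳 : ℤ → Submodule k X) (m : ℤ) (n : ℤ) : Submodule k X := 𝒳 (n + m)

instance shiftDecomposition (𝒳 : ℤ → Submodule k X) [DirectSum.Decomposition 𝒳] (m : ℤ) :
    DirectSum.Decomposition (shift 𝒳 m) :=
  decompositionOfSpan _
    (DirectSum.toModule k ℤ _ (fun n => DirectSum.lof k ℤ (fun n => shift 𝒳 m n) (n - m) ∘ₗ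
        Submodule.inclusion (show 𝒳 n ≤ shift 𝒳 m (n - m) by simp [shift])) ∘ₗ
      (DirectSum.decomposeLinearEquiv 𝒳).toLinearMap)
    (by
      intro x
      induction x using DirectSum.Decomposition.inductionOn 𝒳 with
      | zero => simp
      | add x x' hx hx' => rw [map_add, map_add, hx, hx']
      | homogeneous x => simp)
    (fun n => (shift 𝒳 m n : Set X)) (fun n => (Submodule.span_eq _).symm)
    (by
      rintro n ⟨x, hx⟩ -
      obtain ⟨p, rfl⟩ : ∃ p, n = p - m := ⟨n + m, by ring⟩
      have hx' : x ∈ 𝒳 p := by simpa [shift] using hx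
      lift x to 𝒳 p using hx'
      simp only [LinearMap.comp_apply, LinearEquiv.coe_coe,
        DirectSum.decomposeLinearEquiv_apply_coe, DirectSum.toModule_lof]
      rfl)

/-- The grading induced on a quotient by a subspace spanned by elements of degree zero. -/
def quotGrading (𝒳 : ℤ → Submodule k X) (N : Submodule k X) (n : ℤ) : Submodule k (X ⧸ N) :=
  (𝒳 n).map N.mkQ

/-- The words `[x₁, …, x_r]` in homogeneous letters with `∑ (|x_i| - 1) = n` span the degree-`n`
part of the tensor algebra on the suspension. -/
def wordGrading (𝒳 : ℤ → Submodule k X) (n : ℤ) : Submodule k (TensorAlgebra k X) :=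
  Submodule.span k {w | ∃ l : List (Σ i, 𝒳 i), (l.map (fun p => p.1 - 1)).sum = n ∧
    w = (l.map (fun p => TensorAlgebra.ι k (p.2 : X))).prod}

instance wordGradedMonoid (𝒳 : ℤ → Submodule k X) : SetLike.GradedMonoid (wordGrading 𝒳) where
  one_mem := Submodule.subset_span ⟨[], by simp⟩
  mul_mem := by
    intro i j v w hv hw
    have := Submodule.mul_mem_mul hv hw
    rw [wordGrading, wordGrading, Submodule.span_mul_span] at this
    refine Submodule.span_mono ?_ this
    rintro _ ⟨_, ⟨l, rfl, rfl⟩, _, ⟨l', rfl, rfl⟩, rfl⟩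
    exact ⟨l ++ l', by simp⟩

theorem ι_mem_wordGrading (𝒳 : ℤ → Submodule k X) {n : ℤ} {x : X} (hx : x ∈ 𝒳 n) :
    TensorAlgebra.ι k x ∈ wordGrading 𝒳 (n - 1) :=
  Submodule.subset_span ⟨[⟨n, x, hx⟩], by simp⟩

/-- The map sorting a word by degree. -/
def wordSort (𝒳 : ℤ → Submodule k X) [DirectSum.Decomposition 𝒳] :
    TensorAlgebra k X →ₐ[k] ⨁ n, wordGrading 𝒳 n :=
  TensorAlgebra.lift k (DirectSum.toModule k ℤ _ (fun n =>
      DirectSum.lof k ℤ (fun n => wordGrading 𝒳 n) (n - 1) ∘ₗ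
        (TensorAlgebra.ι k ∘ₗ (𝒳 n).subtype).codRestrict _
          (fun x => ι_mem_wordGrading 𝒳 x.2)) ∘ₗ
    (DirectSum.decomposeLinearEquiv 𝒳).toLinearMap)

theorem wordSort_ι (𝒳 : ℤ → Submodule k X) [DirectSum.Decomposition 𝒳] {n : ℤ} (x : 𝒳 n) :
    wordSort 𝒳 (TensorAlgebra.ι k (x : X)) =
      DirectSum.of (fun n => wordGrading 𝒳 n) (n - 1) ⟨_, ι_mem_wordGrading 𝒳 x.2⟩ := by
  simp only [wordSort, TensorAlgebra.lift_ι_apply, LinearMap.comp_apply, LinearEquiv.coe_coe,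
    DirectSum.decomposeLinearEquiv_apply_coe, DirectSum.toModule_lof]
  rfl

instance wordGradedAlgebra (𝒳 : ℤ → Submodule k X) [DirectSum.Decomposition 𝒳] :
    GradedAlgebra (wordGrading 𝒳) :=
  GradedAlgebra.ofAlgHom _ (wordSort 𝒳)
    (by
      ext x
      simp only [LinearMap.comp_apply, AlgHom.toLinearMap_apply, AlgHom.comp_apply,
        AlgHom.id_apply]
      induction x using DirectSum.Decomposition.inductionOn 𝒳 with
      | zero => simp
      | add x x' hx hx' => simp only [map_add, hx, hx']
      | homogeneous x => rw [wordSort_ι, DirectSum.coeAlgHom_of])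
    (by
      have key : ∀ l : List (Σ i, 𝒳 i), ∀ h,
          wordSort 𝒳 (l.map (fun p => TensorAlgebra.ι k (p.2 : X))).prod =
            DirectSum.of (fun n => wordGrading 𝒳 n) (l.map (fun p => p.1 - 1)).sum
              ⟨(l.map (fun p => TensorAlgebra.ι k (p.2 : X))).prod, h⟩ := by
        intro l
        induction l with
        | nil => intro h; simp; rfl
        | cons p l ih =>
          intro h
          have h' : (l.map (fun p => TensorAlgebra.ι k (p.2 : X))).prod ∈
              wordGrading 𝒳 (l.map (fun p => p.1 - 1)).sum := Submodule.subset_span ⟨l, rfl, rfl⟩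
          simp only [List.map_cons, List.prod_cons, map_mul]
          rw [ih h', wordSort_ι, DirectSum.of_mul_of]
          rfl
      rintro n ⟨w, hw⟩
      have key2 : ∀ (w : TensorAlgebra k X) (hw : w ∈ wordGrading 𝒳 n),
          wordSort 𝒳 w = DirectSum.lof k ℤ (fun n => wordGrading 𝒳 n) n ⟨w, hw⟩ := by
        intro w hw
        have hw' := hw
        unfold wordGrading at hw'
        induction hw' using Submodule.span_induction with
        | mem y hy => obtain ⟨l, rfl, rfl⟩ := hy; exact key l _
        | zero => rw [map_zero]; exact (map_zero _).symm
        | add y z hy hz ihy ihz => rw [map_add, ihy hy, ihz hz, ← map_add]; rfl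
        | smul c y hy ih => rw [map_smul, ih hy, ← map_smul]; rfl
      exact key2 w hw)

end Graded

section Words

variable {k : Type*} [Field k] {V : Type*} [AddCommGroup V] [Module k V]

/-- Auxiliary recursion step for `deconc`. -/
def deconcStep : V →ₗ[k] Module.End k
    (TensorAlgebra k V × (TensorAlgebra k V ⊗[k] TensorAlgebra k V)) :=
  LinearMap.mk₂ k (fun a p => (TensorAlgebra.ι k a * p.1,
      1 ⊗ₜ[k] (TensorAlgebra.ι k a * p.1) + (TensorAlgebra.ι k a ⊗ₜ[k] 1) * p.2))
    (by intro a b p; ext <;> simp [add_mul, TensorProduct.tmul_add, TensorProduct.add_tmul]; abel)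
    (by
      intro c a p
      ext
      · simp
      · simp only [map_smul, smul_mul_assoc, TensorProduct.tmul_smul, ← TensorProduct.smul_tmul',
          Prod.smul_snd, smul_add])
    (by intro a p q; ext <;> simp [mul_add, TensorProduct.tmul_add]; abel)
    (by intro c a p; ext <;> simp)

/-- Deconcatenation `[a₁, …, a_n] ↦ ∑_{0 ≤ i ≤ n} [a₁, …, a_i] ⊗ [a_{i+1}, …, a_n]`. -/
def deconc : TensorAlgebra k V →ₗ[k] TensorAlgebra k V ⊗[k] TensorAlgebra k V :=
  LinearMap.snd k _ _ ∘ₗ LinearMap.applyₗ ((1, 1 ⊗ₜ[k] 1) :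
      TensorAlgebra k V × (TensorAlgebra k V ⊗[k] TensorAlgebra k V)) ∘ₗ
    (TensorAlgebra.lift k (deconcStep (k := k) (V := V))).toLinearMap

theorem deconcAux (w : TensorAlgebra k V) (x : TensorAlgebra k V)
    (y : TensorAlgebra k V ⊗[k] TensorAlgebra k V) :
    (TensorAlgebra.lift k (deconcStep (k := k) (V := V)) w (x, y)).1 = w * x := by
  induction w using TensorAlgebra.induction generalizing x y with
  | algebraMap r => simp [Algebra.algebraMap_eq_smul_one]
  | ι a => simp [deconcStep]
  | mul a b ha hb =>
    rw [map_mul, Module.End.mul_apply, mul_assoc, ← hb x y, ← ha _ _]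
  | add a b ha hb => simp [add_mul, ha, hb]

theorem deconc_one : deconc (1 : TensorAlgebra k V) = 1 ⊗ₜ 1 := by
  simp [deconc]

theorem deconc_ι_mul (a : V) (w : TensorAlgebra k V) :
    deconc (TensorAlgebra.ι k a * w) =
      1 ⊗ₜ[k] (TensorAlgebra.ι k a * w) + (TensorAlgebra.ι k a ⊗ₜ[k] 1) * deconc w := by
  have := deconcAux w 1 (1 ⊗ₜ[k] 1)
  rw [mul_one] at this
  simp only [deconc, LinearMap.comp_apply, AlgHom.toLinearMap_apply, map_mul,
    LinearMap.applyₗ_apply_apply, Module.End.mul_apply, TensorAlgebra.lift_ι_apply,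
    LinearMap.snd_apply]
  conv_lhs => rw [deconcStep, LinearMap.mk₂_apply]
  rw [← deconcStep, this]

/-- Induction on words. -/
theorem word_induction {P : TensorAlgebra k V → Prop} (one : P 1)
    (add : ∀ v w, P v → P w → P (v + w)) (smul : ∀ (c : k) w, P w → P (c • w))
    (cons : ∀ a w, P w → P (TensorAlgebra.ι k a * w)) (w : TensorAlgebra k V) : P w := by
  have key : ∀ w : TensorAlgebra k V, ∀ x, P x → P (w * x) := by
    intro w
    induction w using TensorAlgebra.induction with
    | algebraMap r => intro x hx; rw [← Algebra.smul_def]; exact smul r x hx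
    | ι a => exact fun x hx => cons a x hx
    | mul a b ha hb => intro x hx; rw [mul_assoc]; exact ha _ (hb _ hx)
    | add a b ha hb => intro x hx; rw [add_mul]; exact add _ _ (ha _ hx) (hb _ hx)
  simpa using key w 1 one

/-- Splitting into three subwords. -/
def deconc₃ : TensorAlgebra k V →ₗ[k]
    TensorAlgebra k V ⊗[k] (TensorAlgebra k V ⊗[k] TensorAlgebra k V) :=
  LinearMap.lTensor _ deconc ∘ₗ deconc

/-- The letter of a word of length one; zero on words of any other length. -/
def letter : TensorAlgebra k V →ₗ[k] V := TensorAlgebra.ιInv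

/-- Map of tensor algebras induced by a linear map. -/
def wordMap {W : Type*} [AddCommGroup W] [Module k W] (f : V →ₗ[k] W) :
    TensorAlgebra k V →ₐ[k] TensorAlgebra k W :=
  TensorAlgebra.lift k (TensorAlgebra.ι k ∘ₗ f)

end Words

section Hochschild

variable {k : Type*} [Field k] {A : Type*} [Ring A] [Algebra k A]

variable (k A) in
/-- `Ā = A / k·1`. -/
abbrev Abar : Type _ := A ⧸ Submodule.span k {(1 : A)}

variable (𝒜 : ℤ → Submodule k A) [GradedAlgebra 𝒜]

/-- Auxiliary form of `abarSort`, before passing to the quotient. -/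
def abarSortAux : A →ₗ[k] ⨁ n, quotGrading 𝒜 (Submodule.span k {(1 : A)}) n :=
  DirectSum.toModule k ℤ _ (fun n =>
      DirectSum.lof k ℤ (fun n => quotGrading 𝒜 (Submodule.span k {(1 : A)}) n) n ∘ₗ
        ((Submodule.mkQ (Submodule.span k {(1 : A)})) ∘ₗ (𝒜 n).subtype).codRestrict
          (quotGrading 𝒜 (Submodule.span k {(1 : A)}) n)
          (fun x => Submodule.mem_map_of_mem x.2)) ∘ₗ
    (DirectSum.decomposeLinearEquiv 𝒜).toLinearMap

theorem abarSortAux_of_mem {n : ℤ} {x : A} (hx : x ∈ 𝒜 n) :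
    abarSortAux 𝒜 x =
      DirectSum.lof k ℤ (fun n => quotGrading 𝒜 (Submodule.span k {(1 : A)}) n) n
        ⟨Submodule.mkQ _ x, Submodule.mem_map_of_mem hx⟩ := by
  lift x to 𝒜 n using hx
  simp only [abarSortAux, LinearMap.comp_apply, LinearEquiv.coe_coe,
    DirectSum.decomposeLinearEquiv_apply_coe, DirectSum.toModule_lof]
  rfl

theorem abarSortAux_one : abarSortAux 𝒜 (1 : A) = 0 := by
  rw [abarSortAux_of_mem 𝒜 SetLike.GradedOne.one_mem]
  have h : (⟨Submodule.mkQ (Submodule.span k {(1 : A)}) 1,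
      Submodule.mem_map_of_mem SetLike.GradedOne.one_mem⟩ :
      quotGrading 𝒜 (Submodule.span k {(1 : A)}) 0) = 0 :=
    Subtype.ext ((Submodule.Quotient.mk_eq_zero _).2 (Submodule.mem_span_singleton_self _))
  rw [h, map_zero]

/-- The map sorting an element of `Ā` by degree. -/
def abarSort : Abar k A →ₗ[k] ⨁ n, quotGrading 𝒜 (Submodule.span k {(1 : A)}) n :=
  Submodule.liftQ (R₂ := k) (τ₁₂ := RingHom.id k)
    (M₂ := ⨁ n, quotGrading 𝒜 (Submodule.span k {(1 : A)}) n)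
    (Submodule.span k {(1 : A)}) (abarSortAux 𝒜)
    ((Submodule.span_singleton_le_iff_mem _ _).2 (abarSortAux_one 𝒜))

theorem abarSort_mk {n : ℤ} (x : 𝒜 n) :
    abarSort 𝒜 (Submodule.mkQ _ (x : A)) =
      DirectSum.lof k ℤ (fun n => quotGrading 𝒜 (Submodule.span k {(1 : A)}) n) n
        ⟨Submodule.mkQ _ (x : A), Submodule.mem_map_of_mem x.2⟩ :=
  abarSortAux_of_mem 𝒜 x.2

instance abarDecomposition :
    DirectSum.Decomposition (quotGrading 𝒜 (Submodule.span k {(1 : A)})) :=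
  decompositionOfSpan _ (abarSort 𝒜)
    (by
      intro x
      obtain ⟨x, rfl⟩ := Submodule.mkQ_surjective _ x
      induction x using DirectSum.Decomposition.inductionOn 𝒜 with
      | zero => simp
      | add x x' hx hx' => rw [map_add, map_add, map_add, hx, hx']
      | homogeneous x => rw [abarSort_mk, DirectSum.coeLinearMap_lof])
    (fun n => (quotGrading 𝒜 (Submodule.span k {(1 : A)}) n : Set (Abar k A)))
    (fun n => (Submodule.span_eq _).symm)
    (by
      rintro n ⟨_, x, hx, rfl⟩ -
      exact abarSort_mk 𝒜 ⟨x, hx⟩)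

variable (k A) in
/-- Words `a₀[a₁, …, a_n]` with all entries in `A`. -/
abbrev BigChain : Type _ := A ⊗[k] TensorAlgebra k A

variable (k A) in
/-- The underlying space `A ⊗ T(sĀ)` of the normalized Hochschild chain complex `C_*(A, A)`. -/
abbrev Chain : Type _ := A ⊗[k] TensorAlgebra k (Abar k A)

/-- The grading of `C_*(A, A)`: `a₀[a₁, …, a_n]` has degree `|a₀| + ∑ (|a_i| - 1)`. -/
abbrev chainGrading : ℤ → Submodule k (Chain k A) :=
  tensorGrading 𝒜 (wordGrading (quotGrading 𝒜 (Submodule.span k {(1 : A)})))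

/-- `[a] ↦ -d a`, `[a, b] ↦ -(-1)^{|a|} a b`, zero on words of other lengths. -/
def barMap (d : A →ₗ[k] A) : TensorAlgebra k A →ₗ[k] A :=
  -(d ∘ₗ letter) -
    LinearMap.mul' k A ∘ₗ TensorProduct.map (sgn 𝒜 ∘ₗ letter) letter ∘ₗ deconc

/-- `w ↦ ∑_{w = w₁w₂w₃} (-1)^{|w₁|} w₁ · [barMap w₂] · w₃`. -/
def barDiff (d : A →ₗ[k] A) : TensorAlgebra k A →ₗ[k] TensorAlgebra k A :=
  LinearMap.mul' k _ ∘ₗ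
    TensorProduct.map (sgn (wordGrading 𝒜))
      (LinearMap.mul' k _ ∘ₗ TensorProduct.map (TensorAlgebra.ι k ∘ₗ barMap 𝒜 d) LinearMap.id) ∘ₗ
    deconc₃

/-- `a₀[a₁, …, a_n] ↦ (a₀ a₁)[a₂, …, a_n]`, zero for `n = 0`. -/
def firstFace : BigChain k A →ₗ[k] BigChain k A :=
  LinearMap.rTensor _ (LinearMap.mul' k A) ∘ₗ
    (TensorProduct.assoc k A A (TensorAlgebra k A)).symm.toLinearMap ∘ₗ
    LinearMap.lTensor A (LinearMap.rTensor _ letter ∘ₗ deconc)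

/-- `a₀[a₁, …, a_n] ↦ (-1)^{(|a_n| - 1)(|a₀| + ∑_{i<n} (|a_i| - 1))} (a_n a₀)[a₁, …, a_{n-1}]`,
zero for `n = 0`. -/
def lastFace : BigChain k A →ₗ[k] BigChain k A :=
  LinearMap.rTensor _ (LinearMap.mul' k A) ∘ₗ
    (TensorProduct.assoc k A A (TensorAlgebra k A)).symm.toLinearMap ∘ₗ
    koszul (tensorGrading 𝒜 (wordGrading 𝒜)) (shift 𝒜 1) ∘ₗ
    (TensorProduct.assoc k A (TensorAlgebra k A) A).symm.toLinearMap ∘ₗ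
    LinearMap.lTensor A (LinearMap.lTensor _ letter ∘ₗ deconc)

/-- The Hochschild differential before normalization. With
`η_i = |a₀| + ∑_{1 ≤ j ≤ i} (|a_j| - 1)`, it sends `a₀[a₁, …, a_n]` to
`(d a₀)[a₁, …, a_n] - ∑_{i=1}^n (-1)^{η_{i-1}} a₀[…, d a_i, …]
+ (-1)^{|a₀|} (a₀ a₁)[a₂, …, a_n] + ∑_{i=1}^{n-1} (-1)^{η_i} a₀[…, a_i a_{i+1}, …]
- (-1)^{(|a_n| - 1) η_{n-1}} (a_n a₀)[a₁, …, a_{n-1}]`. -/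
def bigDiff (d : A →ₗ[k] A) : BigChain k A →ₗ[k] BigChain k A :=
  LinearMap.rTensor _ d + TensorProduct.map (sgn 𝒜) (barDiff 𝒜 d) +
    firstFace ∘ₗ LinearMap.rTensor _ (sgn 𝒜) - lastFace 𝒜

variable (k A) in
/-- The projection onto normalized chains. -/
def normalize : BigChain k A →ₗ[k] Chain k A :=
  LinearMap.lTensor A (wordMap (Submodule.mkQ (Submodule.span k {(1 : A)}))).toLinearMap

variable (k A) in
/-- Some linear section `Ā → A`. -/
def abarLift : Abar k A →ₗ[k] A :=
  Classical.choose ((Submodule.mkQ (Submodule.span k {(1 : A)})).exists_rightInverse_of_surjective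
    (Submodule.range_mkQ _))

/-- The differential `D` of the normalized Hochschild chain complex: lift to `A ⊗ T(sA)`, apply the
Hochschild differential, project back. -/
def chainDiff (d : A →ₗ[k] A) : Chain k A →ₗ[k] Chain k A :=
  normalize k A ∘ₗ bigDiff 𝒜 d ∘ₗ LinearMap.lTensor A (wordMap (abarLift k A)).toLinearMap

/-- Connes' operator
`B(a₀[a₁, …, a_n]) = ∑_{i=1}^{n+1} (-1)^{ε_i} 1[a_i, …, a_n, a₀, …, a_{i-1}]`,
`ε_i = (∑_{j<i} (|a_j| - 1)) (∑_{j≥i} (|a_j| - 1))`. -/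
def connes : Chain k A →ₗ[k] Chain k A :=
  TensorProduct.mk k A (TensorAlgebra k (Abar k A)) 1 ∘ₗ
    LinearMap.mul' k _ ∘ₗ
    koszul (wordGrading (quotGrading 𝒜 (Submodule.span k {(1 : A)})))
      (wordGrading (quotGrading 𝒜 (Submodule.span k {(1 : A)}))) ∘ₗ
    LinearMap.rTensor _ (LinearMap.mul' k _ ∘ₗ
      LinearMap.rTensor _ (TensorAlgebra.ι k ∘ₗ Submodule.mkQ _)) ∘ₗ
    (TensorProduct.assoc k A _ _).symm.toLinearMap ∘ₗ
    LinearMap.lTensor A deconc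

/-- The coproduct
`θ(a₀[a₁, …, a_n]) = ∑_{(a₀), 0 ≤ i ≤ n} ± a₀'[a₁, …, a_i] ⊗ a₀''[a_{i+1}, …, a_n]`, with the
Koszul sign `± = (-1)^{|a₀''| (|a₁| + ⋯ + |a_i| - i)}`. -/
def chainCoproduct (δ : A →ₗ[k] A ⊗[k] A) : Chain k A →ₗ[k] Chain k A ⊗[k] Chain k A :=
  (TensorProduct.assoc k A (TensorAlgebra k (Abar k A)) (Chain k A)).symm.toLinearMap ∘ₗ
    LinearMap.lTensor A
      ((TensorProduct.assoc k (TensorAlgebra k (Abar k A)) A _).toLinearMap ∘ₗ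
        LinearMap.rTensor _
          (koszul 𝒜 (wordGrading (quotGrading 𝒜 (Submodule.span k {(1 : A)})))) ∘ₗ
        (TensorProduct.assoc k A (TensorAlgebra k (Abar k A)) _).symm.toLinearMap) ∘ₗ
    (TensorProduct.assoc k A A
      (TensorAlgebra k (Abar k A) ⊗[k] TensorAlgebra k (Abar k A))).toLinearMap ∘ₗ
    TensorProduct.map δ deconc

end Hochschild

section Descent

open TensorProduct

variable {k : Type*} [Field k] {V : Type*} [AddCommGroup V] [Module k V]

theorem letter_one : letter (1 : TensorAlgebra k V) = 0 := by
  let _ : Module kᵐᵒᵖ V := Module.compHom _ ((RingHom.id k).fromOpposite mul_comm)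
  have _ : IsCentralScalar k V := ⟨fun r m => rfl⟩
  change TrivSqZeroExt.snd
    (TensorAlgebra.toTrivSqZeroExt (R := k) (M := V) (1 : TensorAlgebra k V)) = 0
  rw [map_one, TrivSqZeroExt.snd_one]

theorem letter_ι_mul (a : V) (w : TensorAlgebra k V) :
    letter (TensorAlgebra.ι k a * w) = TensorAlgebra.algebraMapInv w • a := by
  let _ : Module kᵐᵒᵖ V := Module.compHom _ ((RingHom.id k).fromOpposite mul_comm)
  have _ : IsCentralScalar k V := ⟨fun r m => rfl⟩
  have h : (TrivSqZeroExt.fstHom k k V).comp (TensorAlgebra.toTrivSqZeroExt (R := k) (M := V)) =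
      TensorAlgebra.algebraMapInv := by
    ext; simp [TensorAlgebra.algebraMapInv]
  have h' := DFunLike.congr_fun h w
  rw [← h']
  change TrivSqZeroExt.snd (TensorAlgebra.toTrivSqZeroExt (TensorAlgebra.ι k a * w)) = _
  rw [map_mul, TensorAlgebra.toTrivSqZeroExt_ι, TrivSqZeroExt.snd_mul]
  simp

theorem letter_mul_ι (a : V) (w : TensorAlgebra k V) :
    letter (w * TensorAlgebra.ι k a) = TensorAlgebra.algebraMapInv w • a := by
  let _ : Module kᵐᵒᵖ V := Module.compHom _ ((RingHom.id k).fromOpposite mul_comm)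
  have _ : IsCentralScalar k V := ⟨fun r m => rfl⟩
  have h : (TrivSqZeroExt.fstHom k k V).comp (TensorAlgebra.toTrivSqZeroExt (R := k) (M := V)) =
      TensorAlgebra.algebraMapInv := by
    ext; simp [TensorAlgebra.algebraMapInv]
  have h' := DFunLike.congr_fun h w
  rw [← h']
  change TrivSqZeroExt.snd (TensorAlgebra.toTrivSqZeroExt (w * TensorAlgebra.ι k a)) = _
  rw [map_mul, TensorAlgebra.toTrivSqZeroExt_ι, TrivSqZeroExt.snd_mul]
  simp

theorem algebraMapInv_ι_mul (a : V) (w : TensorAlgebra k V) :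
    TensorAlgebra.algebraMapInv (TensorAlgebra.ι k a * w) = 0 := by
  simp [TensorAlgebra.algebraMapInv]

theorem deconc_mul_ι (a : V) (w : TensorAlgebra k V) :
    deconc (w * TensorAlgebra.ι k a) =
      deconc w * (1 ⊗ₜ[k] TensorAlgebra.ι k a) + (w * TensorAlgebra.ι k a) ⊗ₜ[k] 1 := by
  induction w using word_induction with
  | one =>
    have := deconc_ι_mul (k := k) a 1
    rw [mul_one, deconc_one] at this
    rw [one_mul, this, deconc_one]
    simp
  | add v w hv hw => rw [add_mul, map_add, hv, hw, map_add, add_mul, add_tmul]; abel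
  | smul c w hw =>
    rw [smul_mul_assoc, map_smul, hw, map_smul, smul_add, smul_mul_assoc, smul_tmul']
  | cons b w hw =>
    rw [mul_assoc, deconc_ι_mul, hw, deconc_ι_mul]
    simp [mul_add, add_mul, mul_assoc, add_assoc]

/-- Left counit. -/
theorem counit_left (w : TensorAlgebra k V) :
    LinearMap.rTensor _ (TensorAlgebra.algebraMapInv (R := k) (M := V)).toLinearMap (deconc w) =
      1 ⊗ₜ w := by
  have key : ∀ (b : V) (z : TensorAlgebra k V ⊗[k] TensorAlgebra k V),
      LinearMap.rTensor _ (TensorAlgebra.algebraMapInv (R := k) (M := V)).toLinearMap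
        ((TensorAlgebra.ι k b ⊗ₜ[k] 1) * z) = 0 := by
    intro b z
    induction z using TensorProduct.induction_on with
    | zero => simp
    | add x y hx hy => rw [mul_add, map_add, hx, hy, add_zero]
    | tmul x y =>
      rw [Algebra.TensorProduct.tmul_mul_tmul, LinearMap.rTensor_tmul, AlgHom.toLinearMap_apply,
        algebraMapInv_ι_mul, zero_tmul]
  induction w using word_induction with
  | one => rw [deconc_one]; simp
  | add v w hv hw => rw [map_add, map_add, hv, hw, tmul_add]
  | smul c w hw => rw [map_smul, map_smul, hw, tmul_smul]
  | cons b w hw => rw [deconc_ι_mul, map_add, key]; simp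

/-- Right counit. -/
theorem counit_right (w : TensorAlgebra k V) :
    LinearMap.lTensor _ (TensorAlgebra.algebraMapInv (R := k) (M := V)).toLinearMap (deconc w) =
      w ⊗ₜ 1 := by
  induction w using word_induction with
  | one => rw [deconc_one]; simp
  | add v w hv hw => rw [map_add, map_add, hv, hw, add_tmul]
  | smul c w hw => rw [map_smul, map_smul, hw, smul_tmul']
  | cons b w hw =>
    rw [deconc_ι_mul, map_add]
    have key : ∀ z : TensorAlgebra k V ⊗[k] TensorAlgebra k V,
        LinearMap.lTensor _ (TensorAlgebra.algebraMapInv (R := k) (M := V)).toLinearMap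
          ((TensorAlgebra.ι k b ⊗ₜ[k] 1) * z) =
        LinearMap.rTensor _ (LinearMap.mulLeft k (TensorAlgebra.ι k b))
          (LinearMap.lTensor _ (TensorAlgebra.algebraMapInv (R := k) (M := V)).toLinearMap z) := by
      intro z
      induction z using TensorProduct.induction_on with
      | zero => simp
      | add x y hx hy => rw [mul_add, map_add, hx, hy, map_add, map_add]
      | tmul x y => simp
    rw [key, hw]
    simp [TensorAlgebra.algebraMapInv]

/-- Splitting off the first letter. -/
theorem letter_deconc_ι_mul (b : V) (w : TensorAlgebra k V) :
    LinearMap.rTensor _ letter (deconc (TensorAlgebra.ι k b * w)) = b ⊗ₜ w := by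
  have key : ∀ z : TensorAlgebra k V ⊗[k] TensorAlgebra k V,
      LinearMap.rTensor _ letter ((TensorAlgebra.ι k b ⊗ₜ[k] 1) * z) =
      LinearMap.rTensor _ (LinearMap.toSpanSingleton k V b)
        (LinearMap.rTensor _ (TensorAlgebra.algebraMapInv (R := k) (M := V)).toLinearMap z) := by
    intro z
    induction z using TensorProduct.induction_on with
    | zero => simp
    | add x y hx hy => rw [mul_add, map_add, hx, hy, map_add, map_add]
    | tmul x y => simp [letter_ι_mul]
  rw [deconc_ι_mul, map_add, key, counit_left]
  simp [letter_one]

/-- Splitting off the last letter. -/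
theorem letter_deconc_mul_ι (b : V) (w : TensorAlgebra k V) :
    LinearMap.lTensor _ letter (deconc (w * TensorAlgebra.ι k b)) = w ⊗ₜ b := by
  have key : ∀ z : TensorAlgebra k V ⊗[k] TensorAlgebra k V,
      LinearMap.lTensor _ letter (z * (1 ⊗ₜ[k] TensorAlgebra.ι k b)) =
      LinearMap.lTensor _ (LinearMap.toSpanSingleton k V b)
        (LinearMap.lTensor _ (TensorAlgebra.algebraMapInv (R := k) (M := V)).toLinearMap z) := by
    intro z
    induction z using TensorProduct.induction_on with
    | zero => simp
    | add x y hx hy => rw [add_mul, map_add, hx, hy, map_add, map_add]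
    | tmul x y => simp [letter_mul_ι]
  rw [deconc_mul_ι, map_add, key, counit_right]
  simp [letter_one]

theorem sg_add (m n : ℤ) : sg k (m + n) = sg k m * sg k n := by
  simp [sg, Int.negOnePow_add]

theorem sg_mul_natAbs (i j : ℤ) : sg k (i * j) = sg k i ^ j.natAbs := by
  have h : (i * j).negOnePow = i.negOnePow ^ j.natAbs := by
    rcases Int.natAbs_eq j with h | h
    · conv_lhs => rw [h]
      rw [Int.negOnePow_def, Int.negOnePow_def, zpow_mul, zpow_natCast]
    · conv_lhs => rw [h]
      rw [mul_neg, Int.negOnePow_neg, Int.negOnePow_def, Int.negOnePow_def, zpow_mul, zpow_natCast]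
  simp [sg, h]

theorem sgn_pow_of_mem {X : Type*} [AddCommGroup X] [Module k X] (𝒳 : ℤ → Submodule k X)
    [DirectSum.Decomposition 𝒳] {n : ℤ} {x : X} (hx : x ∈ 𝒳 n) (r : ℕ) :
    (sgn 𝒳 ^ r) x = sg k n ^ r • x := by
  induction r with
  | zero => simp
  | succ r ih => rw [pow_succ', Module.End.mul_apply, ih, map_smul, sgn_of_mem 𝒳 hx, smul_smul,
      pow_succ]

theorem koszul_right {X Y : Type*} [AddCommGroup X] [Module k X] [AddCommGroup Y] [Module k Y]
    (𝒳 : ℤ → Submodule k X) (𝒴 : ℤ → Submodule k Y)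
    [DirectSum.Decomposition 𝒳] [DirectSum.Decomposition 𝒴] {j : ℤ} (x : X) {y : Y}
    (hy : y ∈ 𝒴 j) : koszul 𝒳 𝒴 (x ⊗ₜ y) = y ⊗ₜ[k] (sgn 𝒳 ^ j.natAbs) x := by
  induction x using DirectSum.Decomposition.inductionOn 𝒳 with
  | zero => simp
  | add x x' hx hx' => rw [add_tmul, map_add, hx, hx', map_add, tmul_add]
  | homogeneous x =>
    rw [koszul_tmul 𝒳 𝒴 x.2 hy, sgn_pow_of_mem 𝒳 x.2, sg_mul_natAbs, tmul_smul]

theorem sgn_tmul {X Y : Type*} [AddCommGroup X] [Module k X] [AddCommGroup Y] [Module k Y]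
    (𝒳 : ℤ → Submodule k X) (𝒴 : ℤ → Submodule k Y)
    [DirectSum.Decomposition 𝒳] [DirectSum.Decomposition 𝒴] (x : X) (y : Y) :
    sgn (tensorGrading 𝒳 𝒴) (x ⊗ₜ y) = sgn 𝒳 x ⊗ₜ[k] sgn 𝒴 y := by
  induction x using DirectSum.Decomposition.inductionOn 𝒳 with
  | zero => simp
  | add x x' hx hx' => rw [add_tmul, map_add, hx, hx', map_add, add_tmul]
  | homogeneous x =>
    induction y using DirectSum.Decomposition.inductionOn 𝒴 with
    | zero => simp
    | add y y' hy hy' => rw [tmul_add, map_add, hy, hy', map_add, tmul_add]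
    | homogeneous y =>
      rw [sgn_of_mem _ (tmul_mem_tensorGrading 𝒳 𝒴 x.2 y.2), sgn_of_mem 𝒳 x.2,
        sgn_of_mem 𝒴 y.2, sg_add, smul_tmul_smul]

theorem sgn_word_mul (𝒱 : ℤ → Submodule k V) [DirectSum.Decomposition 𝒱]
    (v w : TensorAlgebra k V) :
    sgn (wordGrading 𝒱) (v * w) = sgn (wordGrading 𝒱) v * sgn (wordGrading 𝒱) w := by
  induction v using DirectSum.Decomposition.inductionOn (wordGrading 𝒱) with
  | zero => simp
  | add x x' hx hx' => rw [add_mul, map_add, hx, hx', map_add, add_mul]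
  | homogeneous x =>
    induction w using DirectSum.Decomposition.inductionOn (wordGrading 𝒱) with
    | zero => simp
    | add y y' hy hy' => rw [mul_add, map_add, hy, hy', map_add, mul_add]
    | homogeneous y =>
      rw [sgn_of_mem _ (SetLike.mul_mem_graded x.2 y.2), sgn_of_mem _ x.2,
        sgn_of_mem _ y.2, sg_add, smul_mul_smul_comm]

theorem sgn_word_one (𝒱 : ℤ → Submodule k V) [DirectSum.Decomposition 𝒱] :
    sgn (wordGrading 𝒱) (1 : TensorAlgebra k V) = 1 := by
  rw [sgn_of_mem (wordGrading 𝒱) SetLike.GradedOne.one_mem]; simp [sg]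

theorem sgn_word_ι (𝒱 : ℤ → Submodule k V) [DirectSum.Decomposition 𝒱] (b : V) :
    sgn (wordGrading 𝒱) (TensorAlgebra.ι k b) = -TensorAlgebra.ι k (sgn 𝒱 b) := by
  induction b using DirectSum.Decomposition.inductionOn 𝒱 with
  | zero => simp
  | add x x' hx hx' => rw [map_add, map_add, hx, hx', map_add, map_add, neg_add]
  | homogeneous x =>
    rw [sgn_of_mem _ (ι_mem_wordGrading 𝒱 x.2), sgn_of_mem 𝒱 x.2, map_smul, ← neg_smul]
    congr 1
    simp [sg, Int.negOnePow_sub]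

variable {A : Type*} [Ring A] [Algebra k A] (𝒜 : ℤ → Submodule k A) [GradedAlgebra 𝒜]

theorem sgn_one : sgn 𝒜 (1 : A) = 1 := by
  rw [sgn_of_mem 𝒜 SetLike.GradedOne.one_mem]; simp [sg]

/-- `a ⊗ w ↦ [a] · w`. -/
def prepend : BigChain k A →ₗ[k] TensorAlgebra k A :=
  LinearMap.mul' k _ ∘ₗ LinearMap.rTensor _ (TensorAlgebra.ι k)

/-- The Hochschild differential without its last face. -/
def diffE (d : A →ₗ[k] A) : BigChain k A →ₗ[k] BigChain k A :=
  LinearMap.rTensor _ d + TensorProduct.map (sgn 𝒜) (barDiff 𝒜 d) +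
    firstFace ∘ₗ LinearMap.rTensor _ (sgn 𝒜)

theorem firstFace_ι_mul (a b : A) (w : TensorAlgebra k A) :
    firstFace (a ⊗ₜ[k] (TensorAlgebra.ι k b * w)) = (a * b) ⊗ₜ[k] w := by
  simp [firstFace, letter_deconc_ι_mul]

theorem firstFace_one (a : A) :
    firstFace (a ⊗ₜ[k] (1 : TensorAlgebra k A)) = 0 := by
  simp [firstFace, deconc_one, letter_one]

theorem barMap_one (d : A →ₗ[k] A) : barMap 𝒜 d 1 = 0 := by
  simp [barMap, deconc_one, letter_one]

theorem barMap_ι_mul (d : A →ₗ[k] A) (b : A) (w : TensorAlgebra k A) :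
    barMap 𝒜 d (TensorAlgebra.ι k b * w) =
      -(TensorAlgebra.algebraMapInv w • d b) - sgn 𝒜 b * letter w := by
  have key : ∀ z : TensorAlgebra k A ⊗[k] TensorAlgebra k A,
      LinearMap.mul' k A (TensorProduct.map (sgn 𝒜 ∘ₗ letter) letter
        ((TensorAlgebra.ι k b ⊗ₜ[k] 1) * z)) =
      sgn 𝒜 b * letter (TensorProduct.lid k _ (LinearMap.rTensor _
        (TensorAlgebra.algebraMapInv (R := k) (M := A)).toLinearMap z)) := by
    intro z
    induction z using TensorProduct.induction_on with
    | zero => simp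
    | add x y hx hy => rw [mul_add, map_add, map_add, hx, hy, map_add, map_add, map_add, mul_add]
    | tmul x y => simp [letter_ι_mul]
  simp only [barMap, LinearMap.sub_apply, LinearMap.neg_apply, LinearMap.comp_apply,
    letter_ι_mul, map_smul]
  congr 1
  rw [deconc_ι_mul, map_add, map_add, key, counit_left]
  simp [letter_one]

theorem barDiff_one (d : A →ₗ[k] A) : barDiff 𝒜 d 1 = 0 := by
  simp [barDiff, deconc₃, deconc_one, barMap_one]

theorem barDiff_ι_mul (d : A →ₗ[k] A) (b : A) (w : TensorAlgebra k A) :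
    barDiff 𝒜 d (TensorAlgebra.ι k b * w) = -prepend (diffE 𝒜 d (b ⊗ₜ w)) := by
  have h1 : ∀ z : TensorAlgebra k A ⊗[k] TensorAlgebra k A,
      LinearMap.mul' k _ (TensorProduct.map (sgn (wordGrading 𝒜))
        (LinearMap.mul' k _ ∘ₗ
          TensorProduct.map (TensorAlgebra.ι k ∘ₗ barMap 𝒜 d) LinearMap.id)
        (LinearMap.lTensor _ deconc ((TensorAlgebra.ι k b ⊗ₜ[k] 1) * z))) =
      -TensorAlgebra.ι k (sgn 𝒜 b) * LinearMap.mul' k _ (TensorProduct.map (sgn (wordGrading 𝒜))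
        (LinearMap.mul' k _ ∘ₗ
          TensorProduct.map (TensorAlgebra.ι k ∘ₗ barMap 𝒜 d) LinearMap.id)
        (LinearMap.lTensor _ deconc z)) := by
    intro z
    induction z using TensorProduct.induction_on with
    | zero => simp
    | add x y hx hy => simp only [mul_add, map_add, hx, hy]
    | tmul x y => simp [sgn_word_mul, sgn_word_ι, mul_assoc]
  have h2 : ∀ z : TensorAlgebra k A ⊗[k] TensorAlgebra k A,
      LinearMap.mul' k _ (TensorProduct.map (TensorAlgebra.ι k ∘ₗ barMap 𝒜 d) LinearMap.id
        ((TensorAlgebra.ι k b ⊗ₜ[k] 1) * z)) =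
      -(TensorAlgebra.ι k (d b) * TensorProduct.lid k _ (LinearMap.rTensor _
        (TensorAlgebra.algebraMapInv (R := k) (M := A)).toLinearMap z)) -
      prepend (LinearMap.rTensor _ (LinearMap.mulLeft k (sgn 𝒜 b))
        (LinearMap.rTensor _ letter z)) := by
    intro z
    induction z using TensorProduct.induction_on with
    | zero => simp
    | add x y hx hy => simp only [mul_add, map_add, hx, hy]; abel
    | tmul x y =>
      simp [barMap_ι_mul, prepend, sub_mul]
  have h3 : firstFace (sgn 𝒜 b ⊗ₜ[k] w) =
      LinearMap.rTensor _ (LinearMap.mulLeft k (sgn 𝒜 b))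
        (LinearMap.rTensor _ letter (deconc w)) := by
    simp only [firstFace, LinearMap.comp_apply, LinearMap.lTensor_tmul, LinearEquiv.coe_coe]
    generalize LinearMap.rTensor _ letter (deconc w) = z
    induction z using TensorProduct.induction_on with
    | zero => simp
    | add x y hx hy => rw [tmul_add, map_add, map_add, hx, hy, map_add]
    | tmul x y => simp
  have h4 := h2 (deconc w)
  rw [counit_left] at h4
  simp only [barDiff, LinearMap.comp_apply, deconc₃]
  rw [deconc_ι_mul, map_add, map_add, map_add, h1]
  simp only [LinearMap.lTensor_tmul, TensorProduct.map_tmul, LinearMap.comp_apply,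
    LinearMap.mul'_apply, sgn_word_one, one_mul]
  rw [deconc_ι_mul, map_add, map_add, h4]
  simp only [diffE, LinearMap.add_apply, LinearMap.comp_apply, LinearMap.rTensor_tmul,
    TensorProduct.map_tmul, h3, map_add, barMap_one, map_zero, LinearMap.mul'_apply, zero_mul,
    zero_add, TensorProduct.lid_tmul, one_smul, barDiff, deconc₃]
  simp only [prepend, LinearMap.comp_apply, LinearMap.rTensor_tmul, LinearMap.mul'_apply, neg_mul]
  abel

theorem diffE_ι_mul (d : A →ₗ[k] A) (a b : A) (w : TensorAlgebra k A) :
    diffE 𝒜 d (a ⊗ₜ (TensorAlgebra.ι k b * w)) =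
      d a ⊗ₜ (TensorAlgebra.ι k b * w) + (sgn 𝒜 a * b) ⊗ₜ w -
        sgn 𝒜 a ⊗ₜ prepend (diffE 𝒜 d (b ⊗ₜ w)) := by
  have h := barDiff_ι_mul 𝒜 d b w
  generalize prepend (diffE 𝒜 d (b ⊗ₜ[k] w)) = P at h ⊢
  simp only [diffE, LinearMap.add_apply, LinearMap.comp_apply, LinearMap.rTensor_tmul,
    TensorProduct.map_tmul, firstFace_ι_mul, h, tmul_neg]
  abel

theorem diffE_one (d : A →ₗ[k] A) (a : A) :
    diffE 𝒜 d (a ⊗ₜ (1 : TensorAlgebra k A)) = d a ⊗ₜ 1 := by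
  simp [diffE, barDiff_one, firstFace_one]

theorem normalize_prepend (x : BigChain k A) :
    wordMap (Submodule.mkQ (Submodule.span k {(1 : A)})) (prepend x) =
      LinearMap.mul' k _ (LinearMap.rTensor _
        (TensorAlgebra.ι k ∘ₗ Submodule.mkQ (Submodule.span k {(1 : A)})) (normalize k A x)) := by
  induction x using TensorProduct.induction_on with
  | zero => simp
  | add x y hx hy => simp only [map_add, hx, hy]
  | tmul a w => simp [prepend, normalize, wordMap]

theorem normalize_tmul (a : A) (w : TensorAlgebra k A) :
    normalize k A (a ⊗ₜ w) =
      a ⊗ₜ wordMap (Submodule.mkQ (Submodule.span k {(1 : A)})) w := by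
  simp [normalize]

theorem wordMap_ι {V W : Type*} [AddCommGroup V] [Module k V] [AddCommGroup W] [Module k W]
    (f : V →ₗ[k] W) (b : V) :
    wordMap f (TensorAlgebra.ι k b) = TensorAlgebra.ι k (f b) := by
  simp [wordMap]

theorem wordMap_mkQ_one :
    wordMap (Submodule.mkQ (Submodule.span k {(1 : A)})) (TensorAlgebra.ι k (1 : A)) = 0 := by
  rw [wordMap_ι, Submodule.mkQ_apply,
    (Submodule.Quotient.mk_eq_zero _).2 (Submodule.mem_span_singleton_self _), map_zero]

theorem normalize_degenerate (a : A) (u v : TensorAlgebra k A) :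
    normalize k A (a ⊗ₜ (u * (TensorAlgebra.ι k (1 : A) * v))) = 0 := by
  rw [normalize_tmul, map_mul, map_mul, wordMap_mkQ_one, zero_mul, mul_zero, tmul_zero]

theorem prepend_diffE_one (d : A →ₗ[k] A) (hd : d 1 = 0) (v : TensorAlgebra k A) :
    wordMap (Submodule.mkQ (Submodule.span k {(1 : A)})) (prepend (diffE 𝒜 d (1 ⊗ₜ v))) =
      wordMap (Submodule.mkQ (Submodule.span k {(1 : A)})) v -
        TensorAlgebra.algebraMapInv v • 1 := by
  induction v using word_induction with
  | one => rw [diffE_one, hd]; simp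
  | add v w hv hw => simp only [tmul_add, map_add, hv, hw, add_smul]; abel
  | smul c w hw => simp only [tmul_smul, map_smul, hw, smul_sub, smul_assoc]
  | cons b w hw =>
    have h : ∀ t : TensorAlgebra k A,
        wordMap (Submodule.mkQ (Submodule.span k {(1 : A)})) (prepend (1 ⊗ₜ[k] t)) = 0 := by
      intro t
      have : prepend ((1 : A) ⊗ₜ[k] t) = TensorAlgebra.ι k 1 * t := by simp [prepend]
      rw [this, map_mul, wordMap_mkQ_one, zero_mul]
    have h' : prepend (b ⊗ₜ[k] w) = TensorAlgebra.ι k b * w := by simp [prepend]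
    rw [diffE_ι_mul, hd, sgn_one, one_mul, zero_tmul, zero_add, map_sub, map_sub, h, sub_zero,
      algebraMapInv_ι_mul, zero_smul, sub_zero, h']

theorem diffE_degenerate (d : A →ₗ[k] A) (hd : d 1 = 0) (a : A) (u v : TensorAlgebra k A) :
    normalize k A (diffE 𝒜 d (a ⊗ₜ (u * (TensorAlgebra.ι k (1 : A) * v)))) =
      TensorAlgebra.algebraMapInv v •
        normalize k A (sgn 𝒜 a ⊗ₜ sgn (wordGrading 𝒜) u) := by
  induction u using word_induction generalizing a with
  | one =>
    have h := normalize_degenerate (k := k) (d a) 1 v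
    rw [one_mul] at h
    rw [one_mul, diffE_ι_mul, map_sub, map_add, h, zero_add, normalize_tmul, normalize_tmul,
      prepend_diffE_one 𝒜 d hd, sgn_word_one, normalize_tmul, map_one, mul_one, tmul_sub,
      tmul_smul]
    abel
  | add x y hx hy => simp only [add_mul, tmul_add, map_add, hx, hy, smul_add]
  | smul c x hx =>
    simp only [smul_mul_assoc, tmul_smul, map_smul, hx]
    rw [smul_comm]
  | cons b x hx =>
    have h := normalize_degenerate (k := k) (d a) (TensorAlgebra.ι k b * x) v
    have h' := normalize_degenerate (k := k) (sgn 𝒜 a * b) x v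
    rw [mul_assoc] at h
    rw [mul_assoc, diffE_ι_mul, map_sub, map_add, h, h', zero_add, zero_sub, normalize_tmul,
      normalize_prepend, hx, sgn_word_mul, sgn_word_ι]
    simp [normalize_tmul, wordMap_ι, tmul_neg]

theorem lastFace_mul_ι (a b : A) {n : ℤ} (hb : b ∈ 𝒜 n) (w : TensorAlgebra k A) :
    lastFace 𝒜 (a ⊗ₜ (w * TensorAlgebra.ι k b)) =
      LinearMap.rTensor _ (LinearMap.mulLeft k b)
        ((sgn (tensorGrading 𝒜 (wordGrading 𝒜)) ^ (n - 1).natAbs) (a ⊗ₜ w)) := by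
  have h : b ∈ shift 𝒜 1 (n - 1) := by simpa [shift] using hb
  simp only [lastFace, LinearMap.comp_apply, LinearMap.lTensor_tmul, LinearEquiv.coe_coe,
    letter_deconc_mul_ι, assoc_symm_tmul, koszul_right _ _ _ h]
  generalize (sgn (tensorGrading 𝒜 (wordGrading 𝒜)) ^ (n - 1).natAbs) (a ⊗ₜ[k] w) = z
  induction z using TensorProduct.induction_on with
  | zero => simp
  | add x y hx hy => rw [tmul_add, map_add, map_add, hx, hy, map_add]
  | tmul x y => simp

theorem sgn_pow_tmul (a : A) (w : TensorAlgebra k A) (r : ℕ) :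
    (sgn (tensorGrading 𝒜 (wordGrading 𝒜)) ^ r) (a ⊗ₜ[k] w) =
      (sgn 𝒜 ^ r) a ⊗ₜ[k] (sgn (wordGrading 𝒜) ^ r) w := by
  induction r with
  | zero => simp
  | succ r ih => simp only [pow_succ', Module.End.mul_apply, ih, sgn_tmul]

theorem sgn_pow_degenerate (u v : TensorAlgebra k A) (r : ℕ) :
    ∃ u' v', (sgn (wordGrading 𝒜) ^ r) (u * (TensorAlgebra.ι k (1 : A) * v)) =
      u' * (TensorAlgebra.ι k (1 : A) * v') := by
  induction r with
  | zero => exact ⟨u, v, rfl⟩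
  | succ r ih =>
    obtain ⟨u', v', h⟩ := ih
    refine ⟨-sgn (wordGrading 𝒜) u', sgn (wordGrading 𝒜) v', ?_⟩
    rw [pow_succ', Module.End.mul_apply, h, sgn_word_mul, sgn_word_mul, sgn_word_ι, sgn_one]
    simp

/-- Induction on words, from the right. -/
theorem word_induction_right {P : TensorAlgebra k V → Prop} (one : P 1)
    (add : ∀ v w, P v → P w → P (v + w)) (smul : ∀ (c : k) w, P w → P (c • w))
    (snoc : ∀ a w, P w → P (w * TensorAlgebra.ι k a)) (w : TensorAlgebra k V) : P w := by
  have key : ∀ w : TensorAlgebra k V, ∀ x, P x → P (x * w) := by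
    intro w
    induction w using TensorAlgebra.induction with
    | algebraMap r =>
      intro x hx; rw [← Algebra.commutes, ← Algebra.smul_def]; exact smul r x hx
    | ι a => exact fun x hx => snoc a x hx
    | mul a b ha hb => intro x hx; rw [← mul_assoc]; exact hb _ (ha _ hx)
    | add a b ha hb => intro x hx; rw [mul_add]; exact add _ _ (ha _ hx) (hb _ hx)
  simpa using key w 1 one

theorem lastFace_degenerate (a : A) (u v : TensorAlgebra k A) :
    normalize k A (lastFace 𝒜 (a ⊗ₜ (u * (TensorAlgebra.ι k (1 : A) * v)))) =
      TensorAlgebra.algebraMapInv v •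
        normalize k A (sgn 𝒜 a ⊗ₜ sgn (wordGrading 𝒜) u) := by
  induction v using word_induction_right with
  | one =>
    rw [mul_one, lastFace_mul_ι 𝒜 a 1 (n := 0) SetLike.GradedOne.one_mem, sgn_pow_tmul]
    simp
  | add x y hx hy => simp only [mul_add, tmul_add, map_add, hx, hy, add_smul]
  | smul c x hx => simp only [mul_smul_comm, tmul_smul, map_smul, hx, smul_assoc]
  | snoc b x hx =>
    have h0 : TensorAlgebra.algebraMapInv (x * TensorAlgebra.ι k b) = 0 := by
      simp [TensorAlgebra.algebraMapInv]
    rw [h0, zero_smul, ← mul_assoc, ← mul_assoc]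
    induction b using DirectSum.Decomposition.inductionOn 𝒜 with
    | zero => simp
    | add b b' hb hb' =>
      rw [map_add, mul_add, tmul_add, map_add, map_add, hb, hb', add_zero] <;>
        simp [TensorAlgebra.algebraMapInv]
    | homogeneous b =>
      rw [lastFace_mul_ι 𝒜 a (b : A) b.2, sgn_pow_tmul, LinearMap.rTensor_tmul, mul_assoc]
      obtain ⟨u', v', h⟩ := sgn_pow_degenerate 𝒜 u x (Int.natAbs (_ - 1))
      rw [h, normalize_degenerate]

theorem bigDiff_degenerate (d : A →ₗ[k] A) (hd : d 1 = 0) (a : A) (u v : TensorAlgebra k A) :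
    normalize k A (bigDiff 𝒜 d (a ⊗ₜ (u * (TensorAlgebra.ι k (1 : A) * v)))) = 0 := by
  change normalize k A (diffE 𝒜 d _ - lastFace 𝒜 _) = 0
  rw [map_sub, diffE_degenerate 𝒜 d hd, lastFace_degenerate, sub_self]

theorem abarLift_spec (x : Abar k A) :
    Submodule.mkQ (Submodule.span k {(1 : A)}) (abarLift k A x) = x :=
  LinearMap.congr_fun (Classical.choose_spec
    ((Submodule.mkQ (Submodule.span k {(1 : A)})).exists_rightInverse_of_surjective
      (Submodule.range_mkQ _))) x

/-- A linear map that vanishes on degenerate words depends only on normalized words. -/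
theorem eq_of_degenerate {Y : Type*} [AddCommGroup Y] [Module k Y] (f : TensorAlgebra k A →ₗ[k] Y)
    (hf : ∀ u v, f (u * (TensorAlgebra.ι k (1 : A) * v)) = 0) (w : TensorAlgebra k A) :
    f (wordMap (abarLift k A) (wordMap (Submodule.mkQ (Submodule.span k {(1 : A)})) w)) = f w := by
  have key : ∀ w u : TensorAlgebra k A, f (u * wordMap (abarLift k A)
      (wordMap (Submodule.mkQ (Submodule.span k {(1 : A)})) w)) = f (u * w) := by
    intro w
    induction w using word_induction with
    | one => intro u; simp
    | add x y hx hy => intro u; simp only [map_add, mul_add, hx, hy]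
    | smul c x hx => intro u; simp only [map_smul, mul_smul_comm, hx]
    | cons b x hx =>
      intro u
      have hb : b - abarLift k A (Submodule.mkQ (Submodule.span k {(1 : A)}) b) ∈
          Submodule.span k {(1 : A)} := by
        rw [← Submodule.Quotient.mk_eq_zero, Submodule.Quotient.mk_sub, sub_eq_zero]
        exact (abarLift_spec _).symm
      obtain ⟨c, hc⟩ := Submodule.mem_span_singleton.1 hb
      have hb' : b = abarLift k A (Submodule.mkQ (Submodule.span k {(1 : A)}) b) + c • 1 := by
        rw [hc]; abel
      rw [map_mul (wordMap (Submodule.mkQ (Submodule.span k {(1 : A)}))),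
        map_mul (wordMap (abarLift k A)), wordMap_ι, wordMap_ι, ← mul_assoc, hx]
      conv_rhs => rw [hb', map_add, map_smul, add_mul, mul_add, map_add, smul_mul_assoc,
        mul_smul_comm, map_smul, hf, smul_zero, add_zero]
      rw [mul_assoc]
  simpa using key w 1

/-- The Hochschild differential preserves degenerate words, hence descends to normalized chains,
and `chainDiff` is the induced map (whatever the section `abarLift`). -/
theorem chainDiff_normalize (d : A →ₗ[k] A) (hd : d 1 = 0) (x : BigChain k A) :
    chainDiff 𝒜 d (normalize k A x) = normalize k A (bigDiff 𝒜 d x) := by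
  induction x using TensorProduct.induction_on with
  | zero => simp
  | add x y hx hy => simp only [map_add, hx, hy]
  | tmul a w =>
    rw [normalize_tmul]
    exact eq_of_degenerate (normalize k A ∘ₗ bigDiff 𝒜 d ∘ₗ TensorProduct.mk k A _ a)
      (fun u v => bigDiff_degenerate 𝒜 d hd a u v) w

end Descent

section Structures

variable {k : Type*} [Field k]

/-- `(x, y, z) ↦ (-1)^{|x||y|} y ⊗ (x ⊗ z)`. -/
def swap₁₂ {X : Type*} [AddCommGroup X] [Module k X] (𝒳 : ℤ → Submodule k X)
    [DirectSum.Decomposition 𝒳] : X ⊗[k] (X ⊗[k] X) →ₗ[k] X ⊗[k] (X ⊗[k] X) :=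
  (TensorProduct.assoc k X X X).toLinearMap ∘ₗ LinearMap.rTensor X (koszul 𝒳 𝒳) ∘ₗ
    (TensorProduct.assoc k X X X).symm.toLinearMap

/-- For a map `f` of odd degree on `X` and a map `g` of the same degree on `Y`, the map
`f ⊗ 1 + 1 ⊗ g` on `X ⊗ Y`, that is, `x ⊗ y ↦ f x ⊗ y + (-1)^{|x|} x ⊗ g y`. -/
def oddSum {X Y : Type*} [AddCommGroup X] [Module k X] [AddCommGroup Y] [Module k Y]
    (𝒳 : ℤ → Submodule k X) [DirectSum.Decomposition 𝒳]
    (f : X →ₗ[k] X) (g : Y →ₗ[k] Y) : X ⊗[k] Y →ₗ[k] X ⊗[k] Y :=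
  LinearMap.rTensor Y f + TensorProduct.map (sgn 𝒳) g

/-- A differential graded open Frobenius algebra of degree `m`. As the coproduct `δ` has degree
`m`, the axioms carry the Koszul signs of an operation of degree `m`. -/
structure OpenFrobenius {A : Type*} [Ring A] [Algebra k A] (𝒜 : ℤ → Submodule k A)
    [GradedAlgebra 𝒜] (m : ℤ) where
  /-- the differential -/
  d : A →ₗ[k] A
  d_mem : ∀ ⦃n : ℤ⦄ ⦃a : A⦄, a ∈ 𝒜 n → d a ∈ 𝒜 (n + 1)
  d_d : ∀ a, d (d a) = 0
  leibniz : ∀ ⦃n : ℤ⦄ ⦃a : A⦄, a ∈ 𝒜 n → ∀ b, d (a * b) = d a * b + sg k n • (a * d b)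
  /-- the coproduct -/
  δ : A →ₗ[k] A ⊗[k] A
  δ_mem : ∀ ⦃n : ℤ⦄ ⦃a : A⦄, a ∈ 𝒜 n → δ a ∈ tensorGrading 𝒜 𝒜 (n + m)
  δ_d : ∀ a, δ (d a) = sg k m • oddSum 𝒜 d d (δ a)
  /-- `(δ ⊗ 1) δ = (-1)^m (1 ⊗ δ) δ`, where `(1 ⊗ δ)(x ⊗ y) = (-1)^{m |x|} x ⊗ δ y` -/
  coassoc : ∀ ⦃n : ℤ⦄ ⦃a : A⦄, a ∈ 𝒜 n →
    TensorProduct.assoc k A A A (LinearMap.rTensor A δ (δ a)) =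
      sg k m • TensorProduct.map (sgn 𝒜 ^ m.natAbs) δ (δ a)
  /-- `τ δ = (-1)^m δ` -/
  cocomm : ∀ a, koszul 𝒜 𝒜 (δ a) = sg k m • δ a
  /-- `δ (x y) = (-1)^{m |x|} ∑ x y' ⊗ y''` -/
  left_linear : ∀ ⦃n : ℤ⦄ ⦃x : A⦄, x ∈ 𝒜 n → ∀ y,
    δ (x * y) = sg k (m * n) • LinearMap.rTensor A (LinearMap.mulLeft k x) (δ y)
  /-- `δ (x y) = ∑ x' ⊗ x'' y` -/
  right_linear : ∀ x y, δ (x * y) = LinearMap.lTensor A (LinearMap.mulRight k y) (δ x)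

theorem OpenFrobenius.d_one {A : Type*} [Ring A] [Algebra k A] {𝒜 : ℤ → Submodule k A}
    [GradedAlgebra 𝒜] {m : ℤ} (F : OpenFrobenius 𝒜 m) : F.d 1 = 0 := by
  have h := F.leibniz (SetLike.GradedOne.one_mem (A := 𝒜)) 1
  simpa [sg] using h

/-- A homotopy coBV coalgebra: a complex `(C, D)` of cohomological degree, with a coproduct `θ` of
degree zero and an operator `B` of degree `-1`, such that `θ` is a coassociative chain map,
cocommutative up to homotopy, `B² = 0`, `B` is a chain map, and the coBV relation (the seven-term
relation, read backwards) holds up to homotopy. -/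
structure IsHomotopyCoBV {C : Type*} [AddCommGroup C] [Module k C] (𝒞 : ℤ → Submodule k C)
    [DirectSum.Decomposition 𝒞] (D : C →ₗ[k] C) (θ : C →ₗ[k] C ⊗[k] C) (B : C →ₗ[k] C) :
    Prop where
  D_mem : ∀ ⦃n : ℤ⦄ ⦃x : C⦄, x ∈ 𝒞 n → D x ∈ 𝒞 (n + 1)
  D_D : D ∘ₗ D = 0
  θ_mem : ∀ ⦃n : ℤ⦄ ⦃x : C⦄, x ∈ 𝒞 n → θ x ∈ tensorGrading 𝒞 𝒞 n
  θ_D : θ ∘ₗ D = oddSum 𝒞 D D ∘ₗ θ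
  B_mem : ∀ ⦃n : ℤ⦄ ⦃x : C⦄, x ∈ 𝒞 n → B x ∈ 𝒞 (n - 1)
  B_B : B ∘ₗ B = 0
  D_B : D ∘ₗ B + B ∘ₗ D = 0
  coassoc : (TensorProduct.assoc k C C C).toLinearMap ∘ₗ LinearMap.rTensor C θ ∘ₗ θ =
    LinearMap.lTensor C θ ∘ₗ θ
  cocomm : ∃ h : C →ₗ[k] C ⊗[k] C,
    (∀ ⦃n : ℤ⦄ ⦃x : C⦄, x ∈ 𝒞 n → h x ∈ tensorGrading 𝒞 𝒞 (n - 1)) ∧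
    h ∘ₗ D + oddSum 𝒞 D D ∘ₗ h = θ - koszul 𝒞 𝒞 ∘ₗ θ
  coBV : ∃ H : C →ₗ[k] C ⊗[k] (C ⊗[k] C),
    (∀ ⦃n : ℤ⦄ ⦃x : C⦄, x ∈ 𝒞 n → H x ∈ tensorGrading 𝒞 (tensorGrading 𝒞 𝒞) (n - 2)) ∧
    oddSum 𝒞 D (oddSum 𝒞 D D) ∘ₗ H - H ∘ₗ D =
      LinearMap.lTensor C θ ∘ₗ θ ∘ₗ B -
      ((TensorProduct.assoc k C C C).toLinearMap ∘ₗ LinearMap.rTensor C (θ ∘ₗ B) ∘ₗ θ +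
        TensorProduct.map (sgn 𝒞) (θ ∘ₗ B) ∘ₗ θ +
        swap₁₂ 𝒞 ∘ₗ TensorProduct.map (sgn 𝒞) (θ ∘ₗ B) ∘ₗ θ -
        oddSum 𝒞 B (oddSum 𝒞 B B) ∘ₗ LinearMap.lTensor C θ ∘ₗ θ)

/-- A BV-algebra structure on a graded vector space `H`: a graded commutative associative product
and an operator `Δ` of degree one with `Δ² = 0` that satisfy the seven-term relation. -/
structure BVAlgebra (k : Type*) [Field k] (H : ℤ → Type*) [∀ n, AddCommGroup (H n)]
    [∀ n, Module k (H n)] where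
  /-- the product -/
  mul : ∀ {p q r : ℤ}, p + q = r → H p →ₗ[k] H q →ₗ[k] H r
  /-- the BV operator -/
  Δ : ∀ {p q : ℤ}, p + 1 = q → H p →ₗ[k] H q
  mul_assoc : ∀ {p q r pq qr n : ℤ} (h₁ : p + q = pq) (h₂ : q + r = qr) (h₃ : pq + r = n)
    (h₄ : p + qr = n) (a : H p) (b : H q) (c : H r),
    mul h₃ (mul h₁ a b) c = mul h₄ a (mul h₂ b c)
  mul_comm : ∀ {p q n : ℤ} (h₁ : p + q = n) (h₂ : q + p = n) (a : H p) (b : H q),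
    mul h₁ a b = sg k (p * q) • mul h₂ b a
  Δ_Δ : ∀ {p q r : ℤ} (h₁ : p + 1 = q) (h₂ : q + 1 = r) (a : H p), Δ h₂ (Δ h₁ a) = 0
  seven_term : ∀ {p q r pq pr qr n : ℤ} (h₁ : p + q = pq) (h₂ : p + r = pr) (h₃ : q + r = qr)
    (h : pq + r = n) (a : H p) (b : H q) (c : H r),
    Δ (p := n) (q := n + 1) rfl (mul h (mul h₁ a b) c) =
      mul (by omega) (Δ (q := pq + 1) rfl (mul h₁ a b)) c +
      sg k p • mul (by omega) a (Δ (q := qr + 1) rfl (mul h₃ b c)) +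
      sg k ((p - 1) * q) • mul (by omega) b (Δ (q := pr + 1) rfl (mul h₂ a c)) -
      mul (p := pq + 1) (by omega) (mul (by omega) (Δ (q := p + 1) rfl a) b) c -
      sg k p • mul (p := pq + 1) (by omega) (mul (by omega) a (Δ (q := q + 1) rfl b)) c -
      sg k (p + q) • mul (by omega) (mul h₁ a b) (Δ (q := r + 1) rfl c)

variable {C : Type*} [AddCommGroup C] [Module k C] {N : Type*} [AddCommGroup N] [Module k N]

/-- Degree-`n` cochains with values in `N`: linear maps `C → N` supported in degree `-n`. -/
def cochains (𝒞 : ℤ → Submodule k C) (N : Type*) [AddCommGroup N] [Module k N] (n : ℤ) :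
    Submodule k (C →ₗ[k] N) where
  carrier := {f | ∀ j, j ≠ -n → ∀ x ∈ 𝒞 j, f x = 0}
  add_mem' := fun hf hg j hj x hx => by
    rw [LinearMap.add_apply, hf j hj x hx, hg j hj x hx, add_zero]
  zero_mem' := fun _ _ _ _ => rfl
  smul_mem' := fun c f hf j hj x hx => by rw [LinearMap.smul_apply, hf j hj x hx, smul_zero]

/-- Degree-`n` cocycles of the complex `Hom(C, N)`, whose differential is `f ↦ ± f ∘ D`. -/
def cocycles (𝒞 : ℤ → Submodule k C) (D : C →ₗ[k] C) (N : Type*) [AddCommGroup N] [Module k N]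
    (n : ℤ) : Submodule k (C →ₗ[k] N) :=
  cochains 𝒞 N n ⊓ LinearMap.ker (LinearMap.lcomp k N D)

/-- Degree-`n` coboundaries of the complex `Hom(C, N)`. -/
def coboundaries (𝒞 : ℤ → Submodule k C) (D : C →ₗ[k] C) (N : Type*) [AddCommGroup N]
    [Module k N] (n : ℤ) : Submodule k (C →ₗ[k] N) :=
  (cochains 𝒞 N (n - 1)).map (LinearMap.lcomp k N D)

/-- Degree-`n` cohomology of the complex `Hom(C, N)`. -/
abbrev Cohomology (𝒞 : ℤ → Submodule k C) (D : C →ₗ[k] C) (N : Type*) [AddCommGroup N]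
    [Module k N] (n : ℤ) : Type _ :=
  cocycles 𝒞 D N n ⧸ (coboundaries 𝒞 D N n).submoduleOf (cocycles 𝒞 D N n)

/-- The cohomology class of a cocycle. -/
def cls {𝒞 : ℤ → Submodule k C} {D : C →ₗ[k] C} {n : ℤ} {f : C →ₗ[k] N}
    (hf : f ∈ cocycles 𝒞 D N n) : Cohomology 𝒞 D N n :=
  Submodule.Quotient.mk ⟨f, hf⟩

end Structures

section Main

variable {k : Type*} [Field k] {A : Type*} [Ring A] [Algebra k A]
variable {𝒜 : ℤ → Submodule k A} [GradedAlgebra 𝒜] {m : ℤ}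

/-- The cup product of `f ∈ C^p(A, A^∨)` and `g ∈ C^q(A, A^∨)`:
`(f ∪ g)(a₀[a₁, …, a_n]) = ∑ ± f(a₀'[a₁, …, a_i]) g(a₀''[a_{i+1}, …, a_n])`. -/
def cup (F : OpenFrobenius 𝒜 m) (p q : ℤ) (f g : Chain k A →ₗ[k] k) :
    Chain k A →ₗ[k] k :=
  sg k ((p + m) * q) •
    (LinearMap.mul' k k ∘ₗ TensorProduct.map f g ∘ₗ chainCoproduct 𝒜 F.δ)

/-- `B^∨ f = (-1)^{|f|} f ∘ B` for `f ∈ C^p(A, A^∨)`. -/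
def connesDual (𝒜 : ℤ → Submodule k A) [GradedAlgebra 𝒜] (p : ℤ)
    (f : Chain k A →ₗ[k] k) : Chain k A →ₗ[k] k :=
  sg k p • (f ∘ₗ connes 𝒜)

/-- `HH^n(A, A^∨)`, computed by `C^*(A, A^∨) = Hom(A ⊗ T(sĀ), k)`. -/
abbrev HH (F : OpenFrobenius 𝒜 m) (n : ℤ) : Type _ :=
  Cohomology (chainGrading 𝒜) (chainDiff 𝒜 F.d) k n

/-- The coproduct `θ` as an operation of degree zero on the chains shifted by `m`:
`x ↦ ∑ (-1)^{m |x'|} x' ⊗ x''`. -/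
def shiftedCoproduct (F : OpenFrobenius 𝒜 m) : Chain k A →ₗ[k] Chain k A ⊗[k] Chain k A :=
  LinearMap.rTensor _ (sgn (chainGrading 𝒜) ^ m.natAbs) ∘ₗ chainCoproduct 𝒜 F.δ

end Main

end HochBV

end

open scoped TensorProduct DirectSum

noncomputable section

namespace HochBV

set_option linter.unusedSectionVars false

/-! ### Signs as polynomials in degrees modulo 2. -/

section Signs

variable {k : Type*} [Field k]

/-! Module linearity gives `δ x = ∑ e' ⊗ e'' x`, where `δ 1 = ∑ e' ⊗ e''`, so the coproduct of `A`
is carried by one element of `A ⊗ A` (`Casimir`). This element is a cycle and symmetric up to sign,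
and factors move between its slots: `c e' ⊗ e'' = ± e' ⊗ e'' c` (`Casimir.mul_left`), `e' c ⊗ e'' =
± e' ⊗ c e''` (`Casimir.mul_mid`), `e' ⊗ e'' c = ± e' c ⊗ e''` (`Casimir.mul_right`). These rules
make `θ` a coassociative chain map: the faces on the two sides of a cut of the word cancel
(`cyc_coprod`).

All homotopies insert the Casimir element into a word: a subword `v` is replaced by the letter `e'`
and split off as the chain `e''[v]`. The faces at the seams cancel by the same rules
(`ins_insDiff`), so the differential of an insertion consists only of terms in which the inserted
letter meets a marked letter or becomes part of the coefficient. Three insertions are used.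

(a) `g(a[l]) = ∑ ± a[u, e', w] ⊗ e''[v]`. The boundary terms `a e'` and `e' a` are `τθ` and `θ`, so
`g` is a homotopy between them (`cyc_comm`).

(b) `S(a[l]) = ∑ ± 1[y, a, u, e', w] ⊗ e''[v]`. Write `θ B = Q + τ Q`, where `Q` collects the terms
with `a` in the left factor (`rot_coprod`). Then `[D, S] + g + (B ⊗ 1)τθ = Q` (`rotIns_tensorDiff`),
and `H = S + τ S + (B ⊗ 1) g` is a homotopy between `θ B - (B ⊗ 1 + 1 ⊗ B)θ` and the cobracket `g +
τ g`.

(c) Two nested insertions, with the last two factors exchanged, give `K`, which shows that `g` is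
compatible with `θ` up to homotopy (`tripleDiff_brace`); `τ g` is compatible with it strictly
(`comm_coprod`).

Thus the deviation of `B` from a coderivation is itself a coderivation in each argument up to
homotopy, so `B` has order two, which is the coBV relation. `coBV_homotopy` combines `H`, `K` and a
correction built from `g` that reorders tensor factors.

For the second part, functionals are paired with these identities. On cocycles a homotopy
contributes only a coboundary, so associativity, commutativity and the seven-term relation pass to
cohomology; only the comparison of signs remains (`cup_eq_dualMul`, `connesDual_eq`).

Operators are handled through their values on words of homogeneous letters: `cyc F Ψ a l` is `Ψ`
evaluated on `D(a[l])`, so that every identity becomes one about cutting lists, together with a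
congruence of sign exponents. -/

theorem sg_congr {p q : ℤ} (h : ((p : ℤ) : ZMod 2) = ((q : ℤ) : ZMod 2)) : sg k p = sg k q := by
  obtain ⟨r, hr⟩ := (ZMod.intCast_eq_intCast_iff_dvd_sub p q 2).1 h
  have : q = p + 2 * r := by push_cast at hr; linarith
  rw [this]; simp [sg, Int.negOnePow_add]

/-- Modulo 2 a degree is idempotent. Comparing two signs amounts to comparing two polynomials over
`ZMod 2` in the degrees, and this rule makes them multilinear. -/
theorem intCast_mul_self (n : ℤ) : (n : ZMod 2) * (n : ZMod 2) = (n : ZMod 2) := by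
  generalize (n : ZMod 2) = z; revert z; decide

theorem sg_zero : sg k 0 = 1 := by simp [sg]

theorem neg_sg (p : ℤ) : -sg k p = sg k (p + 1) := by simp [sg, Int.negOnePow_add]

theorem sg_mul_self (p : ℤ) : sg k p * sg k p = 1 := by
  rw [← sg_add, ← sg_zero]; exact sg_congr (by push_cast; grind [=_ intCast_mul_self])

theorem sg_smul_congr {Y : Type*} [AddCommGroup Y] [Module k Y] {p q : ℤ} {y : Y}
    (h : ((p : ℤ) : ZMod 2) = ((q : ℤ) : ZMod 2)) : sg k p • y = sg k q • y := by
  rw [sg_congr h]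

end Signs

/-! ### Cutting lists: the combinatorics of deconcatenation. -/

section Splittings

variable {k : Type*} [Field k] {X Y Z : Type*} [AddCommGroup Y] [Module k Y]
  [AddCommGroup Z] [Module k Z]

/-- `∑ Φ u v` over all `u ++ v = l`. -/
def splitSum : (List X → List X → Y) → List X → Y
  | Φ, [] => Φ [] []
  | Φ, x :: l => Φ [] (x :: l) + splitSum (fun u v => Φ (x :: u) v) l

/-- `y` on the empty word, zero otherwise. -/
def onNil (y : Y) : List X → Y
  | [] => y
  | _ :: _ => 0

/-- Split off the first letter; zero on the empty word. -/
def onHead (Φ : X → List X → Y) : List X → Y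
  | [] => 0
  | x :: l => Φ x l

/-- Split off the last letter; zero on the empty word. -/
def onLast : (List X → X → Y) → List X → Y
  | _, [] => 0
  | Φ, x :: l => onNil (Φ [] x) l + onLast (fun u y => Φ (x :: u) y) l

@[simp] theorem onNil_nil (y : Y) : onNil y ([] : List X) = y := rfl

@[simp] theorem onNil_cons (y : Y) (x : X) (l : List X) : onNil y (x :: l) = 0 := rfl

@[simp] theorem onHead_nil (Φ : X → List X → Y) : onHead Φ [] = 0 := rfl

@[simp] theorem onHead_cons (Φ : X → List X → Y) (x : X) (l : List X) :
    onHead Φ (x :: l) = Φ x l := rfl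

theorem splitSum_congr {Φ Ψ : List X → List X → Y} {l : List X}
    (h : ∀ u v, u ++ v = l → Φ u v = Ψ u v) : splitSum Φ l = splitSum Ψ l := by
  induction l generalizing Φ Ψ with
  | nil => exact h _ _ rfl
  | cons x l ih =>
    simp only [splitSum]
    rw [h [] (x :: l) rfl, ih]
    intro u v e
    exact h _ _ (by rw [← e]; rfl)

theorem onHead_congr {Φ Ψ : X → List X → Y} {l : List X}
    (h : ∀ x u, x :: u = l → Φ x u = Ψ x u) : onHead Φ l = onHead Ψ l := by
  cases l with
  | nil => rfl
  | cons x l => exact h _ _ rfl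

/-- The recursion for `onLast` runs from the left, like that of `splitSum`; here it is evaluated
from the right, which is how face terms at the end of a word are computed. -/
theorem onLast_append (Φ : List X → X → Y) (l : List X) (x : X) : onLast Φ (l ++ [x]) = Φ l x := by
  induction l generalizing Φ with
  | nil => simp [onLast]
  | cons y l ih =>
    rw [List.cons_append, onLast, ih]
    cases l <;> simp

theorem onLast_congr {Φ Ψ : List X → X → Y} {l : List X}
    (h : ∀ u x, u ++ [x] = l → Φ u x = Ψ u x) : onLast Φ l = onLast Ψ l := by
  induction l using List.reverseRecOn with
  | nil => rfl
  | append_singleton l x => rw [onLast_append, onLast_append]; exact h _ _ rfl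

theorem map_splitSum (f : Y →ₗ[k] Z) (Φ : List X → List X → Y) (l : List X) :
    f (splitSum Φ l) = splitSum (fun u v => f (Φ u v)) l := by
  induction l generalizing Φ with
  | nil => rfl
  | cons x l ih => simp only [splitSum, map_add, ih]

theorem map_onHead (f : Y →ₗ[k] Z) (Φ : X → List X → Y) (l : List X) :
    f (onHead Φ l) = onHead (fun x u => f (Φ x u)) l := by
  cases l <;> simp

theorem map_onLast (f : Y →ₗ[k] Z) (Φ : List X → X → Y) (l : List X) :
    f (onLast Φ l) = onLast (fun u x => f (Φ u x)) l := by
  induction l using List.reverseRecOn with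
  | nil => simp [onLast]
  | append_singleton l x => rw [onLast_append, onLast_append]

theorem splitSum_add (Φ Ψ : List X → List X → Y) (l : List X) :
    splitSum (fun u v => Φ u v + Ψ u v) l = splitSum Φ l + splitSum Ψ l := by
  induction l generalizing Φ Ψ with
  | nil => rfl
  | cons x l ih => simp only [splitSum, ih]; abel

theorem splitSum_neg (Φ : List X → List X → Y) (l : List X) :
    splitSum (fun u v => -Φ u v) l = -splitSum Φ l := by
  induction l generalizing Φ with
  | nil => rfl
  | cons x l ih => simp only [splitSum, ih]; abel

theorem splitSum_sub (Φ Ψ : List X → List X → Y) (l : List X) :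
    splitSum (fun u v => Φ u v - Ψ u v) l = splitSum Φ l - splitSum Ψ l := by
  simp only [sub_eq_add_neg, splitSum_add, splitSum_neg]

theorem splitSum_smul (c : k) (Φ : List X → List X → Y) (l : List X) :
    splitSum (fun u v => c • Φ u v) l = c • splitSum Φ l :=
  (map_splitSum (LinearMap.lsmul k Y c) Φ l).symm

theorem splitSum_sum {ι : Type*} (t : Finset ι) (Φ : ι → List X → List X → Y) (l : List X) :
    splitSum (fun u v => ∑ s ∈ t, Φ s u v) l = ∑ s ∈ t, splitSum (Φ s) l := by
  induction l generalizing Φ with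
  | nil => rfl
  | cons x l ih => simp only [splitSum, ih, Finset.sum_add_distrib]

theorem onHead_add (Φ Ψ : X → List X → Y) (l : List X) :
    onHead (fun x u => Φ x u + Ψ x u) l = onHead Φ l + onHead Ψ l := by
  cases l <;> simp

theorem onHead_neg (Φ : X → List X → Y) (l : List X) :
    onHead (fun x u => -Φ x u) l = -onHead Φ l := by
  cases l <;> simp

theorem onHead_smul (c : k) (Φ : X → List X → Y) (l : List X) :
    onHead (fun x u => c • Φ x u) l = c • onHead Φ l :=
  (map_onHead (LinearMap.lsmul k Y c) Φ l).symm

theorem onHead_sum {ι : Type*} (t : Finset ι) (Φ : ι → X → List X → Y) (l : List X) :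
    onHead (fun x u => ∑ s ∈ t, Φ s x u) l = ∑ s ∈ t, onHead (Φ s) l := by
  cases l <;> simp

theorem onLast_add (Φ Ψ : List X → X → Y) (l : List X) :
    onLast (fun u x => Φ u x + Ψ u x) l = onLast Φ l + onLast Ψ l := by
  induction l using List.reverseRecOn with
  | nil => simp [onLast]
  | append_singleton l x => simp only [onLast_append]

theorem onLast_neg (Φ : List X → X → Y) (l : List X) :
    onLast (fun u x => -Φ u x) l = -onLast Φ l := by
  induction l using List.reverseRecOn with
  | nil => simp [onLast]
  | append_singleton l x => simp only [onLast_append]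

theorem onLast_smul (c : k) (Φ : List X → X → Y) (l : List X) :
    onLast (fun u x => c • Φ u x) l = c • onLast Φ l :=
  (map_onLast (LinearMap.lsmul k Y c) Φ l).symm

theorem onLast_sum {ι : Type*} (t : Finset ι) (Φ : ι → List X → X → Y) (l : List X) :
    onLast (fun u x => ∑ s ∈ t, Φ s u x) l = ∑ s ∈ t, onLast (Φ s) l := by
  induction l using List.reverseRecOn with
  | nil => simp [onLast]
  | append_singleton l x => simp only [onLast_append]

theorem splitSum_zero (l : List X) : splitSum (fun _ _ => (0 : Y)) l = 0 := by
  induction l with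
  | nil => rfl
  | cons x l ih => simp only [splitSum, ih, add_zero]

/-- Counit law: only the cut at the left end contributes. -/
theorem splitSum_onNil_left (Φ : List X → Y) (l : List X) :
    splitSum (fun u v => onNil (Φ v) u) l = Φ l := by
  cases l with
  | nil => rfl
  | cons x l => simp only [splitSum, onNil_nil, onNil_cons, splitSum_zero, add_zero]

theorem splitSum_onNil_right (Φ : List X → Y) (l : List X) :
    splitSum (fun u v => onNil (Φ u) v) l = Φ l := by
  induction l generalizing Φ with
  | nil => rfl
  | cons x l ih => simp only [splitSum, onNil_cons, zero_add, ih]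

/-- A letter at a cut is either the first letter of the right piece or, after moving the cut one
place, the last letter of the left piece. This exchange lets face terms on the two sides of a cut be
compared. -/
theorem splitSum_onHead_right (Φ : List X → X → List X → Y) (l : List X) :
    splitSum (fun u v => onHead (Φ u) v) l =
      splitSum (fun u v => onLast (fun u' x => Φ u' x v) u) l := by
  induction l generalizing Φ with
  | nil => rfl
  | cons x l ih =>
    simp only [splitSum, onHead_cons, onLast, zero_add, ih, splitSum_add]
    rw [splitSum_onNil_left (fun v => Φ [] x v)]

theorem splitSum_onHead_left (Φ : X → List X → List X → Y) (l : List X) :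
    splitSum (fun u v => onHead (fun x u' => Φ x u' v) u) l =
      onHead (fun x l' => splitSum (Φ x) l') l := by
  cases l with
  | nil => rfl
  | cons x l => simp only [splitSum, onHead_cons, onHead_nil, zero_add]

theorem splitSum_onLast_right (Φ : List X → List X → X → Y) (l : List X) :
    splitSum (fun u v => onLast (Φ u) v) l =
      onLast (fun l' x => splitSum (fun u v => Φ u v x) l') l := by
  induction l generalizing Φ with
  | nil => rfl
  | cons x l ih =>
    simp only [splitSum, onLast, ih, onLast_add]
    cases l with
    | nil => simp [onLast]
    | cons y l => simp

/-- Coassociativity of deconcatenation. -/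
theorem splitSum_assoc (Φ : List X → List X → List X → Y) (l : List X) :
    splitSum (fun r w => splitSum (fun u v => Φ u v w) r) l =
      splitSum (fun u r => splitSum (Φ u) r) l := by
  induction l generalizing Φ with
  | nil => rfl
  | cons x l ih => simp only [splitSum, splitSum_add, ih]; abel

/-- The cut falls on one side of the marked letter `x`. Cutting directly before `x` is the term `u₂
= []` of the first sum, directly after it the term `v₁ = []` of the second, so each cut is counted
once. -/
theorem splitSum_append (Φ : List X → List X → Y) (u : List X) (x : X) (v : List X) :
    splitSum Φ (u ++ x :: v) = splitSum (fun u₁ u₂ => Φ u₁ (u₂ ++ x :: v)) u +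
      splitSum (fun v₁ v₂ => Φ (u ++ x :: v₁) v₂) v := by
  induction u generalizing Φ with
  | nil => rfl
  | cons y u ih => simp only [List.cons_append, splitSum, ih, add_assoc]

end Splittings

/-! ### Homogeneous letters; the bar and Hochschild differentials as operations on functions of
words. -/

section Letters

variable {k : Type*} [Field k] {A : Type*} [Ring A] [Algebra k A]
  {𝒜 : ℤ → Submodule k A} [GradedAlgebra 𝒜] {m : ℤ}
  {Y Z : Type*} [AddCommGroup Y] [Module k Y] [AddCommGroup Z] [Module k Z]

/-- Homogeneous elements. -/
@[ext] structure Letter (𝒜 : ℤ → Submodule k A) where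
  /-- the degree -/
  deg : ℤ
  /-- the underlying element -/
  val : A
  mem : val ∈ 𝒜 deg

/-- The degree is part of the data, so signs are functions of letters even when the element is zero,
and the monoid laws hold as equalities of letters, degrees included. -/
instance : Monoid (Letter 𝒜) where
  mul x y := ⟨x.deg + y.deg, x.val * y.val, SetLike.mul_mem_graded x.mem y.mem⟩
  one := ⟨0, 1, SetLike.GradedOne.one_mem⟩
  mul_assoc x y z := Letter.ext (add_assoc _ _ _) (mul_assoc _ _ _)
  one_mul x := Letter.ext (zero_add _) (one_mul _)
  mul_one x := Letter.ext (add_zero _) (mul_one _)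

/-- The differential of a homogeneous element. -/
def OpenFrobenius.dL (F : OpenFrobenius 𝒜 m) (x : Letter 𝒜) : Letter 𝒜 :=
  ⟨x.deg + 1, F.d x.val, F.d_mem x.mem⟩

@[simp] theorem OpenFrobenius.dL_deg (F : OpenFrobenius 𝒜 m) (x : Letter 𝒜) :
    (F.dL x).deg = x.deg + 1 := rfl

@[simp] theorem OpenFrobenius.dL_val (F : OpenFrobenius 𝒜 m) (x : Letter 𝒜) :
    (F.dL x).val = F.d x.val := rfl

@[simp] theorem Letter.mul_deg (x y : Letter 𝒜) : (x * y).deg = x.deg + y.deg := rfl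

@[simp] theorem Letter.mul_val (x y : Letter 𝒜) : (x * y).val = x.val * y.val := rfl

@[simp] theorem Letter.one_deg : (1 : Letter 𝒜).deg = 0 := rfl

@[simp] theorem Letter.one_val : (1 : Letter 𝒜).val = 1 := rfl

/-- The degree `∑ (|x| - 1)` of a word. -/
def wd (l : List (Letter 𝒜)) : ℤ := (l.map fun x => x.deg - 1).sum

@[simp] theorem wd_nil : wd ([] : List (Letter 𝒜)) = 0 := rfl

@[simp] theorem wd_cons (x : Letter 𝒜) (l : List (Letter 𝒜)) : wd (x :: l) = x.deg - 1 + wd l := rfl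

@[simp] theorem wd_append (l l' : List (Letter 𝒜)) : wd (l ++ l') = wd l + wd l' := by
  simp [wd]

/-- The bar differential of a function of words. -/
def bar (F : OpenFrobenius 𝒜 m) : (List (Letter 𝒜) → Y) → List (Letter 𝒜) → Y
  | _, [] => 0
  | G, x :: l => -G (F.dL x :: l) - sg k x.deg • onHead (fun y l' => G (x * y :: l')) l -
      sg k x.deg • bar F (fun l' => G (x :: l')) l

/-- The Hochschild differential of a function of a coefficient and a word. -/
def cyc (F : OpenFrobenius 𝒜 m) (Ψ : Letter 𝒜 → List (Letter 𝒜) → Y) (a : Letter 𝒜)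
    (l : List (Letter 𝒜)) : Y :=
  Ψ (F.dL a) l + sg k a.deg • bar F (Ψ a) l + sg k a.deg • onHead (fun x l' => Ψ (a * x) l') l -
    onLast (fun l' x => sg k ((x.deg - 1) * (a.deg + wd l')) • Ψ (x * a) l') l

variable (F : OpenFrobenius 𝒜 m)

/-- `bar F G` is the linear extension of `G` evaluated on the bar differential of a word, hence
natural in the target. Additivity and homogeneity in `G` are instances of the same principle. -/
theorem map_bar (f : Y →ₗ[k] Z) (G : List (Letter 𝒜) → Y) (l : List (Letter 𝒜)) :
    f (bar F G l) = bar F (fun l' => f (G l')) l := by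
  induction l generalizing G with
  | nil => simp [bar]
  | cons x l ih => simp only [bar, map_sub, map_neg, map_smul, map_onHead, ih]

theorem bar_add (G H : List (Letter 𝒜) → Y) (l : List (Letter 𝒜)) :
    bar F (fun l' => G l' + H l') l = bar F G l + bar F H l := by
  induction l generalizing G H with
  | nil => simp [bar]
  | cons x l ih => simp only [bar, onHead_add, ih, smul_add]; abel

theorem bar_smul (c : k) (G : List (Letter 𝒜) → Y) (l : List (Letter 𝒜)) :
    bar F (fun l' => c • G l') l = c • bar F G l :=
  (map_bar F (LinearMap.lsmul k Y c) G l).symm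

theorem bar_neg (G : List (Letter 𝒜) → Y) (l : List (Letter 𝒜)) :
    bar F (fun l' => -G l') l = -bar F G l :=
  (map_bar F (-LinearMap.id) G l).symm

theorem bar_zero (l : List (Letter 𝒜)) : bar F (fun _ => (0 : Y)) l = 0 := by
  have := map_bar F (0 : Y →ₗ[k] Y) (fun _ => 0) l
  simpa using this.symm

theorem bar_sum {ι : Type*} (t : Finset ι) (G : ι → List (Letter 𝒜) → Y) (l : List (Letter 𝒜)) :
    bar F (fun l' => ∑ s ∈ t, G s l') l = ∑ s ∈ t, bar F (G s) l := by
  classical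
  induction t using Finset.induction_on with
  | empty => simp [bar_zero]
  | insert a t ha ih => simp only [Finset.sum_insert ha, bar_add, ih]

/-- Every word occurring in the bar differential of `l` has degree `wd l + 1`, so a sign depending
on the degree of the word comes out as a constant. -/
theorem bar_congr_deg {G H : List (Letter 𝒜) → Y} {l : List (Letter 𝒜)} (c : k)
    (h : ∀ l', wd l' = wd l + 1 → G l' = c • H l') : bar F G l = c • bar F H l := by
  rw [← bar_smul]
  induction l generalizing G H with
  | nil => simp [bar]
  | cons x l ih =>
    simp only [bar]
    congr 1
    · congr 1
      · rw [h _ (by simp; ring)]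
      · congr 1
        refine onHead_congr fun y l' e => h _ ?_
        rw [← e]; simp; ring
    · congr 1
      refine ih fun l' e => h _ ?_
      rw [wd_cons, e, wd_cons]; ring

/-- The bar differential is a coderivation of deconcatenation: a cut of a differentiated word never
passes through the merged letter, which therefore lies wholly in one of the two pieces. -/
theorem bar_splitSum (Φ : List (Letter 𝒜) → List (Letter 𝒜) → Y) (l : List (Letter 𝒜)) :
    bar F (splitSum Φ) l =
      splitSum (fun u v => bar F (fun u' => Φ u' v) u + sg k (wd u) • bar F (Φ u) v) l := by
  induction l generalizing Φ with
  | nil => simp [bar, splitSum]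
  | cons x l ih =>
    simp only [bar, splitSum, bar_add, ih, splitSum_sub, splitSum_add, splitSum_neg,
      splitSum_smul, onHead_add, wd_nil, sg_zero, one_smul, wd_cons, sg_add]
    rw [splitSum_onHead_left (fun y u' v => Φ (x * y :: u') v)]
    simp only [← smul_smul, splitSum_smul]
    have : sg k (x.deg - 1) = - sg k x.deg := by
      rw [neg_sg]; exact sg_congr (by push_cast; grind)
    rw [this]
    simp only [smul_add, neg_smul]
    abel

/-- A merge inside `u ++ p :: w` takes place within `u`, between the last letter of `u` and `p`, or
within `p :: w`. -/
theorem bar_append (G : List (Letter 𝒜) → Y) (u : List (Letter 𝒜)) (p : Letter 𝒜)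
    (w : List (Letter 𝒜)) :
    bar F G (u ++ p :: w) = bar F (fun u' => G (u' ++ p :: w)) u -
      onLast (fun u' x => sg k (wd u' + x.deg) • G (u' ++ x * p :: w)) u +
      sg k (wd u) • bar F (fun l => G (u ++ l)) (p :: w) := by
  induction u generalizing G with
  | nil => simp [bar, onLast, sg_zero]
  | cons x u ih =>
    have hx : sg k (x.deg - 1) = - sg k x.deg := by
      rw [neg_sg]; exact sg_congr (by push_cast; grind)
    -- If `u` is empty, the neighbour that `x` is merged with is `p` itself; this is the `onNil`
    -- term.
    have e : onHead (fun y l' => G (x * y :: l')) (u ++ p :: w) =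
        onHead (fun y l' => G (x * y :: (l' ++ p :: w))) u + onNil (G (x * p :: w)) u := by
      cases u <;> simp
    rw [List.cons_append, bar, e, ih, onLast]
    have e4 : bar F (fun u' => G (u' ++ p :: w)) (x :: u) =
        -G (F.dL x :: (u ++ p :: w)) -
          sg k x.deg • onHead (fun y l' => G (x * y :: (l' ++ p :: w))) u -
          sg k x.deg • bar F (fun u' => G (x :: (u' ++ p :: w))) u := rfl
    rw [e4]
    have e2 : onLast (fun u' y => sg k (wd (x :: u') + y.deg) • G (x :: u' ++ y * p :: w)) u =
        - sg k x.deg • onLast (fun u' y => sg k (wd u' + y.deg) • G (x :: (u' ++ y * p :: w))) u := by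
      rw [← onLast_smul]
      refine onLast_congr fun u' y _ => ?_
      rw [smul_smul, neg_sg, ← sg_add]
      exact sg_smul_congr (by simp; grind)
    have e3 : onNil (sg k (wd ([] : List (Letter 𝒜)) + x.deg) • G ([] ++ x * p :: w)) u =
        sg k x.deg • onNil (G (x * p :: w)) u := by
      cases u <;> simp
    rw [e2, e3, wd_cons, sg_add, hx]
    simp only [List.cons_append, smul_add, smul_sub, smul_smul, neg_mul, neg_smul]
    abel

end Letters

/-! ### Normalized chains spelled in letters, and the differential on them. -/

section Chains

variable {k : Type*} [Field k] {A : Type*} [Ring A] [Algebra k A]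
  {𝒜 : ℤ → Submodule k A} [GradedAlgebra 𝒜] {m : ℤ}
  {Y Z : Type*} [AddCommGroup Y] [Module k Y] [AddCommGroup Z] [Module k Z]

/-- The word `[x₁, …, x_n]` in `T(sĀ)`. -/
def word (l : List (Letter 𝒜)) : TensorAlgebra k (Abar k A) :=
  (l.map fun x => TensorAlgebra.ι k (Submodule.mkQ (Submodule.span k {(1 : A)}) x.val)).prod

/-- The normalized chain `a[x₁, …, x_n]`. -/
def chain (a : Letter 𝒜) (l : List (Letter 𝒜)) : Chain k A := a.val ⊗ₜ[k] word l

@[simp] theorem word_nil : word ([] : List (Letter 𝒜)) = 1 := rfl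

theorem word_cons (x : Letter 𝒜) (l : List (Letter 𝒜)) :
    word (x :: l) =
      TensorAlgebra.ι k (Submodule.mkQ (Submodule.span k {(1 : A)}) x.val) * word l := by
  simp [word]

theorem word_append (l l' : List (Letter 𝒜)) : word (l ++ l') = word l * word l' := by
  simp [word]

theorem word_mem (l : List (Letter 𝒜)) :
    word l ∈ wordGrading (quotGrading 𝒜 (Submodule.span k {(1 : A)})) (wd l) := by
  induction l with
  | nil => exact SetLike.GradedOne.one_mem
  | cons x l ih =>
    rw [word_cons]
    exact SetLike.mul_mem_graded (ι_mem_wordGrading _ (Submodule.mem_map_of_mem x.mem)) ih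

theorem chain_mem (a : Letter 𝒜) (l : List (Letter 𝒜)) :
    chain a l ∈ chainGrading 𝒜 (a.deg + wd l) :=
  tmul_mem_tensorGrading _ _ a.mem (word_mem l)

/-- A homogeneous element of the quotient has a homogeneous representative in `A`, so words in
letters of `A` span. -/
theorem wordGrading_le (n : ℤ) :
    wordGrading (quotGrading 𝒜 (Submodule.span k {(1 : A)})) n ≤
      Submodule.span k {w | ∃ l : List (Letter 𝒜), wd l = n ∧ word l = w} := by
  refine Submodule.span_le.2 ?_
  rintro _ ⟨l, rfl, rfl⟩
  refine Submodule.subset_span ?_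
  induction l with
  | nil => exact ⟨[], rfl, rfl⟩
  | cons x l ih =>
    obtain ⟨l', h, h'⟩ := ih
    obtain ⟨i, y, z, hz, rfl⟩ := x
    refine ⟨⟨i, z, hz⟩ :: l', by simp [h], ?_⟩
    rw [word_cons, h', List.map_cons, List.prod_cons]

/-- The chains `a[l]` in letters span each graded piece. Both the comparison of linear maps on
chains and the computation of their degrees rest on this. -/
theorem map_mem_of_chain (f : Chain k A →ₗ[k] Y) (S : Submodule k Y) {n : ℤ}
    (h : ∀ (a : Letter 𝒜) l, a.deg + wd l = n → f (chain a l) ∈ S) {x : Chain k A}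
    (hx : x ∈ chainGrading 𝒜 n) : f x ∈ S := by
  have : chainGrading 𝒜 n ≤ S.comap f := by
    refine Submodule.span_le.2 ?_
    clear hx
    rintro _ ⟨i, j, rfl, x, hx, w, hw, rfl⟩
    replace hw := wordGrading_le j hw
    change f (x ⊗ₜ w) ∈ S
    induction hw using Submodule.span_induction with
    | mem w hw => obtain ⟨l, rfl, rfl⟩ := hw; exact h ⟨i, x, hx⟩ l rfl
    | zero => simp
    | add v w _ _ hv hw => rw [TensorProduct.tmul_add, map_add]; exact S.add_mem hv hw
    | smul c w _ hw => rw [TensorProduct.tmul_smul, map_smul]; exact S.smul_mem c hw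
  exact this hx

theorem chain_ext {f g : Chain k A →ₗ[k] Y}
    (h : ∀ (a : Letter 𝒜) l, f (chain a l) = g (chain a l)) : f = g := by
  refine LinearMap.ext fun x => ?_
  induction x using DirectSum.Decomposition.inductionOn (chainGrading 𝒜) with
  | zero => simp
  | add x y hx hy => rw [map_add, map_add, hx, hy]
  | homogeneous x =>
    have := map_mem_of_chain (f - g) ⊥ (n := _) (fun a l _ => by simp [h a l]) x.2
    simpa [sub_eq_zero] using this

theorem deconc_word (l : List (Letter 𝒜)) :
    deconc (word l) = splitSum (fun u v => word u ⊗ₜ[k] word v) l := by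
  induction l with
  | nil => simp [deconc_one, splitSum]
  | cons x l ih =>
    have := map_splitSum (LinearMap.mulLeft k (TensorAlgebra.ι k
      (Submodule.mkQ (Submodule.span k {(1 : A)}) x.val) ⊗ₜ[k]
        (1 : TensorAlgebra k (Abar k A)))) (fun u v => word u ⊗ₜ[k] word v) l
    rw [splitSum, word_cons, deconc_ι_mul, ih]
    simp only [LinearMap.mulLeft_apply, Algebra.TensorProduct.tmul_mul_tmul, one_mul] at this
    rw [this]
    simp [word_cons]

/-- Lists of homogeneous elements as unnormalized words. -/
def bigWord (l : List (Letter 𝒜)) : TensorAlgebra k A :=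
  (l.map fun x => TensorAlgebra.ι k x.val).prod

theorem bigWord_cons (x : Letter 𝒜) (l : List (Letter 𝒜)) :
    bigWord (x :: l) = TensorAlgebra.ι k x.val * bigWord l := by
  simp [bigWord]

theorem bigWord_concat (l : List (Letter 𝒜)) (x : Letter 𝒜) :
    bigWord (l ++ [x]) = bigWord l * TensorAlgebra.ι k x.val := by
  simp [bigWord]

theorem bigWord_mem (l : List (Letter 𝒜)) : bigWord l ∈ wordGrading 𝒜 (wd l) := by
  induction l with
  | nil => exact SetLike.GradedOne.one_mem
  | cons x l ih =>
    rw [bigWord_cons]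
    exact SetLike.mul_mem_graded (ι_mem_wordGrading _ x.mem) ih

theorem normalize_bigWord (a : Letter 𝒜) (l : List (Letter 𝒜)) :
    normalize k A (a.val ⊗ₜ[k] bigWord l) = chain a l := by
  rw [normalize_tmul, chain]
  congr 1
  induction l with
  | nil => simp [bigWord]
  | cons x l ih => rw [bigWord_cons, map_mul, ih, word_cons, wordMap_ι]

/-- `b ⊗ w ↦ a ⊗ [b] w`. -/
def consChain (a : A) : Chain k A →ₗ[k] Chain k A :=
  TensorProduct.mk k A _ a ∘ₗ LinearMap.mul' k _ ∘ₗ LinearMap.rTensor _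
        (TensorAlgebra.ι k ∘ₗ Submodule.mkQ (Submodule.span k {(1 : A)}))

theorem consChain_chain (a x : Letter 𝒜) (l : List (Letter 𝒜)) :
    consChain a.val (chain x l) = chain a (x :: l) := by
  simp [consChain, chain, word_cons]

variable (F : OpenFrobenius 𝒜 m)

/-- Induction on the word by `diffE_ι_mul`: apart from `d a` and the first face, the differential of
`a[x, l]` is that of `x[l]`, with its coefficient turned back into a letter behind `a`. -/
theorem normalize_diffE (a : Letter 𝒜) (l : List (Letter 𝒜)) :
    normalize k A (diffE 𝒜 F.d (a.val ⊗ₜ[k] bigWord l)) =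
      chain (F.dL a) l + sg k a.deg • bar F (chain a) l +
        sg k a.deg • onHead (fun x l' => chain (a * x) l') l := by
  induction l generalizing a with
  | nil =>
    have := normalize_bigWord (F.dL a) []
    simpa [bigWord, bar, diffE_one] using this
  | cons x l ih =>
    have h1 := normalize_bigWord (F.dL a) (x :: l)
    have h2 := normalize_bigWord (a * x) l
    -- `consChain` turns a coefficient into the first letter, and so carries the induction
    -- hypothesis for `x[l]` to a statement about words behind `a`.
    have h3 : normalize k A (sgn 𝒜 a.val ⊗ₜ[k] prepend (diffE 𝒜 F.d (x.val ⊗ₜ bigWord l))) =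
        sg k a.deg • consChain a.val (chain (F.dL x) l + sg k x.deg • bar F (chain x) l +
        sg k x.deg • onHead (fun y l' => chain (x * y) l') l) := by
      rw [← ih x, normalize_tmul, normalize_prepend, sgn_of_mem 𝒜 a.mem, ← TensorProduct.smul_tmul']
      rfl
    rw [bigWord_cons] at h1
    rw [bigWord_cons, diffE_ι_mul, map_sub, map_add, h3, sgn_of_mem 𝒜 a.mem]
    rw [smul_mul_assoc, ← TensorProduct.smul_tmul', map_smul]
    erw [h1, h2]
    simp only [map_add, map_smul, map_bar, map_onHead, consChain_chain, bar, onHead_cons]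
    simp only [smul_add, smul_sub, smul_neg]
    abel

theorem normalize_lastFace (a : Letter 𝒜) (l : List (Letter 𝒜)) :
    normalize k A (lastFace 𝒜 (a.val ⊗ₜ[k] bigWord l)) =
      onLast (fun l' x => sg k ((x.deg - 1) * (a.deg + wd l')) • chain (x * a) l') l := by
  induction l using List.reverseRecOn with
  | nil => simp [bigWord, lastFace, deconc_one, letter_one, onLast]
  | append_singleton l x =>
    have h : a.val ⊗ₜ[k] bigWord l ∈ tensorGrading 𝒜 (wordGrading 𝒜) (a.deg + wd l) :=
      tmul_mem_tensorGrading _ _ a.mem (bigWord_mem l)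
    have h2 := normalize_bigWord (x * a) l
    rw [onLast_append, bigWord_concat, lastFace_mul_ι 𝒜 _ _ x.mem, sgn_pow_of_mem _ h,
      ← sg_mul_natAbs, map_smul, map_smul, LinearMap.rTensor_tmul, mul_comm]
    congr 1

/-- The bridge from the differential, defined through a lift to unnormalized words, to the recursive
`cyc`. Independence of the lift needs `d 1 = 0`. -/
theorem chainDiff_chain (a : Letter 𝒜) (l : List (Letter 𝒜)) :
    chainDiff 𝒜 F.d (chain a l) = cyc F chain a l := by
  rw [← normalize_bigWord, chainDiff_normalize 𝒜 F.d F.d_one]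
  change normalize k A (diffE 𝒜 F.d _ - lastFace 𝒜 _) = _
  rw [map_sub, normalize_diffE, normalize_lastFace, cyc]

end Chains

/-! ### Functions of letters that are linear in each degree. -/

section GradedBilinear

variable {k : Type*} [Field k] {A : Type*} [Ring A] [Algebra k A]
  {𝒜 : ℤ → Submodule k A} [GradedAlgebra 𝒜] {m : ℤ}
  {Y Z : Type*} [AddCommGroup Y] [Module k Y] [AddCommGroup Z] [Module k Z]

/-- A function of homogeneous elements that is linear in each degree. -/
structure GLin (f : Letter 𝒜 → Y) : Prop where
  add : ∀ i x y hx hy hxy, f ⟨i, x + y, hxy⟩ = f ⟨i, x, hx⟩ + f ⟨i, y, hy⟩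
  smul : ∀ i (c : k) x hx hcx, f ⟨i, c • x, hcx⟩ = c • f ⟨i, x, hx⟩

/-- A function of two homogeneous elements that is bilinear in each bidegree. -/
structure GBilin (Ψ : Letter 𝒜 → Letter 𝒜 → Y) : Prop where
  left : ∀ y, GLin fun x => Ψ x y
  right : ∀ x, GLin (Ψ x)

/-- The linear map on `A ⊗ A` that a graded bilinear function induces. -/
def GBilin.lift {Ψ : Letter 𝒜 → Letter 𝒜 → Y} (h : GBilin Ψ) : A ⊗[k] A →ₗ[k] Y :=
  TensorProduct.lift
    ((DirectSum.toModule k ℤ _ (fun i =>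
        (DirectSum.toModule k ℤ _ (fun j =>
            LinearMap.mk₂ k (fun (y : 𝒜 j) (x : 𝒜 i) => Ψ ⟨i, x, x.2⟩ ⟨j, y, y.2⟩)
              (fun y y' _ => (h.right _).add j y y' _ _ _)
              (fun c y _ => (h.right _).smul j c y _ _)
              (fun _ x x' => (h.left _).add i x x' _ _ _)
              (fun c _ x => (h.left _).smul i c x _ _)) ∘ₗ
          (DirectSum.decomposeLinearEquiv 𝒜).toLinearMap).flip)) ∘ₗ
      (DirectSum.decomposeLinearEquiv 𝒜).toLinearMap)

/-- A function that is bilinear in each bidegree may contain signs depending on the degrees and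
still comes from a linear map on `A ⊗ A`. Hence an equality of tensors yields an equality of signed
sums over any homogeneous presentations. -/
theorem GBilin.lift_tmul {Ψ : Letter 𝒜 → Letter 𝒜 → Y} (h : GBilin Ψ) (x y : Letter 𝒜) :
    h.lift (x.val ⊗ₜ y.val) = Ψ x y := by
  obtain ⟨i, x, hx⟩ := x
  obtain ⟨j, y, hy⟩ := y
  lift x to 𝒜 i using hx
  lift y to 𝒜 j using hy
  simp [GBilin.lift]

/-- The point of requiring linearity only degree by degree: signs may be absorbed into the function.
-/
theorem GLin.const_smul {f : Letter 𝒜 → Y} (h : GLin f) (c : ℤ → k) :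
    GLin fun x => c x.deg • f x where
  add i x y hx hy hxy := by simp only [h.add i x y hx hy hxy, smul_add]
  smul i c x hx hcx := by simp only [h.smul i c x hx hcx]; rw [smul_comm]

theorem GLin.map {f : Letter 𝒜 → Y} (h : GLin f) (g : Y →ₗ[k] Z) : GLin fun x => g (f x) where
  add i x y hx hy hxy := by simp only [h.add i x y hx hy hxy, map_add]
  smul i c x hx hcx := by simp only [h.smul i c x hx hcx, map_smul]

theorem GLin.mul_left {f : Letter 𝒜 → Y} (h : GLin f) (c : Letter 𝒜) :
    GLin fun x => f (c * x) where
  add i x y hx hy hxy := by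
    have e : c * (⟨i, x + y, hxy⟩ : Letter 𝒜) =
        ⟨c.deg + i, c.val * x + c.val * y, (𝒜 _).add_mem (SetLike.mul_mem_graded c.mem hx)
          (SetLike.mul_mem_graded c.mem hy)⟩ := Letter.ext rfl (mul_add _ _ _)
    rw [e]
    exact h.add _ _ _ _ _ _
  smul i r x hx hcx := by
    have e : c * (⟨i, r • x, hcx⟩ : Letter 𝒜) =
        ⟨c.deg + i, r • (c.val * x), (𝒜 _).smul_mem r (SetLike.mul_mem_graded c.mem hx)⟩ :=
      Letter.ext rfl (mul_smul_comm _ _ _)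
    rw [e]
    exact h.smul _ _ _ _ _

theorem GLin.mul_right {f : Letter 𝒜 → Y} (h : GLin f) (c : Letter 𝒜) :
    GLin fun x => f (x * c) where
  add i x y hx hy hxy := by
    have e : (⟨i, x + y, hxy⟩ : Letter 𝒜) * c =
        ⟨i + c.deg, x * c.val + y * c.val, (𝒜 _).add_mem (SetLike.mul_mem_graded hx c.mem)
          (SetLike.mul_mem_graded hy c.mem)⟩ := Letter.ext rfl (add_mul _ _ _)
    rw [e]
    exact h.add _ _ _ _ _ _
  smul i r x hx hcx := by
    have e : (⟨i, r • x, hcx⟩ : Letter 𝒜) * c =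
        ⟨i + c.deg, r • (x * c.val), (𝒜 _).smul_mem r (SetLike.mul_mem_graded hx c.mem)⟩ :=
      Letter.ext rfl (smul_mul_assoc _ _ _)
    rw [e]
    exact h.smul _ _ _ _ _

theorem GLin.sum {ι : Type*} (t : Finset ι) {f : ι → Letter 𝒜 → Y} (h : ∀ s, GLin (f s)) :
    GLin fun x => ∑ s ∈ t, f s x where
  add i x y hx hy hxy := by
    simp only [fun s => (h s).add i x y hx hy hxy, Finset.sum_add_distrib]
  smul i c x hx hcx := by
    simp only [fun s => (h s).smul i c x hx hcx, Finset.smul_sum]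

theorem GLin.splitSum {f : List (Letter 𝒜) → List (Letter 𝒜) → Letter 𝒜 → Y}
    (h : ∀ u v, GLin (f u v)) (l : List (Letter 𝒜)) :
    GLin fun x => HochBV.splitSum (fun u v => f u v x) l where
  add i x y hx hy hxy := by
    simp only [fun u v => (h u v).add i x y hx hy hxy, splitSum_add]
  smul i c x hx hcx := by
    simp only [fun u v => (h u v).smul i c x hx hcx, splitSum_smul]

theorem GLin.chain_left (l : List (Letter 𝒜)) : GLin fun a : Letter 𝒜 => chain a l where
  add i x y hx hy hxy := TensorProduct.add_tmul _ _ _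
  smul i c x hx hcx := by simp only [chain]; rw [TensorProduct.smul_tmul']

theorem GLin.chain_word (a : Letter 𝒜) (u w : List (Letter 𝒜)) :
    GLin fun x : Letter 𝒜 => chain a (u ++ x :: w) where
  add i x y hx hy hxy := by
    simp only [chain, word_append, word_cons, map_add, add_mul, mul_add, TensorProduct.tmul_add]
  smul i c x hx hcx := by
    simp only [chain, word_append, word_cons, map_smul, smul_mul_assoc, mul_smul_comm,
      TensorProduct.tmul_smul]

theorem GLin.tmul_left {f : Letter 𝒜 → Y} (h : GLin f) (z : Z) : GLin fun x => f x ⊗ₜ[k] z :=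
  h.map ((TensorProduct.mk k Y Z).flip z)

theorem GLin.tmul_right {f : Letter 𝒜 → Y} (h : GLin f) (z : Z) : GLin fun x => z ⊗ₜ[k] f x :=
  h.map (TensorProduct.mk k Z Y z)

theorem GBilin.tmul {f : Letter 𝒜 → Y} {g : Letter 𝒜 → Z} (hf : GLin f) (hg : GLin g) :
    GBilin fun x y => f x ⊗ₜ[k] g y :=
  ⟨fun y => hf.tmul_left (g y), fun x => hg.tmul_right (f x)⟩

theorem GBilin.const_smul {Ψ : Letter 𝒜 → Letter 𝒜 → Y} (h : GBilin Ψ) (c : ℤ → ℤ → k) :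
    GBilin fun x y => c x.deg y.deg • Ψ x y :=
  ⟨fun y => (h.left y).const_smul fun i => c i y.deg,
    fun x => (h.right x).const_smul fun j => c x.deg j⟩

end GradedBilinear

/-! ### The Casimir element `δ 1` and its exchange rules. -/

section Casimir

variable {k : Type*} [Field k] {A : Type*} [Ring A] [Algebra k A]
  {𝒜 : ℤ → Submodule k A} [GradedAlgebra 𝒜] {m : ℤ}
  {Y Z : Type*} [AddCommGroup Y] [Module k Y] [AddCommGroup Z] [Module k Z]

/-- A presentation `δ 1 = ∑ p_s ⊗ q_s` by homogeneous elements. -/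
structure Casimir (F : OpenFrobenius 𝒜 m) where
  /-- the number of summands -/
  n : ℕ
  /-- the left tensor factors -/
  p : Fin n → Letter 𝒜
  /-- the right tensor factors -/
  q : Fin n → Letter 𝒜
  q_deg : ∀ s, (q s).deg = m - (p s).deg
  δ_one : F.δ 1 = ∑ s, (p s).val ⊗ₜ[k] (q s).val

theorem exists_homogeneous_sum {n : ℤ} {z : A ⊗[k] A} (hz : z ∈ tensorGrading 𝒜 𝒜 n) :
    ∃ (r : ℕ) (p q : Fin r → Letter 𝒜), (∀ s, (q s).deg = n - (p s).deg) ∧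
      z = ∑ s, (p s).val ⊗ₜ[k] (q s).val := by
  unfold tensorGrading at hz
  induction hz using Submodule.span_induction with
  | mem z hz =>
    obtain ⟨i, j, rfl, x, hx, y, hy, rfl⟩ := hz
    exact ⟨1, fun _ => ⟨i, x, hx⟩, fun _ => ⟨j, y, hy⟩, fun _ => by simp, by simp⟩
  | zero => exact ⟨0, Fin.elim0, Fin.elim0, fun s => s.elim0, by simp⟩
  | add z w _ _ hz hw =>
    obtain ⟨r, p, q, h, rfl⟩ := hz
    obtain ⟨r', p', q', h', rfl⟩ := hw
    refine ⟨r + r', Fin.append p p', Fin.append q q', fun s => ?_, by simp [Fin.sum_univ_add]⟩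
    refine Fin.addCases (fun s => ?_) (fun s => ?_) s
    · simp [h]
    · simp [h']
  | smul c z _ hz =>
    obtain ⟨r, p, q, h, rfl⟩ := hz
    refine ⟨r, fun s => ⟨(p s).deg, c • (p s).val, (𝒜 _).smul_mem c (p s).mem⟩, q, h, ?_⟩
    simp [Finset.smul_sum, TensorProduct.smul_tmul']

/-- The unit has degree `0`, so `δ 1` has degree `m` and is a finite sum of homogeneous tensors with
degrees adding up to `m`. -/
theorem exists_casimir (F : OpenFrobenius 𝒜 m) : Nonempty (Casimir F) := by
  have := F.δ_mem (SetLike.GradedOne.one_mem (A := 𝒜))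
  rw [zero_add] at this
  obtain ⟨r, p, q, h, h'⟩ := exists_homogeneous_sum this
  exact ⟨⟨r, p, q, h, h'⟩⟩

variable {F : OpenFrobenius 𝒜 m} (E : Casimir F)

/-- Right linearity at the unit: `δ` is determined by the Casimir element. -/
theorem Casimir.δ_right (E : Casimir F) (a : A) :
    F.δ a = ∑ s, (E.p s).val ⊗ₜ[k] ((E.q s).val * a) := by
  rw [← one_mul a, F.right_linear, E.δ_one]
  simp

theorem Casimir.δ_left (E : Casimir F) (a : Letter 𝒜) :
    F.δ a.val = sg k (m * a.deg) • ∑ s, (a.val * (E.p s).val) ⊗ₜ[k] (E.q s).val := by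
  rw [← mul_one a.val, F.left_linear a.mem, E.δ_one]
  simp

/-- `c e' ⊗ e'' = ± e' ⊗ e'' c`. -/
theorem Casimir.mul_left {Ψ : Letter 𝒜 → Letter 𝒜 → Y} (h : GBilin Ψ) (c : Letter 𝒜) :
    ∑ s, Ψ (c * E.p s) (E.q s) = sg k (m * c.deg) • ∑ s, Ψ (E.p s) (E.q s * c) := by
  -- Left and right linearity compute `δ c` in two ways; the rule is their comparison.
  have := E.δ_left c
  rw [E.δ_right] at this
  have := congrArg (fun z => sg k (m * c.deg) • h.lift z) this
  simp only [map_smul, smul_smul, sg_mul_self, one_smul, map_sum] at this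
  calc _ = ∑ s, h.lift ((c * E.p s).val ⊗ₜ (E.q s).val) := by simp only [h.lift_tmul]
    _ = _ := by
      rw [← Finset.sum_congr rfl fun s _ => h.lift_tmul (E.p s) (E.q s * c)]
      exact this.symm

/-- `e' ⊗ e'' = ± e'' ⊗ e'`. -/
theorem Casimir.symm {Ψ : Letter 𝒜 → Letter 𝒜 → Y} (h : GBilin Ψ) :
    ∑ s, Ψ (E.p s) (E.q s) =
      sg k m • ∑ s, sg k ((E.p s).deg * (E.q s).deg) • Ψ (E.q s) (E.p s) := by
  have := F.cocomm 1
  rw [E.δ_one, map_sum] at this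
  rw [Finset.sum_congr rfl fun s _ => koszul_tmul 𝒜 𝒜 (E.p s).mem (E.q s).mem] at this
  have := congrArg (fun z => sg k m • h.lift z) this
  simp only [map_smul, smul_smul, sg_mul_self, one_smul, map_sum, h.lift_tmul] at this
  exact this.symm

/-- `e' c ⊗ e'' = ± e' ⊗ c e''`. -/
theorem Casimir.mul_mid {Ψ : Letter 𝒜 → Letter 𝒜 → Y} (h : GBilin Ψ) (c : Letter 𝒜) :
    ∑ s, Ψ (E.p s * c) (E.q s) = sg k c.deg • ∑ s, Ψ (E.p s) (c * E.q s) := by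
  have h1 : GBilin fun x y => Ψ (x * c) y :=
    ⟨fun y => (h.left y).mul_right c, fun x => h.right _⟩
  -- Symmetry turns `e' c ⊗ e''` into `e'' c ⊗ e'`, to which `Casimir.mul_left` applies with the
  -- arguments interchanged. The subtracted `c.deg` recovers the degree of `e''` from that of `e''
  -- c`.
  have h2 : GBilin fun x y => sg k (x.deg * (y.deg - c.deg)) • Ψ y x :=
    GBilin.const_smul (Ψ := fun x y => Ψ y x) ⟨fun y => h.right y, fun x => h.left x⟩
      fun i j => sg k (i * (j - c.deg))
  have h3 : GBilin fun x y => Ψ x (c * y) :=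
    ⟨fun y => h.left _, fun x => (h.right x).mul_left c⟩
  rw [E.symm h1, E.symm h3]
  have := E.mul_left h2 c
  simp only [Finset.smul_sum, smul_smul, ← sg_add] at this ⊢
  have e := congrArg (fun z => sg k (m + m * c.deg) • z) this
  simp only [Finset.smul_sum, smul_smul, ← sg_add] at e
  rw [Finset.sum_congr rfl fun s _ => ?_, ← e]
  · refine Finset.sum_congr rfl fun s _ => ?_
    refine sg_smul_congr ?_
    simp only [Letter.mul_deg, E.q_deg]
    push_cast; grind [=_ intCast_mul_self]
  · refine sg_smul_congr ?_
    simp only [Letter.mul_deg, E.q_deg]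
    push_cast; grind [=_ intCast_mul_self]

/-- `e'' c ⊗ e' = ± e' ⊗ e'' c`. -/
theorem Casimir.symm_mul {Ψ : Letter 𝒜 → Letter 𝒜 → Y} (h : GBilin Ψ) (c : Letter 𝒜) :
    ∑ s, Ψ (E.p s) (E.q s * c) =
      sg k m • ∑ s, sg k ((E.p s).deg * ((E.q s).deg + c.deg)) • Ψ (E.q s * c) (E.p s) := by
  -- Cocommutativity of `δ` at `c`, where `Casimir.symm` uses it at the unit.
  have := F.cocomm c.val
  rw [E.δ_right, map_sum] at this
  erw [Finset.sum_congr rfl fun s _ => koszul_tmul 𝒜 𝒜 (E.p s).mem (E.q s * c).mem] at this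
  have := congrArg (fun z => sg k m • h.lift z) this
  simp only [map_smul, smul_smul, sg_mul_self, one_smul, map_sum] at this
  rw [Finset.sum_congr rfl fun s _ => (h.lift_tmul (E.p s) (E.q s * c)).symm]
  refine this.symm.trans ?_
  congr 1
  refine Finset.sum_congr rfl fun s _ => ?_
  rw [h.lift_tmul]
  rfl

/-- `e' c ⊗ e'' = ± e' ⊗ e'' c`. -/
theorem Casimir.mul_right {Ψ : Letter 𝒜 → Letter 𝒜 → Y} (h : GBilin Ψ) (c : Letter 𝒜) :
    ∑ s, Ψ (E.p s) (E.q s * c) = ∑ s, sg k ((E.q s).deg * c.deg) • Ψ (E.p s * c) (E.q s) := by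
  have h2 : GBilin fun x y => sg k (y.deg * c.deg) • Ψ (x * c) y :=
    GBilin.const_smul (Ψ := fun x y => Ψ (x * c) y)
      ⟨fun y => (h.left y).mul_right c, fun x => h.right _⟩ fun _ j => sg k (j * c.deg)
  -- Both sides become sums over `e'' c ⊗ e'`: the left one by cocommutativity at `c`, the right one
  -- by cocommutativity at the unit.
  rw [E.symm_mul h, E.symm h2]
  congr 1
  refine Finset.sum_congr rfl fun s _ => ?_
  rw [smul_smul, ← sg_add, mul_add]

/-- `e' ⊗ e'' x y = ± e' ⊗ e'' y x`. -/
theorem Casimir.mul_comm {Ψ : Letter 𝒜 → Letter 𝒜 → Y} (h : GBilin Ψ) (x y : Letter 𝒜) :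
    ∑ s, Ψ (E.p s) (E.q s * (x * y)) =
      sg k (x.deg * y.deg) • ∑ s, Ψ (E.p s) (E.q s * (y * x)) := by
  have h1 : GBilin fun p q => Ψ p (q * y) := ⟨fun q => h.left _, fun p => (h.right p).mul_right y⟩
  have h2 : GBilin fun p q => sg k (q.deg * x.deg) • Ψ (p * x) q :=
    GBilin.const_smul (Ψ := fun p q => Ψ (p * x) q)
      ⟨fun q => (h.left q).mul_right x, fun p => h.right _⟩ fun _ j => sg k (j * x.deg)
  -- Moving `x` and then `y` into the left slot gives `e' y x`, and so does moving the single factor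
  -- `y x`. Comparing the two exchanges the order of the product.
  have e1 := E.mul_right h1 x
  have e2 := E.mul_right h2 y
  have e3 := E.mul_right h (y * x)
  simp only [mul_assoc] at e1 e2 e3
  rw [e1, e3]
  have e4 := congrArg (fun z => sg k (x.deg * y.deg) • z) e2
  simp only [Finset.smul_sum, smul_smul, ← sg_add] at e4 ⊢
  refine (Finset.sum_congr rfl fun s _ => sg_smul_congr ?_).trans
    (e4.trans (Finset.sum_congr rfl fun s _ => sg_smul_congr ?_)) <;>
  · simp only [Letter.mul_deg]
    push_cast; grind [=_ intCast_mul_self]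

/-- Since `d 1 = 0`, the chain map condition says that `δ 1` is a cycle. -/
theorem Casimir.d {Ψ : Letter 𝒜 → Letter 𝒜 → Y} (h : GBilin Ψ) :
    ∑ s, Ψ (F.dL (E.p s)) (E.q s) = -∑ s, sg k (E.p s).deg • Ψ (E.p s) (F.dL (E.q s)) := by
  have := F.δ_d 1
  rw [F.d_one, map_zero, E.δ_one] at this
  have := congrArg (fun z => sg k m • h.lift z) this
  simp only [oddSum, LinearMap.add_apply, map_sum, LinearMap.rTensor_tmul,
    TensorProduct.map_tmul, map_smul, map_zero, smul_zero, smul_smul, sg_mul_self, one_smul,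
    map_add] at this
  rw [eq_neg_iff_add_eq_zero]
  refine Eq.trans ?_ this.symm
  rw [Finset.sum_add_distrib]
  congr 1
  · exact Finset.sum_congr rfl fun s _ => (h.lift_tmul (F.dL (E.p s)) (E.q s)).symm
  · refine Finset.sum_congr rfl fun s _ => ?_
    rw [sgn_of_mem 𝒜 (E.p s).mem, ← TensorProduct.smul_tmul', map_smul]
    rw [← h.lift_tmul]; rfl

end Casimir

/-! ### Interchanging operations on two independent words. -/

section Commute

variable {k : Type*} [Field k] {A : Type*} [Ring A] [Algebra k A]
  {𝒜 : ℤ → Submodule k A} [GradedAlgebra 𝒜] {m : ℤ}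
  {X Y Z : Type*} [AddCommGroup Y] [Module k Y] [AddCommGroup Z] [Module k Z]

theorem splitSum_onLast_const (Φ : List X → X → List X → List X → Y) (u r : List X) :
    splitSum (fun v w => onLast (fun u' x => Φ u' x v w) u) r =
      onLast (fun u' x => splitSum (Φ u' x) r) u := by
  induction u using List.reverseRecOn with
  | nil => simp [onLast, splitSum_zero]
  | append_singleton u x => simp only [onLast_append]

theorem splitSum_onHead_const (Φ : X → List X → List X → List X → Y) (u r : List X) :
    splitSum (fun v w => onHead (fun x u' => Φ x u' v w) u) r =
      onHead (fun x u' => splitSum (Φ x u') r) u := by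
  cases u with
  | nil => simp [splitSum_zero]
  | cons x u => simp only [onHead_cons]

theorem splitSum_splitSum_comm (Φ : List X → List X → List X → List X → Y) (l r : List X) :
    splitSum (fun u v => splitSum (Φ u v) r) l =
      splitSum (fun u' v' => splitSum (fun u v => Φ u v u' v') l) r := by
  induction l generalizing Φ with
  | nil => rfl
  | cons x l ih => simp only [splitSum, splitSum_add, ih]

theorem bar_splitSum_comm (F : OpenFrobenius 𝒜 m)
    (Φ : List (Letter 𝒜) → List X → List X → Y) (l : List (Letter 𝒜)) (r : List X) :
    bar F (fun u => splitSum (Φ u) r) l =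
      splitSum (fun v w => bar F (fun u => Φ u v w) l) r := by
  induction r generalizing Φ with
  | nil => rfl
  | cons x r ih => simp only [splitSum, bar_add, ih]

end Commute

/-! ### Inserting the Casimir element into a word. -/

section Insertion

variable {k : Type*} [Field k] {A : Type*} [Ring A] [Algebra k A]
  {𝒜 : ℤ → Submodule k A} [GradedAlgebra 𝒜] {m : ℤ}
  {Y Z : Type*} [AddCommGroup Y] [Module k Y] [AddCommGroup Z] [Module k Z]
  {F : OpenFrobenius 𝒜 m}

/-- The sum of `± Φ u e' w e'' v` over all `u ++ v ++ w = l`: the subword `v` is replaced by the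
letter `e'`, and attached to the coefficient `e''`. -/
def ins (E : Casimir F)
    (Φ : List (Letter 𝒜) → Letter 𝒜 → List (Letter 𝒜) → Letter 𝒜 → List (Letter 𝒜) → Y) :
    List (Letter 𝒜) → Y :=
  splitSum fun u r => splitSum (fun v w => ∑ s,
    sg k (wd u + m * (E.p s).deg + wd w * ((E.p s).deg + wd v)) •
      Φ u (E.p s) w (E.q s) v) r

/-- The differential of a function of a word `u ++ p :: w` and a chain `q[v]`. -/
def insDiff (F : OpenFrobenius 𝒜 m)
    (Φ : List (Letter 𝒜) → Letter 𝒜 → List (Letter 𝒜) → Letter 𝒜 → List (Letter 𝒜) → Y)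
    (u : List (Letter 𝒜)) (p : Letter 𝒜) (w : List (Letter 𝒜)) (q : Letter 𝒜)
    (v : List (Letter 𝒜)) : Y :=
  bar F (fun u' => Φ u' p w q v) u -
    onLast (fun u' x => sg k (wd u' + x.deg) • Φ u' (x * p) w q v) u -
    sg k (wd u) • Φ u (F.dL p) w q v -
    sg k (wd u + p.deg) • onHead (fun x w' => Φ u (p * x) w' q v) w +
    sg k (wd u + p.deg - 1) • bar F (fun w' => Φ u p w' q v) w +
    sg k (wd u + p.deg - 1 + wd w + m) • cyc F (fun q' v' => Φ u p w q' v') q v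

variable (E : Casimir F)
  {Φ : List (Letter 𝒜) → Letter 𝒜 → List (Letter 𝒜) → Letter 𝒜 → List (Letter 𝒜) → Y}

/-- By the coderivation property, used twice, the differential of `l` acts on one of the three
pieces `u`, `v`, `w`. The signs in `ins` are then re-evaluated with the degree of that piece raised
by one. -/
theorem bar_ins (l : List (Letter 𝒜)) :
    bar F (ins E Φ) l = -splitSum (fun u r => splitSum (fun v w => ∑ s,
      sg k (wd u + m * (E.p s).deg + wd w * ((E.p s).deg + wd v)) •
        (bar F (fun u' => Φ u' (E.p s) w (E.q s) v) u +
          sg k (wd u + (E.p s).deg - 1) • bar F (fun w' => Φ u (E.p s) w' (E.q s) v) w +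
          sg k (wd u + wd w + 1) • bar F (fun v' => Φ u (E.p s) w (E.q s) v') v)) r) l := by
  rw [ins, bar_splitSum, ← splitSum_neg]
  refine splitSum_congr fun u r _ => ?_
  rw [bar_splitSum_comm, bar_splitSum, ← splitSum_smul, ← splitSum_add, ← splitSum_neg]
  refine splitSum_congr fun v w _ => ?_
  simp only [bar_sum, smul_add, Finset.smul_sum]
  rw [← Finset.sum_neg_distrib, ← Finset.sum_add_distrib, ← Finset.sum_add_distrib]
  refine Finset.sum_congr rfl fun s _ => ?_
  rw [bar_congr_deg F (l := u)
      (-sg k (wd u + m * (E.p s).deg + wd w * ((E.p s).deg + wd v)))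
      (H := fun u' => Φ u' (E.p s) w (E.q s) v)
      (fun u' h => by rw [neg_sg]; exact sg_smul_congr (by rw [h]; push_cast; clear * -; grind)),
    bar_congr_deg F (l := v)
      (sg k (wd u + m * (E.p s).deg + wd w * ((E.p s).deg + wd v) + wd w))
      (H := fun v' => Φ u (E.p s) w (E.q s) v')
      (fun u' h => sg_smul_congr (by rw [h]; push_cast; clear * -; grind)),
    bar_congr_deg F (l := w)
      (sg k (wd u + m * (E.p s).deg + wd w * ((E.p s).deg + wd v) + (E.p s).deg + wd v))
      (H := fun w' => Φ u (E.p s) w' (E.q s) v)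
      (fun u' h => sg_smul_congr (by rw [h]; push_cast; clear * -; grind))]
  simp only [smul_smul, ← sg_add, neg_add, ← neg_smul, neg_sg]
  rw [add_assoc, add_comm (sg k _ • bar F (fun v' => Φ u (E.p s) w (E.q s) v') v)]
  rw [← add_assoc]
  congr 1
  · congr 1
    exact sg_smul_congr (by push_cast; clear * -; grind)
  · exact sg_smul_congr (by push_cast; clear * -; grind)

/-- At the cut between `u` and `v`, a letter `x` is either merged into `x e'` from the left or
multiplied into the coefficient as `e'' x`. The two agree up to sign by `Casimir.mul_left`. -/
theorem ins_junction_left (h : ∀ u w v, GBilin fun p q => Φ u p w q v) (l : List (Letter 𝒜)) :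
    splitSum (fun u r => splitSum (fun v w => ∑ s,
      sg k (wd u + m * (E.p s).deg + wd w * ((E.p s).deg + wd v)) •
        onLast (fun u' x => sg k (wd u' + x.deg) • Φ u' (x * E.p s) w (E.q s) v) u) r) l =
    splitSum (fun u r => splitSum (fun v w => ∑ s,
      sg k (wd u + m * (E.p s).deg + wd w * ((E.p s).deg + wd v)) •
        sg k (wd u + (E.p s).deg - 1 + wd w + m + (E.q s).deg) •
          onHead (fun x v' => Φ u (E.p s) w (E.q s * x) v') v) r) l := by
  have e1 : ∀ u r, splitSum (fun v w => ∑ s,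
      sg k (wd u + m * (E.p s).deg + wd w * ((E.p s).deg + wd v)) •
        onLast (fun u' x => sg k (wd u' + x.deg) • Φ u' (x * E.p s) w (E.q s) v) u) r =
      onLast (fun u' x => splitSum (fun v w => ∑ s,
        sg k (wd u' + x.deg - 1 + m * (E.p s).deg + wd w * ((E.p s).deg + wd v)) •
          sg k (wd u' + x.deg) • Φ u' (x * E.p s) w (E.q s) v) r) u := by
    intro u r
    rw [← splitSum_onLast_const]
    refine splitSum_congr fun v w _ => ?_
    simp only [← onLast_smul, ← onLast_sum]
    refine onLast_congr fun u' x e => Finset.sum_congr rfl fun s _ => ?_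
    rw [← e]
    exact sg_smul_congr (by simp; grind)
  have e2 : ∀ u r, splitSum (fun v w => ∑ s,
      sg k (wd u + m * (E.p s).deg + wd w * ((E.p s).deg + wd v)) •
        sg k (wd u + (E.p s).deg - 1 + wd w + m + (E.q s).deg) •
          onHead (fun x v' => Φ u (E.p s) w (E.q s * x) v') v) r =
      onHead (fun x r' => splitSum (fun v w => ∑ s,
        sg k (wd u + m * (E.p s).deg + wd w * ((E.p s).deg + x.deg - 1 + wd v)) •
        sg k (wd u + (E.p s).deg - 1 + wd w + m + (E.q s).deg) •
          Φ u (E.p s) w (E.q s * x) v) r') r := by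
    intro u r
    rw [← splitSum_onHead_left]
    refine splitSum_congr fun v w _ => ?_
    simp only [← onHead_smul, ← onHead_sum]
    refine onHead_congr fun x v' e => Finset.sum_congr rfl fun s _ => ?_
    rw [← e]
    exact sg_smul_congr (by simp; grind)
  simp only [e1, e2]
  rw [splitSum_onHead_right]
  refine splitSum_congr fun u r _ => onLast_congr fun u' x _ => splitSum_congr fun v w _ => ?_
  -- The first argument is `x e'` on the left side, so `i - x.deg` stands for the degree of `e'`
  -- there.
  have := E.mul_left ((h u' w v).const_smul fun i _ =>
    sg k (m * (i - x.deg) + wd w * (i - x.deg + wd v) + 1)) x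
  simp only [smul_smul, Finset.smul_sum, ← sg_add] at this ⊢
  refine (Finset.sum_congr rfl fun s _ => sg_smul_congr ?_).trans
    (this.trans (Finset.sum_congr rfl fun s _ => sg_smul_congr ?_)) <;>
  · simp only [Letter.mul_deg, E.q_deg]
    push_cast; clear * -; grind [=_ intCast_mul_self]

/-- The same at the cut between `v` and `w`: `e' x` in the word against the last face `x e''` of the
split-off chain, related by `Casimir.mul_mid`. -/
theorem ins_junction_right (h : ∀ u w v, GBilin fun p q => Φ u p w q v) (l : List (Letter 𝒜)) :
    splitSum (fun u r => splitSum (fun v w => ∑ s,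
      sg k (wd u + m * (E.p s).deg + wd w * ((E.p s).deg + wd v)) •
        sg k (wd u + (E.p s).deg) • onHead (fun x w' => Φ u (E.p s * x) w' (E.q s) v) w) r) l =
    -splitSum (fun u r => splitSum (fun v w => ∑ s,
      sg k (wd u + m * (E.p s).deg + wd w * ((E.p s).deg + wd v)) •
        sg k (wd u + (E.p s).deg - 1 + wd w + m) •
          onLast (fun v' x => sg k ((x.deg - 1) * ((E.q s).deg + wd v')) •
            Φ u (E.p s) w (x * E.q s) v') v) r) l := by
  rw [← splitSum_neg]
  refine splitSum_congr fun u r _ => ?_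
  have e1 : splitSum (fun v w => ∑ s,
      sg k (wd u + m * (E.p s).deg + wd w * ((E.p s).deg + wd v)) •
        sg k (wd u + (E.p s).deg) • onHead (fun x w' => Φ u (E.p s * x) w' (E.q s) v) w) r =
      splitSum (fun v w => onHead (fun x w' => ∑ s,
        sg k (wd u + m * (E.p s).deg + (x.deg - 1 + wd w') * ((E.p s).deg + wd v)) •
          sg k (wd u + (E.p s).deg) • Φ u (E.p s * x) w' (E.q s) v) w) r := by
    refine splitSum_congr fun v w _ => ?_
    simp only [← onHead_smul, ← onHead_sum]
    refine onHead_congr fun x v' e => Finset.sum_congr rfl fun s _ => ?_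
    rw [← e]
    exact sg_smul_congr (by simp)
  rw [e1, splitSum_onHead_right, ← splitSum_neg]
  refine splitSum_congr fun v w _ => ?_
  simp only [← onLast_smul, ← onLast_sum, ← onLast_neg]
  refine onLast_congr fun v' x e => ?_
  have := E.mul_mid ((h u w v').const_smul fun _ j =>
    sg k (m * (m - j) + (x.deg - 1 + wd w) * (m - j + wd v') + m - j)) x
  simp only [smul_smul, Finset.smul_sum, ← sg_add, ← Finset.sum_neg_distrib, ← neg_smul, neg_sg,
    ← e] at this ⊢
  refine (Finset.sum_congr rfl fun s _ => sg_smul_congr ?_).trans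
    (this.trans (Finset.sum_congr rfl fun s _ => sg_smul_congr ?_)) <;>
  · simp only [Letter.mul_deg, E.q_deg, wd_append, wd_cons, wd_nil]
    push_cast; clear * -; grind [=_ intCast_mul_self]

/-- The terms with `d e'` and `d e''` match because the Casimir element is a cycle. -/
theorem ins_d (h : ∀ u w v, GBilin fun p q => Φ u p w q v) (l : List (Letter 𝒜)) :
    splitSum (fun u r => splitSum (fun v w => ∑ s,
      sg k (wd u + m * (E.p s).deg + wd w * ((E.p s).deg + wd v)) •
        sg k (wd u) • Φ u (F.dL (E.p s)) w (E.q s) v) r) l =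
    splitSum (fun u r => splitSum (fun v w => ∑ s,
      sg k (wd u + m * (E.p s).deg + wd w * ((E.p s).deg + wd v)) •
        sg k (wd u + (E.p s).deg - 1 + wd w + m) • Φ u (E.p s) w (F.dL (E.q s)) v) r) l := by
  refine splitSum_congr fun u r _ => splitSum_congr fun v w _ => ?_
  have := E.d ((h u w v).const_smul fun i _ => sg k (m * (i - 1) + wd w * (i - 1 + wd v)))
  simp only [smul_smul, ← Finset.sum_neg_distrib, ← sg_add, ← neg_smul, neg_sg] at this ⊢
  refine (Finset.sum_congr rfl fun s _ => sg_smul_congr ?_).trans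
    (this.trans (Finset.sum_congr rfl fun s _ => sg_smul_congr ?_)) <;>
  · push_cast [OpenFrobenius.dL_deg]
    clear * -; grind [=_ intCast_mul_self]

/-- Insertion anticommutes with the differentials: the terms of `insDiff` at the two seams and on
the Casimir element itself cancel in pairs by the three preceding lemmas, and what remains
differentiates the pieces `u`, `v`, `w`. -/
theorem ins_insDiff (h : ∀ u w v, GBilin fun p q => Φ u p w q v) (l : List (Letter 𝒜)) :
    ins E (insDiff F Φ) l = -bar F (ins E Φ) l := by
  have h1 := ins_junction_left E h l
  have h2 := ins_junction_right E h l
  have h3 := ins_d E h l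
  have e : ins E (insDiff F Φ) l = -bar F (ins E Φ) l -
      splitSum (fun u r => splitSum (fun v w => ∑ s,
        sg k (wd u + m * (E.p s).deg + wd w * ((E.p s).deg + wd v)) •
          onLast (fun u' x => sg k (wd u' + x.deg) • Φ u' (x * E.p s) w (E.q s) v) u) r) l -
      splitSum (fun u r => splitSum (fun v w => ∑ s,
      sg k (wd u + m * (E.p s).deg + wd w * ((E.p s).deg + wd v)) •
        sg k (wd u) • Φ u (F.dL (E.p s)) w (E.q s) v) r) l -
      splitSum (fun u r => splitSum (fun v w => ∑ s,
      sg k (wd u + m * (E.p s).deg + wd w * ((E.p s).deg + wd v)) •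
        sg k (wd u + (E.p s).deg) • onHead (fun x w' => Φ u (E.p s * x) w' (E.q s) v) w) r) l +
      splitSum (fun u r => splitSum (fun v w => ∑ s,
      sg k (wd u + m * (E.p s).deg + wd w * ((E.p s).deg + wd v)) •
        sg k (wd u + (E.p s).deg - 1 + wd w + m) • Φ u (E.p s) w (F.dL (E.q s)) v) r) l +
      splitSum (fun u r => splitSum (fun v w => ∑ s,
      sg k (wd u + m * (E.p s).deg + wd w * ((E.p s).deg + wd v)) •
        sg k (wd u + (E.p s).deg - 1 + wd w + m + (E.q s).deg) •
          onHead (fun x v' => Φ u (E.p s) w (E.q s * x) v') v) r) l -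
      splitSum (fun u r => splitSum (fun v w => ∑ s,
      sg k (wd u + m * (E.p s).deg + wd w * ((E.p s).deg + wd v)) •
        sg k (wd u + (E.p s).deg - 1 + wd w + m) •
          onLast (fun v' x => sg k ((x.deg - 1) * ((E.q s).deg + wd v')) •
            Φ u (E.p s) w (x * E.q s) v') v) r) l := by
    rw [bar_ins, neg_neg, ins]
    simp only [← splitSum_add, ← splitSum_sub, ← Finset.sum_add_distrib, ← Finset.sum_sub_distrib]
    refine splitSum_congr fun u r _ => splitSum_congr fun v w _ =>
      Finset.sum_congr rfl fun s _ => ?_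
    simp only [← smul_sub, ← smul_add]
    congr 1
    rw [insDiff, cyc]
    -- The degrees of `e'` and `e''` add up to `m`, so the sign of the bar differential on `v`
    -- agrees with the one that `cyc` produces from the coefficient `e''`.
    have e2 : ∀ y : Y, sg k (wd u + wd w + 1) • y =
        sg k (wd u + (E.p s).deg - 1 + wd w + m + (E.q s).deg) • y := fun y =>
      sg_smul_congr (by simp only [E.q_deg]; push_cast; clear * -; grind)
    rw [e2]
    simp only [sg_add _ (E.q s).deg, smul_sub, smul_add, smul_smul]
    abel
  rw [e, h1, h2, h3]
  abel

end Insertion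

/-! ### Linear maps with signs that depend on the degrees of tensor factors. -/

section Twist

variable {k : Type*} [Field k]
variable {X : Type*} [AddCommMonoid X] [Module k X]
variable {Y : Type*} [AddCommMonoid Y] [Module k Y]

/-- The map that is `L n` in degree `n`. -/
def gradedMap (𝒳 : ℤ → Submodule k X) [DirectSum.Decomposition 𝒳] (L : ℤ → X →ₗ[k] Y) :
    X →ₗ[k] Y :=
  DirectSum.toModule k ℤ Y (fun n => L n ∘ₗ (𝒳 n).subtype) ∘ₗ
    (DirectSum.decomposeLinearEquiv 𝒳).toLinearMap

theorem gradedMap_of_mem (𝒳 : ℤ → Submodule k X) [DirectSum.Decomposition 𝒳]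
    (L : ℤ → X →ₗ[k] Y) {n : ℤ} {x : X} (hx : x ∈ 𝒳 n) : gradedMap 𝒳 L x = L n x := by
  lift x to 𝒳 n using hx
  simp [gradedMap]

/-- `x ⊗ y ↦ x ⊗ R n y` for `x` of degree `n`. -/
def gradedTensor (𝒳 : ℤ → Submodule k X) [DirectSum.Decomposition 𝒳] (R : ℤ → Y →ₗ[k] Y) :
    X ⊗[k] Y →ₗ[k] X ⊗[k] Y :=
  TensorProduct.lift (gradedMap 𝒳 fun n => (TensorProduct.mk k X Y).compl₂ (R n))

theorem gradedTensor_tmul (𝒳 : ℤ → Submodule k X) [DirectSum.Decomposition 𝒳]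
    (R : ℤ → Y →ₗ[k] Y) {n : ℤ} {x : X} (hx : x ∈ 𝒳 n) (y : Y) :
    gradedTensor 𝒳 R (x ⊗ₜ y) = x ⊗ₜ R n y := by
  simp [gradedTensor, gradedMap_of_mem 𝒳 _ hx]

variable {Z : Type*} [AddCommMonoid Z] [Module k Z]

/-- Multiply `x ⊗ (y ⊗ z)` by a scalar that depends on the three degrees. -/
def tripleTwist (𝒳 : ℤ → Submodule k X) [DirectSum.Decomposition 𝒳]
    (𝒴 : ℤ → Submodule k Y) [DirectSum.Decomposition 𝒴]
    (𝒵 : ℤ → Submodule k Z) [DirectSum.Decomposition 𝒵] (σ : ℤ → ℤ → ℤ → k) :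
    X ⊗[k] (Y ⊗[k] Z) →ₗ[k] X ⊗[k] (Y ⊗[k] Z) :=
  gradedTensor 𝒳 fun i => gradedTensor 𝒴 fun j => gradedMap 𝒵 fun l => σ i j l • LinearMap.id

theorem tripleTwist_tmul (𝒳 : ℤ → Submodule k X) [DirectSum.Decomposition 𝒳]
    (𝒴 : ℤ → Submodule k Y) [DirectSum.Decomposition 𝒴]
    (𝒵 : ℤ → Submodule k Z) [DirectSum.Decomposition 𝒵] (σ : ℤ → ℤ → ℤ → k) {i j l : ℤ}
    {x : X} {y : Y} {z : Z} (hx : x ∈ 𝒳 i) (hy : y ∈ 𝒴 j) (hz : z ∈ 𝒵 l) :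
    tripleTwist 𝒳 𝒴 𝒵 σ (x ⊗ₜ (y ⊗ₜ z)) = σ i j l • (x ⊗ₜ (y ⊗ₜ z)) := by
  rw [tripleTwist, gradedTensor_tmul 𝒳 _ hx, gradedTensor_tmul 𝒴 _ hy, gradedMap_of_mem 𝒵 _ hz]
  simp

end Twist

/-! ### Placing letters and coefficients by permutations of tensor factors. -/

section Insertion

variable {k : Type*} [Field k] {A : Type*} [AddCommGroup A] [Module k A] {T : Type*} [Semiring T]
  [Algebra k T]

/-- `u ⊗ (v ⊗ w) ↦ u x w ⊗ v`. -/
def insert₃ (x : T) : T ⊗[k] (T ⊗[k] T) →ₗ[k] T ⊗[k] T :=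
  (TensorProduct.comm k _ _).toLinearMap ∘ₗ
    LinearMap.lTensor _ (LinearMap.mul' k _ ∘ₗ LinearMap.rTensor _ (LinearMap.mulRight k x)) ∘ₗ
    (TensorProduct.leftComm k _ _ _).toLinearMap

theorem insert₃_tmul (x u v w : T) :
    insert₃ x (u ⊗ₜ[k] (v ⊗ₜ[k] w)) = (u * (x * w)) ⊗ₜ[k] v := by
  simp [insert₃, mul_assoc]

/-- `a ⊗ (u ⊗ (v ⊗ (x ⊗ z))) ↦ (a ⊗ u p x) ⊗ ((q' ⊗ z) ⊗ (q ⊗ v))`. -/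
def insert₅ (p : T) (q q' : A) : A ⊗[k] (T ⊗[k] (T ⊗[k] (T ⊗[k] T))) →ₗ[k]
    (A ⊗[k] T) ⊗[k] ((A ⊗[k] T) ⊗[k] (A ⊗[k] T)) :=
  (TensorProduct.assoc k _ _ _).symm.toLinearMap ∘ₗ
    LinearMap.lTensor _ (TensorProduct.map
        (LinearMap.mul' k _ ∘ₗ LinearMap.rTensor _ (LinearMap.mulRight k p))
        (TensorProduct.map (TensorProduct.mk k A _ q') (TensorProduct.mk k A _ q) ∘ₗ
          (TensorProduct.comm k _ _).toLinearMap) ∘ₗ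
      (TensorProduct.assoc k _ _ _).symm.toLinearMap ∘ₗ
      LinearMap.lTensor _ (TensorProduct.leftComm k _ _ _).toLinearMap)

theorem insert₅_tmul (p : T) (a q q' : A) (u v x z : T) :
    insert₅ p q q' (a ⊗ₜ[k] (u ⊗ₜ[k] (v ⊗ₜ[k] (x ⊗ₜ[k] z)))) =
      (a ⊗ₜ (u * (p * x))) ⊗ₜ[k] ((q' ⊗ₜ z) ⊗ₜ[k] (q ⊗ₜ v)) := by
  simp [insert₅, mul_assoc]

end Insertion

/-! ### The homotopies as linear operators on chains. -/

section Operations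

variable {k : Type*} [Field k] {A : Type*} [Ring A] [Algebra k A]
  {𝒜 : ℤ → Submodule k A} [GradedAlgebra 𝒜] {m : ℤ}
  {Y Z : Type*} [AddCommGroup Y] [Module k Y] [AddCommGroup Z] [Module k Z]

/-- The grading of `T(sĀ)`. -/
abbrev barGrading (𝒜 : ℤ → Submodule k A) : ℤ → Submodule k (TensorAlgebra k (Abar k A)) :=
  wordGrading (quotGrading 𝒜 (Submodule.span k {(1 : A)}))

/-- The letter `[x]`. -/
abbrev single (x : A) : TensorAlgebra k (Abar k A) :=
  TensorAlgebra.ι k (Submodule.mkQ (Submodule.span k {(1 : A)}) x)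

theorem deconc₃_word (l : List (Letter 𝒜)) :
    deconc₃ (word l) =
      splitSum (fun u r => splitSum (fun v w => word u ⊗ₜ[k] (word v ⊗ₜ[k] word w)) r) l := by
  rw [deconc₃, LinearMap.comp_apply, deconc_word, map_splitSum]
  refine splitSum_congr fun u r _ => ?_
  rw [LinearMap.lTensor_tmul, deconc_word]
  exact map_splitSum (TensorProduct.mk k _ _ (word u)) _ _

/-- Splitting into three subwords, with signs. -/
def split₃ (𝒜 : ℤ → Submodule k A) [GradedAlgebra 𝒜] (σ : ℤ → ℤ → ℤ → k) :
    TensorAlgebra k (Abar k A) →ₗ[k] TensorAlgebra k (Abar k A) ⊗[k]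
      (TensorAlgebra k (Abar k A) ⊗[k] TensorAlgebra k (Abar k A)) :=
  tripleTwist (barGrading 𝒜) (barGrading 𝒜) (barGrading 𝒜) σ ∘ₗ deconc₃

theorem split₃_word (σ : ℤ → ℤ → ℤ → k) (l : List (Letter 𝒜)) :
    split₃ 𝒜 σ (word l) = splitSum (fun u r => splitSum (fun v w =>
      σ (wd u) (wd v) (wd w) • (word u ⊗ₜ[k] (word v ⊗ₜ[k] word w))) r) l := by
  rw [split₃, LinearMap.comp_apply, deconc₃_word]
  refine (map_splitSum _ _ _).trans (splitSum_congr fun u r _ => ?_)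
  refine (map_splitSum _ _ _).trans (splitSum_congr fun v w _ => ?_)
  exact tripleTwist_tmul _ _ _ σ (word_mem _) (word_mem _) (word_mem _)

theorem insert₃_word (p : Letter 𝒜) (u v w : List (Letter 𝒜)) :
    insert₃ (single p.val) (word u ⊗ₜ[k] (word v ⊗ₜ[k] word w)) =
      word (u ++ p :: w) ⊗ₜ[k] word v := by
  rw [insert₃_tmul, word_append, word_cons]

variable {F : OpenFrobenius 𝒜 m} (E : Casimir F)

/-- `∑ ± u [e'] w ⊗ v`, for one summand of `e' ⊗ e''`. -/
def insertWord (s : Fin E.n) : TensorAlgebra k (Abar k A) →ₗ[k]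
    TensorAlgebra k (Abar k A) ⊗[k] TensorAlgebra k (Abar k A) :=
  insert₃ (single (E.p s).val) ∘ₗ
    split₃ 𝒜 fun i j l => sg k (i + m * (E.p s).deg + l * ((E.p s).deg + j))

/-- Connects the linear operators, one for each summand of the Casimir element, with the signed sum
`ins`. The map `f s` attaches the second leg. -/
theorem insertWord_word (f : Fin E.n → TensorAlgebra k (Abar k A) ⊗[k]
      TensorAlgebra k (Abar k A) →ₗ[k] Y)
    (Φ : List (Letter 𝒜) → Letter 𝒜 → List (Letter 𝒜) → Letter 𝒜 → List (Letter 𝒜) → Y)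
    (h : ∀ s u v w, f s (word (u ++ E.p s :: w) ⊗ₜ word v) = Φ u (E.p s) w (E.q s) v)
    (l : List (Letter 𝒜)) : ∑ s, f s (insertWord E s (word l)) = ins E Φ l := by
  rw [ins]
  simp only [insertWord, LinearMap.comp_apply, split₃_word, map_splitSum, map_smul, insert₃_word, h,
    splitSum_sum]

/-- `a ⊗ (x ⊗ y) ↦ (a ⊗ x) ⊗ (q ⊗ y)`. -/
def attach (q : A) : A ⊗[k] (TensorAlgebra k (Abar k A) ⊗[k] TensorAlgebra k (Abar k A)) →ₗ[k]
    Chain k A ⊗[k] Chain k A :=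
  TensorProduct.map LinearMap.id (TensorProduct.mk k A _ q) ∘ₗ
    (TensorProduct.assoc k _ _ _).symm.toLinearMap

/-- The homotopy `a[l] ↦ ∑ ± a[u, e', w] ⊗ e''[v]` for cocommutativity. -/
def commHomotopy : Chain k A →ₗ[k] Chain k A ⊗[k] Chain k A :=
  -∑ s, attach (E.q s).val ∘ₗ TensorProduct.map (sgn 𝒜) (insertWord E s)

theorem commHomotopy_chain (a : Letter 𝒜) (l : List (Letter 𝒜)) :
    commHomotopy E (chain a l) =
      -(sg k a.deg • ins E (fun u p w q v => chain a (u ++ p :: w) ⊗ₜ[k] chain q v) l) := by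
  rw [← insertWord_word E (fun s => attach (E.q s).val ∘ₗ TensorProduct.mk k A _ a.val)
    (fun u p w q v => chain a (u ++ p :: w) ⊗ₜ[k] chain q v)
    (fun s u v w => by simp [attach, chain])]
  simp only [commHomotopy, LinearMap.neg_apply, LinearMap.sum_apply, LinearMap.comp_apply, chain,
    TensorProduct.map_tmul, sgn_of_mem 𝒜 a.mem, ← TensorProduct.smul_tmul', map_smul,
    Finset.smul_sum, TensorProduct.mk_apply]

/-- `a ⊗ (y ⊗ x) ↦ 1 ⊗ y [a] x`. -/
def rotate : A ⊗[k] (TensorAlgebra k (Abar k A) ⊗[k] TensorAlgebra k (Abar k A)) →ₗ[k]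
    Chain k A :=
  TensorProduct.mk k A _ 1 ∘ₗ LinearMap.mul' k _ ∘ₗ
    LinearMap.lTensor _ (LinearMap.mul' k _ ∘ₗ
      LinearMap.rTensor _ (TensorAlgebra.ι k ∘ₗ Submodule.mkQ _)) ∘ₗ
    (TensorProduct.leftComm k _ _ _).toLinearMap

theorem rotate_word (a : Letter 𝒜) (y x : List (Letter 𝒜)) :
    rotate (a.val ⊗ₜ[k] (word y ⊗ₜ[k] word x)) = chain (1 : Letter 𝒜) (y ++ a :: x) := by
  simp [rotate, chain, word_append, word_cons]

/-- `a ⊗ ((x ⊗ v) ⊗ y) ↦ 1[y, a, x] ⊗ q[v]`. -/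
def rotateAttach (q : A) : A ⊗[k] ((TensorAlgebra k (Abar k A) ⊗[k] TensorAlgebra k (Abar k A)) ⊗[k]
      TensorAlgebra k (Abar k A)) →ₗ[k] Chain k A ⊗[k] Chain k A :=
  TensorProduct.map rotate (TensorProduct.mk k A _ q) ∘ₗ
    (TensorProduct.assoc k _ _ _).symm.toLinearMap ∘ₗ
    LinearMap.lTensor _ ((TensorProduct.assoc k _ _ _).symm.toLinearMap ∘ₗ
      (TensorProduct.comm k _ _).toLinearMap)

/-- Splitting the word of a chain into two subwords, with signs. -/
def splitTwist (𝒜 : ℤ → Submodule k A) [GradedAlgebra 𝒜] (σ : ℤ → ℤ → ℤ → k) :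
    Chain k A →ₗ[k] A ⊗[k] (TensorAlgebra k (Abar k A) ⊗[k] TensorAlgebra k (Abar k A)) :=
  tripleTwist 𝒜 (barGrading 𝒜) (barGrading 𝒜) σ ∘ₗ LinearMap.lTensor _ deconc

theorem splitTwist_chain (σ : ℤ → ℤ → ℤ → k) (a : Letter 𝒜) (l : List (Letter 𝒜)) :
    splitTwist 𝒜 σ (chain a l) = splitSum (fun r y =>
      σ a.deg (wd r) (wd y) • (a.val ⊗ₜ[k] (word r ⊗ₜ[k] word y))) l := by
  have e2 : LinearMap.lTensor A deconc (chain a l) =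
      splitSum (fun r y => a.val ⊗ₜ[k] (word r ⊗ₜ[k] word y)) l := by
    rw [chain, LinearMap.lTensor_tmul, deconc_word]
    exact map_splitSum (TensorProduct.mk k _ _ a.val) _ _
  rw [splitTwist, LinearMap.comp_apply, e2]
  refine (map_splitSum _ _ _).trans (splitSum_congr fun r y _ => ?_)
  exact tripleTwist_tmul _ _ _ σ a.mem (word_mem _) (word_mem _)

/-- `a[l] ↦ ∑ ± 1[y, a, u, e', w] ⊗ e''[v]`. -/
def rotationHomotopy : Chain k A →ₗ[k] Chain k A ⊗[k] Chain k A :=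
  (∑ s, rotateAttach (E.q s).val ∘ₗ
      LinearMap.lTensor _ (LinearMap.rTensor _ (insertWord E s))) ∘ₗ
    splitTwist 𝒜 fun i j l => sg k (l * (i + j) + i)

theorem rotationHomotopy_chain (a : Letter 𝒜) (l : List (Letter 𝒜)) :
    rotationHomotopy E (chain a l) = splitSum (fun r y => sg k (wd y * (a.deg + wd r) + a.deg) •
      ins E (fun u p w q v =>
        chain (1 : Letter 𝒜) (y ++ a :: (u ++ p :: w)) ⊗ₜ[k] chain q v) r) l := by
  have e : ∀ y r : List (Letter 𝒜), ∑ s, rotateAttach (E.q s).val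
      (a.val ⊗ₜ[k] (insertWord E s (word r) ⊗ₜ[k] word y)) =
      ins E (fun u p w q v =>
        chain (1 : Letter 𝒜) (y ++ a :: (u ++ p :: w)) ⊗ₜ[k] chain q v) r := by
    intro y r
    rw [← insertWord_word E (fun s => rotateAttach (E.q s).val ∘ₗ TensorProduct.mk k A _ a.val ∘ₗ
        (TensorProduct.mk k _ _).flip (word y))
      (fun u p w q v => chain (1 : Letter 𝒜) (y ++ a :: (u ++ p :: w)) ⊗ₜ[k] chain q v)
      (fun s u v w => by simp [rotateAttach, rotate_word]; rfl)]
    rfl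
  rw [rotationHomotopy, LinearMap.comp_apply, splitTwist_chain]
  refine (map_splitSum _ _ _).trans (splitSum_congr fun r y _ => ?_)
  rw [map_smul, LinearMap.sum_apply, ← e]
  rfl

/-- `a ⊗ (u ⊗ (v ⊗ (x ⊗ z))) ↦ a[u, p, x] ⊗ (q'[z] ⊗ q[v])`. -/
abbrev attach₂ (p q q' : A) : A ⊗[k] (TensorAlgebra k (Abar k A) ⊗[k]
      (TensorAlgebra k (Abar k A) ⊗[k]
        (TensorAlgebra k (Abar k A) ⊗[k] TensorAlgebra k (Abar k A)))) →ₗ[k]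
    Chain k A ⊗[k] (Chain k A ⊗[k] Chain k A) :=
  insert₅ (single p) q q'

theorem attach₂_word (a p q q' : Letter 𝒜) (u v x z : List (Letter 𝒜)) :
    attach₂ p.val q.val q'.val (a.val ⊗ₜ[k] (word u ⊗ₜ[k] (word v ⊗ₜ[k] (word x ⊗ₜ[k] word z)))) =
      chain a (u ++ p :: x) ⊗ₜ[k] (chain q' z ⊗ₜ[k] chain q v) := by
  simp only [chain, word_append, word_cons]
  exact insert₅_tmul _ _ _ _ _ _ _ _

/-- `a[l] ↦ ∑ ± a[u, e₁', x, e₂', y] ⊗ (e₂''[z] ⊗ e₁''[v])`. -/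
def braceHomotopy : Chain k A →ₗ[k] Chain k A ⊗[k] (Chain k A ⊗[k] Chain k A) :=
  ∑ s, ∑ t, attach₂ (E.p s).val (E.q s).val (E.q t).val ∘ₗ
    LinearMap.lTensor _ (LinearMap.lTensor _ (LinearMap.lTensor _ (insertWord E t)) ∘ₗ
      split₃ 𝒜 fun i j l =>
        sg k (i + m * (E.p s).deg + l * ((E.p s).deg + j)) * sg k (i + (E.p s).deg))

/-- The second insertion takes place in the last piece of the first one, so `e₂'` stands to the
right of `e₁'` and the two split-off words do not overlap. -/
theorem braceHomotopy_chain (a : Letter 𝒜) (l : List (Letter 𝒜)) :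
    braceHomotopy E (chain a l) = ins E (fun u p r q v => sg k (wd u + p.deg) •
      ins E (fun u' p' w' q' v' => chain a (u ++ p :: (u' ++ p' :: w')) ⊗ₜ[k]
        (chain q' v' ⊗ₜ[k] chain q v)) r) l := by
  have e : ∀ s u v r, ∑ t, attach₂ (E.p s).val (E.q s).val (E.q t).val
      (a.val ⊗ₜ[k] (word u ⊗ₜ[k] (word v ⊗ₜ[k] insertWord E t (word r)))) =
      ins E (fun u' p' w' q' v' => chain a (u ++ E.p s :: (u' ++ p' :: w')) ⊗ₜ[k]
        (chain q' v' ⊗ₜ[k] chain (E.q s) v)) r := by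
    intro s u v r
    rw [← insertWord_word E (fun t => attach₂ (E.p s).val (E.q s).val (E.q t).val ∘ₗ
        TensorProduct.mk k A _ a.val ∘ₗ TensorProduct.mk k _ _ (word u) ∘ₗ
        TensorProduct.mk k _ _ (word v))
      (fun u' p' w' q' v' => chain a (u ++ E.p s :: (u' ++ p' :: w')) ⊗ₜ[k]
        (chain q' v' ⊗ₜ[k] chain (E.q s) v))
      (fun t u' v' w' => attach₂_word a (E.p s) (E.q s) (E.q t) u v (u' ++ E.p t :: w') v')]
    rfl
  have e2 : ∀ (s t) (σ : ℤ → ℤ → ℤ → k), attach₂ (E.p s).val (E.q s).val (E.q t).val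
      (LinearMap.lTensor A (LinearMap.lTensor _ (LinearMap.lTensor _ (insertWord E t)) ∘ₗ
        split₃ 𝒜 σ) (chain a l)) =
      splitSum (fun u r => splitSum (fun v w => σ (wd u) (wd v) (wd w) •
        attach₂ (E.p s).val (E.q s).val (E.q t).val
          (a.val ⊗ₜ[k] (word u ⊗ₜ[k] (word v ⊗ₜ[k] insertWord E t (word w))))) r) l := by
    intro s t σ
    rw [chain]
    refine (congrArg (attach₂ (E.p s).val (E.q s).val (E.q t).val ∘ₗ TensorProduct.mk k A _ a.val ∘ₗ
      LinearMap.lTensor _ (LinearMap.lTensor _ (insertWord E t))) (split₃_word σ l)).trans ?_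
    rw [map_splitSum]
    refine splitSum_congr fun u r _ => ?_
    rw [map_splitSum]
    refine splitSum_congr fun v w _ => ?_
    rw [map_smul]; rfl
  simp only [braceHomotopy, LinearMap.sum_apply, LinearMap.comp_apply (f := attach₂ _ _ _), e2]
  simp only [ins, ← splitSum_sum, ← Finset.smul_sum, e, smul_smul]

end Operations

/-! ### The Koszul symmetry under linear maps. -/

section Koszul

variable {k : Type*} [Field k] {X C : Type*} [AddCommGroup X] [Module k X] [AddCommGroup C]
  [Module k C]

theorem map_koszul (f : X ⊗[k] X →ₗ[k] C) (𝒳 : ℤ → Submodule k X) [DirectSum.Decomposition 𝒳]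
    {i j : ℤ} {x y : X} (hx : x ∈ 𝒳 i) (hy : y ∈ 𝒳 j) :
    f (koszul 𝒳 𝒳 (x ⊗ₜ y)) = sg k (i * j) • f (y ⊗ₜ x) := by
  rw [koszul_tmul 𝒳 𝒳 hx hy, map_smul]

end Koszul

/-! ### Connes' operator, the coproduct and the Koszul signs on letters. -/

section Formulas

variable {k : Type*} [Field k] {A : Type*} [Ring A] [Algebra k A]
  {𝒜 : ℤ → Submodule k A} [GradedAlgebra 𝒜] {m : ℤ}
  {Y Z : Type*} [AddCommGroup Y] [Module k Y] [AddCommGroup Z] [Module k Z]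

theorem chain_mem_shift (m : ℤ) (a : Letter 𝒜) (l : List (Letter 𝒜)) :
    chain a l ∈ shift (chainGrading 𝒜) m (a.deg + wd l - m) := by
  have := chain_mem a l
  rwa [shift, sub_add_cancel]

theorem lTensor_deconc_chain (a : Letter 𝒜) (l : List (Letter 𝒜)) :
    LinearMap.lTensor A deconc (chain a l) =
      splitSum (fun u v => a.val ⊗ₜ[k] (word u ⊗ₜ[k] word v)) l := by
  rw [chain, LinearMap.lTensor_tmul, deconc_word]
  exact map_splitSum (TensorProduct.mk k _ _ a.val) _ _

theorem connes_chain (a : Letter 𝒜) (l : List (Letter 𝒜)) :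
    connes 𝒜 (chain a l) = splitSum (fun u v =>
      sg k ((a.deg - 1 + wd u) * wd v) • chain (1 : Letter 𝒜) (v ++ a :: u)) l := by
  rw [connes]
  simp only [LinearMap.comp_apply (g := LinearMap.lTensor A deconc), lTensor_deconc_chain,
    ← LinearMap.comp_assoc]
  refine (map_splitSum _ _ _).trans (splitSum_congr fun u v _ => ?_)
  have h := map_koszul (TensorProduct.mk k A (TensorAlgebra k (Abar k A)) 1 ∘ₗ LinearMap.mul' k _)
    (barGrading 𝒜) (word_mem (a :: u)) (word_mem v)
  have h2 : (TensorProduct.mk k A (TensorAlgebra k (Abar k A)) 1 ∘ₗ LinearMap.mul' k _)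
      (word v ⊗ₜ word (a :: u)) = chain (1 : Letter 𝒜) (v ++ a :: u) := by
    rw [chain, word_append]; rfl
  rw [h2, word_cons] at h
  exact h

variable {F : OpenFrobenius 𝒜 m} (E : Casimir F)

/-- The first part of the exponent is the Koszul sign for moving `e'' a` past the word `u`; the part
with the factor `m` comes from making the coproduct an operation of degree zero. -/
theorem shiftedCoproduct_chain (a : Letter 𝒜) (l : List (Letter 𝒜)) :
    shiftedCoproduct F (chain a l) = splitSum (fun u v => ∑ s,
      sg k (((E.q s).deg + a.deg) * wd u + m * ((E.p s).deg + wd u)) •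
        (chain (E.p s) u ⊗ₜ[k] chain (E.q s * a) v)) l := by
  have h1 : TensorProduct.map F.δ deconc (chain a l) = splitSum (fun u v =>
      ∑ s, ((E.p s).val ⊗ₜ[k] (E.q s * a).val) ⊗ₜ[k] (word u ⊗ₜ[k] word v)) l := by
    rw [chain, TensorProduct.map_tmul, deconc_word]
    refine (map_splitSum (TensorProduct.mk k _ _ (F.δ a.val)) _ _).trans
      (splitSum_congr fun u v _ => ?_)
    rw [TensorProduct.mk_apply, E.δ_right, TensorProduct.sum_tmul]
    rfl
  rw [shiftedCoproduct, chainCoproduct]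
  simp only [LinearMap.comp_apply (g := TensorProduct.map F.δ deconc), h1,
    ← LinearMap.comp_assoc]
  refine (map_splitSum _ _ _).trans (splitSum_congr fun u v _ => ?_)
  rw [map_sum]
  refine Finset.sum_congr rfl fun s _ => ?_
  have h : koszul 𝒜 (barGrading 𝒜) ((E.q s * a).val ⊗ₜ word u) =
      sg k (((E.q s).deg + a.deg) * wd u) • (word u ⊗ₜ (E.q s * a).val) :=
    koszul_tmul _ _ (E.q s * a).mem (word_mem u)
  simp only [LinearMap.comp_apply, LinearEquiv.coe_coe, TensorProduct.assoc_symm_tmul,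
    LinearMap.rTensor_tmul, LinearMap.lTensor_tmul, TensorProduct.assoc_tmul]
  rw [h, ← TensorProduct.smul_tmul', map_smul, TensorProduct.tmul_smul, map_smul, map_smul,
    TensorProduct.assoc_tmul, TensorProduct.assoc_symm_tmul, LinearMap.rTensor_tmul, sg_add,
    ← smul_smul]
  congr 1
  have h2 := sgn_pow_of_mem (chainGrading 𝒜) (chain_mem (E.p s) u) m.natAbs
  rw [← sg_mul_natAbs] at h2
  refine (congrArg (fun z => z ⊗ₜ[k] chain (E.q s * a) v) h2).trans ?_
  rw [← TensorProduct.smul_tmul', mul_comm]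

theorem sgn_chain (m : ℤ) (a : Letter 𝒜) (l : List (Letter 𝒜)) :
    sgn (shift (chainGrading 𝒜) m) (chain a l) = sg k (a.deg + wd l - m) • chain a l :=
  sgn_of_mem _ (chain_mem_shift m a l)

theorem koszul_chain (m : ℤ) (a b : Letter 𝒜) (l l' : List (Letter 𝒜)) :
    koszul (shift (chainGrading 𝒜) m) (shift (chainGrading 𝒜) m) (chain a l ⊗ₜ chain b l') =
      sg k ((a.deg + wd l - m) * (b.deg + wd l' - m)) • (chain b l' ⊗ₜ[k] chain a l) :=
  koszul_tmul _ _ (chain_mem_shift m a l) (chain_mem_shift m b l')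

theorem oddSum_chain (m : ℤ) (f g : Chain k A →ₗ[k] Chain k A) (a b : Letter 𝒜)
    (l l' : List (Letter 𝒜)) :
    oddSum (shift (chainGrading 𝒜) m) f g (chain a l ⊗ₜ chain b l') =
      f (chain a l) ⊗ₜ chain b l' +
        sg k (a.deg + wd l - m) • (chain a l ⊗ₜ[k] g (chain b l')) := by
  rw [oddSum, LinearMap.add_apply, LinearMap.rTensor_tmul, TensorProduct.map_tmul, sgn_chain,
    TensorProduct.smul_tmul']

end Formulas

/-! ### The coproduct is a chain map. -/

section Coproduct

variable {k : Type*} [Field k] {A : Type*} [Ring A] [Algebra k A]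
  {𝒜 : ℤ → Submodule k A} [GradedAlgebra 𝒜] {m : ℤ}
  {Y Z : Type*} [AddCommGroup Y] [Module k Y] [AddCommGroup Z] [Module k Z]
  {F : OpenFrobenius 𝒜 m}

/-- The Leibniz rule in letters. The three products have equal but differently bracketed degrees, so
they are first rewritten over one common degree before linearity applies. -/
theorem GLin.dL_mul {f : Letter 𝒜 → Y} (h : GLin f) (x y : Letter 𝒜) :
    f (F.dL (x * y)) = f (F.dL x * y) + sg k x.deg • f (x * F.dL y) := by
  have m2 : F.d x.val * y.val ∈ 𝒜 (x.deg + y.deg + 1) := by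
    have := (F.dL x * y).mem
    rwa [show (F.dL x * y).deg = x.deg + y.deg + 1 by simp; ring] at this
  have m3 : x.val * F.d y.val ∈ 𝒜 (x.deg + y.deg + 1) := by
    have := (x * F.dL y).mem
    rwa [show (x * F.dL y).deg = x.deg + y.deg + 1 by simp; ring] at this
  have e1 : F.dL (x * y) = ⟨x.deg + y.deg + 1, F.d x.val * y.val + sg k x.deg •
      (x.val * F.d y.val), (𝒜 _).add_mem m2 ((𝒜 _).smul_mem _ m3)⟩ :=
    Letter.ext rfl (F.leibniz x.mem y.val)
  have e2 : F.dL x * y = ⟨x.deg + y.deg + 1, F.d x.val * y.val, m2⟩ :=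
    Letter.ext (by simp; ring) rfl
  have e3 : x * F.dL y = ⟨x.deg + y.deg + 1, x.val * F.d y.val, m3⟩ :=
    Letter.ext (by simp; ring) rfl
  rw [e1, e2, e3, h.add _ _ _ m2 ((𝒜 _).smul_mem _ m3), h.smul _ _ _ m3]

theorem GBilin.mul_right {Ψ : Letter 𝒜 → Letter 𝒜 → Y} (h : GBilin Ψ) (c : Letter 𝒜) :
    GBilin fun p q => Ψ p (q * c) :=
  ⟨fun _ => h.left _, fun x => (h.right x).mul_right c⟩

theorem map_cyc (f : Y →ₗ[k] Z) (Ψ : Letter 𝒜 → List (Letter 𝒜) → Y) (a : Letter 𝒜)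
    (l : List (Letter 𝒜)) : f (cyc F Ψ a l) = cyc F (fun a l => f (Ψ a l)) a l := by
  simp only [cyc, map_add, map_sub, map_smul, map_bar, map_onHead, map_onLast]

/-- The sum of `± Φ e' u (e'' a) v` over all `u ++ v = l`. -/
def coprod (E : Casimir F)
    (Φ : Letter 𝒜 → List (Letter 𝒜) → Letter 𝒜 → List (Letter 𝒜) → Y) (a : Letter 𝒜) :
    List (Letter 𝒜) → Y :=
  splitSum fun u v => ∑ s, sg k (((E.q s).deg + a.deg) * wd u + m * ((E.p s).deg + wd u)) •
    Φ (E.p s) u (E.q s * a) v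

/-- The differential of a function of two chains. -/
def tensorDiff (F : OpenFrobenius 𝒜 m)
    (Φ : Letter 𝒜 → List (Letter 𝒜) → Letter 𝒜 → List (Letter 𝒜) → Y)
    (p : Letter 𝒜) (u : List (Letter 𝒜)) (q : Letter 𝒜) (v : List (Letter 𝒜)) : Y :=
  cyc F (fun p u => Φ p u q v) p u + sg k (p.deg + wd u - m) • cyc F (Φ p u) q v

variable (E : Casimir F)
  {Φ : Letter 𝒜 → List (Letter 𝒜) → Letter 𝒜 → List (Letter 𝒜) → Y}

/-- Combine `Casimir.mul_right` and `Casimir.mul_mid`: up to sign, the second leg commutes with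
every element. -/
theorem Casimir.mul_central {Ψ : Letter 𝒜 → Letter 𝒜 → Y} (h : GBilin Ψ) (c : Letter 𝒜) :
    ∑ s, Ψ (E.p s) (E.q s * c) = ∑ s, sg k ((E.q s).deg * c.deg) • Ψ (E.p s) (c * E.q s) := by
  rw [E.mul_right h c]
  have := E.mul_mid (h.const_smul fun _ j => sg k (j * c.deg)) c
  rw [this, Finset.smul_sum]
  refine Finset.sum_congr rfl fun s _ => ?_
  rw [smul_smul, ← sg_add]
  exact sg_smul_congr (by push_cast [Letter.mul_deg]; grind [=_ intCast_mul_self])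

/-- `e' ⊗ e'' a x = ± e' x ⊗ e'' a`. -/
theorem Casimir.mul_cross {Ψ : Letter 𝒜 → Letter 𝒜 → Y} (h : GBilin Ψ) (a x : Letter 𝒜) :
    ∑ s, Ψ (E.p s) (E.q s * (a * x)) =
      ∑ s, sg k (a.deg * x.deg + (E.q s).deg * x.deg) • Ψ (E.p s * x) (E.q s * a) := by
  rw [E.mul_comm h a x]
  have := E.mul_right (h.mul_right a) x
  simp only [mul_assoc] at this
  rw [this, Finset.smul_sum]
  simp only [smul_smul, ← sg_add]

/-- `x e' ⊗ e'' a = ± e' ⊗ e'' a x`. -/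
theorem Casimir.mul_left_cross {Ψ : Letter 𝒜 → Letter 𝒜 → Y} (h : GBilin Ψ) (a x : Letter 𝒜) :
    ∑ s, Ψ (x * E.p s) (E.q s * a) =
      sg k (m * x.deg + a.deg * x.deg) • ∑ s, Ψ (E.p s) (E.q s * (a * x)) := by
  rw [E.mul_comm h a x]
  have := E.mul_left (h.mul_right a) x
  simp only [mul_assoc] at this
  rw [this, smul_smul, ← sg_add]
  exact sg_smul_congr (by push_cast; grind)

/-- The Leibniz rule splits `d (e'' a)`. The part with `d e''` cancels the term with `d e'` because
the Casimir element is a cycle, and the part `e'' d a` remains. -/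
theorem coprod_d (h : ∀ u v, GBilin fun p q => Φ p u q v) (a : Letter 𝒜) (l : List (Letter 𝒜)) :
    splitSum (fun u v => ∑ s,
      sg k (((E.q s).deg + a.deg) * wd u + m * ((E.p s).deg + wd u)) •
        (Φ (F.dL (E.p s)) u (E.q s * a) v +
          sg k ((E.p s).deg + wd u - m) • Φ (E.p s) u (F.dL (E.q s * a)) v)) l =
    coprod E Φ (F.dL a) l := by
  refine splitSum_congr fun u v _ => ?_
  simp only [((h u v).right _).dL_mul, smul_add, smul_smul, ← sg_add, Finset.sum_add_distrib]
  have := E.d (((h u v).mul_right a).const_smul fun i j =>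
    sg k ((j + a.deg) * wd u + m * (i - 1 + wd u)))
  simp only [smul_smul, ← Finset.sum_neg_distrib, ← sg_add, ← neg_smul, neg_sg] at this
  have e1 := (Finset.sum_congr rfl fun s _ => sg_smul_congr (k := k)
    (p := ((E.q s).deg + a.deg) * wd u + m * ((E.p s).deg + wd u))
    (y := Φ (F.dL (E.p s)) u (E.q s * a) v)
    (by push_cast [OpenFrobenius.dL_deg]; clear * -; grind)).trans this
  rw [e1, ← add_assoc, ← Finset.sum_add_distrib]
  have e2 : ∑ s, (sg k ((E.p s).deg + (((F.dL (E.q s)).deg + a.deg) * wd u +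
        m * ((E.p s).deg - 1 + wd u)) + 1) • Φ (E.p s) u (F.dL (E.q s) * a) v +
      sg k (((E.q s).deg + a.deg) * wd u + m * ((E.p s).deg + wd u) +
        ((E.p s).deg + wd u - m)) • Φ (E.p s) u (F.dL (E.q s) * a) v) = 0 := by
    refine Finset.sum_eq_zero fun s _ => ?_
    rw [← eq_neg_iff_add_eq_zero, ← neg_smul, neg_sg]
    exact sg_smul_congr (by push_cast [OpenFrobenius.dL_deg]; clear * -; grind)
  rw [e2, zero_add]
  refine Finset.sum_congr rfl fun s _ => sg_smul_congr ?_
  push_cast [OpenFrobenius.dL_deg, E.q_deg]; clear * -; grind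

theorem coprod_bar (a : Letter 𝒜) (l : List (Letter 𝒜)) :
    splitSum (fun u v => ∑ s,
      sg k (((E.q s).deg + a.deg) * wd u + m * ((E.p s).deg + wd u)) •
        (sg k (E.p s).deg • bar F (fun u' => Φ (E.p s) u' (E.q s * a) v) u +
          sg k ((E.p s).deg + wd u - m) • sg k ((E.q s).deg + a.deg) •
            bar F (Φ (E.p s) u (E.q s * a)) v)) l =
    sg k a.deg • bar F (coprod E Φ a) l := by
  rw [coprod, bar_splitSum, ← splitSum_smul]
  refine splitSum_congr fun u v _ => ?_
  simp only [bar_sum, Finset.smul_sum, ← Finset.sum_add_distrib]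
  refine Finset.sum_congr rfl fun s _ => ?_
  rw [bar_congr_deg F (l := u)
      (sg k (((E.q s).deg + a.deg) * (wd u + 1) + m * ((E.p s).deg + (wd u + 1))))
      (G := fun u' => sg k (((E.q s).deg + a.deg) * wd u' + m * ((E.p s).deg + wd u')) •
        Φ (E.p s) u' (E.q s * a) v)
      (H := fun u' => Φ (E.p s) u' (E.q s * a) v) (fun u' h => by rw [h]), bar_smul]
  simp only [smul_add, smul_smul, ← sg_add]
  congr 1 <;> exact sg_smul_congr (by push_cast [E.q_deg]; clear * -; grind)

/-- The first face of the left factor is `e' x ⊗ e'' a`, equal up to sign to `e' ⊗ e'' a x`, the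
coproduct of the first face of the whole chain. -/
theorem coprod_head (h : ∀ u v, GBilin fun p q => Φ p u q v) (a : Letter 𝒜)
    (l : List (Letter 𝒜)) :
    splitSum (fun u v => ∑ s,
      sg k (((E.q s).deg + a.deg) * wd u + m * ((E.p s).deg + wd u)) •
        sg k (E.p s).deg • onHead (fun x u' => Φ (E.p s * x) u' (E.q s * a) v) u) l =
    sg k a.deg • onHead (fun x l' => coprod E Φ (a * x) l') l := by
  simp only [coprod]
  rw [← splitSum_onHead_left, ← splitSum_smul]
  refine splitSum_congr fun u v _ => ?_
  simp only [← onHead_smul, ← onHead_sum]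
  refine onHead_congr fun x u' e => ?_
  have := E.mul_cross ((h u' v).const_smul fun i j => sg k (j * wd u' + m * (i + wd u'))) a x
  rw [← e]
  simp only [smul_smul, Finset.smul_sum, ← sg_add, Letter.mul_deg] at this ⊢
  replace this := congrArg (sg k a.deg • ·) this
  simp only [smul_smul, Finset.smul_sum, ← sg_add] at this
  refine (Finset.sum_congr rfl fun s _ => sg_smul_congr ?_).trans
    (this.symm.trans (Finset.sum_congr rfl fun s _ => sg_smul_congr ?_)) <;>
  · push_cast [E.q_deg, wd_cons]; clear * -; grind [=_ intCast_mul_self]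

/-- For the letter `x` at the cut, the first face of the right factor is `e' ⊗ e'' a x` and the last
face of the left factor is `x e' ⊗ e'' a`. These have no counterpart in the differential of the
whole chain and must cancel each other. -/
theorem coprod_mid (h : ∀ u v, GBilin fun p q => Φ p u q v) (a : Letter 𝒜)
    (l : List (Letter 𝒜)) :
    splitSum (fun u v => ∑ s,
      sg k (((E.q s).deg + a.deg) * wd u + m * ((E.p s).deg + wd u)) •
        sg k ((E.p s).deg + wd u - m) • sg k ((E.q s).deg + a.deg) •
          onHead (fun x v' => Φ (E.p s) u (E.q s * a * x) v') v) l =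
    splitSum (fun u v => ∑ s,
      sg k (((E.q s).deg + a.deg) * wd u + m * ((E.p s).deg + wd u)) •
        onLast (fun u' x => sg k ((x.deg - 1) * ((E.p s).deg + wd u')) •
          Φ (x * E.p s) u' (E.q s * a) v) u) l := by
  simp only [← onHead_smul, ← onHead_sum, ← onLast_smul, ← onLast_sum]
  rw [splitSum_onHead_right]
  refine splitSum_congr fun u v _ => onLast_congr fun u' x e => ?_
  have := E.mul_left_cross ((h u' v).const_smul fun i j =>
    sg k (j * (wd u' + x.deg - 1) + m * (i - x.deg + wd u' + x.deg - 1) +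
      (x.deg - 1) * (i - x.deg + wd u'))) a x
  rw [← e]
  simp only [smul_smul, Finset.smul_sum, ← sg_add, Letter.mul_deg, ← mul_assoc] at this ⊢
  refine (Finset.sum_congr rfl fun s _ => sg_smul_congr ?_).trans
    (this.symm.trans (Finset.sum_congr rfl fun s _ => sg_smul_congr ?_)) <;>
  · push_cast [E.q_deg, wd_cons, wd_append, wd_nil]; clear * -; grind [=_ intCast_mul_self]

/-- The last face of the right factor has coefficient `x e'' a`, the coproduct of the last face has
`e'' x a`; `Casimir.mul_central` relates them. -/
theorem coprod_last (h : ∀ u v, GBilin fun p q => Φ p u q v) (a : Letter 𝒜)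
    (l : List (Letter 𝒜)) :
    splitSum (fun u v => ∑ s,
      sg k (((E.q s).deg + a.deg) * wd u + m * ((E.p s).deg + wd u)) •
        sg k ((E.p s).deg + wd u - m) •
          onLast (fun v' x => sg k ((x.deg - 1) * ((E.q s).deg + a.deg + wd v')) •
            Φ (E.p s) u (x * (E.q s * a)) v') v) l =
    onLast (fun l' x => sg k ((x.deg - 1) * (a.deg + wd l')) • coprod E Φ (x * a) l') l := by
  have e1 : ∀ l' x, sg k ((x.deg - 1) * (a.deg + wd l')) • coprod E Φ (x * a) l' =
      splitSum (fun u v => sg k ((x.deg - 1) * (a.deg + wd u + wd v)) • ∑ s,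
        sg k (((E.q s).deg + (x * a).deg) * wd u + m * ((E.p s).deg + wd u)) •
          Φ (E.p s) u (E.q s * (x * a)) v) l' := by
    intro l' x
    rw [coprod, ← splitSum_smul]
    refine splitSum_congr fun u v e => ?_
    rw [← e, wd_append, add_assoc]
  simp only [e1]
  rw [← splitSum_onLast_right]
  refine splitSum_congr fun u v _ => ?_
  simp only [← onLast_smul, ← onLast_sum, Finset.smul_sum]
  refine onLast_congr fun v' x e => ?_
  have := E.mul_central (((h u v').mul_right a).const_smul fun i j =>
    sg k ((j + a.deg) * wd u + m * (i + wd u) + (x.deg - 1) * (a.deg + wd u + wd v'))) x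
  simp only [smul_smul, ← sg_add, Letter.mul_deg, mul_assoc] at this ⊢
  refine (Finset.sum_congr rfl fun s _ => sg_smul_congr ?_).trans
    (this.symm.trans (Finset.sum_congr rfl fun s _ => sg_smul_congr ?_)) <;>
  · push_cast [E.q_deg, wd_cons, wd_append, wd_nil]; clear * -; grind [=_ intCast_mul_self]

/-- The chain map property of the coproduct in letters: outer faces and interior differentials
correspond to those of the whole chain, and the two faces at the cut cancel. -/
theorem cyc_coprod (h : ∀ u v, GBilin fun p q => Φ p u q v) (a : Letter 𝒜)
    (l : List (Letter 𝒜)) : cyc F (coprod E Φ) a l = coprod E (tensorDiff F Φ) a l := by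
  rw [cyc, ← coprod_d E h, ← coprod_bar, ← coprod_head E h, ← coprod_last E h]
  -- The two cancelling faces at the cut are added as a zero, after which both sides agree summand
  -- by summand.
  have e := coprod_mid E h a l
  rw [← sub_eq_zero] at e
  refine (add_zero _).symm.trans ((congrArg (_ + ·) e.symm).trans ?_)
  rw [coprod]
  simp only [← splitSum_add, ← splitSum_sub, ← Finset.sum_add_distrib, ← Finset.sum_sub_distrib]
  refine splitSum_congr fun u v _ => Finset.sum_congr rfl fun s _ => ?_
  simp only [← smul_sub, ← smul_add]
  congr 1
  rw [tensorDiff, cyc, cyc]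
  simp only [smul_add, smul_sub, Letter.mul_deg]
  abel

end Coproduct

theorem sg_one {k : Type*} [Field k] : sg k 1 = -1 := by simp [sg]

/-! ### The Hochschild differential squares to zero. -/

section Square

variable {k : Type*} [Field k] {A : Type*} [Ring A] [Algebra k A]
  {𝒜 : ℤ → Submodule k A} [GradedAlgebra 𝒜] {m : ℤ}
  {Y Z : Type*} [AddCommGroup Y] [Module k Y] [AddCommGroup Z] [Module k Z]
  {F : OpenFrobenius 𝒜 m}

theorem GLin.dL_dL {f : Letter 𝒜 → Y} (h : GLin f) (x : Letter 𝒜) : f (F.dL (F.dL x)) = 0 := by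
  -- Zero is written as `(0 : k) • 0`, so that homogeneity in the given degree makes `f` vanish on
  -- it.
  have e : F.dL (F.dL x) = ⟨x.deg + 1 + 1, (0 : k) • 0, by simp⟩ :=
    Letter.ext rfl (by simp [F.d_d])
  rw [e, h.smul _ _ _ (zero_mem _), zero_smul]

theorem bar_onHead (Φ : Letter 𝒜 → List (Letter 𝒜) → Y) (l : List (Letter 𝒜)) :
    bar F (onHead Φ) l = onHead (fun y l' => -Φ (F.dL y) l' -
      sg k y.deg • onHead (fun z l'' => Φ (y * z) l'') l' - sg k y.deg • bar F (Φ y) l') l := by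
  cases l <;> rfl

/-- Induction on the word. Terms away from the first two letters cancel by induction; those at the
front cancel by `d² = 0`, the Leibniz rule and associativity. -/
theorem bar_bar (G : List (Letter 𝒜) → Y) (h : ∀ u v, GLin fun x => G (u ++ x :: v))
    (l : List (Letter 𝒜)) : bar F (bar F G) l = 0 := by
  induction l generalizing G with
  | nil => rfl
  | cons x l ih =>
    have e1 : bar F (fun l' => bar F G (x :: l')) l = -bar F (fun l' => G (F.dL x :: l')) l -
        sg k x.deg • bar F (onHead fun y l' => G (x * y :: l')) l := by
      simp only [bar, sub_eq_add_neg, bar_add, bar_neg, bar_smul]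
      rw [ih (fun l' => G (x :: l')) fun u v => h (x :: u) v]
      simp
    have e0 : G (F.dL (F.dL x) :: l) = 0 := (h [] l).dL_dL x
    rw [bar, e1, bar_onHead, bar, e0]
    cases l with
    | nil => simp [bar]
    | cons y l =>
      have e2 : G (F.dL (x * y) :: l) = G (F.dL x * y :: l) + sg k x.deg • G (x * F.dL y :: l) :=
        (h [] l).dL_mul x y
      simp only [onHead_cons, bar, e2, OpenFrobenius.dL_deg, Letter.mul_deg, mul_assoc,
        sg_add, sg_one]
      have hx := sg_mul_self (k := k) x.deg
      match_scalars <;> grind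

theorem bar_onLast (Φ : List (Letter 𝒜) → Letter 𝒜 → Y) (l : List (Letter 𝒜)) :
    bar F (onLast Φ) l = onLast (fun u p => bar F (fun u' => Φ u' p) u -
      onLast (fun u' x => sg k (wd u' + x.deg) • Φ u' (x * p)) u -
      sg k (wd u) • Φ u (F.dL p)) l := by
  induction l using List.reverseRecOn with
  | nil => rfl
  | append_singleton u p =>
    rw [bar_append, onLast_append]
    simp only [onLast_append, bar, onHead_nil, smul_zero, sub_zero]
    rw [smul_neg, sub_eq_add_neg _ (sg k (wd u) • _)]

/-- The part of `cyc` without the last face. -/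
def cycHead (F : OpenFrobenius 𝒜 m) (Ψ : Letter 𝒜 → List (Letter 𝒜) → Y) (a : Letter 𝒜)
    (l : List (Letter 𝒜)) : Y :=
  Ψ (F.dL a) l + sg k a.deg • bar F (Ψ a) l + sg k a.deg • onHead (fun x l' => Ψ (a * x) l') l

/-- The last face of `cyc`. -/
def cycLast (Ψ : Letter 𝒜 → List (Letter 𝒜) → Y) (a : Letter 𝒜) (l : List (Letter 𝒜)) : Y :=
  onLast (fun l' x => sg k ((x.deg - 1) * (a.deg + wd l')) • Ψ (x * a) l') l

theorem cycHead_sub (Ψ Ψ' : Letter 𝒜 → List (Letter 𝒜) → Y) (a : Letter 𝒜)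
    (l : List (Letter 𝒜)) :
    cycHead F (fun a l => Ψ a l - Ψ' a l) a l = cycHead F Ψ a l - cycHead F Ψ' a l := by
  simp only [cycHead, sub_eq_add_neg, bar_add, bar_neg, onHead_add, onHead_neg, smul_add,
    smul_neg]
  abel

theorem cycLast_sub (Ψ Ψ' : Letter 𝒜 → List (Letter 𝒜) → Y) (a : Letter 𝒜)
    (l : List (Letter 𝒜)) :
    cycLast (fun a l => Ψ a l - Ψ' a l) a l = cycLast Ψ a l - cycLast Ψ' a l := by
  simp only [cycLast, sub_eq_add_neg, onLast_add, onLast_neg, smul_add, smul_neg]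

/-- Apart from the last face, the Hochschild differential of `a[l]` is minus the bar differential of
the word `a :: l`, read with its first letter as coefficient. Its square therefore vanishes with
that of `bar`. -/
theorem cycHead_eq_bar (Ψ : Letter 𝒜 → List (Letter 𝒜) → Y) (a : Letter 𝒜)
    (l : List (Letter 𝒜)) : cycHead F Ψ a l = -bar F (onHead Ψ) (a :: l) := by
  simp only [cycHead, bar, onHead_cons, neg_sub]
  abel

theorem cycHead_cycHead {Ψ : Letter 𝒜 → List (Letter 𝒜) → Y} (h : ∀ l, GLin fun a => Ψ a l)
    (h' : ∀ a u v, GLin fun x => Ψ a (u ++ x :: v)) (a : Letter 𝒜) (l : List (Letter 𝒜)) :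
    cycHead F (cycHead F Ψ) a l = 0 := by
  rw [cycHead_eq_bar, neg_eq_zero]
  refine Eq.trans ?_ ((congrArg Neg.neg (bar_bar (F := F) (onHead Ψ) ?_ (a :: l))).trans neg_zero)
  · rw [← bar_neg]
    congr 1
    funext w
    cases w with
    | nil => simp [bar]
    | cons x w => exact cycHead_eq_bar Ψ x w
  · intro u v
    cases u with
    | nil => exact h v
    | cons y u => exact h' y u v

/-- Taking the last face commutes up to sign with the other terms, with one exception: merging the
last two letters and then taking the last face gives the same as two successive last faces. -/
theorem cycHead_cycLast {Ψ : Letter 𝒜 → List (Letter 𝒜) → Y} (h : ∀ l, GLin fun a => Ψ a l)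
    (a : Letter 𝒜) (l : List (Letter 𝒜)) :
    cycHead F (cycLast Ψ) a l + cycLast (cycHead F Ψ) a l = cycLast (cycLast Ψ) a l := by
  induction l using List.reverseRecOn with
  | nil => simp [cycHead, cycLast, bar, onLast]
  | append_singleton l x =>
    have e1 : onHead (fun y l' => cycLast Ψ (a * y) l') (l ++ [x]) = onHead (fun y l' =>
        sg k ((x.deg - 1) * (a.deg + y.deg + wd l')) • Ψ (x * (a * y)) l') l := by
      cases l with
      | nil => rfl
      | cons y l =>
        simp only [List.cons_append, onHead_cons, cycLast, onLast_append, Letter.mul_deg]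
    have e2 : bar F (cycLast Ψ a) (l ++ [x]) = _ := bar_onLast _ _
    rw [onLast_append] at e2
    rw [cycHead, e1, e2]
    simp only [cycLast, onLast_append, cycHead, ((h l).dL_mul x a)]
    rw [bar_congr_deg F (l := l) (sg k ((x.deg - 1) * (a.deg + wd l + 1)))
      (H := Ψ (x * a)) (fun l' h => by rw [h, add_assoc])]
    have e3 : onHead (fun y l' => sg k ((x.deg - 1) * (a.deg + y.deg + wd l')) •
        Ψ (x * (a * y)) l') l =
        sg k ((x.deg - 1) * (a.deg + wd l + 1)) • onHead (fun y l' => Ψ (x * a * y) l') l := by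
      rw [← onHead_smul]
      refine onHead_congr fun y l' e => ?_
      rw [← e, mul_assoc]
      exact sg_smul_congr (by push_cast [wd_cons]; ring)
    -- This is the exceptional term: `(y x) a = y (x a)`.
    have e4 : onLast (fun u' y => sg k (wd u' + y.deg) • sg k (((y * x).deg - 1) *
        (a.deg + wd u')) • Ψ (y * x * a) u') l =
        -(sg k (a.deg + (x.deg - 1) * (a.deg + wd l)) • onLast (fun u' y =>
          sg k ((y.deg - 1) * ((x * a).deg + wd u')) • Ψ (y * (x * a)) u') l) := by
      rw [← onLast_smul, ← onLast_neg]
      refine onLast_congr fun u' y e => ?_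
      rw [← e, mul_assoc, smul_smul, smul_smul, ← sg_add, ← sg_add, ← neg_smul, neg_sg]
      refine sg_smul_congr ?_
      push_cast [wd_append, wd_cons, wd_nil, Letter.mul_deg]
      clear * -; grind [=_ intCast_mul_self]
    have s1 : sg k ((x.deg - 1) * ((F.dL a).deg + wd l)) =
        -sg k x.deg * sg k ((x.deg - 1) * (a.deg + wd l)) := by
      rw [neg_sg, ← sg_add]
      exact sg_congr (by push_cast [OpenFrobenius.dL_deg]; clear * -; grind)
    have s2 : sg k (((F.dL x).deg - 1) * (a.deg + wd l)) =
        sg k a.deg * sg k (wd l) * sg k ((x.deg - 1) * (a.deg + wd l)) := by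
      rw [← sg_add, ← sg_add]
      exact sg_congr (by push_cast [OpenFrobenius.dL_deg]; clear * -; grind)
    have s3 : sg k ((x.deg - 1) * (a.deg + wd l + 1)) =
        -sg k x.deg * sg k ((x.deg - 1) * (a.deg + wd l)) := by
      rw [neg_sg, ← sg_add]
      exact sg_congr (by push_cast; clear * -; grind)
    have s4 : sg k (x * a).deg = sg k x.deg * sg k a.deg := by rw [Letter.mul_deg, sg_add]
    rw [e3, e4, s1, s2, s3, s4, sg_add a.deg]
    have hx := sg_mul_self (k := k) x.deg
    have ha := sg_mul_self (k := k) a.deg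
    have hl := sg_mul_self (k := k) (wd l)
    match_scalars <;> grind

/-- For head part `h` and last face `t`, `(h - t)² = h² - (ht + th) + t²`, where `h² = 0` and `ht +
th = t²`. -/
theorem cyc_cyc {Ψ : Letter 𝒜 → List (Letter 𝒜) → Y} (h : ∀ l, GLin fun a => Ψ a l)
    (h' : ∀ a u v, GLin fun x => Ψ a (u ++ x :: v)) (a : Letter 𝒜) (l : List (Letter 𝒜)) :
    cyc F (cyc F Ψ) a l = 0 := by
  have e : ∀ Ψ : Letter 𝒜 → List (Letter 𝒜) → Y, cyc F Ψ = fun a l =>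
    cycHead F Ψ a l - cycLast Ψ a l := fun _ => rfl
  rw [e, e]
  simp only [cycHead_sub, cycLast_sub]
  rw [cycHead_cycHead h h', ← cycHead_cycLast h]
  abel

end Square

/-- Moving a letter across the cut. -/
theorem splitSum_onHead_eq_onLast {X Y : Type*} [AddCommGroup Y]
    {Φ : List X → List X → X → List X → Y} {Ψ : List X → List X → List X → X → Y} {l : List X}
    (h : ∀ u x v, u ++ x :: v = l → Φ u (x :: v) x v = Ψ (u ++ [x]) v u x) :
    splitSum (fun u v => onHead (Φ u v) v) l = splitSum (fun u v => onLast (Ψ u v) u) l := by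
  have e1 : splitSum (fun u v => onHead (Φ u v) v) l =
      splitSum (fun u v => onHead (fun x v' => Φ u (x :: v') x v') v) l :=
    splitSum_congr fun u v _ => onHead_congr fun x v' e => by rw [e]
  rw [e1, splitSum_onHead_right]
  refine splitSum_congr fun u v e => onLast_congr fun u' x e' => ?_
  rw [h _ _ _ (by rw [← e, ← e']; simp), e']

/-- Coassociativity for summands that also see the joined piece: `u ++ v` on the left, `v ++ w` on
the right. Signs usually involve the degrees of these joined pieces. -/
theorem splitSum_assoc_congr {X Y : Type*} [AddCommGroup Y]
    {Φ Ψ : List X → List X → List X → List X → Y} {l : List X}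
    (h : ∀ u v w, u ++ v ++ w = l → Φ (u ++ v) u v w = Ψ u (v ++ w) v w) :
    splitSum (fun r w => splitSum (fun u v => Φ r u v w) r) l =
      splitSum (fun u r => splitSum (Ψ u r) r) l := by
  have e1 : splitSum (fun r w => splitSum (fun u v => Φ r u v w) r) l =
      splitSum (fun r w => splitSum (fun u v => Φ (u ++ v) u v w) r) l :=
    splitSum_congr fun r w _ => splitSum_congr fun u v e => by rw [e]
  rw [e1, splitSum_assoc fun u v w => Φ (u ++ v) u v w]
  refine splitSum_congr fun u r e => splitSum_congr fun v w e' => ?_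
  rw [h _ _ _ (by rw [← e, ← e', List.append_assoc]), e']

/-! ### Rotations of cyclic words. -/

section Rotation

variable {k : Type*} [Field k] {A : Type*} [Ring A] [Algebra k A]
  {𝒜 : ℤ → Submodule k A} [GradedAlgebra 𝒜] {m : ℤ}
  {Y Z : Type*} [AddCommGroup Y] [Module k Y] [AddCommGroup Z] [Module k Z]
  {F : OpenFrobenius 𝒜 m}

/-- The signed sum of a function of words over all rotations of `a :: l`. -/
def rot (G : List (Letter 𝒜) → Y) (a : Letter 𝒜) : List (Letter 𝒜) → Y :=
  splitSum fun u v => sg k ((a.deg - 1 + wd u) * wd v) • G (v ++ a :: u)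

/-- For `a :: l` as a cyclic word, the faces of `a[l]`, the last one included, are exactly the
merges of neighbours. In each rotation these are the merges of adjacent letters, since a cut never
falls inside a merged letter. -/
theorem cyc_rot (G : List (Letter 𝒜) → Y) (a : Letter 𝒜) (l : List (Letter 𝒜)) :
    cyc F (rot G) a l = -rot (bar F G) a l := by
  have e1 : ∀ l' x, sg k ((x.deg - 1) * (a.deg + wd l')) • rot G (x * a) l' =
      splitSum (fun u v => sg k ((x.deg - 1) * (a.deg + wd u + wd v)) •
        sg k (((x * a).deg - 1 + wd u) * wd v) • G (v ++ x * a :: u)) l' := by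
    intro l' x
    rw [rot, ← splitSum_smul]
    refine splitSum_congr fun u v e => ?_
    rw [← e, wd_append, add_assoc]
  have e2 : sg k a.deg • bar F (rot G a) l = splitSum (fun u v =>
      sg k (a.deg + (a.deg + wd u) * wd v) • bar F (fun u' => G (v ++ a :: u')) u -
        sg k ((a.deg - 1 + wd u) * wd v) • bar F (fun v' => G (v' ++ a :: u)) v) l := by
    rw [rot, bar_splitSum, ← splitSum_smul]
    refine splitSum_congr fun u v _ => ?_
    rw [bar_congr_deg F (l := u) (sg k ((a.deg + wd u) * wd v))
        (H := fun u' => G (v ++ a :: u')) (fun u' h => by rw [h]; congr 3; ring),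
      bar_congr_deg F (l := v) (sg k ((a.deg - 1 + wd u) * (wd v + 1)))
        (H := fun v' => G (v' ++ a :: u)) (fun u' h => by rw [h])]
    simp only [smul_add, smul_smul, ← sg_add, sub_eq_add_neg _ (sg k _ • _), ← neg_smul, neg_sg]
    congr 1
    exact sg_smul_congr (by push_cast; clear * -; grind [=_ intCast_mul_self])
  have e3 : sg k a.deg • onHead (fun x l' => rot G (a * x) l') l = splitSum (fun u v =>
      sg k ((a.deg - 1 + wd u) * wd v + wd v + a.deg) •
        onHead (fun x u' => G (v ++ a * x :: u')) u) l := by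
    simp only [rot]
    rw [← splitSum_onHead_left, ← splitSum_smul]
    refine splitSum_congr fun u v _ => ?_
    rw [← onHead_smul, ← onHead_smul]
    refine onHead_congr fun x u' e => ?_
    rw [← e, smul_smul, ← sg_add]
    exact sg_smul_congr (by push_cast [wd_cons, Letter.mul_deg]; clear * -; grind)
  have e4 : rot G (F.dL a) l = splitSum (fun u v =>
      sg k ((a.deg - 1 + wd u) * wd v + wd v) • G (v ++ F.dL a :: u)) l :=
    splitSum_congr fun u v _ => sg_smul_congr (by
      push_cast [OpenFrobenius.dL_deg]; clear * -; grind)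
  have e5 : rot (bar F G) a l = splitSum (fun u v => sg k ((a.deg - 1 + wd u) * wd v) •
      (bar F (fun v' => G (v' ++ a :: u)) v -
      onLast (fun v' x => sg k (wd v' + x.deg) • G (v' ++ x * a :: u)) v +
      sg k (wd v) • (-G (v ++ F.dL a :: u) - sg k a.deg • onHead (fun x u' => G (v ++ a * x :: u')) u
        - sg k a.deg • bar F (fun u' => G (v ++ a :: u')) u))) l :=
    splitSum_congr fun u v _ => by rw [bar_append, bar]
  rw [cyc, e2, e3, e4, e5]
  simp only [e1]
  rw [← splitSum_onLast_right]
  simp only [← splitSum_add, ← splitSum_sub, ← splitSum_neg]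
  refine splitSum_congr fun u v _ => ?_
  -- In the rotated word the last letter of `v` stands directly before `a`, so the last face appears
  -- as an ordinary merge.
  have e6 : onLast (fun l' x => sg k ((x.deg - 1) * (a.deg + wd u + wd l')) •
      sg k (((x * a).deg - 1 + wd u) * wd l') • G (l' ++ x * a :: u)) v =
      -(sg k ((a.deg - 1 + wd u) * wd v) •
        onLast (fun v' x => sg k (wd v' + x.deg) • G (v' ++ x * a :: u)) v) := by
    rw [← onLast_smul, ← onLast_neg]
    refine onLast_congr fun v' x e => ?_
    rw [← e, smul_smul, smul_smul, ← sg_add, ← sg_add, ← neg_smul, neg_sg]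
    refine sg_smul_congr ?_
    push_cast [wd_append, wd_cons, wd_nil, Letter.mul_deg]
    clear * -; grind [=_ intCast_mul_self]
  rw [e6]
  have s1 : sg k (a.deg + (a.deg + wd u) * wd v) =
      sg k a.deg * sg k (wd v) * sg k ((a.deg - 1 + wd u) * wd v) := by
    rw [← sg_add, ← sg_add]
    exact sg_congr (by push_cast; clear * -; grind)
  rw [s1, sg_add _ a.deg, sg_add _ (wd v)]
  module

/-- Summed over all rotations, splitting off the first letter and splitting off the last letter give
the same cyclic sum. -/
theorem rot_onHead (Ψ : Letter 𝒜 → List (Letter 𝒜) → Y) (a : Letter 𝒜) (l : List (Letter 𝒜)) :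
    rot (onHead Ψ) a l = rot (onLast fun l' x => sg k ((x.deg - 1) * wd l') • Ψ x l') a l := by
  have e1 : ∀ u v : List (Letter 𝒜), onHead Ψ (v ++ a :: u) =
      onNil (Ψ a u) v + onHead (fun x v' => Ψ x (v' ++ a :: u)) v := by
    intro u v; cases v <;> simp
  have e2 : ∀ (Φ : List (Letter 𝒜) → Letter 𝒜 → Y) (u v : List (Letter 𝒜)),
      onLast Φ (v ++ a :: u) =
      onNil (Φ v a) u + onLast (fun u' x => Φ (v ++ a :: u') x) u := by
    intro Φ u v
    induction u using List.reverseRecOn with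
    | nil => simp [onLast, onLast_append]
    | append_singleton u x =>
      rw [← List.cons_append, ← List.append_assoc, onLast_append, onLast_append]
      cases u <;> simp
  have n1 : ∀ (c : ℤ) (y : Y) (u : List (Letter 𝒜)), sg k (c * wd u) • onNil y u = onNil y u := by
    intro c y u; cases u <;> simp [sg_zero]
  have n2 : ∀ (b c : ℤ) (y : Y) (u : List (Letter 𝒜)), sg k ((b + wd u) * c) •
      onNil (sg k (b * c) • y) u = onNil y u := by
    intro b c y u; cases u <;> simp [smul_smul, sg_mul_self]
  simp only [rot, e1, e2, smul_add, splitSum_add, n1, n2, splitSum_onNil_left,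
    splitSum_onNil_right]
  congr 1
  simp only [← onHead_smul, ← onLast_smul]
  refine splitSum_onHead_eq_onLast fun u' x v _ => ?_
  rw [smul_smul, ← sg_add]
  exact sg_smul_congr (by
    push_cast [wd_append, wd_cons, wd_nil]; clear * -; grind [=_ intCast_mul_self])

end Rotation

theorem GBilin.map {k : Type*} [Field k] {A : Type*} [Ring A] [Algebra k A]
    {𝒜 : ℤ → Submodule k A} [GradedAlgebra 𝒜]
    {Y Z : Type*} [AddCommGroup Y] [Module k Y] [AddCommGroup Z] [Module k Z]
    {Ψ : Letter 𝒜 → Letter 𝒜 → Y} (h : GBilin Ψ) (f : Y →ₗ[k] Z) :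
    GBilin fun x y => f (Ψ x y) :=
  ⟨fun y => (h.left y).map f, fun x => (h.right x).map f⟩

/-! ### The strict identities for the differential, Connes' operator and the coproduct. -/

section Fields

variable {k : Type*} [Field k] {A : Type*} [Ring A] [Algebra k A]
  {𝒜 : ℤ → Submodule k A} [GradedAlgebra 𝒜] {m : ℤ}
  {Y Z : Type*} [AddCommGroup Y] [Module k Y] [AddCommGroup Z] [Module k Z]
  {F : OpenFrobenius 𝒜 m}

theorem chainDiff_chainDiff : chainDiff 𝒜 F.d ∘ₗ chainDiff 𝒜 F.d = 0 := by
  refine chain_ext (𝒜 := 𝒜) fun a l => ?_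
  rw [LinearMap.comp_apply, chainDiff_chain, map_cyc]
  simp only [chainDiff_chain]
  exact cyc_cyc (fun l => GLin.chain_left l) (fun a u v => GLin.chain_word a u v) a l

/-- Normalization: the unit is zero as a letter. -/
theorem chain_one_word (a : Letter 𝒜) (u v : List (Letter 𝒜)) :
    chain a (u ++ 1 :: v) = 0 := by
  have h : Submodule.mkQ (Submodule.span k {(1 : A)}) (1 : Letter 𝒜).val = 0 :=
    (Submodule.Quotient.mk_eq_zero _).2 (Submodule.mem_span_singleton_self _)
  rw [chain, word_append, word_cons, h]
  simp

theorem connes_chain_one (l : List (Letter 𝒜)) : connes 𝒜 (chain 1 l) = 0 := by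
  rw [connes_chain]
  simp only [chain_one_word, smul_zero, splitSum_zero]

/-- A value of `B` has coefficient `1`, which a second application turns into a letter. -/
theorem connes_connes : connes 𝒜 ∘ₗ connes 𝒜 = 0 := by
  refine chain_ext (𝒜 := 𝒜) fun a l => ?_
  rw [LinearMap.comp_apply, connes_chain]
  refine (map_splitSum _ _ _).trans ?_
  simp only [map_smul, connes_chain_one, smul_zero, splitSum_zero]
  rfl

/-- With coefficient `1` the two outer faces only turn the first or the last letter into the
coefficient. -/
theorem cyc_one (l : List (Letter 𝒜)) : cyc F chain 1 l = bar F (chain 1) l + onHead chain l -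
    onLast (fun l' x => sg k ((x.deg - 1) * wd l') • chain x l') l := by
  have h : chain (F.dL (1 : Letter 𝒜)) l = 0 := by simp [chain, F.d_one]
  rw [cyc, h]
  simp [sg_zero]

theorem connes_chain' (a : Letter 𝒜) (l : List (Letter 𝒜)) :
    connes 𝒜 (chain a l) = rot (chain 1) a l := connes_chain a l

/-- In `D B` the two outer faces cancel by `rot_onHead`; what remains is the rotated bar
differential, which `cyc_rot` identifies with `-B D`. -/
theorem chainDiff_connes :
    chainDiff 𝒜 F.d ∘ₗ connes 𝒜 + connes 𝒜 ∘ₗ chainDiff 𝒜 F.d = 0 := by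
  refine chain_ext (𝒜 := 𝒜) fun a l => ?_
  rw [LinearMap.add_apply, LinearMap.comp_apply, LinearMap.comp_apply, chainDiff_chain, map_cyc]
  simp only [connes_chain', cyc_rot]
  have e : chainDiff 𝒜 F.d (rot (chain 1) a l) = rot (bar F (chain 1)) a l +
      rot (onHead chain) a l -
      rot (onLast fun l' x => sg k ((x.deg - 1) * wd l') • chain x l') a l := by
    simp only [rot, ← splitSum_add, ← splitSum_sub, ← smul_sub, ← smul_add]
    refine (map_splitSum _ _ _).trans (splitSum_congr fun u v _ => ?_)
    rw [map_smul, chainDiff_chain, cyc_one]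
  rw [e, rot_onHead]
  simp

variable (E : Casimir F)

theorem map_coprod (f : Y →ₗ[k] Z)
    (Φ : Letter 𝒜 → List (Letter 𝒜) → Letter 𝒜 → List (Letter 𝒜) → Y) (a : Letter 𝒜)
    (l : List (Letter 𝒜)) :
    f (coprod E Φ a l) = coprod E (fun p u q v => f (Φ p u q v)) a l := by
  simp only [coprod, map_splitSum, map_sum, map_smul]

theorem shiftedCoproduct_chain' (a : Letter 𝒜) (l : List (Letter 𝒜)) :
    shiftedCoproduct F (chain a l) =
      coprod E (fun p u q v => chain p u ⊗ₜ[k] chain q v) a l :=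
  shiftedCoproduct_chain E a l

theorem gbilin_chain (u v : List (Letter 𝒜)) :
    GBilin fun p q : Letter 𝒜 => chain p u ⊗ₜ[k] chain q v :=
  GBilin.tmul (GLin.chain_left u) (GLin.chain_left v)

theorem oddSum_chainDiff (p q : Letter 𝒜) (u v : List (Letter 𝒜)) :
    oddSum (shift (chainGrading 𝒜) m) (chainDiff 𝒜 F.d) (chainDiff 𝒜 F.d)
        (chain p u ⊗ₜ chain q v) =
      tensorDiff F (fun p u q v => chain p u ⊗ₜ[k] chain q v) p u q v := by
  rw [oddSum_chain, chainDiff_chain, chainDiff_chain, tensorDiff]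
  exact congrArg₂ (· + ·) (map_cyc ((TensorProduct.mk k _ _).flip (chain q v)) chain p u)
    (congrArg (_ • ·) (map_cyc (TensorProduct.mk k _ _ (chain p u)) chain q v))

/-- `cyc_coprod` applied to the tensor product of two chains. -/
theorem shiftedCoproduct_chainDiff : shiftedCoproduct F ∘ₗ chainDiff 𝒜 F.d =
    oddSum (shift (chainGrading 𝒜) m) (chainDiff 𝒜 F.d) (chainDiff 𝒜 F.d) ∘ₗ
      shiftedCoproduct F := by
  obtain ⟨E⟩ := exists_casimir F
  refine chain_ext (𝒜 := 𝒜) fun a l => ?_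
  rw [LinearMap.comp_apply, LinearMap.comp_apply, chainDiff_chain, map_cyc]
  simp only [shiftedCoproduct_chain' E]
  rw [cyc_coprod E gbilin_chain, map_coprod]
  simp only [oddSum_chainDiff]

theorem shiftedCoproduct_coassoc :
    (TensorProduct.assoc k (Chain k A) (Chain k A) (Chain k A)).toLinearMap ∘ₗ
      LinearMap.rTensor _ (shiftedCoproduct F) ∘ₗ shiftedCoproduct F =
    LinearMap.lTensor _ (shiftedCoproduct F) ∘ₗ shiftedCoproduct F := by
  obtain ⟨E⟩ := exists_casimir F
  refine chain_ext (𝒜 := 𝒜) fun a l => ?_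
  have e1 : ∀ (p : Letter 𝒜) (u) (q : Letter 𝒜) (v), (TensorProduct.assoc k (Chain k A) (Chain k A) (Chain k A)).toLinearMap
      (LinearMap.rTensor _ (shiftedCoproduct F) (chain p u ⊗ₜ chain q v)) =
      coprod E (fun p' u' q' v' => chain p' u' ⊗ₜ[k] (chain q' v' ⊗ₜ[k] chain q v)) p u := by
    intro p u q v
    rw [LinearMap.rTensor_tmul, shiftedCoproduct_chain' E]
    exact map_coprod E ((TensorProduct.assoc k (Chain k A) (Chain k A) (Chain k A)).toLinearMap ∘ₗ
      (TensorProduct.mk k (Chain k A ⊗[k] Chain k A) (Chain k A)).flip (chain q v)) _ p u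
  have e2 : ∀ (p : Letter 𝒜) (u) (q : Letter 𝒜) (v), LinearMap.lTensor _ (shiftedCoproduct F) (chain p u ⊗ₜ chain q v) =
      coprod E (fun p' u' q' v' => chain p u ⊗ₜ[k] (chain p' u' ⊗ₜ[k] chain q' v')) q v := by
    intro p u q v
    rw [LinearMap.lTensor_tmul, shiftedCoproduct_chain' E]
    exact map_coprod E (TensorProduct.mk k _ _ (chain p u)) _ q v
  rw [LinearMap.comp_apply, LinearMap.comp_apply, LinearMap.comp_apply, shiftedCoproduct_chain' E]
  rw [map_coprod]
  refine (map_coprod E ((TensorProduct.assoc k (Chain k A) (Chain k A) (Chain k A)).toLinearMap ∘ₗ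
    LinearMap.rTensor _ (shiftedCoproduct F)) _ a l).trans ?_
  simp only [LinearMap.comp_apply (TensorProduct.assoc k _ _ _).toLinearMap]
  simp only [e1, e2, coprod, ← splitSum_smul, ← splitSum_sum]
  refine splitSum_assoc_congr fun u w v _ => ?_
  simp only [Finset.smul_sum]
  rw [Finset.sum_comm]
  refine Finset.sum_congr rfl fun t _ => ?_
  -- With `t` fixed, the two iterated coproducts have the coefficients `e_t' ⊗ e_t'' e_s' ⊗ e_s'' a`
  -- and `e_t' ⊗ e_s' ⊗ e_s'' e_t'' a`; moving `c = e_t''` through the Casimir element relates them.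
  have := E.mul_left (Ψ := fun x y => sg k (((y.deg + a.deg) * (wd u + wd w) +
    m * (x.deg - (E.q t).deg + wd u + wd w)) + (((E.q t).deg + x.deg - (E.q t).deg) * wd u +
      m * ((E.p t).deg + wd u))) • (chain (E.p t) u ⊗ₜ[k] (chain x w ⊗ₜ[k] chain (y * a) v)))
    (((GBilin.tmul (GLin.chain_left w) ((GLin.chain_left v).mul_right a)).map
      (TensorProduct.mk k _ _ (chain (E.p t) u))).const_smul fun i j =>
        sg k (((j + a.deg) * (wd u + wd w) +
    m * (i - (E.q t).deg + wd u + wd w)) + (((E.q t).deg + i - (E.q t).deg) * wd u +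
      m * ((E.p t).deg + wd u)))) (E.q t)
  simp only [smul_smul, Finset.smul_sum, ← sg_add, Letter.mul_deg, mul_assoc] at this ⊢
  refine (Finset.sum_congr rfl fun s _ => sg_smul_congr ?_).trans
    (this.trans (Finset.sum_congr rfl fun s _ => sg_smul_congr ?_)) <;>
  · push_cast [E.q_deg, wd_append]; clear * -; grind [=_ intCast_mul_self]

end Fields

theorem sg_sub_one {k : Type*} [Field k] (p : ℤ) : sg k (p - 1) = -sg k p := by
  rw [neg_sg]; exact sg_congr (by push_cast; grind)

/-! ### Faces of a word with an inserted letter. -/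

section Faces

variable {k : Type*} [Field k] {A : Type*} [Ring A] [Algebra k A]
  {𝒜 : ℤ → Submodule k A} [GradedAlgebra 𝒜] {m : ℤ}
  {X Y Z : Type*} [AddCommGroup Y] [Module k Y] [AddCommGroup Z] [Module k Z]
  {F : OpenFrobenius 𝒜 m}

theorem onHead_append (Ψ : X → List X → Y) (u : List X) (p : X) (w : List X) :
    onHead Ψ (u ++ p :: w) = onNil (Ψ p w) u + onHead (fun x u' => Ψ x (u' ++ p :: w)) u := by
  cases u <;> simp

theorem onLast_append_cons (Φ : List X → X → Y) (u : List X) (p : X) (w : List X) :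
    onLast Φ (u ++ p :: w) =
      onNil (Φ u p) w + onLast (fun w' x => Φ (u ++ p :: w') x) w := by
  induction w using List.reverseRecOn with
  | nil => simp [onLast, onLast_append]
  | append_singleton w x =>
    rw [← List.cons_append, ← List.append_assoc, onLast_append, onLast_append]
    cases w <;> simp

variable (E : Casimir F)

theorem ins_congr {Φ Ψ : List (Letter 𝒜) → Letter 𝒜 → List (Letter 𝒜) → Letter 𝒜 →
      List (Letter 𝒜) → Y} {l : List (Letter 𝒜)}
    (h : ∀ u w v s, u ++ v ++ w = l → Φ u (E.p s) w (E.q s) v = Ψ u (E.p s) w (E.q s) v) :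
    ins E Φ l = ins E Ψ l :=
  splitSum_congr fun u r e => splitSum_congr fun v w e' => Finset.sum_congr rfl fun s _ => by
    rw [h _ _ _ _ (by rw [← e, ← e', List.append_assoc])]

theorem ins_add (Φ Ψ : List (Letter 𝒜) → Letter 𝒜 → List (Letter 𝒜) → Letter 𝒜 →
      List (Letter 𝒜) → Y) (l : List (Letter 𝒜)) :
    ins E (fun u p w q v => Φ u p w q v + Ψ u p w q v) l = ins E Φ l + ins E Ψ l := by
  simp only [ins, smul_add, Finset.sum_add_distrib, splitSum_add]

theorem map_ins (f : Y →ₗ[k] Z) (Φ : List (Letter 𝒜) → Letter 𝒜 → List (Letter 𝒜) → Letter 𝒜 →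
      List (Letter 𝒜) → Y) (l : List (Letter 𝒜)) :
    f (ins E Φ l) = ins E (fun u p w q v => f (Φ u p w q v)) l := by
  simp only [ins, map_splitSum, map_sum, map_smul]

theorem ins_smul (c : k) (Φ : List (Letter 𝒜) → Letter 𝒜 → List (Letter 𝒜) → Letter 𝒜 →
      List (Letter 𝒜) → Y) (l : List (Letter 𝒜)) :
    ins E (fun u p w q v => c • Φ u p w q v) l = c • ins E Φ l :=
  (map_ins E (LinearMap.lsmul k Y c) Φ l).symm

theorem ins_neg (Φ : List (Letter 𝒜) → Letter 𝒜 → List (Letter 𝒜) → Letter 𝒜 →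
      List (Letter 𝒜) → Y) (l : List (Letter 𝒜)) :
    ins E (fun u p w q v => -Φ u p w q v) l = -ins E Φ l :=
  (map_ins E (-LinearMap.id) Φ l).symm

theorem ins_sub (Φ Ψ : List (Letter 𝒜) → Letter 𝒜 → List (Letter 𝒜) → Letter 𝒜 →
      List (Letter 𝒜) → Y) (l : List (Letter 𝒜)) :
    ins E (fun u p w q v => Φ u p w q v - Ψ u p w q v) l = ins E Φ l - ins E Ψ l := by
  simp only [sub_eq_add_neg, ins_add, ins_neg]

/-- The case in which the inserted letter is the first of the word, so that a first face meets `e'`.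
-/
theorem ins_onNil_left (Φ : Letter 𝒜 → List (Letter 𝒜) → Letter 𝒜 → List (Letter 𝒜) → Y)
    (l : List (Letter 𝒜)) :
    ins E (fun u p w q v => onNil (Φ p w q v) u) l = splitSum (fun v w => ∑ s,
      sg k (m * (E.p s).deg + wd w * ((E.p s).deg + wd v)) • Φ (E.p s) w (E.q s) v) l := by
  rw [ins, ← splitSum_onNil_left (fun r => splitSum (fun v w => ∑ s,
      sg k (m * (E.p s).deg + wd w * ((E.p s).deg + wd v)) • Φ (E.p s) w (E.q s) v) r) l]
  refine splitSum_congr fun u r _ => ?_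
  cases u <;> simp [splitSum_zero]

theorem ins_onNil_right (Φ : List (Letter 𝒜) → Letter 𝒜 → Letter 𝒜 → List (Letter 𝒜) → Y)
    (l : List (Letter 𝒜)) :
    ins E (fun u p w q v => onNil (Φ u p q v) w) l = splitSum (fun u v => ∑ s,
      sg k (wd u + m * (E.p s).deg) • Φ u (E.p s) (E.q s) v) l := by
  refine splitSum_congr fun u r _ => ?_
  rw [← splitSum_onNil_right (fun v => ∑ s,
      sg k (wd u + m * (E.p s).deg) • Φ u (E.p s) (E.q s) v) r]
  refine splitSum_congr fun v w _ => ?_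
  cases w <;> simp

/-- If the first letter belongs to `u`, removing it commutes with insertion up to the sign of its
degree as a letter. -/
theorem ins_onHead (Φ : Letter 𝒜 → List (Letter 𝒜) → Letter 𝒜 → List (Letter 𝒜) → Letter 𝒜 →
      List (Letter 𝒜) → Y) (l : List (Letter 𝒜)) :
    ins E (fun u p w q v => onHead (fun x u' => Φ x u' p w q v) u) l =
      onHead (fun x l' => sg k (x.deg - 1) • ins E (Φ x) l') l := by
  simp only [ins, ← splitSum_smul]
  rw [← splitSum_onHead_left]
  refine splitSum_congr fun u r _ => ?_
  rw [← splitSum_onHead_const]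
  refine splitSum_congr fun v w _ => ?_
  simp only [← onHead_smul, ← onHead_sum, Finset.smul_sum]
  refine onHead_congr fun x u' e => Finset.sum_congr rfl fun s _ => ?_
  rw [← e, smul_smul, ← sg_add, wd_cons]
  exact sg_smul_congr (by push_cast; ring)

theorem ins_onLast (Φ : List (Letter 𝒜) → Letter 𝒜 → List (Letter 𝒜) → Letter 𝒜 → Letter 𝒜 →
      List (Letter 𝒜) → Y) (l : List (Letter 𝒜)) :
    ins E (fun u p w q v => onLast (fun w' x => Φ u p w' x q v) w) l =
      onLast (fun l' x => ins E (fun u p w q v =>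
        sg k ((x.deg - 1) * (p.deg + wd v)) • Φ u p w x q v) l') l := by
  simp only [ins]
  rw [← splitSum_onLast_right]
  refine splitSum_congr fun u r _ => ?_
  rw [← splitSum_onLast_right]
  refine splitSum_congr fun v w _ => ?_
  simp only [← onLast_smul, ← onLast_sum]
  refine onLast_congr fun w' x e => Finset.sum_congr rfl fun s _ => ?_
  rw [← e, smul_smul, ← sg_add, wd_append, wd_cons, wd_nil]
  exact sg_smul_congr (by push_cast; ring)

/-- Collects the differential of the long word and of the split-off chain into `insDiff`, the form
to which `ins_insDiff` applies. -/
theorem bar_insert (Ψ : List (Letter 𝒜) → Letter 𝒜 → List (Letter 𝒜) → Y)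
    (u w v : List (Letter 𝒜)) (p q : Letter 𝒜) :
    bar F (fun r => Ψ r q v) (u ++ p :: w) +
      sg k (wd u + p.deg - 1 + wd w + m) • cyc F (Ψ (u ++ p :: w)) q v =
    insDiff F (fun u p w q v => Ψ (u ++ p :: w) q v) u p w q v := by
  rw [bar_append, bar, insDiff, sg_sub_one, sg_add (wd u) p.deg]
  simp only [smul_sub, smul_neg, smul_smul, neg_smul]
  abel

end Faces

/-! ### The homotopy between the coproduct and its opposite. -/

section Commutativity

variable {k : Type*} [Field k] {A : Type*} [Ring A] [Algebra k A]
  {𝒜 : ℤ → Submodule k A} [GradedAlgebra 𝒜] {m : ℤ}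
  {Y Z : Type*} [AddCommGroup Y] [Module k Y] [AddCommGroup Z] [Module k Z]
  {F : OpenFrobenius 𝒜 m} (E : Casimir F)
  {Ψ : Letter 𝒜 → List (Letter 𝒜) → Letter 𝒜 → List (Letter 𝒜) → Y}

/-- `(a, l) ↦ ∑ ± Ψ a (u ++ e' :: w) e'' v` over all `u ++ v ++ w = l`. -/
def comm (E : Casimir F) (Ψ : Letter 𝒜 → List (Letter 𝒜) → Letter 𝒜 → List (Letter 𝒜) → Y)
    (a : Letter 𝒜) (l : List (Letter 𝒜)) : Y :=
  -(sg k a.deg • ins E (fun u p w q v => Ψ a (u ++ p :: w) q v) l)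

/-- The composite of `coprod` with the Koszul symmetry. -/
def coprodSwap (E : Casimir F)
    (Ψ : Letter 𝒜 → List (Letter 𝒜) → Letter 𝒜 → List (Letter 𝒜) → Y) :
    Letter 𝒜 → List (Letter 𝒜) → Y :=
  coprod E fun p u q v => sg k ((p.deg + wd u - m) * (q.deg + wd v - m)) • Ψ q v p u

/-- If the inserted letter comes first, the first face produces `a e' ⊗ e''`. `Casimir.mul_left`
turns this into `e' ⊗ e'' a`, and cocommutativity at `a` gives the swapped coproduct. -/
theorem comm_first (h : ∀ u v, GBilin fun p q => Ψ p u q v) (a : Letter 𝒜)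
    (l : List (Letter 𝒜)) :
    splitSum (fun v w => ∑ s, sg k (m * (E.p s).deg + wd w * ((E.p s).deg + wd v)) •
      Ψ (a * E.p s) w (E.q s) v) l = coprodSwap E Ψ a l := by
  refine splitSum_congr fun v w _ => ?_
  have e1 := E.mul_left ((h w v).const_smul fun i j =>
    sg k (m * (i - a.deg) + wd w * (i - a.deg + wd v))) a
  have e2 := E.symm_mul ((h w v).const_smul fun i j =>
    sg k (m * (i - a.deg) + wd w * (i - a.deg + wd v) + m * a.deg)) a
  simp only [smul_smul, Finset.smul_sum, ← sg_add, Letter.mul_deg] at e1 e2 ⊢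
  refine (Finset.sum_congr rfl fun s _ => sg_smul_congr ?_).trans
    (e1.trans ((Finset.sum_congr rfl fun s _ => sg_smul_congr ?_).trans
      (e2.trans (Finset.sum_congr rfl fun s _ => sg_smul_congr ?_)))) <;>
  · push_cast [E.q_deg, Letter.mul_deg]; clear * -; grind [=_ intCast_mul_self]

/-- If the inserted letter comes last, the last face produces `e' a ⊗ e''`, which is `e' ⊗ e'' a`,
the coproduct itself. -/
theorem comm_last (h : ∀ u v, GBilin fun p q => Ψ p u q v) (a : Letter 𝒜)
    (l : List (Letter 𝒜)) :
    splitSum (fun u v => ∑ s, sg k (wd u + m * (E.p s).deg) •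
      sg k (((E.p s).deg - 1) * (a.deg + wd u)) • Ψ (E.p s * a) u (E.q s) v) l =
    sg k a.deg • coprod E Ψ a l := by
  rw [coprod, ← splitSum_smul]
  refine splitSum_congr fun u v _ => ?_
  have := E.mul_right ((h u v).const_smul fun i j =>
    sg k (a.deg + j * wd u + m * (i + wd u))) a
  simp only [smul_smul, Finset.smul_sum, ← sg_add, Letter.mul_deg] at this ⊢
  refine (Finset.sum_congr rfl fun s _ => sg_smul_congr ?_).trans
    (this.symm.trans (Finset.sum_congr rfl fun s _ => sg_smul_congr ?_)) <;>
  · push_cast [E.q_deg, Letter.mul_deg]; clear * -; grind [=_ intCast_mul_self]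

theorem tensorDiff_insert (Ψ : Letter 𝒜 → List (Letter 𝒜) → Letter 𝒜 → List (Letter 𝒜) → Y)
    (a q : Letter 𝒜) (u v w : List (Letter 𝒜)) (p : Letter 𝒜) :
    tensorDiff F Ψ a (u ++ p :: w) q v =
      Ψ (F.dL a) (u ++ p :: w) q v +
      sg k a.deg • insDiff F (fun u p w q v => Ψ a (u ++ p :: w) q v) u p w q v +
      sg k a.deg • (onNil (Ψ (a * p) w q v) u +
        onHead (fun x u' => Ψ (a * x) (u' ++ p :: w) q v) u) -
      (onNil (sg k ((p.deg - 1) * (a.deg + wd u)) • Ψ (p * a) u q v) w +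
        onLast (fun w' x => sg k ((x.deg - 1) * (a.deg + wd (u ++ p :: w'))) •
          Ψ (x * a) (u ++ p :: w') q v) w) := by
  have e := bar_insert (F := F) (Ψ a) u w v p q
  rw [← e, tensorDiff, cyc, ← onHead_append (fun x l' => Ψ (a * x) l' q v),
    ← onLast_append_cons (fun l' x => sg k ((x.deg - 1) * (a.deg + wd l')) • Ψ (x * a) l' q v)]
  have s1 : sg k (a.deg + wd (u ++ p :: w) - m) =
      sg k a.deg * sg k (wd u + p.deg - 1 + wd w + m) := by
    rw [← sg_add]
    exact sg_congr (by push_cast [wd_append, wd_cons]; clear * -; grind)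
  rw [s1]
  module

/-- The interior terms cancel by `ins_insDiff`, and faces using a letter of the original word cancel
between the two summands. Only the two faces in which `e'` meets `a` remain. -/
theorem cyc_comm (h : ∀ u v, GBilin fun p q => Ψ p u q v)
    (h' : ∀ a u w v, GBilin fun p q => Ψ a (u ++ p :: w) q v) (a : Letter 𝒜)
    (l : List (Letter 𝒜)) :
    cyc F (comm E Ψ) a l + comm E (tensorDiff F Ψ) a l = coprod E Ψ a l - coprodSwap E Ψ a l := by
  have e0 : comm E (tensorDiff F Ψ) a l = -(sg k a.deg • ins E (fun u p w q v =>
      tensorDiff F Ψ a (u ++ p :: w) q v) l) := rfl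
  have e5 : bar F (comm E Ψ a) l =
      -(sg k a.deg • bar F (ins E fun u p w q v => Ψ a (u ++ p :: w) q v) l) := by
    rw [← bar_smul, ← bar_neg]; rfl
  simp only [tensorDiff_insert] at e0
  rw [ins_sub, ins_add, ins_add, ins_smul, ins_smul, ins_add, ins_add,
    ins_insDiff E (h' a), ins_onNil_left, ins_onNil_right, ins_onHead, ins_onLast, comm_first E h,
    comm_last E h] at e0
  have e3 : onHead (fun x l' => comm E Ψ (a * x) l') l =
      sg k a.deg • onHead (fun x l' => sg k (x.deg - 1) • ins E (fun u p w q v =>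
        Ψ (a * x) (u ++ p :: w) q v) l') l := by
    rw [← onHead_smul]
    refine onHead_congr fun x l' _ => ?_
    rw [comm, Letter.mul_deg, sg_add, sg_sub_one]
    module
  -- Taking a last face before inserting agrees up to sign with inserting to the left of that letter
  -- and taking the last face afterwards.
  have e4 : onLast (fun l' x => sg k ((x.deg - 1) * (a.deg + wd l')) • comm E Ψ (x * a) l') l =
      sg k a.deg • onLast (fun l' x => ins E (fun u p w q v =>
        sg k ((x.deg - 1) * (p.deg + wd v)) • sg k ((x.deg - 1) * (a.deg + wd (u ++ p :: w))) •
          Ψ (x * a) (u ++ p :: w) q v) l') l := by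
    rw [← onLast_smul]
    refine onLast_congr fun l' x _ => ?_
    rw [comm, ← ins_smul, ← ins_neg, ← ins_smul, ← ins_smul]
    refine ins_congr E fun u w v s e => ?_
    rw [← e]
    simp only [smul_smul, ← neg_smul, ← sg_add, neg_sg]
    refine sg_smul_congr ?_
    push_cast [wd_append, wd_cons, Letter.mul_deg]
    clear * -; grind
  have ha := sg_mul_self (k := k) a.deg
  rw [cyc, e0, e5, e3, e4, comm, OpenFrobenius.dL_deg, sg_add, sg_one]
  simp only [smul_add, smul_sub, smul_neg, neg_smul, smul_smul, mul_neg, mul_one, ha,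
    one_smul, neg_sub]
  abel

theorem map_comm (f : Y →ₗ[k] Z)
    (Ψ : Letter 𝒜 → List (Letter 𝒜) → Letter 𝒜 → List (Letter 𝒜) → Y) (a : Letter 𝒜)
    (l : List (Letter 𝒜)) :
    f (comm E Ψ a l) = comm E (fun p u q v => f (Ψ p u q v)) a l := by
  rw [comm, map_neg, map_smul, map_ins]; rfl

theorem commHomotopy_chain' (a : Letter 𝒜) (l : List (Letter 𝒜)) :
    commHomotopy E (chain a l) = comm E (fun p u q v => chain p u ⊗ₜ[k] chain q v) a l :=
  commHomotopy_chain E a l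

theorem koszul_shiftedCoproduct_chain (a : Letter 𝒜) (l : List (Letter 𝒜)) :
    koszul (shift (chainGrading 𝒜) m) (shift (chainGrading 𝒜) m) (shiftedCoproduct F (chain a l)) =
      coprodSwap E (fun p u q v => chain p u ⊗ₜ[k] chain q v) a l := by
  rw [shiftedCoproduct_chain' E, map_coprod]
  simp only [koszul_chain]
  rfl

theorem commHomotopy_chainDiff :
    commHomotopy E ∘ₗ chainDiff 𝒜 F.d +
      oddSum (shift (chainGrading 𝒜) m) (chainDiff 𝒜 F.d) (chainDiff 𝒜 F.d) ∘ₗ commHomotopy E =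
    shiftedCoproduct F - koszul (shift (chainGrading 𝒜) m) (shift (chainGrading 𝒜) m) ∘ₗ
      shiftedCoproduct F := by
  refine chain_ext (𝒜 := 𝒜) fun a l => ?_
  have e1 := map_cyc (F := F) (commHomotopy E) chain a l
  have e2 := map_comm E (oddSum (shift (chainGrading 𝒜) m) (chainDiff 𝒜 F.d) (chainDiff 𝒜 F.d))
    (fun p u q v => chain p u ⊗ₜ[k] chain q v) a l
  simp only [commHomotopy_chain'] at e1
  simp only [oddSum_chainDiff] at e2
  rw [LinearMap.add_apply, LinearMap.sub_apply, LinearMap.comp_apply, LinearMap.comp_apply,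
    LinearMap.comp_apply, chainDiff_chain, e1, commHomotopy_chain', e2,
    koszul_shiftedCoproduct_chain E, shiftedCoproduct_chain' E]
  exact cyc_comm E gbilin_chain
    (fun a u w v => GBilin.tmul (GLin.chain_word a u w) (GLin.chain_left v)) a l

end Commutativity

/-! ### Inserting behind the coefficient in a rotated word. -/

section Rotation

variable {k : Type*} [Field k] {A : Type*} [Ring A] [Algebra k A]
  {𝒜 : ℤ → Submodule k A} [GradedAlgebra 𝒜] {m : ℤ}
  {Y Z : Type*} [AddCommGroup Y] [Module k Y] [AddCommGroup Z] [Module k Z]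
  {F : OpenFrobenius 𝒜 m}

/-- The sum of `± T y a r` over all `r ++ y = l`. -/
def twistedRot (T : List (Letter 𝒜) → Letter 𝒜 → List (Letter 𝒜) → Y) (a : Letter 𝒜) :
    List (Letter 𝒜) → Y :=
  splitSum fun r y => sg k (wd y * (a.deg + wd r) + a.deg) • T y a r

/-- The differential of a function of a word `y ++ a :: r`. -/
def wordDiff (F : OpenFrobenius 𝒜 m) (T : List (Letter 𝒜) → Letter 𝒜 → List (Letter 𝒜) → Y)
    (y : List (Letter 𝒜)) (a : Letter 𝒜) (r : List (Letter 𝒜)) : Y :=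
  bar F (fun y' => T y' a r) y - onLast (fun y' x => sg k (wd y' + x.deg) • T y' (x * a) r) y -
    sg k (wd y) • T y (F.dL a) r +
    sg k (wd y + a.deg) • onHead (fun x r' => sg k x.deg • T y (a * x) r') r +
    sg k (wd y + a.deg) • bar F (T y a) r

/-- The analogue of `cyc_rot` for a function that remembers the position of `a` in the rotated word;
the signs are those needed when an odd insertion follows `a`. -/
theorem cyc_twistedRot (T : List (Letter 𝒜) → Letter 𝒜 → List (Letter 𝒜) → Y) (a : Letter 𝒜)
    (l : List (Letter 𝒜)) : cyc F (twistedRot T) a l = twistedRot (wordDiff F T) a l := by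
  have e1 : ∀ l' x, sg k ((x.deg - 1) * (a.deg + wd l')) • twistedRot T (x * a) l' =
      splitSum (fun r y => sg k ((x.deg - 1) * (a.deg + wd r + wd y)) •
        sg k (wd y * ((x * a).deg + wd r) + (x * a).deg) • T y (x * a) r) l' := by
    intro l' x
    rw [twistedRot, ← splitSum_smul]
    refine splitSum_congr fun u v e => ?_
    rw [← e, wd_append, add_assoc]
  have e2 : sg k a.deg • bar F (twistedRot T a) l = splitSum (fun r y =>
      sg k (wd y * (a.deg + wd r) + wd y) • bar F (T y a) r +
        sg k (wd y * (a.deg + wd r) + a.deg) • bar F (fun y' => T y' a r) y) l := by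
    unfold twistedRot
    rw [bar_splitSum, ← splitSum_smul]
    refine splitSum_congr fun r y _ => ?_
    rw [bar_congr_deg F (l := r) (sg k (wd y * (a.deg + (wd r + 1)) + a.deg))
        (H := T y a) (fun u' h => by rw [h]),
      bar_congr_deg F (l := y) (sg k ((wd y + 1) * (a.deg + wd r) + a.deg))
        (H := fun y' => T y' a r) (fun u' h => by rw [h])]
    simp only [smul_add, smul_smul, ← sg_add]
    congr 1 <;>
    exact sg_smul_congr (by push_cast; clear * -; grind [=_ intCast_mul_self])
  have e3 : sg k a.deg • onHead (fun x l' => twistedRot T (a * x) l') l = splitSum (fun r y =>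
      sg k (wd y * (a.deg + wd r) + wd y) • onHead (fun x r' => sg k x.deg • T y (a * x) r') r)
        l := by
    simp only [twistedRot]
    rw [← splitSum_onHead_left, ← splitSum_smul]
    refine splitSum_congr fun u v _ => ?_
    rw [← onHead_smul, ← onHead_smul]
    refine onHead_congr fun x u' e => ?_
    rw [← e, smul_smul, smul_smul, ← sg_add, ← sg_add]
    exact sg_smul_congr (by push_cast [wd_cons, Letter.mul_deg]; clear * -; grind)
  have e4 : twistedRot T (F.dL a) l = splitSum (fun r y =>
      -(sg k (wd y * (a.deg + wd r) + a.deg + wd y) • T y (F.dL a) r)) l :=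
    splitSum_congr fun u v _ => by
      rw [← neg_smul, neg_sg]
      exact sg_smul_congr (by push_cast [OpenFrobenius.dL_deg]; clear * -; grind)
  rw [cyc, e2, e3, e4]
  simp only [e1]
  rw [← splitSum_onLast_right]
  conv_rhs => unfold twistedRot
  simp only [← splitSum_add, ← splitSum_sub]
  refine splitSum_congr fun r y _ => ?_
  have e6 : onLast (fun l' x => sg k ((x.deg - 1) * (a.deg + wd r + wd l')) •
      sg k (wd l' * ((x * a).deg + wd r) + (x * a).deg) • T l' (x * a) r) y =
      sg k (wd y * (a.deg + wd r) + a.deg) •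
        onLast (fun y' x => sg k (wd y' + x.deg) • T y' (x * a) r) y := by
    rw [← onLast_smul]
    refine onLast_congr fun v' x e => ?_
    rw [← e, smul_smul, smul_smul, ← sg_add, ← sg_add]
    refine sg_smul_congr ?_
    push_cast [wd_append, wd_cons, wd_nil, Letter.mul_deg]
    clear * -; grind [=_ intCast_mul_self]
  rw [e6, wordDiff]
  have s1 : sg k (wd y * (a.deg + wd r) + wd y) =
      sg k (wd y * (a.deg + wd r) + a.deg) * sg k (wd y + a.deg) := by
    rw [← sg_add]
    exact sg_congr (by push_cast; clear * -; grind)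
  rw [s1, sg_add _ (wd y)]
  module

variable (E : Casimir F)

theorem bar_ins_comm (Φ : List (Letter 𝒜) → List (Letter 𝒜) → Letter 𝒜 → List (Letter 𝒜) →
      Letter 𝒜 → List (Letter 𝒜) → Y) (y r : List (Letter 𝒜)) :
    ins E (fun u p w q v => bar F (fun y' => Φ y' u p w q v) y) r =
      bar F (fun y' => ins E (Φ y') r) y := by
  simp only [ins, bar_splitSum_comm, bar_sum, bar_smul]

theorem ins_zero (l : List (Letter 𝒜)) : ins E (fun _ _ _ _ _ => (0 : Y)) l = 0 := by
  simp only [ins, smul_zero, Finset.sum_const_zero, splitSum_zero]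

theorem onLast_ins_comm (Φ : List (Letter 𝒜) → Letter 𝒜 → List (Letter 𝒜) → Letter 𝒜 →
      List (Letter 𝒜) → Letter 𝒜 → List (Letter 𝒜) → Y) (y r : List (Letter 𝒜)) :
    ins E (fun u p w q v => onLast (fun y' x => Φ y' x u p w q v) y) r =
      onLast (fun y' x => ins E (Φ y' x) r) y := by
  induction y using List.reverseRecOn with
  | nil => simp [onLast, ins_zero]
  | append_singleton y x => simp only [onLast_append]

theorem onHead_ins_comm (Φ : Letter 𝒜 → List (Letter 𝒜) → List (Letter 𝒜) → Letter 𝒜 →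
      List (Letter 𝒜) → Letter 𝒜 → List (Letter 𝒜) → Y) (y r : List (Letter 𝒜)) :
    ins E (fun u p w q v => onHead (fun x y' => Φ x y' u p w q v) y) r =
      onHead (fun x y' => ins E (Φ x y') r) y := by
  cases y with
  | nil => simp [ins_zero]
  | cons x y => simp only [onHead_cons]

/-- `G (y ++ a :: (u ++ e' :: w)) e'' v`, summed over all `u ++ v ++ w = r`. -/
def insAfter (G : List (Letter 𝒜) → Letter 𝒜 → List (Letter 𝒜) → Y) (y : List (Letter 𝒜))
    (a : Letter 𝒜) (r : List (Letter 𝒜)) : Y :=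
  ins E (fun u p w q v => G (y ++ a :: (u ++ p :: w)) q v) r

/-- The differential of a function of a word and a chain. -/
def wordTensorDiff (F : OpenFrobenius 𝒜 m)
    (G : List (Letter 𝒜) → Letter 𝒜 → List (Letter 𝒜) → Y) (l : List (Letter 𝒜)) (q : Letter 𝒜)
    (v : List (Letter 𝒜)) : Y :=
  bar F (fun l' => G l' q v) l + sg k (wd l - m) • cyc F (G l) q v

theorem wordTensorDiff_insert (G : List (Letter 𝒜) → Letter 𝒜 → List (Letter 𝒜) → Y)
    (y u w v : List (Letter 𝒜)) (a p q : Letter 𝒜) :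
    wordTensorDiff F G (y ++ a :: (u ++ p :: w)) q v =
      bar F (fun y' => G (y' ++ a :: (u ++ p :: w)) q v) y -
      onLast (fun y' x => sg k (wd y' + x.deg) • G (y' ++ x * a :: (u ++ p :: w)) q v) y -
      sg k (wd y) • G (y ++ F.dL a :: (u ++ p :: w)) q v -
      sg k (wd y + a.deg) • (onNil (G (y ++ a * p :: w) q v) u +
        onHead (fun x u' => G (y ++ a * x :: (u' ++ p :: w)) q v) u) -
      sg k (wd y + a.deg) • insDiff F (fun u p w q v => G (y ++ a :: (u ++ p :: w)) q v) u p w q v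
      := by
  have e := bar_insert (F := F) (fun z => G (y ++ a :: z)) u w v p q
  rw [← e, wordTensorDiff, bar_append, bar,
    ← onHead_append (fun x l' => G (y ++ a * x :: l') q v)]
  have s1 : sg k (wd (y ++ a :: (u ++ p :: w)) - m) =
      -(sg k (wd y + a.deg) * sg k (wd u + p.deg - 1 + wd w + m)) := by
    rw [neg_eq_neg_one_mul, ← sg_one, ← sg_add, ← sg_add]
    exact sg_congr (by push_cast [wd_append, wd_cons]; clear * -; grind)
  rw [s1, sg_add (wd y)]
  module

/-- The terms of the differential in which the inserted letter is multiplied into the letter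
before it. -/
def insJunction (G : List (Letter 𝒜) → Letter 𝒜 → List (Letter 𝒜) → Y) (y : List (Letter 𝒜))
    (a : Letter 𝒜) : List (Letter 𝒜) → Y :=
  splitSum fun v w => ∑ s, sg k (m * (E.p s).deg + wd w * ((E.p s).deg + wd v)) •
    G (y ++ a * E.p s :: w) (E.q s) v

/-- Insertion takes place only to the right of `a`. All seams cancel as before, except that the
product `a e'`, with the inserted letter directly behind `a`, has no partner. -/
theorem insAfter_wordTensorDiff {G : List (Letter 𝒜) → Letter 𝒜 → List (Letter 𝒜) → Y}
    (h : ∀ y u v, GBilin fun p q => G (y ++ p :: u) q v) (y : List (Letter 𝒜)) (a : Letter 𝒜)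
    (r : List (Letter 𝒜)) :
    insAfter E (wordTensorDiff F G) y a r = wordDiff F (insAfter E G) y a r -
      sg k (wd y + a.deg) • insJunction E G y a r := by
  have h' : ∀ u w v, GBilin fun p q => G (y ++ a :: (u ++ p :: w)) q v := fun u w v => by
    have := h (y ++ a :: u) w v
    simpa only [List.append_assoc, List.cons_append] using this
  unfold insAfter
  simp only [wordTensorDiff_insert]
  rw [ins_sub, ins_sub, ins_sub, ins_sub, ins_smul, ins_smul, ins_smul, ins_add, ins_insDiff E h',
    ins_onNil_left, ins_onHead, bar_ins_comm, onLast_ins_comm]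
  simp only [ins_smul]
  have e : onHead (fun x r' => sg k x.deg •
        ins E (fun u p w q v => G (y ++ a * x :: (u ++ p :: w)) q v) r') r =
      -onHead (fun x r' => sg k (x.deg - 1) •
        ins E (fun u p w q v => G (y ++ a * x :: (u ++ p :: w)) q v) r') r := by
    rw [← onHead_neg]
    exact onHead_congr fun x r' _ => by rw [sg_sub_one]; module
  rw [wordDiff, e, insJunction]
  module

theorem twistedRot_sub (T T' : List (Letter 𝒜) → Letter 𝒜 → List (Letter 𝒜) → Y) (a : Letter 𝒜)
    (l : List (Letter 𝒜)) : twistedRot (fun y a r => T y a r - T' y a r) a l =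
      twistedRot T a l - twistedRot T' a l := by
  simp only [twistedRot, smul_sub, splitSum_sub]

theorem twistedRot_add (T T' : List (Letter 𝒜) → Letter 𝒜 → List (Letter 𝒜) → Y) (a : Letter 𝒜)
    (l : List (Letter 𝒜)) : twistedRot (fun y a r => T y a r + T' y a r) a l =
      twistedRot T a l + twistedRot T' a l := by
  simp only [twistedRot, smul_add, splitSum_add]

/-- The unpaired products `a e'`, summed over rotations, are a coproduct with swapped factors whose
left factor is then rotated: in letters, the term `(B ⊗ 1) τ θ`. -/
theorem twistedRot_insJunction {G : List (Letter 𝒜) → Letter 𝒜 → List (Letter 𝒜) → Y}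
    (h : ∀ y u v, GBilin fun p q => G (y ++ p :: u) q v) (a : Letter 𝒜) (l : List (Letter 𝒜)) :
    twistedRot (fun y a r => sg k (wd y + a.deg) • insJunction E G y a r) a l =
      coprodSwap E (fun p u q v => rot (fun l' => G l' q v) p u) a l := by
  have hb : ∀ u v, GBilin fun p q => rot (fun l' => G l' q v) p u := fun u v =>
    ⟨fun q => GLin.splitSum (fun u' v' => ((h v' u' v).left q).const_smul
        fun i => sg k ((i - 1 + wd u') * wd v')) u,
      fun p => GLin.splitSum (fun u' v' => ((h v' u' v).right p).const_smul
        fun _ => sg k ((p.deg - 1 + wd u') * wd v')) u⟩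
  refine Eq.trans ?_ (comm_first E hb a l)
  simp only [twistedRot, insJunction, rot, ← splitSum_smul, ← splitSum_sum]
  refine splitSum_assoc_congr fun u v w _ => ?_
  simp only [Finset.smul_sum, smul_smul, ← sg_add]
  refine Finset.sum_congr rfl fun s _ => sg_smul_congr ?_
  push_cast [wd_append, Letter.mul_deg]
  clear * -; grind [=_ intCast_mul_self]

end Rotation

/-! ### The coproduct of a rotated chain. -/

section Rotation

variable {k : Type*} [Field k] {A : Type*} [Ring A] [Algebra k A]
  {𝒜 : ℤ → Submodule k A} [GradedAlgebra 𝒜] {m : ℤ}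
  {Y Z : Type*} [AddCommGroup Y] [Module k Y] [AddCommGroup Z] [Module k Z]
  {F : OpenFrobenius 𝒜 m} (E : Casimir F)
  {Ψ : Letter 𝒜 → List (Letter 𝒜) → Letter 𝒜 → List (Letter 𝒜) → Y}

/-- The terms of `θ B` in which `a` lies in the left factor. -/
def coprodRot (E : Casimir F) (Ψ : Letter 𝒜 → List (Letter 𝒜) → Letter 𝒜 → List (Letter 𝒜) → Y)
    (a : Letter 𝒜) : List (Letter 𝒜) → Y :=
  splitSum fun r y => splitSum (fun u v => ∑ s, sg k ((a.deg - 1 + wd r) * wd y +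
    (E.q s).deg * (wd y + a.deg - 1 + wd u) + m * ((E.p s).deg + wd y + a.deg - 1 + wd u)) •
      Ψ (E.p s) (y ++ a :: u) (E.q s) v) r

/-- The cut of the rotated word falls behind `a` or in front of it. The second case is the mirror
image of the first by symmetry of the Casimir element. -/
theorem rot_coprod (h : ∀ u v, GBilin fun p q => Ψ p u q v) (a : Letter 𝒜)
    (l : List (Letter 𝒜)) :
    rot (coprod E Ψ 1) a l = coprodRot E Ψ a l +
      coprodRot E (fun p u q v => sg k ((p.deg + wd u - m) * (q.deg + wd v - m)) • Ψ q v p u)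
        a l := by
  have e : ∀ u v : List (Letter 𝒜), coprod E Ψ 1 (v ++ a :: u) =
      splitSum (fun v₁ v₂ => ∑ s, sg k ((E.q s).deg * wd v₁ + m * ((E.p s).deg + wd v₁)) •
        Ψ (E.p s) v₁ (E.q s) (v₂ ++ a :: u)) v +
      splitSum (fun u₁ u₂ => ∑ s, sg k ((E.q s).deg * (wd v + a.deg - 1 + wd u₁) +
        m * ((E.p s).deg + wd v + a.deg - 1 + wd u₁)) • Ψ (E.p s) (v ++ a :: u₁) (E.q s) u₂) u := by
    intro u v
    rw [coprod, splitSum_append]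
    simp only [mul_one, Letter.one_deg, add_zero, wd_append, wd_cons]
    congr 1
    refine splitSum_congr fun u₁ u₂ _ => Finset.sum_congr rfl fun s _ => ?_
    exact sg_smul_congr (by push_cast; ring)
  unfold rot
  simp only [e, smul_add, splitSum_add]
  rw [add_comm]
  congr 1
  · simp only [coprodRot, ← splitSum_smul, Finset.smul_sum, smul_smul, ← sg_add]
    refine splitSum_congr fun u v _ => splitSum_congr fun u₁ u₂ _ =>
      Finset.sum_congr rfl fun s _ => sg_smul_congr ?_
    push_cast; ring
  · simp only [coprodRot, ← splitSum_smul]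
    refine (splitSum_assoc_congr fun u v y _ => ?_).symm
    have := E.symm ((h v (y ++ a :: u)).const_smul fun i j =>
      sg k ((a.deg - 1 + wd u) * (wd v + wd y) + j * wd v + m * (i + wd v)))
    simp only [smul_smul, Finset.smul_sum, ← sg_add] at this ⊢
    refine (Finset.sum_congr rfl fun s _ => sg_smul_congr ?_).trans
      (this.symm.trans (Finset.sum_congr rfl fun s _ => sg_smul_congr ?_)) <;>
    · push_cast [E.q_deg, wd_append, wd_cons]; clear * -; grind [=_ intCast_mul_self]

/-- `(a, l) ↦ ∑ ± G (y ++ a :: (u ++ e' :: w)) e'' v` over all `u ++ v ++ w ++ y = l`. -/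
def rotIns (E : Casimir F) (G : List (Letter 𝒜) → Letter 𝒜 → List (Letter 𝒜) → Y) :
    Letter 𝒜 → List (Letter 𝒜) → Y :=
  twistedRot (insAfter E G)

theorem cyc_rotIns {G : List (Letter 𝒜) → Letter 𝒜 → List (Letter 𝒜) → Y}
    (h : ∀ y u v, GBilin fun p q => G (y ++ p :: u) q v) (a : Letter 𝒜) (l : List (Letter 𝒜)) :
    rotIns E (wordTensorDiff F G) a l = cyc F (rotIns E G) a l -
      coprodSwap E (fun p u q v => rot (fun l' => G l' q v) p u) a l := by
  rw [rotIns, rotIns, cyc_twistedRot, ← twistedRot_insJunction E h, ← twistedRot_sub]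
  exact splitSum_congr fun r y _ => by rw [insAfter_wordTensorDiff E h]

/-- The first letter of `y ++ a :: ⋯` is `a` when `y` is empty, which returns the insertion for
cocommutativity; otherwise it is a letter of `y`. -/
theorem rotIns_onHead (Ψ : Letter 𝒜 → List (Letter 𝒜) → Letter 𝒜 → List (Letter 𝒜) → Y)
    (a : Letter 𝒜) (l : List (Letter 𝒜)) :
    rotIns E (fun l' q v => onHead (fun x l'' => Ψ x l'' q v) l') a l =
      -comm E Ψ a l + splitSum (fun r y => onHead (fun x y' =>
        sg k (wd y * (a.deg + wd r) + a.deg) • insAfter E (Ψ x) y' a r) y) l := by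
  have e : ∀ y r, insAfter E (fun l' q v => onHead (fun x l'' => Ψ x l'' q v) l') y a r =
      onNil (ins E (fun u p w q v => Ψ a (u ++ p :: w) q v) r) y +
        onHead (fun x y' => insAfter E (Ψ x) y' a r) y := by
    intro y r
    cases y with
    | nil => simp [insAfter]
    | cons x y => simp [insAfter]
  rw [rotIns, twistedRot]
  simp only [e, smul_add, splitSum_add, ← onHead_smul]
  congr 1
  rw [comm, neg_neg, ← splitSum_onNil_right (ins E fun u p w q v => Ψ a (u ++ p :: w) q v) l,
    ← splitSum_smul]
  refine splitSum_congr fun r y _ => ?_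
  cases y <;> simp

/-- The last letter is `e'` when nothing follows the insertion, and making it the coefficient gives
the terms of the coproduct with `a` on the left. Otherwise it is the last letter of `r`. -/
theorem rotIns_onLast (Ψ : Letter 𝒜 → List (Letter 𝒜) → Letter 𝒜 → List (Letter 𝒜) → Y) (a : Letter 𝒜)
    (l : List (Letter 𝒜)) :
    rotIns E (fun l' q v => onLast (fun l'' x => sg k ((x.deg - 1) * wd l'') • Ψ x l'' q v) l')
        a l =
      -coprodRot E Ψ a l + splitSum (fun r y => onLast (fun r' x =>
        sg k (wd y * (a.deg + wd r) + a.deg) • sg k ((x.deg - 1) * (wd r' + wd y + a.deg)) •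
          insAfter E (Ψ x) y a r') r) l := by
  have e : ∀ y r, insAfter E
      (fun l' q v => onLast (fun l'' x => sg k ((x.deg - 1) * wd l'') • Ψ x l'' q v) l') y a r =
      splitSum (fun u v => ∑ s, sg k (wd u + m * (E.p s).deg) •
        sg k (((E.p s).deg - 1) * wd (y ++ a :: u)) • Ψ (E.p s) (y ++ a :: u) (E.q s) v) r +
      onLast (fun r' x => sg k ((x.deg - 1) * (wd r' + wd y + a.deg)) •
        insAfter E (Ψ x) y a r') r := by
    intro y r
    have e1 : ∀ u w v p q, onLast (fun l'' x => sg k ((x.deg - 1) * wd l'') • Ψ x l'' q v)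
        (y ++ a :: (u ++ p :: w)) =
        onNil (sg k ((p.deg - 1) * wd (y ++ a :: u)) • Ψ p (y ++ a :: u) q v) w +
        onLast (fun w' x => sg k ((x.deg - 1) * wd (y ++ a :: (u ++ p :: w'))) •
          Ψ x (y ++ a :: (u ++ p :: w')) q v) w := by
      intro u w v p q
      have := onLast_append_cons (fun l'' x => sg k ((x.deg - 1) * wd l'') • Ψ x l'' q v)
        (y ++ a :: u) p w
      simpa only [List.append_assoc, List.cons_append] using this
    unfold insAfter
    simp only [e1]
    rw [ins_add, ins_onNil_right, ins_onLast]
    congr 1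
    refine onLast_congr fun r' x _ => ?_
    rw [← ins_smul]
    refine ins_congr E fun u w v s e => ?_
    rw [smul_smul, ← sg_add, ← e]
    exact sg_smul_congr (by push_cast [wd_append, wd_cons]; clear * -; grind)
  rw [rotIns, twistedRot]
  simp only [e, smul_add, splitSum_add, ← onLast_smul]
  congr 1
  rw [coprodRot, ← splitSum_neg]
  refine splitSum_congr fun r y _ => ?_
  rw [← splitSum_neg, ← splitSum_smul]
  refine splitSum_congr fun u v e => ?_
  rw [← Finset.sum_neg_distrib, Finset.smul_sum]
  refine Finset.sum_congr rfl fun s _ => ?_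
  rw [smul_smul, smul_smul, ← sg_add, ← sg_add, ← neg_smul, neg_sg, ← e]
  refine sg_smul_congr ?_
  push_cast [E.q_deg, wd_append, wd_cons]
  clear * -; grind [=_ intCast_mul_self]

theorem tensorDiff_one (hd : ∀ u q v, Ψ (F.dL 1) u q v = 0) (l : List (Letter 𝒜)) (q : Letter 𝒜)
    (v : List (Letter 𝒜)) :
    tensorDiff F Ψ 1 l q v = wordTensorDiff F (Ψ 1) l q v +
      onHead (fun x l' => Ψ x l' q v) l -
      onLast (fun l' x => sg k ((x.deg - 1) * wd l') • Ψ x l' q v) l := by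
  rw [tensorDiff, cyc, wordTensorDiff, hd]
  simp only [Letter.one_deg, sg_zero, one_smul, one_mul, mul_one, zero_add]
  abel

/-- The commutator of the rotated insertion with the differential. With coefficient `1` the outer
faces only promote letters to coefficients: promoting `e'` gives `coprodRot`, promoting `a` gives
`comm`, and the unpaired product `a e'` gives the rotated term. -/
theorem rotIns_tensorDiff
    (h' : ∀ a u w v, GBilin fun p q => Ψ a (u ++ p :: w) q v)
    (hd : ∀ u q v, Ψ (F.dL 1) u q v = 0) (a : Letter 𝒜) (l : List (Letter 𝒜)) :
    rotIns E (tensorDiff F Ψ 1) a l - cyc F (rotIns E (Ψ 1)) a l =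
      coprodRot E Ψ a l - comm E Ψ a l -
        coprodSwap E (fun p u q v => rot (fun l' => Ψ 1 l' q v) p u) a l := by
  have e : rotIns E (tensorDiff F Ψ 1) a l = rotIns E (wordTensorDiff F (Ψ 1)) a l +
      rotIns E (fun l' q v => onHead (fun x l'' => Ψ x l'' q v) l') a l -
      rotIns E (fun l' q v => onLast (fun l'' x => sg k ((x.deg - 1) * wd l'') • Ψ x l'' q v) l')
        a l := by
    simp only [rotIns, ← twistedRot_add, ← twistedRot_sub, insAfter, ← ins_add, ← ins_sub,
      ← tensorDiff_one hd]
    rfl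
  -- The remaining outer faces cancel: the letter next to the cut between `r` and `y` is the first
  -- of the rotated word or the last, according to the side on which it lies.
  have e' : splitSum (fun r y => onHead (fun x y' =>
        sg k (wd y * (a.deg + wd r) + a.deg) • insAfter E (Ψ x) y' a r) y) l =
      splitSum (fun r y => onLast (fun r' x =>
        sg k (wd y * (a.deg + wd r) + a.deg) • sg k ((x.deg - 1) * (wd r' + wd y + a.deg)) •
          insAfter E (Ψ x) y a r') r) l := by
    refine splitSum_onHead_eq_onLast fun r x y _ => ?_
    rw [smul_smul, ← sg_add]
    exact sg_smul_congr (by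
      push_cast [wd_append, wd_cons, wd_nil]; clear * -; grind [=_ intCast_mul_self])
  rw [e, cyc_rotIns E (h' 1), rotIns_onHead, rotIns_onLast, e']
  abel

end Rotation

theorem splitSum_assoc₄ {X Y : Type*} [AddCommGroup Y]
    (Φ : List X → List X → List X → List X → Y) (l : List X) :
    splitSum (fun r x => splitSum (fun u r' => splitSum (fun v w => Φ u v w x) r') r) l =
      splitSum (fun u r => splitSum (fun v r' => splitSum (fun w x => Φ u v w x) r') r) l := by
  rw [splitSum_assoc fun u r' x => splitSum (fun v w => Φ u v w x) r']
  exact splitSum_congr fun u r _ => splitSum_assoc (fun v w x => Φ u v w x) r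

/-! ### The strict half of the compatibility of cobracket and coproduct. -/

section Leibniz

variable {k : Type*} [Field k] {A : Type*} [Ring A] [Algebra k A]
  {𝒜 : ℤ → Submodule k A} [GradedAlgebra 𝒜] {m : ℤ}
  {Y Z : Type*} [AddCommGroup Y] [Module k Y] [AddCommGroup Z] [Module k Z]
  {F : OpenFrobenius 𝒜 m} (E : Casimir F)

/-- The coproduct is a strict coderivation in one argument of the homotopy for cocommutativity. -/
theorem comm_coprod (Ψ : Letter 𝒜 → List (Letter 𝒜) → Letter 𝒜 → List (Letter 𝒜) →
      Letter 𝒜 → List (Letter 𝒜) → Y) (a : Letter 𝒜) (l : List (Letter 𝒜)) :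
    comm E (fun p u q v => sg k ((p.deg + wd u - m) * (q.deg + wd v - m)) •
        coprod E (Ψ q v) p u) a l =
      coprod E (fun p₁ u₁ p₂ u₂ => sg k (p₁.deg + wd u₁ - m) • comm E (fun p u q v =>
        sg k ((p.deg + wd u - m) * (q.deg + wd v - m)) •
          sg k ((p₁.deg + wd u₁ - m) * (q.deg + wd v - m)) • Ψ q v p₁ u₁ p u) p₂ u₂) a l +
      coprod E (fun p₁ u₁ p₂ u₂ => comm E (fun p u q v =>
        sg k ((p.deg + wd u - m) * (q.deg + wd v - m)) • Ψ q v p u p₂ u₂) p₁ u₁) a l := by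
  have e1 : coprod E (fun p₁ u₁ p₂ u₂ => sg k (p₁.deg + wd u₁ - m) • comm E (fun p u q v =>
        sg k ((p.deg + wd u - m) * (q.deg + wd v - m)) •
          sg k ((p₁.deg + wd u₁ - m) * (q.deg + wd v - m)) • Ψ q v p₁ u₁ p u) p₂ u₂) a l =
      splitSum (fun u r => splitSum (fun u₁ u₂ => splitSum (fun v w => ∑ s, ∑ t,
        sg k (a.deg + 1 + (wd u + m * (E.p s).deg + wd w * ((E.p s).deg + wd v)) +
          (a.deg + (wd u + (E.p s).deg - 1 + wd w) - m) * ((E.q s).deg + wd v - m) +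
          ((E.q t).deg + a.deg) * wd u₁ + m * ((E.p t).deg + wd u₁)) •
        Ψ (E.q s) v (E.p t) u₁ (E.q t * a) (u₂ ++ E.p s :: w)) r) u) l := by
    simp only [coprod, comm, ins]
    simp only [← neg_smul, neg_sg, ← splitSum_neg, ← Finset.sum_neg_distrib, ← splitSum_smul,
      ← splitSum_sum, Finset.smul_sum, smul_smul,
      ← sg_add]
    refine (splitSum_assoc_congr fun u₁ u₂ r _ => splitSum_congr fun v w _ => ?_).symm
    rw [Finset.sum_comm]
    refine Finset.sum_congr rfl fun t _ => Finset.sum_congr rfl fun s _ => sg_smul_congr ?_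
    push_cast [wd_append, wd_cons, Letter.mul_deg, E.q_deg]
    clear * -; grind [=_ intCast_mul_self]
  have e2 : coprod E (fun p₁ u₁ p₂ u₂ => comm E (fun p u q v =>
        sg k ((p.deg + wd u - m) * (q.deg + wd v - m)) • Ψ q v p u p₂ u₂) p₁ u₁) a l =
      splitSum (fun u r => splitSum (fun v w => splitSum (fun w₁ w₂ => ∑ s, ∑ t,
        sg k (a.deg + 1 + (wd u + m * (E.p s).deg + (wd w₁ + wd w₂) * ((E.p s).deg + wd v)) +
          (a.deg + (wd u + (E.p s).deg - 1 + wd w₁ + wd w₂) - m) * ((E.q s).deg + wd v - m) +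
          ((E.q t).deg + a.deg) * (wd u + (E.p s).deg - 1 + wd w₁) +
          m * ((E.p t).deg + wd u + (E.p s).deg - 1 + wd w₁)) •
        Ψ (E.q s) v (E.p t) (u ++ E.p s :: w₁) (E.q t * a) w₂) w) r) l := by
    rw [← splitSum_assoc₄]
    simp only [coprod, comm, ins]
    simp only [← neg_smul, neg_sg, ← splitSum_neg, ← Finset.sum_neg_distrib, ← splitSum_smul,
      ← splitSum_sum, Finset.smul_sum, smul_smul,
      ← sg_add]
    refine splitSum_congr fun r w₂ _ => splitSum_congr fun u r' e => splitSum_congr fun v w e' => ?_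
    rw [Finset.sum_comm]
    refine Finset.sum_congr rfl fun t _ => Finset.sum_congr rfl fun s _ => sg_smul_congr ?_
    rw [← e, ← e']
    push_cast [wd_append, wd_cons, Letter.mul_deg, E.q_deg]
    clear * -; grind [=_ intCast_mul_self]
  rw [e1, e2, comm, ins, ← splitSum_smul, ← splitSum_neg, ← splitSum_add]
  refine splitSum_congr fun u r _ => ?_
  rw [splitSum_splitSum_comm (fun u₁ u₂ v w => ∑ s, ∑ t,
        sg k (a.deg + 1 + (wd u + m * (E.p s).deg + wd w * ((E.p s).deg + wd v)) +
          (a.deg + (wd u + (E.p s).deg - 1 + wd w) - m) * ((E.q s).deg + wd v - m) +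
          ((E.q t).deg + a.deg) * wd u₁ + m * ((E.p t).deg + wd u₁)) •
        Ψ (E.q s) v (E.p t) u₁ (E.q t * a) (u₂ ++ E.p s :: w)) u r,
    ← splitSum_smul, ← splitSum_neg, ← splitSum_add]
  refine splitSum_congr fun v w _ => ?_
  rw [splitSum_sum, splitSum_sum, ← Finset.sum_add_distrib, Finset.smul_sum,
    ← Finset.sum_neg_distrib]
  refine Finset.sum_congr rfl fun s _ => ?_
  -- The coproduct cuts the word `u ++ e' :: w` before or after the inserted letter. This decides
  -- which of the two factors carries the insertion.
  rw [coprod, splitSum_append, smul_add, smul_add, smul_add, neg_add]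
  simp only [← neg_smul, neg_sg, ← splitSum_neg, ← Finset.sum_neg_distrib, ← splitSum_smul,
      Finset.smul_sum, smul_smul, ← sg_add]
  congr 1
  · refine splitSum_congr fun u₁ u₂ e => Finset.sum_congr rfl fun t _ => sg_smul_congr ?_
    rw [← e]
    push_cast [wd_append, wd_cons, Letter.mul_deg, E.q_deg]
    clear * -; grind [=_ intCast_mul_self]
  · refine splitSum_congr fun u₁ u₂ e => Finset.sum_congr rfl fun t _ => sg_smul_congr ?_
    rw [← e]
    push_cast [wd_append, wd_cons, Letter.mul_deg, E.q_deg]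
    clear * -; grind [=_ intCast_mul_self]

end Leibniz

/-! ### Two nested insertions and their differential. -/

section Brace

variable {k : Type*} [Field k] {A : Type*} [Ring A] [Algebra k A]
  {𝒜 : ℤ → Submodule k A} [GradedAlgebra 𝒜] {m : ℤ}
  {Y Z : Type*} [AddCommGroup Y] [Module k Y] [AddCommGroup Z] [Module k Z]
  {F : OpenFrobenius 𝒜 m} (E : Casimir F)

theorem GLin.ins {f : Letter 𝒜 → List (Letter 𝒜) → Letter 𝒜 → List (Letter 𝒜) → Letter 𝒜 →
      List (Letter 𝒜) → Y} (h : ∀ u p w q v, GLin fun x => f x u p w q v) (l : List (Letter 𝒜)) :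
    GLin fun x => HochBV.ins E (f x) l :=
  GLin.splitSum (fun u r => GLin.splitSum (fun v w => GLin.sum Finset.univ fun s =>
    (h u (E.p s) w (E.q s) v).const_smul fun _ =>
      sg k (wd u + m * (E.p s).deg + wd w * ((E.p s).deg + wd v))) r) l

theorem cyc_ins_comm (Φ : Letter 𝒜 → List (Letter 𝒜) → List (Letter 𝒜) → Letter 𝒜 →
      List (Letter 𝒜) → Letter 𝒜 → List (Letter 𝒜) → Y) (a : Letter 𝒜) (y r : List (Letter 𝒜)) :
    ins E (fun u p w q v => cyc F (fun a y => Φ a y u p w q v) a y) r =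
      cyc F (fun a y => ins E (Φ a y) r) a y := by
  simp only [cyc]
  rw [ins_sub, ins_add, ins_add, ins_smul, ins_smul, bar_ins_comm, onLast_ins_comm,
    onHead_ins_comm (E := E) (fun x y u p w q v => Φ (a * x) y u p w q v)]
  simp only [ins_smul]

/-- The sum of `± Θ (u ++ e' :: (u' ++ f' :: w)) f'' v' e'' v` over all
`u ++ v ++ u' ++ v' ++ w = l`, for two copies `e` and `f` of `δ 1`. -/
def brace (E : Casimir F) (Θ : List (Letter 𝒜) → Letter 𝒜 → List (Letter 𝒜) → Letter 𝒜 →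
      List (Letter 𝒜) → Y) : List (Letter 𝒜) → Y :=
  ins E fun u p r q v => sg k (wd u + p.deg) • insAfter E (fun l q' v' => Θ l q' v' q v) u p r

/-- The differential of a function of a word and two chains. -/
def braceDiff (F : OpenFrobenius 𝒜 m) (Θ : List (Letter 𝒜) → Letter 𝒜 → List (Letter 𝒜) →
      Letter 𝒜 → List (Letter 𝒜) → Y) (l : List (Letter 𝒜)) (q' : Letter 𝒜) (v' : List (Letter 𝒜))
    (q : Letter 𝒜) (v : List (Letter 𝒜)) : Y :=
  wordTensorDiff F (fun l q' v' => Θ l q' v' q v) l q' v' +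
    sg k (wd l - m + (q'.deg + wd v' - m)) • cyc F (Θ l q' v') q v

variable {Θ Θ' : List (Letter 𝒜) → Letter 𝒜 → List (Letter 𝒜) → Letter 𝒜 → List (Letter 𝒜) → Y}

theorem brace_add (l : List (Letter 𝒜)) :
    brace E (fun l q' v' q v => Θ l q' v' q v + Θ' l q' v' q v) l =
      brace E Θ l + brace E Θ' l := by
  simp only [brace, insAfter, ins_add, smul_add]

theorem brace_sub (l : List (Letter 𝒜)) :
    brace E (fun l q' v' q v => Θ l q' v' q v - Θ' l q' v' q v) l =
      brace E Θ l - brace E Θ' l := by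
  simp only [brace, insAfter, ins_sub, smul_sub]

theorem brace_smul (c : k) (l : List (Letter 𝒜)) :
    brace E (fun l q' v' q v => c • Θ l q' v' q v) l = c • brace E Θ l := by
  simp only [brace, insAfter, ins_smul, smul_comm _ c]

/-- The sign `sg k (wd u + p.deg)` makes the inner insertion anticommute with the outer one; pulled
out, it leaves the differential `wordDiff` of a word with marked letter `p`, which is where the
inner insertion starts. -/
theorem insDiff_sg_smul (T : List (Letter 𝒜) → Letter 𝒜 → List (Letter 𝒜) → Letter 𝒜 →
      List (Letter 𝒜) → Y) (u r v : List (Letter 𝒜)) (p q : Letter 𝒜) :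
    insDiff F (fun u p r q v => sg k (wd u + p.deg) • T u p r q v) u p r q v =
      -(sg k (wd u + p.deg) • wordDiff F (fun u p r => T u p r q v) u p r) +
        sg k (wd r + m + 1) • cyc F (T u p r) q v := by
  have e1 : bar F (fun u' => sg k (wd u' + p.deg) • T u' p r q v) u =
      -(sg k (wd u + p.deg) • bar F (fun u' => T u' p r q v) u) := by
    rw [← neg_smul, neg_sg]
    exact bar_congr_deg F _ fun u' h => by rw [h]; exact sg_smul_congr (by push_cast; ring)
  have e2 : onLast (fun u' x => sg k (wd u' + x.deg) • sg k (wd u' + (x * p).deg) •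
        T u' (x * p) r q v) u = -(sg k (wd u + p.deg) •
      onLast (fun u' x => sg k (wd u' + x.deg) • T u' (x * p) r q v) u) := by
    rw [← onLast_smul, ← onLast_neg]
    refine onLast_congr fun u' x e => ?_
    rw [← e, smul_smul, smul_smul, ← sg_add, ← sg_add, ← neg_smul, neg_sg]
    exact sg_smul_congr (by push_cast [wd_append, wd_cons, wd_nil, Letter.mul_deg]; clear * -; grind)
  have e3 : onHead (fun x r' => sg k (wd u + (p * x).deg) • T u (p * x) r' q v) r =
      sg k (wd u + p.deg) • onHead (fun x r' => sg k x.deg • T u (p * x) r' q v) r := by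
    rw [← onHead_smul]
    refine onHead_congr fun x r' e => ?_
    rw [smul_smul, ← sg_add, Letter.mul_deg, add_assoc]
  have e4 : cyc F (fun q v => sg k (wd u + p.deg) • T u p r q v) q v =
      sg k (wd u + p.deg) • cyc F (T u p r) q v :=
    (map_cyc (LinearMap.lsmul k Y (sg k (wd u + p.deg))) _ q v).symm
  rw [insDiff, e1, e2, e3, e4, bar_smul, wordDiff, OpenFrobenius.dL_deg]
  have s1 : sg k (wd u + (p.deg + 1)) = -sg k (wd u + p.deg) := by
    rw [neg_sg]; exact sg_congr (by push_cast; ring)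
  have s2 : sg k (wd u + p.deg - 1 + wd r + m) = sg k (wd u + p.deg) * sg k (wd r + m + 1) := by
    rw [← sg_add]; exact sg_congr (by push_cast; clear * -; grind)
  have s3 : sg k (wd u + p.deg - 1) = -sg k (wd u + p.deg) := sg_sub_one _
  have ha := sg_mul_self (k := k) (wd u + p.deg)
  rw [s1, s2, s3]
  simp only [smul_add, smul_sub, smul_neg, neg_smul, smul_smul, neg_mul, mul_comm (sg k (wd u)),
    ha, mul_right_comm _ _ (sg k (wd u + p.deg)), one_smul, one_mul]
  abel

/-- The outer insertion is handled by `ins_insDiff`, the inner one by `insAfter_wordTensorDiff` with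
the outer letter `e'` as marked letter. The one uncancelled term is the product `e' f'` of the two
inserted letters. -/
theorem brace_braceDiff (h₁ : ∀ u w v' q v, GBilin fun p' q' => Θ (u ++ p' :: w) q' v' q v)
    (h₂ : ∀ u w q' v' v, GBilin fun p q => Θ (u ++ p :: w) q' v' q v) (l : List (Letter 𝒜)) :
    brace E (braceDiff F Θ) l = bar F (brace E Θ) l -
      ins E (fun u p r q v => insJunction E (fun l q' v' => Θ l q' v' q v) u p r) l := by
  have e : ∀ u r v s, ins E (fun u' p' w' q' v' =>
      sg k (wd (u ++ E.p s :: (u' ++ p' :: w')) - m + (q'.deg + wd v' - m)) •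
        cyc F (Θ (u ++ E.p s :: (u' ++ p' :: w')) q' v') (E.q s) v) r =
      -(sg k (wd u + (E.p s).deg) • sg k (wd r + m + 1) •
        cyc F (fun q v => insAfter E (fun l q' v' => Θ l q' v' q v) u (E.p s) r) (E.q s) v) := by
    intro u r v s
    unfold insAfter
    rw [← cyc_ins_comm (F := F) E (fun q v u' p' w' q' v' =>
      Θ (u ++ E.p s :: (u' ++ p' :: w')) q' v' q v), ← ins_smul, ← ins_smul, ← ins_neg]
    refine ins_congr E fun u' w' v' t e => ?_
    rw [← e, smul_smul, ← sg_add, ← neg_smul, neg_sg]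
    refine sg_smul_congr ?_
    push_cast [E.q_deg, wd_append, wd_cons]
    clear * -; grind
  have h₃ : ∀ u r v, GBilin fun p q =>
      sg k (wd u + p.deg) • insAfter E (fun l q' v' => Θ l q' v' q v) u p r := fun u r v =>
    GBilin.const_smul (Ψ := fun p q => insAfter E (fun l q' v' => Θ l q' v' q v) u p r)
      ⟨fun q => GLin.ins E (fun u' p' w' q' v' => (h₂ u (u' ++ p' :: w') q' v' v).left q) r,
       fun p => GLin.ins E (fun u' p' w' q' v' => (h₂ u (u' ++ p' :: w') q' v' v).right p) r⟩
      fun i _ => sg k (wd u + i)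
  have e' := ins_insDiff E h₃ l
  have e2 : brace E (braceDiff F Θ) l =
      ins E (fun u p r q v => -insDiff F (fun u p r q v => sg k (wd u + p.deg) •
        insAfter E (fun l q' v' => Θ l q' v' q v) u p r) u p r q v -
        insJunction E (fun l q' v' => Θ l q' v' q v) u p r) l := by
    refine ins_congr E fun u r v s _ => ?_
    rw [insDiff_sg_smul]
    have e3 : insAfter E (fun l q' v' => braceDiff F Θ l q' v' (E.q s) v) u (E.p s) r =
        insAfter E (wordTensorDiff F fun l q' v' => Θ l q' v' (E.q s) v) u (E.p s) r +
        ins E (fun u' p' w' q' v' =>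
          sg k (wd (u ++ E.p s :: (u' ++ p' :: w')) - m + (q'.deg + wd v' - m)) •
        cyc F (Θ (u ++ E.p s :: (u' ++ p' :: w')) q' v') (E.q s) v) r := by
      rw [insAfter, insAfter, ← ins_add]; rfl
    rw [e3, e, insAfter_wordTensorDiff E (fun y u v' => h₁ y u v' (E.q s) v)]
    have ha := sg_mul_self (k := k) (wd u + (E.p s).deg)
    simp only [smul_add, smul_sub, smul_neg, smul_smul, ha, one_smul, ← mul_assoc, one_mul]
    abel
  rw [e2, ins_sub, ins_neg, e', neg_neg]
  rfl

/-- The first letter is the outer inserted one when nothing precedes it; otherwise it is a letter of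
the original word and may be removed before inserting. -/
theorem brace_onHead (Ψ : Letter 𝒜 → List (Letter 𝒜) → Letter 𝒜 → List (Letter 𝒜) → Letter 𝒜 →
      List (Letter 𝒜) → Y) (l : List (Letter 𝒜)) :
    brace E (fun l q' v' q v => onHead (fun x l' => Ψ x l' q' v' q v) l) l =
      splitSum (fun v w => ∑ s, sg k (m * (E.p s).deg + wd w * ((E.p s).deg + wd v)) •
        sg k (E.p s).deg • ins E (fun u' p' w' q' v' =>
          Ψ (E.p s) (u' ++ p' :: w') q' v' (E.q s) v) w) l +
      onHead (fun x l' => brace E (Ψ x) l') l := by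
  have e : ∀ u p r q v, sg k (wd u + p.deg) • insAfter E
      (fun l q' v' => onHead (fun x l' => Ψ x l' q' v' q v) l) u p r =
      onNil (sg k p.deg • ins E (fun u' p' w' q' v' => Ψ p (u' ++ p' :: w') q' v' q v) r) u +
      onHead (fun x u' => sg k (x.deg - 1) • sg k (wd u' + p.deg) •
        insAfter E (fun l q' v' => Ψ x l q' v' q v) u' p r) u := by
    intro u p r q v
    cases u with
    | nil => simp [insAfter]
    | cons x u =>
      simp only [insAfter, List.cons_append, onHead_cons, onNil_cons, zero_add, smul_smul,
        ← sg_add, wd_cons, add_assoc]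
  unfold brace
  simp only [e]
  rw [ins_add, ins_onNil_left E (fun p r q v => sg k p.deg • ins E (fun u' p' w' q' v' =>
    Ψ p (u' ++ p' :: w') q' v' q v) r), ins_onHead]
  congr 1
  refine onHead_congr fun x l' _ => ?_
  rw [← ins_smul]
  simp only [smul_smul, ← mul_assoc, sg_mul_self, one_mul]

/-- At the other end, the last letter is the inner inserted one or a letter of the original word.
The parameter `b` is the degree of the coefficient. -/
theorem brace_onLast (b : ℤ) (Ψ : Letter 𝒜 → List (Letter 𝒜) → Letter 𝒜 → List (Letter 𝒜) →
      Letter 𝒜 → List (Letter 𝒜) → Y) (l : List (Letter 𝒜)) :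
    brace E (fun l q' v' q v =>
        onLast (fun l' x => sg k ((x.deg - 1) * (b + wd l')) • Ψ x l' q' v' q v) l) l =
      ins E (fun u p r q v => sg k (wd u + p.deg) • splitSum (fun u' v' => ∑ t,
        sg k (wd u' + m * (E.p t).deg) • sg k (((E.p t).deg - 1) * (b + wd (u ++ p :: u'))) •
          Ψ (E.p t) (u ++ p :: u') (E.q t) v' q v) r) l +
      onLast (fun l' x => sg k ((x.deg - 1) * (b + wd l')) • brace E (Ψ x) l') l := by
  have e : ∀ u p r q v, insAfter E (fun l q' v' =>
        onLast (fun l' x => sg k ((x.deg - 1) * (b + wd l')) • Ψ x l' q' v' q v) l) u p r =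
      splitSum (fun u' v' => ∑ t,
        sg k (wd u' + m * (E.p t).deg) • sg k (((E.p t).deg - 1) * (b + wd (u ++ p :: u'))) •
          Ψ (E.p t) (u ++ p :: u') (E.q t) v' q v) r +
      onLast (fun r' x => sg k ((x.deg - 1) * (b + wd u + p.deg + wd r')) •
        insAfter E (fun l q' v' => Ψ x l q' v' q v) u p r') r := by
    intro u p r q v
    have e1 : ∀ u' w' v' p' q', onLast (fun l' x => sg k ((x.deg - 1) * (b + wd l')) •
          Ψ x l' q' v' q v) (u ++ p :: (u' ++ p' :: w')) =
        onNil (sg k ((p'.deg - 1) * (b + wd (u ++ p :: u'))) • Ψ p' (u ++ p :: u') q' v' q v) w' +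
        onLast (fun w' x => sg k ((x.deg - 1) * (b + wd (u ++ p :: (u' ++ p' :: w')))) •
          Ψ x (u ++ p :: (u' ++ p' :: w')) q' v' q v) w' := by
      intro u' w' v' p' q'
      have := onLast_append_cons (fun l' x => sg k ((x.deg - 1) * (b + wd l')) •
          Ψ x l' q' v' q v) (u ++ p :: u') p' w'
      simpa only [List.append_assoc, List.cons_append] using this
    unfold insAfter
    simp only [e1]
    rw [ins_add, ins_onNil_right, ins_onLast]
    congr 1
    refine onLast_congr fun r' x _ => ?_
    rw [← ins_smul]
    refine ins_congr E fun u w v s e => ?_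
    rw [smul_smul, ← sg_add, ← e]
    exact sg_smul_congr (by push_cast [wd_append, wd_cons]; clear * -; grind)
  unfold brace
  simp only [e, smul_add, ← onLast_smul]
  rw [ins_add, ins_onLast]
  congr 1
  refine onLast_congr fun r' x _ => ?_
  rw [← ins_smul]
  refine ins_congr E fun u w v s e => ?_
  simp only [smul_smul, ← sg_add, ← e]
  exact sg_smul_congr (by push_cast [wd_append, wd_cons]; clear * -; grind)

/-- Move `f'` across the outer Casimir element: `e' f' ⊗ f'' ⊗ e''` becomes `e' ⊗ f'' ⊗ f' e''` by
`Casimir.mul_mid`, and `f' e'' ⊗ f''` is the coproduct of `e''` by `Casimir.mul_right`. Thus the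
product of the inserted letters is the coproduct, with factors swapped, of the split-off chain. -/
theorem ins_insJunction (h₂ : ∀ u w q' v' v, GBilin fun p q => Θ (u ++ p :: w) q' v' q v)
    (h₃ : ∀ l v' v, GBilin fun q q' => Θ l q' v' q v) (l : List (Letter 𝒜)) :
    ins E (fun u p r q v => insJunction E (fun l q' v' => Θ l q' v' q v) u p r) l =
      ins E (fun u p w q v => coprodSwap E (Θ (u ++ p :: w)) q v) l := by
  refine splitSum_congr fun u r _ => ?_
  simp only [insJunction, coprodSwap, coprod, ← splitSum_smul, ← splitSum_sum, Finset.smul_sum,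
    smul_smul, ← sg_add]
  refine (splitSum_assoc_congr fun v v' w _ => ?_).symm
  have e1 := fun t : Fin E.n => E.mul_mid ((h₂ u w (E.q t) v' v).const_smul fun i _ =>
    sg k (wd u + m * (i - (E.p t).deg) + (wd v' + wd w) * (i - (E.p t).deg + wd v) +
      (m * (E.p t).deg + wd w * ((E.p t).deg + wd v')))) (E.p t)
  have e2 := fun s : Fin E.n => E.mul_right ((h₃ (u ++ E.p s :: w) v' v).const_smul fun i _ =>
    sg k ((i - (E.q s).deg) + wd u + m * ((E.p s).deg - (i - (E.q s).deg)) +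
      (wd v' + wd w) * ((E.p s).deg - (i - (E.q s).deg) + wd v) +
      (m * (i - (E.q s).deg) + wd w * (i - (E.q s).deg + wd v')) +
      (m - (i - (E.q s).deg)) * (E.q s).deg)) (E.q s)
  simp only [smul_smul, Finset.smul_sum, ← sg_add, Letter.mul_deg] at e1 e2
  have e3 : ∀ s t, sg k ((E.q t).deg * (E.q s).deg + ((E.p t).deg + (E.q s).deg - (E.q s).deg +
      wd u + m * ((E.p s).deg - ((E.p t).deg + (E.q s).deg - (E.q s).deg)) +
      (wd v' + wd w) * ((E.p s).deg - ((E.p t).deg + (E.q s).deg - (E.q s).deg) + wd v) +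
      (m * ((E.p t).deg + (E.q s).deg - (E.q s).deg) +
        wd w * ((E.p t).deg + (E.q s).deg - (E.q s).deg + wd v')) +
      (m - ((E.p t).deg + (E.q s).deg - (E.q s).deg)) * (E.q s).deg)) =
      sg k ((E.p t).deg + (wd u + m * ((E.p s).deg - (E.p t).deg) +
        (wd v' + wd w) * ((E.p s).deg - (E.p t).deg + wd v) +
          (m * (E.p t).deg + wd w * ((E.p t).deg + wd v')))) := by
    intro s t
    refine sg_congr ?_
    push_cast [E.q_deg]; clear * -; grind [=_ intCast_mul_self]
  simp only [e3] at e2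
  refine (Finset.sum_congr rfl fun s _ => (Finset.sum_congr rfl fun t _ =>
    sg_smul_congr ?_).trans (e2 s)).trans (Finset.sum_comm.trans ((Finset.sum_congr rfl fun t _ =>
      (e1 t).symm.trans (Finset.sum_congr rfl fun s _ => sg_smul_congr ?_)).trans
        Finset.sum_comm)) <;>
  · push_cast [E.q_deg, wd_append, Letter.mul_deg]; clear * -; grind [=_ intCast_mul_self]

end Brace

/-! ### The boundary of the double insertion. -/

section Brace

variable {k : Type*} [Field k] {A : Type*} [Ring A] [Algebra k A]
  {𝒜 : ℤ → Submodule k A} [GradedAlgebra 𝒜] {m : ℤ}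
  {Y Z : Type*} [AddCommGroup Y] [Module k Y] [AddCommGroup Z] [Module k Z]
  {F : OpenFrobenius 𝒜 m} (E : Casimir F)
  {Ψ : Letter 𝒜 → List (Letter 𝒜) → Letter 𝒜 → List (Letter 𝒜) → Letter 𝒜 → List (Letter 𝒜) → Y}

/-- The differential of a function of three chains. -/
def tripleDiff (F : OpenFrobenius 𝒜 m) (Ψ : Letter 𝒜 → List (Letter 𝒜) → Letter 𝒜 →
      List (Letter 𝒜) → Letter 𝒜 → List (Letter 𝒜) → Y) (a : Letter 𝒜) (l : List (Letter 𝒜))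
    (q' : Letter 𝒜) (v' : List (Letter 𝒜)) (q : Letter 𝒜) (v : List (Letter 𝒜)) : Y :=
  cyc F (fun a l => Ψ a l q' v' q v) a l +
    sg k (a.deg + wd l - m) • tensorDiff F (Ψ a l) q' v' q v

theorem tripleDiff_eq (a : Letter 𝒜) (l : List (Letter 𝒜)) (q' : Letter 𝒜)
    (v' : List (Letter 𝒜)) (q : Letter 𝒜) (v : List (Letter 𝒜)) :
    tripleDiff F Ψ a l q' v' q v = Ψ (F.dL a) l q' v' q v +
      sg k a.deg • braceDiff F (Ψ a) l q' v' q v +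
      sg k a.deg • onHead (fun x l' => Ψ (a * x) l' q' v' q v) l -
      onLast (fun l' x => sg k ((x.deg - 1) * (a.deg + wd l')) • Ψ (x * a) l' q' v' q v) l := by
  rw [tripleDiff, cyc, braceDiff, wordTensorDiff, tensorDiff, add_sub_assoc a.deg,
    sg_add _ (wd l - m), sg_add (wd l - m)]
  module

/-- If the inner letter comes last, the last face is `f' a ⊗ f'' = ± f' ⊗ f'' a`: a coproduct of the
original chain, with the outer insertion performed in its left factor. -/
theorem brace_last (h : ∀ l v' q v, GBilin fun p q' => Ψ p l q' v' q v) (a : Letter 𝒜)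
    (l : List (Letter 𝒜)) :
    ins E (fun u p r q v => sg k (wd u + p.deg) • splitSum (fun u' v' => ∑ t,
        sg k (wd u' + m * (E.p t).deg) • sg k (((E.p t).deg - 1) * (a.deg + wd (u ++ p :: u'))) •
          Ψ (E.p t * a) (u ++ p :: u') (E.q t) v' q v) r) l =
      coprod E (fun p u q' v' => comm E (fun p l q v =>
        sg k ((q.deg + wd v - m) * (q'.deg + wd v' - m)) •
        Ψ p l q' v' q v) p u) a l := by
  have e : coprod E (fun p u q' v' => comm E (fun p l q v =>
        sg k ((q.deg + wd v - m) * (q'.deg + wd v' - m)) •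
        Ψ p l q' v' q v) p u) a l =
      splitSum (fun u r => splitSum (fun v w => splitSum (fun w₁ w₂ => ∑ s, ∑ t,
        sg k (((E.q t).deg + a.deg) * (wd u + wd v + wd w₁) +
          m * ((E.p t).deg + wd u + wd v + wd w₁) + (E.p t).deg + 1 +
          (wd u + m * (E.p s).deg + wd w₁ * ((E.p s).deg + wd v)) +
          ((E.q s).deg + wd v - m) * ((E.q t).deg + a.deg + wd w₂ - m)) •
        Ψ (E.p t) (u ++ E.p s :: w₁) (E.q t * a) w₂ (E.q s) v) w) r) l := by
    rw [← splitSum_assoc₄]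
    simp only [coprod, comm, ins]
    simp only [← neg_smul, neg_sg, ← splitSum_neg, ← Finset.sum_neg_distrib, ← splitSum_smul,
      ← splitSum_sum, Finset.smul_sum, smul_smul, ← sg_add]
    refine splitSum_congr fun r w₂ _ => splitSum_congr fun u r' e => splitSum_congr fun v w e' => ?_
    rw [Finset.sum_comm]
    refine Finset.sum_congr rfl fun t _ => Finset.sum_congr rfl fun s _ => sg_smul_congr ?_
    rw [← e, ← e']
    push_cast [wd_append, Letter.mul_deg]
    clear * -; grind
  rw [e]
  simp only [ins, ← splitSum_smul, ← splitSum_sum, Finset.smul_sum, smul_smul, ← sg_add]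
  refine splitSum_congr fun u r _ => splitSum_congr fun v r' _ => splitSum_congr fun w v' e =>
    Finset.sum_congr rfl fun s _ => ?_
  have := E.mul_right ((h (u ++ E.p s :: w) v' (E.q s) v).const_smul fun i j =>
    sg k (j * (wd u + wd v + wd w) + m * (i + wd u + wd v + wd w) + i + 1 +
      (wd u + m * (E.p s).deg + wd w * ((E.p s).deg + wd v)) +
      ((E.q s).deg + wd v - m) * (j + wd v' - m))) a
  simp only [smul_smul, ← sg_add, Letter.mul_deg] at this
  refine (Finset.sum_congr rfl fun s _ => sg_smul_congr ?_).trans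
    (this.symm.trans (Finset.sum_congr rfl fun s _ => sg_smul_congr ?_)) <;>
  · try rw [← e]
    push_cast [E.q_deg, wd_append, wd_cons]; clear * -; grind [=_ intCast_mul_self]

/-- Three terms survive, one for each place where an inserted letter is absorbed: `e'` and `f'` into
each other, `e'` into the coefficient from the right, `f'` into the coefficient from the left. They
are an insertion followed by a coproduct, and a coproduct followed by an insertion in either factor.
-/
theorem tripleDiff_brace
    (h₁ : ∀ a u w v' q v, GBilin fun p' q' => Ψ a (u ++ p' :: w) q' v' q v)
    (h₂ : ∀ a u w q' v' v, GBilin fun p q => Ψ a (u ++ p :: w) q' v' q v)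
    (h₃ : ∀ a l v' v, GBilin fun q q' => Ψ a l q' v' q v)
    (h₄ : ∀ l v' q v, GBilin fun p q' => Ψ p l q' v' q v)
    (h₅ : ∀ l q' v' v, GBilin fun p q => Ψ p l q' v' q v) (a : Letter 𝒜) (l : List (Letter 𝒜)) :
    brace E (tripleDiff F Ψ a) l - cyc F (fun a l => brace E (Ψ a) l) a l =
      comm E (fun p u q v => coprodSwap E (Ψ p u) q v) a l -
      coprodSwap E (fun p l q v => comm E (fun p l q' v' => Ψ p l q' v' q v) p l) a l -
      coprod E (fun p u q' v' => comm E (fun p l q v =>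
        sg k ((q.deg + wd v - m) * (q'.deg + wd v' - m)) •
        Ψ p l q' v' q v) p u) a l := by
  have e : brace E (tripleDiff F Ψ a) l = brace E (Ψ (F.dL a)) l +
      sg k a.deg • brace E (braceDiff F (Ψ a)) l +
      sg k a.deg • brace E (fun l q' v' q v => onHead (fun x l' => Ψ (a * x) l' q' v' q v) l) l -
      brace E (fun l q' v' q v => onLast (fun l' x => sg k ((x.deg - 1) * (a.deg + wd l')) •
        Ψ (x * a) l' q' v' q v) l) l := by
    rw [← brace_smul, ← brace_smul, ← brace_add, ← brace_add, ← brace_sub]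
    simp only [← tripleDiff_eq]
  have h₆ : ∀ u v, GBilin fun p q => comm E (fun p l q' v' => Ψ p l q' v' q v) p u := fun u v =>
    ⟨fun q => ((GLin.ins E (fun u' p' w' q' v' => (h₅ (u' ++ p' :: w') q' v' v).left q) u).const_smul
        fun i => sg k i).map (-LinearMap.id),
      fun p => ((GLin.ins E (fun u' p' w' q' v' => (h₅ (u' ++ p' :: w') q' v' v).right p) u).const_smul
        fun _ => sg k p.deg).map (-LinearMap.id)⟩
  -- The outer letter absorbed into the coefficient gives `a e' ⊗ e''`, so `comm_first` applies to
  -- the function that still performs the inner insertion.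
  have e2 : sg k a.deg • splitSum (fun v w => ∑ s,
        sg k (m * (E.p s).deg + wd w * ((E.p s).deg + wd v)) •
        sg k (E.p s).deg • ins E (fun u' p' w' q' v' =>
          Ψ (a * E.p s) (u' ++ p' :: w') q' v' (E.q s) v) w) l =
      -coprodSwap E (fun p l q v => comm E (fun p l q' v' => Ψ p l q' v' q v) p l) a l := by
    rw [← comm_first E h₆ a l, ← splitSum_smul, ← splitSum_neg]
    refine splitSum_congr fun v w _ => ?_
    rw [Finset.smul_sum, ← Finset.sum_neg_distrib]
    refine Finset.sum_congr rfl fun s _ => ?_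
    rw [comm, smul_neg, neg_neg, Letter.mul_deg, sg_add a.deg]
    module
  have e3 : ins E (fun u p r q v =>
        insJunction E (fun l q' v' => Ψ a l q' v' q v) u p r) l = _ :=
    ins_insJunction E (h₂ a) (h₃ a) l
  have e4 := brace_onLast E a.deg (fun x => Ψ (x * a)) l
  rw [e, brace_braceDiff E (h₁ a) (h₂ a), brace_onHead E (fun x => Ψ (a * x)), e4, cyc, smul_add,
    smul_sub, e2, e3, brace_last E h₄, comm]
  abel

end Brace

/-! ### Degrees of linear maps between graded spaces. -/

section Degree

variable {k : Type*} [Field k]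
  {X : Type*} [AddCommGroup X] [Module k X] {X' : Type*} [AddCommGroup X'] [Module k X']
  {Y : Type*} [AddCommGroup Y] [Module k Y] {Y' : Type*} [AddCommGroup Y'] [Module k Y']
  {Z : Type*} [AddCommGroup Z] [Module k Z]
  {𝒳 : ℤ → Submodule k X} {𝒳' : ℤ → Submodule k X'} {𝒴 : ℤ → Submodule k Y}
  {𝒴' : ℤ → Submodule k Y'} {𝒵 : ℤ → Submodule k Z}

theorem hom_ext (𝒳 : ℤ → Submodule k X) [DirectSum.Decomposition 𝒳] {f g : X →ₗ[k] Z}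
    (h : ∀ i, ∀ x ∈ 𝒳 i, f x = g x) : f = g := by
  refine LinearMap.ext fun x => ?_
  induction x using DirectSum.Decomposition.inductionOn 𝒳 with
  | zero => simp
  | add x x' hx hx' => rw [map_add, map_add, hx, hx']
  | homogeneous x => exact h _ _ x.2

theorem tensor_hom_ext_left (𝒳 : ℤ → Submodule k X) [DirectSum.Decomposition 𝒳]
    {f g : X ⊗[k] Y →ₗ[k] Z} (h : ∀ i, ∀ x ∈ 𝒳 i, ∀ y, f (x ⊗ₜ y) = g (x ⊗ₜ y)) : f = g :=
  TensorProduct.ext (hom_ext 𝒳 fun i x hx => LinearMap.ext fun y => h i x hx y)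

theorem tensor_hom_ext (𝒳 : ℤ → Submodule k X) (𝒴 : ℤ → Submodule k Y)
    [DirectSum.Decomposition 𝒳] [DirectSum.Decomposition 𝒴] {f g : X ⊗[k] Y →ₗ[k] Z}
    (h : ∀ i, ∀ x ∈ 𝒳 i, ∀ j, ∀ y ∈ 𝒴 j, f (x ⊗ₜ y) = g (x ⊗ₜ y)) : f = g :=
  TensorProduct.ext (hom_ext 𝒳 fun i x hx => hom_ext 𝒴 fun j y hy => h i x hx j y hy)

theorem triple_hom_ext (𝒳 : ℤ → Submodule k X) [DirectSum.Decomposition 𝒳]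
    {f g : X ⊗[k] (X ⊗[k] X) →ₗ[k] Z}
    (h : ∀ i, ∀ x ∈ 𝒳 i, ∀ j, ∀ y ∈ 𝒳 j, ∀ l, ∀ z ∈ 𝒳 l,
      f (x ⊗ₜ (y ⊗ₜ z)) = g (x ⊗ₜ (y ⊗ₜ z))) : f = g :=
  TensorProduct.ext (hom_ext 𝒳 fun i x hx => tensor_hom_ext 𝒳 𝒳 fun j y hy l z hz =>
    h i x hx j y hy l z hz)

/-- Linear maps of degree `e`. -/
def HasDeg (𝒳 : ℤ → Submodule k X) (𝒴 : ℤ → Submodule k Y) (e : ℤ) (f : X →ₗ[k] Y) : Prop :=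
  ∀ ⦃n : ℤ⦄ ⦃x : X⦄, x ∈ 𝒳 n → f x ∈ 𝒴 (n + e)

namespace HasDeg

theorem congr {e e' : ℤ} {f : X →ₗ[k] Y} (h : HasDeg 𝒳 𝒴 e f) (he : e = e') :
    HasDeg 𝒳 𝒴 e' f := he ▸ h

theorem id : HasDeg 𝒳 𝒳 0 LinearMap.id := fun n x hx => by simpa using hx

theorem comp {e e' : ℤ} {g : Y →ₗ[k] Z} {f : X →ₗ[k] Y} (hg : HasDeg 𝒴 𝒵 e' g)
    (hf : HasDeg 𝒳 𝒴 e f) : HasDeg 𝒳 𝒵 (e + e') (g ∘ₗ f) := fun n x hx => by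
  rw [← add_assoc]; exact hg (hf hx)

theorem add {e : ℤ} {f g : X →ₗ[k] Y} (hf : HasDeg 𝒳 𝒴 e f) (hg : HasDeg 𝒳 𝒴 e g) :
    HasDeg 𝒳 𝒴 e (f + g) := fun _ _ hx => add_mem (hf hx) (hg hx)

theorem sub {e : ℤ} {f g : X →ₗ[k] Y} (hf : HasDeg 𝒳 𝒴 e f) (hg : HasDeg 𝒳 𝒴 e g) :
    HasDeg 𝒳 𝒴 e (f - g) := fun _ _ hx => sub_mem (hf hx) (hg hx)

theorem of_tmul {e : ℤ} {f : X ⊗[k] Y →ₗ[k] Z}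
    (h : ∀ i, ∀ x ∈ 𝒳 i, ∀ j, ∀ y ∈ 𝒴 j, f (x ⊗ₜ y) ∈ 𝒵 (i + j + e)) :
    HasDeg (tensorGrading 𝒳 𝒴) 𝒵 e f := by
  intro n z hz
  have : tensorGrading 𝒳 𝒴 n ≤ (𝒵 (n + e)).comap f := by
    refine Submodule.span_le.2 ?_
    rintro _ ⟨i, j, rfl, x, hx, y, hy, rfl⟩
    exact h i x hx j y hy
  exact this hz

theorem tmap {e e' : ℤ} {f : X →ₗ[k] X'} {g : Y →ₗ[k] Y'} (hf : HasDeg 𝒳 𝒳' e f)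
    (hg : HasDeg 𝒴 𝒴' e' g) : HasDeg (tensorGrading 𝒳 𝒴) (tensorGrading 𝒳' 𝒴') (e + e')
      (TensorProduct.map f g) := by
  refine of_tmul fun i x hx j y hy => ?_
  have := tmul_mem_tensorGrading 𝒳' 𝒴' (hf hx) (hg hy)
  rwa [show i + e + (j + e') = i + j + (e + e') by ring] at this

theorem rTensor {e : ℤ} {f : X →ₗ[k] X'} (hf : HasDeg 𝒳 𝒳' e f) :
    HasDeg (tensorGrading 𝒳 𝒴) (tensorGrading 𝒳' 𝒴) e (LinearMap.rTensor Y f) :=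
  (hf.tmap id).congr (add_zero e)

theorem lTensor {e : ℤ} {f : X →ₗ[k] X'} (hf : HasDeg 𝒳 𝒳' e f) :
    HasDeg (tensorGrading 𝒴 𝒳) (tensorGrading 𝒴 𝒳') e (LinearMap.lTensor Y f) :=
  ((id (𝒳 := 𝒴)).tmap hf).congr (zero_add e)

theorem sgn [DirectSum.Decomposition 𝒳] : HasDeg 𝒳 𝒳 0 (sgn 𝒳) := fun n x hx => by
  rw [sgn_of_mem 𝒳 hx, add_zero]; exact Submodule.smul_mem _ _ hx

theorem map_sgn [DirectSum.Decomposition 𝒴] {e : ℤ} {f : X →ₗ[k] X'} (hf : HasDeg 𝒳 𝒳' e f) :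
    HasDeg (tensorGrading 𝒴 𝒳) (tensorGrading 𝒴 𝒳') e
      (TensorProduct.map (HochBV.sgn 𝒴) f) :=
  ((sgn (𝒳 := 𝒴)).tmap hf).congr (zero_add e)

theorem koszul [DirectSum.Decomposition 𝒳] [DirectSum.Decomposition 𝒴] :
    HasDeg (tensorGrading 𝒳 𝒴) (tensorGrading 𝒴 𝒳) 0 (koszul 𝒳 𝒴) :=
  of_tmul fun i x hx j y hy => by
    rw [koszul_tmul 𝒳 𝒴 hx hy, add_zero, add_comm i j]
    exact Submodule.smul_mem _ _ (tmul_mem_tensorGrading 𝒴 𝒳 hy hx)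

theorem assoc : HasDeg (tensorGrading (tensorGrading 𝒳 𝒴) 𝒵)
    (tensorGrading 𝒳 (tensorGrading 𝒴 𝒵)) 0 (TensorProduct.assoc k X Y Z).toLinearMap := by
  refine of_tmul fun n t ht j z hz => ?_
  have : HasDeg (tensorGrading 𝒳 𝒴) (tensorGrading 𝒳 (tensorGrading 𝒴 𝒵)) j
      ((TensorProduct.assoc k X Y Z).toLinearMap ∘ₗ (TensorProduct.mk k _ Z).flip z) :=
    of_tmul fun a x hx b y hy => by
      rw [add_assoc]
      exact tmul_mem_tensorGrading _ _ hx (tmul_mem_tensorGrading _ _ hy hz)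
  rw [add_zero]
  exact this ht

theorem assoc_symm : HasDeg (tensorGrading 𝒳 (tensorGrading 𝒴 𝒵))
    (tensorGrading (tensorGrading 𝒳 𝒴) 𝒵) 0 (TensorProduct.assoc k X Y Z).symm.toLinearMap := by
  refine of_tmul fun i x hx n t ht => ?_
  have : HasDeg (tensorGrading 𝒴 𝒵) (tensorGrading (tensorGrading 𝒳 𝒴) 𝒵) i
      ((TensorProduct.assoc k X Y Z).symm.toLinearMap ∘ₗ TensorProduct.mk k X _ x) :=
    of_tmul fun a y hy b z hz => by
      rw [add_comm, ← add_assoc]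
      exact tmul_mem_tensorGrading _ _ (tmul_mem_tensorGrading _ _ hx hy) hz
  rw [add_zero, add_comm]
  exact this ht

theorem swap₁₂ [DirectSum.Decomposition 𝒳] :
    HasDeg (tensorGrading 𝒳 (tensorGrading 𝒳 𝒳)) (tensorGrading 𝒳 (tensorGrading 𝒳 𝒳)) 0
      (swap₁₂ 𝒳) :=
  (assoc.comp (koszul.rTensor.comp assoc_symm)).congr (by ring)

end HasDeg

end Degree

/-! ### The total differential under symmetries and one-sided operators. -/

section Signs

variable {k : Type*} [Field k]
  {X : Type*} [AddCommGroup X] [Module k X] {Y : Type*} [AddCommGroup Y] [Module k Y]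
  {Z : Type*} [AddCommGroup Z] [Module k Z]
  {𝒳 : ℤ → Submodule k X} {𝒴 : ℤ → Submodule k Y}
  [DirectSum.Decomposition 𝒳] [DirectSum.Decomposition 𝒴]

theorem oddSum_tmul (f : X →ₗ[k] X) (g : Y →ₗ[k] Y) {i : ℤ} {x : X} (hx : x ∈ 𝒳 i) (y : Y) :
    oddSum 𝒳 f g (x ⊗ₜ y) = f x ⊗ₜ y + sg k i • (x ⊗ₜ[k] g y) := by
  rw [oddSum, LinearMap.add_apply, LinearMap.rTensor_tmul, TensorProduct.map_tmul,
    sgn_of_mem 𝒳 hx, TensorProduct.smul_tmul']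

theorem map_sgn_tmul (g : Y →ₗ[k] Z) {i : ℤ} {x : X} (hx : x ∈ 𝒳 i) (y : Y) :
    TensorProduct.map (sgn 𝒳) g (x ⊗ₜ y) = sg k i • (x ⊗ₜ[k] g y) := by
  rw [TensorProduct.map_tmul, sgn_of_mem 𝒳 hx, TensorProduct.smul_tmul']

theorem swap₁₂_tmul {i j : ℤ} {x y : X} (hx : x ∈ 𝒳 i) (hy : y ∈ 𝒳 j) (z : X) :
    swap₁₂ 𝒳 (x ⊗ₜ (y ⊗ₜ z)) = sg k (i * j) • (y ⊗ₜ[k] (x ⊗ₜ[k] z)) := by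
  simp only [swap₁₂, LinearMap.comp_apply, LinearEquiv.coe_coe, TensorProduct.assoc_symm_tmul,
    LinearMap.rTensor_tmul, koszul_tmul 𝒳 𝒳 hx hy, ← TensorProduct.smul_tmul', map_smul,
    TensorProduct.assoc_tmul]

theorem sg_add_one (n : ℤ) : sg k (n + 1) = -sg k n := (neg_sg n).symm

variable {D : X →ₗ[k] X}

theorem oddSum_koszul (hD : HasDeg 𝒳 𝒳 1 D) :
    oddSum 𝒳 D D ∘ₗ koszul 𝒳 𝒳 = koszul 𝒳 𝒳 ∘ₗ oddSum 𝒳 D D := by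
  refine tensor_hom_ext 𝒳 𝒳 fun i x hx j y hy => ?_
  have ha := sg_mul_self (k := k) i
  rw [LinearMap.comp_apply, LinearMap.comp_apply, koszul_tmul 𝒳 𝒳 hx hy, oddSum_tmul D D hx,
    map_smul, oddSum_tmul D D hy, map_add, map_smul, koszul_tmul 𝒳 𝒳 (hD hx) hy,
    koszul_tmul 𝒳 𝒳 hx (hD hy), add_mul, mul_add, mul_one, one_mul, sg_add, sg_add, smul_add,
    smul_smul, smul_smul, mul_left_comm, ha, mul_one, add_comm]

/-- Conjugation by the symmetry carries `B ⊗ 1` to `1 ⊗ B`, the Koszul sign included because `B` is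
odd. -/
theorem koszul_rTensor_koszul {B : X →ₗ[k] X} (hB : HasDeg 𝒳 𝒳 (-1) B) :
    koszul 𝒳 𝒳 ∘ₗ LinearMap.rTensor X B ∘ₗ koszul 𝒳 𝒳 = TensorProduct.map (sgn 𝒳) B := by
  refine tensor_hom_ext 𝒳 𝒳 fun i x hx j y hy => ?_
  rw [LinearMap.comp_apply, LinearMap.comp_apply, koszul_tmul 𝒳 𝒳 hx hy, map_smul, map_smul,
    LinearMap.rTensor_tmul, koszul_tmul 𝒳 𝒳 (hB hy) hx, map_sgn_tmul B hx, smul_smul, ← sg_add]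
  exact sg_smul_congr (by push_cast; clear * -; grind)

theorem koszul_koszul : koszul 𝒳 𝒳 ∘ₗ koszul 𝒳 𝒳 = LinearMap.id := by
  refine tensor_hom_ext 𝒳 𝒳 fun i x hx j y hy => ?_
  rw [LinearMap.comp_apply, koszul_tmul 𝒳 𝒳 hx hy, map_smul, koszul_tmul 𝒳 𝒳 hy hx, smul_smul,
    mul_comm j, sg_mul_self, one_smul, LinearMap.id_apply]

theorem assoc_oddSum (D B E : X →ₗ[k] X) : (TensorProduct.assoc k X X X).toLinearMap ∘ₗ
      oddSum (tensorGrading 𝒳 𝒳) (oddSum 𝒳 D B) E =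
    oddSum 𝒳 D (oddSum 𝒳 B E) ∘ₗ (TensorProduct.assoc k X X X).toLinearMap := by
  refine TensorProduct.ext (tensor_hom_ext 𝒳 𝒳 fun i x hx j y hy => LinearMap.ext fun z => ?_)
  change TensorProduct.assoc k X X X (oddSum (tensorGrading 𝒳 𝒳) (oddSum 𝒳 D B) E
      ((x ⊗ₜ y) ⊗ₜ z)) =
    oddSum 𝒳 D (oddSum 𝒳 B E) (TensorProduct.assoc k X X X ((x ⊗ₜ y) ⊗ₜ z))
  rw [oddSum_tmul _ _ (tmul_mem_tensorGrading 𝒳 𝒳 hx hy), oddSum_tmul D B hx,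
    TensorProduct.assoc_tmul, oddSum_tmul _ _ hx, oddSum_tmul _ _ hy, TensorProduct.add_tmul,
    ← TensorProduct.smul_tmul', map_add, map_add, map_smul, map_smul, TensorProduct.assoc_tmul,
    TensorProduct.assoc_tmul, TensorProduct.assoc_tmul, TensorProduct.tmul_add,
    TensorProduct.tmul_smul, smul_add, smul_smul, sg_add, add_assoc]

theorem triple_tmul (D : X →ₗ[k] X) {i j : ℤ} {x y : X} (hx : x ∈ 𝒳 i) (hy : y ∈ 𝒳 j) (z : X) :
    oddSum 𝒳 D (oddSum 𝒳 D D) (x ⊗ₜ (y ⊗ₜ z)) = D x ⊗ₜ (y ⊗ₜ z) +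
      sg k i • (x ⊗ₜ[k] (D y ⊗ₜ[k] z)) + sg k (i + j) • (x ⊗ₜ[k] (y ⊗ₜ[k] D z)) := by
  rw [oddSum_tmul _ _ hx, oddSum_tmul D D hy, TensorProduct.tmul_add, TensorProduct.tmul_smul,
    smul_add, smul_smul, sg_add, add_assoc]

theorem oddSum_swap₁₂ (hD : HasDeg 𝒳 𝒳 1 D) :
    oddSum 𝒳 D (oddSum 𝒳 D D) ∘ₗ swap₁₂ 𝒳 = swap₁₂ 𝒳 ∘ₗ oddSum 𝒳 D (oddSum 𝒳 D D) := by
  refine triple_hom_ext 𝒳 fun i x hx j y hy l z _ => ?_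
  have ha := sg_mul_self (k := k) i
  rw [LinearMap.comp_apply, LinearMap.comp_apply, swap₁₂_tmul hx hy, triple_tmul D hx hy,
    map_smul, triple_tmul D hy hx, map_add, map_add, map_smul, map_smul, swap₁₂_tmul (hD hx) hy,
    swap₁₂_tmul hx (hD hy), swap₁₂_tmul hx hy, add_mul, mul_add, mul_one, one_mul, sg_add, sg_add,
    sg_add, sg_add, smul_add, smul_add, smul_smul, smul_smul, smul_smul, smul_smul,
    mul_left_comm (sg k i), ha, mul_one]
  rw [mul_comm (sg k i) (sg k j), mul_comm (sg k (i * j)) (sg k j * sg k i)]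
  abel

theorem lTensor_koszul_oddSum (hD : HasDeg 𝒳 𝒳 1 D) :
    oddSum 𝒳 D (oddSum 𝒳 D D) ∘ₗ LinearMap.lTensor X (koszul 𝒳 𝒳) =
      LinearMap.lTensor X (koszul 𝒳 𝒳) ∘ₗ oddSum 𝒳 D (oddSum 𝒳 D D) := by
  refine tensor_hom_ext 𝒳 (tensorGrading 𝒳 𝒳) fun i x hx j t ht => ?_
  have := LinearMap.congr_fun (oddSum_koszul hD) t
  simp only [LinearMap.comp_apply] at this
  rw [LinearMap.comp_apply, LinearMap.comp_apply, LinearMap.lTensor_tmul, oddSum_tmul _ _ hx,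
    oddSum_tmul _ _ hx, map_add, map_smul, LinearMap.lTensor_tmul, LinearMap.lTensor_tmul, this]

/-- `B ⊗ 1` anticommutes with the summand `D ⊗ 1` by hypothesis, and with `1 ⊗ D'` because both are
odd and act on different factors. -/
theorem rTensor_anticomm {B : X →ₗ[k] X} {D' : Y →ₗ[k] Y} (hB : HasDeg 𝒳 𝒳 (-1) B)
    (h : D ∘ₗ B + B ∘ₗ D = 0) :
    oddSum 𝒳 D D' ∘ₗ LinearMap.rTensor Y B + LinearMap.rTensor Y B ∘ₗ oddSum 𝒳 D D' = 0 := by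
  refine tensor_hom_ext_left 𝒳 fun i x hx y => ?_
  have e : D (B x) + B (D x) = 0 := LinearMap.congr_fun h x
  rw [LinearMap.add_apply, LinearMap.comp_apply, LinearMap.comp_apply, LinearMap.rTensor_tmul,
    oddSum_tmul _ _ hx, oddSum_tmul _ _ (hB hx), map_add, map_smul, LinearMap.rTensor_tmul,
    LinearMap.rTensor_tmul, ← sub_eq_add_neg, sg_sub_one, LinearMap.zero_apply, neg_smul,
    add_add_add_comm, ← TensorProduct.add_tmul, e, TensorProduct.zero_tmul, zero_add,
    neg_add_cancel]

theorem map_sgn_anticomm {B D' : Y →ₗ[k] Y} (hD : HasDeg 𝒳 𝒳 1 D)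
    (h : D' ∘ₗ B + B ∘ₗ D' = 0) :
    oddSum 𝒳 D D' ∘ₗ TensorProduct.map (sgn 𝒳) B +
      TensorProduct.map (sgn 𝒳) B ∘ₗ oddSum 𝒳 D D' = 0 := by
  refine tensor_hom_ext_left 𝒳 fun i x hx y => ?_
  have e : D' (B y) + B (D' y) = 0 := LinearMap.congr_fun h y
  have e' : D' (B y) = -B (D' y) := eq_neg_of_add_eq_zero_left e
  rw [LinearMap.add_apply, LinearMap.comp_apply, LinearMap.comp_apply, map_sgn_tmul B hx,
    oddSum_tmul _ _ hx, map_smul, oddSum_tmul _ _ hx, map_add, map_smul, map_sgn_tmul B hx,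
    map_sgn_tmul B (hD hx), sg_add_one, LinearMap.zero_apply, e', TensorProduct.tmul_neg]
  module

theorem swap₁₂_rTensor {B : X →ₗ[k] X} (hB : HasDeg 𝒳 𝒳 (-1) B) :
    swap₁₂ 𝒳 ∘ₗ TensorProduct.map (sgn 𝒳) (LinearMap.rTensor X B) =
      LinearMap.rTensor (X ⊗[k] X) B ∘ₗ swap₁₂ 𝒳 := by
  refine triple_hom_ext 𝒳 fun i x hx j y hy l z _ => ?_
  rw [LinearMap.comp_apply, LinearMap.comp_apply, map_sgn_tmul _ hx, LinearMap.rTensor_tmul,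
    map_smul, swap₁₂_tmul hx (hB hy), swap₁₂_tmul hx hy, map_smul, LinearMap.rTensor_tmul,
    smul_smul, ← sg_add]
  exact sg_smul_congr (by push_cast; clear * -; grind)

theorem swap₁₂_map_sgn (B : X →ₗ[k] X) :
    swap₁₂ 𝒳 ∘ₗ TensorProduct.map (sgn 𝒳) (TensorProduct.map (sgn 𝒳) B) =
      TensorProduct.map (sgn 𝒳) (TensorProduct.map (sgn 𝒳) B) ∘ₗ swap₁₂ 𝒳 := by
  refine triple_hom_ext 𝒳 fun i x hx j y hy l z _ => ?_
  rw [LinearMap.comp_apply, LinearMap.comp_apply, map_sgn_tmul _ hx, map_sgn_tmul _ hy,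
    TensorProduct.tmul_smul, map_smul, map_smul, swap₁₂_tmul hx hy, swap₁₂_tmul hx hy, map_smul,
    map_sgn_tmul _ hy, map_sgn_tmul _ hx, TensorProduct.tmul_smul, smul_smul, smul_smul,
    smul_smul, smul_smul]
  congr 1; ring

theorem swap₁₂_assoc : swap₁₂ 𝒳 ∘ₗ (TensorProduct.assoc k X X X).toLinearMap =
    (TensorProduct.assoc k X X X).toLinearMap ∘ₗ LinearMap.rTensor X (koszul 𝒳 𝒳) := by
  rw [swap₁₂, LinearMap.comp_assoc, LinearMap.comp_assoc, LinearEquiv.symm_comp,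
    LinearMap.comp_id]

end Signs

/-! ### Commutators of the total differential with a map on one factor. -/

section Leibniz

variable {k : Type*} [Field k] {C : Type*} [AddCommGroup C] [Module k C]
  {𝒞 : ℤ → Submodule k C} [DirectSum.Decomposition 𝒞] {D : C →ₗ[k] C}

/-- The parts of the differential on the other factor cancel, so the graded commutator with `f ⊗ 1`
is `[D, f] ⊗ 1`. -/
theorem oddSum_rTensor {e : ℤ} {f : C →ₗ[k] C ⊗[k] C} (hf : HasDeg 𝒞 (tensorGrading 𝒞 𝒞) e f) :
    oddSum 𝒞 D (oddSum 𝒞 D D) ∘ₗ (TensorProduct.assoc k C C C).toLinearMap ∘ₗ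
        LinearMap.rTensor C f -
      sg k e • ((TensorProduct.assoc k C C C).toLinearMap ∘ₗ LinearMap.rTensor C f ∘ₗ
        oddSum 𝒞 D D) =
    (TensorProduct.assoc k C C C).toLinearMap ∘ₗ
      LinearMap.rTensor C (oddSum 𝒞 D D ∘ₗ f - sg k e • (f ∘ₗ D)) := by
  rw [← LinearMap.comp_assoc, ← assoc_oddSum, LinearMap.comp_assoc, ← LinearMap.comp_smul,
    ← LinearMap.comp_sub]
  congr 1
  refine tensor_hom_ext 𝒞 𝒞 fun i x hx j y _ => ?_
  rw [LinearMap.sub_apply, LinearMap.smul_apply, LinearMap.comp_apply, LinearMap.comp_apply,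
    LinearMap.rTensor_tmul, LinearMap.rTensor_tmul, oddSum_tmul _ _ (hf hx), oddSum_tmul _ _ hx,
    map_add, map_smul, LinearMap.rTensor_tmul, LinearMap.rTensor_tmul, LinearMap.sub_apply,
    LinearMap.smul_apply, LinearMap.comp_apply, LinearMap.comp_apply, TensorProduct.sub_tmul,
    ← TensorProduct.smul_tmul', sg_add]
  module

/-- Here `1 ⊗ f` carries no Koszul sign and the commutator is the ungraded one, as suits maps of
even degree. The sign on the right is that of the odd map `D f - f D`. -/
theorem oddSum_lTensor (f : C →ₗ[k] C ⊗[k] C) :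
    oddSum 𝒞 D (oddSum 𝒞 D D) ∘ₗ LinearMap.lTensor C f - LinearMap.lTensor C f ∘ₗ oddSum 𝒞 D D =
      TensorProduct.map (sgn 𝒞) (oddSum 𝒞 D D ∘ₗ f - f ∘ₗ D) := by
  refine tensor_hom_ext 𝒞 𝒞 fun i x hx j y _ => ?_
  rw [LinearMap.sub_apply, LinearMap.comp_apply, LinearMap.comp_apply, LinearMap.lTensor_tmul,
    oddSum_tmul _ _ hx, oddSum_tmul _ _ hx, map_sgn_tmul _ hx, map_add, map_smul,
    LinearMap.lTensor_tmul, LinearMap.lTensor_tmul, LinearMap.sub_apply, LinearMap.comp_apply,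
    LinearMap.comp_apply, TensorProduct.tmul_sub]
  module

theorem rTensor_assoc_rTensor (B : C →ₗ[k] C) : (TensorProduct.assoc k C C C).toLinearMap ∘ₗ
      LinearMap.rTensor C (LinearMap.rTensor C B) =
    LinearMap.rTensor (C ⊗[k] C) B ∘ₗ (TensorProduct.assoc k C C C).toLinearMap :=
  TensorProduct.ext_threefold fun _ _ _ => rfl

theorem rTensor_assoc_map (B : C →ₗ[k] C) : (TensorProduct.assoc k C C C).toLinearMap ∘ₗ
      LinearMap.rTensor C (TensorProduct.map (sgn 𝒞) B) =
    TensorProduct.map (sgn 𝒞) (LinearMap.rTensor C B) ∘ₗ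
      (TensorProduct.assoc k C C C).toLinearMap :=
  TensorProduct.ext_threefold fun _ _ _ => rfl

end Leibniz

theorem map_sub_right {k : Type*} [Field k] {X Y Z W : Type*} [AddCommGroup X] [Module k X]
    [AddCommGroup Y] [Module k Y] [AddCommGroup Z] [Module k Z] [AddCommGroup W] [Module k W]
    (f : X →ₗ[k] Y) (g g' : Z →ₗ[k] W) :
    TensorProduct.map f (g - g') = TensorProduct.map f g - TensorProduct.map f g' :=
  TensorProduct.ext' fun _ _ => TensorProduct.tmul_sub _ _ _

/-! ### From the cobracket to the coBV relation. -/

section CoBV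

variable {k : Type*} [Field k] {C : Type*} [AddCommGroup C] [Module k C]
  {𝒞 : ℤ → Submodule k C} [DirectSum.Decomposition 𝒞] {D B : C →ₗ[k] C}
  {θ g S : C →ₗ[k] C ⊗[k] C} {K : C →ₗ[k] C ⊗[k] (C ⊗[k] C)}

/-- The failure of `B` to be a coderivation is homotopic to the cobracket `g + τ g`. -/
theorem coderivation_homotopy (hD : HasDeg 𝒞 𝒞 1 D) (hB : HasDeg 𝒞 𝒞 (-1) B)
    (D_B : D ∘ₗ B + B ∘ₗ D = 0)
    (g_eq : g ∘ₗ D + oddSum 𝒞 D D ∘ₗ g = θ - koszul 𝒞 𝒞 ∘ₗ θ)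
    {Q : C →ₗ[k] C ⊗[k] C} (Q_eq : Q = oddSum 𝒞 D D ∘ₗ S - S ∘ₗ D + g +
      LinearMap.rTensor C B ∘ₗ koszul 𝒞 𝒞 ∘ₗ θ)
    (S_eq : θ ∘ₗ B = Q + koszul 𝒞 𝒞 ∘ₗ Q) :
    oddSum 𝒞 D D ∘ₗ (S + koszul 𝒞 𝒞 ∘ₗ S + LinearMap.rTensor C B ∘ₗ g) -
        (S + koszul 𝒞 𝒞 ∘ₗ S + LinearMap.rTensor C B ∘ₗ g) ∘ₗ D =
      θ ∘ₗ B - (g + koszul 𝒞 𝒞 ∘ₗ g) -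
        (LinearMap.rTensor C B ∘ₗ θ + TensorProduct.map (sgn 𝒞) B ∘ₗ θ) := by
  refine LinearMap.ext fun x => ?_
  have e1 := LinearMap.congr_fun S_eq x
  -- In `Q + τ Q` the `τ`-conjugate of `(B ⊗ 1)τθ` is already `(1 ⊗ B)θ`. The unconjugated copy must
  -- be replaced by `(B ⊗ 1)θ`, and this is what `B ⊗ 1` applied to the homotopy `g` achieves.
  have e2 := congrArg (LinearMap.rTensor C B) (LinearMap.congr_fun g_eq x)
  have e3 := LinearMap.congr_fun (oddSum_koszul hD) (S x)
  have e4 := LinearMap.congr_fun (rTensor_anticomm (D' := D) hB D_B) (g x)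
  have e5 := LinearMap.congr_fun (koszul_rTensor_koszul hB) (θ x)
  rw [Q_eq] at e1
  simp only [LinearMap.add_apply, LinearMap.sub_apply, LinearMap.comp_apply, map_add, map_sub,
    LinearMap.zero_apply] at e1 e2 e3 e4 e5 ⊢
  rw [e1, ← e5, e3, eq_neg_of_add_eq_zero_left e4, eq_sub_of_add_eq' e2]
  abel

variable {H : C →ₗ[k] C ⊗[k] C}

theorem oddSum_lTensor_chain (θ_D : θ ∘ₗ D = oddSum 𝒞 D D ∘ₗ θ) (t : C ⊗[k] C) :
    oddSum 𝒞 D (oddSum 𝒞 D D) (LinearMap.lTensor C θ t) =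
      LinearMap.lTensor C θ (oddSum 𝒞 D D t) := by
  have e1 := oddSum_lTensor (𝒞 := 𝒞) (D := D) θ
  rw [← θ_D, sub_self, TensorProduct.map_zero_right, sub_eq_zero] at e1
  exact LinearMap.congr_fun e1 t

/-- The defect of `B` as a coderivation, followed by a further coproduct on the right factor. This
and the next two lemmas are the three places where the defect enters the coBV relation. -/
theorem lTensor_homotopy (θ_D : θ ∘ₗ D = oddSum 𝒞 D D ∘ₗ θ)
    (H_eq : oddSum 𝒞 D D ∘ₗ H - H ∘ₗ D = θ ∘ₗ B - (g + koszul 𝒞 𝒞 ∘ₗ g) -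
        (LinearMap.rTensor C B ∘ₗ θ + TensorProduct.map (sgn 𝒞) B ∘ₗ θ)) (x : C) :
    oddSum 𝒞 D (oddSum 𝒞 D D) (LinearMap.lTensor C θ (H x)) - LinearMap.lTensor C θ (H (D x)) =
      LinearMap.lTensor C θ (θ (B x)) - LinearMap.lTensor C θ (g x) -
      LinearMap.lTensor C θ (koszul 𝒞 𝒞 (g x)) -
      LinearMap.rTensor (C ⊗[k] C) B (LinearMap.lTensor C θ (θ x)) -
      TensorProduct.map (sgn 𝒞) (θ ∘ₗ B) (θ x) := by
  have e2 := congrArg (LinearMap.lTensor C θ) (LinearMap.congr_fun H_eq x)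
  have e3 : LinearMap.lTensor C θ ∘ₗ LinearMap.rTensor C B =
      LinearMap.rTensor (C ⊗[k] C) B ∘ₗ LinearMap.lTensor C θ := by
    rw [LinearMap.lTensor_comp_rTensor, LinearMap.rTensor_comp_lTensor]
  have e4 : LinearMap.lTensor C θ ∘ₗ TensorProduct.map (sgn 𝒞) B =
      TensorProduct.map (sgn 𝒞) (θ ∘ₗ B) := by
    rw [LinearMap.lTensor, ← TensorProduct.map_comp, LinearMap.id_comp]
  replace e3 := LinearMap.congr_fun e3 (θ x)
  replace e4 := LinearMap.congr_fun e4 (θ x)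
  simp only [LinearMap.add_apply, LinearMap.sub_apply, LinearMap.comp_apply, map_add,
    map_sub] at e2 e3 e4
  rw [oddSum_lTensor_chain θ_D, e2, e3, e4]
  abel

theorem rTensor_homotopy (hH : HasDeg 𝒞 (tensorGrading 𝒞 𝒞) (-2) H)
    (θ_D : θ ∘ₗ D = oddSum 𝒞 D D ∘ₗ θ)
    (coassoc : (TensorProduct.assoc k C C C).toLinearMap ∘ₗ LinearMap.rTensor C θ ∘ₗ θ =
      LinearMap.lTensor C θ ∘ₗ θ)
    (H_eq : oddSum 𝒞 D D ∘ₗ H - H ∘ₗ D = θ ∘ₗ B - (g + koszul 𝒞 𝒞 ∘ₗ g) -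
        (LinearMap.rTensor C B ∘ₗ θ + TensorProduct.map (sgn 𝒞) B ∘ₗ θ)) (x : C) :
    oddSum 𝒞 D (oddSum 𝒞 D D) (TensorProduct.assoc k C C C (LinearMap.rTensor C H (θ x))) -
        TensorProduct.assoc k C C C (LinearMap.rTensor C H (θ (D x))) =
      TensorProduct.assoc k C C C (LinearMap.rTensor C (θ ∘ₗ B) (θ x)) -
      TensorProduct.assoc k C C C (LinearMap.rTensor C g (θ x)) -
      TensorProduct.assoc k C C C (LinearMap.rTensor C (koszul 𝒞 𝒞 ∘ₗ g) (θ x)) -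
      LinearMap.rTensor (C ⊗[k] C) B (LinearMap.lTensor C θ (θ x)) -
      TensorProduct.map (sgn 𝒞) (LinearMap.rTensor C B) (LinearMap.lTensor C θ (θ x)) := by
  have e1 := oddSum_rTensor (D := D) hH
  rw [show sg k (-2) = 1 by simp [sg], one_smul, one_smul, H_eq] at e1
  replace e1 := LinearMap.congr_fun e1 (θ x)
  have e2 : oddSum 𝒞 D D (θ x) = θ (D x) := (LinearMap.congr_fun θ_D x).symm
  have e3 := LinearMap.congr_fun (rTensor_assoc_rTensor B) (LinearMap.rTensor C θ (θ x))
  have e4 := LinearMap.congr_fun (rTensor_assoc_map (𝒞 := 𝒞) B) (LinearMap.rTensor C θ (θ x))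
  have e5 := LinearMap.congr_fun coassoc x
  simp only [LinearMap.rTensor_sub, LinearMap.rTensor_add, LinearMap.add_apply,
    LinearMap.sub_apply, LinearMap.comp_apply, map_add, map_sub, LinearEquiv.coe_coe,
    LinearMap.rTensor_comp C (LinearMap.rTensor C B),
    LinearMap.rTensor_comp C (TensorProduct.map (sgn 𝒞) B)] at e1 e3 e4 e5
  rw [e2, e3, e4, e5] at e1
  rw [e1]
  abel

/-- The defect on the right factor, moved past the left one. The terms with `B` now act on permuted
factors of `θ⁽³⁾`. -/
theorem swap_homotopy (hD : HasDeg 𝒞 𝒞 1 D) (hB : HasDeg 𝒞 𝒞 (-1) B)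
    (θ_D : θ ∘ₗ D = oddSum 𝒞 D D ∘ₗ θ)
    (H_eq : oddSum 𝒞 D D ∘ₗ H - H ∘ₗ D = θ ∘ₗ B - (g + koszul 𝒞 𝒞 ∘ₗ g) -
        (LinearMap.rTensor C B ∘ₗ θ + TensorProduct.map (sgn 𝒞) B ∘ₗ θ)) (x : C) :
    oddSum 𝒞 D (oddSum 𝒞 D D) (swap₁₂ 𝒞 (LinearMap.lTensor C H (θ x))) -
        swap₁₂ 𝒞 (LinearMap.lTensor C H (θ (D x))) =
      swap₁₂ 𝒞 (TensorProduct.map (sgn 𝒞) (θ ∘ₗ B) (θ x)) -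
      swap₁₂ 𝒞 (TensorProduct.map (sgn 𝒞) g (θ x)) -
      swap₁₂ 𝒞 (TensorProduct.map (sgn 𝒞) (koszul 𝒞 𝒞 ∘ₗ g) (θ x)) -
      LinearMap.rTensor (C ⊗[k] C) B (swap₁₂ 𝒞 (LinearMap.lTensor C θ (θ x))) -
      TensorProduct.map (sgn 𝒞) (TensorProduct.map (sgn 𝒞) B)
        (swap₁₂ 𝒞 (LinearMap.lTensor C θ (θ x))) := by
  have e1 := oddSum_lTensor (𝒞 := 𝒞) (D := D) H
  rw [H_eq] at e1
  replace e1 := congrArg (swap₁₂ 𝒞) (LinearMap.congr_fun e1 (θ x))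
  have e2 : oddSum 𝒞 D D (θ x) = θ (D x) := (LinearMap.congr_fun θ_D x).symm
  have e3 := LinearMap.congr_fun (swap₁₂_rTensor hB) (LinearMap.lTensor C θ (θ x))
  have e4 := LinearMap.congr_fun (swap₁₂_map_sgn (𝒳 := 𝒞) B) (LinearMap.lTensor C θ (θ x))
  have e5 := LinearMap.congr_fun (oddSum_swap₁₂ hD) (LinearMap.lTensor C H (θ x))
  have e6 (f : C ⊗[k] C →ₗ[k] C ⊗[k] C) : TensorProduct.map (sgn 𝒞) (f ∘ₗ θ) =
      TensorProduct.map (sgn 𝒞) f ∘ₗ LinearMap.lTensor C θ := by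
    rw [LinearMap.lTensor, ← TensorProduct.map_comp, LinearMap.comp_id]
  simp only [map_sub_right, TensorProduct.map_add_right, LinearMap.add_apply,
    LinearMap.sub_apply, map_add, map_sub, e6 (LinearMap.rTensor C B),
    e6 (TensorProduct.map (sgn 𝒞) B), LinearMap.comp_apply] at e1 e3 e4 e5
  rw [e2, e3, e4] at e1
  rw [e5, e1]
  abel

/-- `g ⊗ 1` after `θ` is a homotopy exchanging the first two factors of `θ⁽³⁾`. -/
theorem commutator_homotopy (hg : HasDeg 𝒞 (tensorGrading 𝒞 𝒞) (-1) g)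
    (θ_D : θ ∘ₗ D = oddSum 𝒞 D D ∘ₗ θ)
    (coassoc : (TensorProduct.assoc k C C C).toLinearMap ∘ₗ LinearMap.rTensor C θ ∘ₗ θ =
      LinearMap.lTensor C θ ∘ₗ θ)
    (g_eq : g ∘ₗ D + oddSum 𝒞 D D ∘ₗ g = θ - koszul 𝒞 𝒞 ∘ₗ θ) (x : C) :
    oddSum 𝒞 D (oddSum 𝒞 D D) (TensorProduct.assoc k C C C (LinearMap.rTensor C g (θ x))) +
        TensorProduct.assoc k C C C (LinearMap.rTensor C g (θ (D x))) =
      LinearMap.lTensor C θ (θ x) - swap₁₂ 𝒞 (LinearMap.lTensor C θ (θ x)) := by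
  have e1 := oddSum_rTensor (D := D) hg
  have e0 : ∀ f : C →ₗ[k] C ⊗[k] C, sg k (-1) • f = -f := fun f => by
    rw [show sg k (-1) = -1 by simp [sg]]; module
  have e0' : ∀ f : C ⊗[k] C →ₗ[k] C ⊗[k] (C ⊗[k] C), sg k (-1) • f = -f := fun f => by
    rw [show sg k (-1) = -1 by simp [sg]]; module
  rw [e0, e0', sub_neg_eq_add, sub_neg_eq_add, add_comm (oddSum 𝒞 D D ∘ₗ g), g_eq] at e1
  replace e1 := LinearMap.congr_fun e1 (θ x)
  have e2 : oddSum 𝒞 D D (θ x) = θ (D x) := (LinearMap.congr_fun θ_D x).symm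
  have e3 := LinearMap.congr_fun (swap₁₂_assoc (𝒳 := 𝒞)) (LinearMap.rTensor C θ (θ x))
  have e5 := LinearMap.congr_fun coassoc x
  simp only [LinearMap.rTensor_sub, LinearMap.rTensor_comp C (koszul 𝒞 𝒞), LinearMap.add_apply,
    LinearMap.sub_apply, LinearMap.comp_apply, map_sub, LinearEquiv.coe_coe] at e1 e3 e5
  rw [e2, ← e3, e5] at e1
  exact e1

variable {K : C →ₗ[k] C ⊗[k] (C ⊗[k] C)}

/-- Subtracting from the defect of `B` after a coproduct its contributions on the two factors
cancels all cobracket terms, by `K` for `g` and strictly for `τ g`. What is left differs from the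
relation by `B ⊗ 1 ⊗ 1 + 1 ⊗ 1 ⊗ B` applied to `θ⁽³⁾` with its first two factors exchanged rather
than to `θ⁽³⁾`; the last summand of the homotopy repairs this. -/
theorem coBV_homotopy (hD : HasDeg 𝒞 𝒞 1 D) (hB : HasDeg 𝒞 𝒞 (-1) B)
    (hg : HasDeg 𝒞 (tensorGrading 𝒞 𝒞) (-1) g) (hH : HasDeg 𝒞 (tensorGrading 𝒞 𝒞) (-2) H)
    (D_B : D ∘ₗ B + B ∘ₗ D = 0) (θ_D : θ ∘ₗ D = oddSum 𝒞 D D ∘ₗ θ)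
    (coassoc : (TensorProduct.assoc k C C C).toLinearMap ∘ₗ LinearMap.rTensor C θ ∘ₗ θ =
      LinearMap.lTensor C θ ∘ₗ θ)
    (g_eq : g ∘ₗ D + oddSum 𝒞 D D ∘ₗ g = θ - koszul 𝒞 𝒞 ∘ₗ θ)
    (H_eq : oddSum 𝒞 D D ∘ₗ H - H ∘ₗ D = θ ∘ₗ B - (g + koszul 𝒞 𝒞 ∘ₗ g) -
        (LinearMap.rTensor C B ∘ₗ θ + TensorProduct.map (sgn 𝒞) B ∘ₗ θ))
    (K_eq : oddSum 𝒞 D (oddSum 𝒞 D D) ∘ₗ K - K ∘ₗ D = LinearMap.lTensor C θ ∘ₗ g -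
      (TensorProduct.assoc k C C C).toLinearMap ∘ₗ LinearMap.rTensor C g ∘ₗ θ -
      swap₁₂ 𝒞 ∘ₗ TensorProduct.map (sgn 𝒞) g ∘ₗ θ)
    (g_coprod : LinearMap.lTensor C θ ∘ₗ koszul 𝒞 𝒞 ∘ₗ g =
      swap₁₂ 𝒞 ∘ₗ TensorProduct.map (sgn 𝒞) (koszul 𝒞 𝒞 ∘ₗ g) ∘ₗ θ +
      (TensorProduct.assoc k C C C).toLinearMap ∘ₗ LinearMap.rTensor C (koszul 𝒞 𝒞 ∘ₗ g) ∘ₗ θ) :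
    oddSum 𝒞 D (oddSum 𝒞 D D) ∘ₗ (LinearMap.lTensor C θ ∘ₗ H -
        (TensorProduct.assoc k C C C).toLinearMap ∘ₗ LinearMap.rTensor C H ∘ₗ θ -
        swap₁₂ 𝒞 ∘ₗ LinearMap.lTensor C H ∘ₗ θ + K -
        (LinearMap.rTensor (C ⊗[k] C) B + TensorProduct.map (sgn 𝒞) (TensorProduct.map (sgn 𝒞) B))
          ∘ₗ (TensorProduct.assoc k C C C).toLinearMap ∘ₗ LinearMap.rTensor C g ∘ₗ θ) -
      (LinearMap.lTensor C θ ∘ₗ H -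
        (TensorProduct.assoc k C C C).toLinearMap ∘ₗ LinearMap.rTensor C H ∘ₗ θ -
        swap₁₂ 𝒞 ∘ₗ LinearMap.lTensor C H ∘ₗ θ + K -
        (LinearMap.rTensor (C ⊗[k] C) B + TensorProduct.map (sgn 𝒞) (TensorProduct.map (sgn 𝒞) B))
          ∘ₗ (TensorProduct.assoc k C C C).toLinearMap ∘ₗ LinearMap.rTensor C g ∘ₗ θ) ∘ₗ D =
      LinearMap.lTensor C θ ∘ₗ θ ∘ₗ B -
      ((TensorProduct.assoc k C C C).toLinearMap ∘ₗ LinearMap.rTensor C (θ ∘ₗ B) ∘ₗ θ +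
        TensorProduct.map (sgn 𝒞) (θ ∘ₗ B) ∘ₗ θ +
        swap₁₂ 𝒞 ∘ₗ TensorProduct.map (sgn 𝒞) (θ ∘ₗ B) ∘ₗ θ -
        oddSum 𝒞 B (oddSum 𝒞 B B) ∘ₗ LinearMap.lTensor C θ ∘ₗ θ) := by
  refine LinearMap.ext fun x => ?_
  have a1 := lTensor_homotopy θ_D H_eq x
  have a2 := rTensor_homotopy hH θ_D coassoc H_eq x
  have a3 := swap_homotopy hD hB θ_D H_eq x
  have a4 := LinearMap.congr_fun K_eq x
  have a5 := commutator_homotopy hg θ_D coassoc g_eq x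
  have a6 := LinearMap.congr_fun g_coprod x
  -- `B` on the first or the third factor anticommutes with the total differential, so it can be
  -- applied to the exchange homotopy of `commutator_homotopy`.
  have b1 := LinearMap.congr_fun (rTensor_anticomm (D' := oddSum 𝒞 D D) hB D_B)
    (TensorProduct.assoc k C C C (LinearMap.rTensor C g (θ x)))
  have b3 := LinearMap.congr_fun (map_sgn_anticomm hD (map_sgn_anticomm (𝒳 := 𝒞) hD D_B))
    (TensorProduct.assoc k C C C (LinearMap.rTensor C g (θ x)))
  have b4 : oddSum 𝒞 B (oddSum 𝒞 B B) (LinearMap.lTensor C θ (θ x)) =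
      LinearMap.rTensor (C ⊗[k] C) B (LinearMap.lTensor C θ (θ x)) +
      (TensorProduct.map (sgn 𝒞) (LinearMap.rTensor C B) (LinearMap.lTensor C θ (θ x)) +
      TensorProduct.map (sgn 𝒞) (TensorProduct.map (sgn 𝒞) B) (LinearMap.lTensor C θ (θ x))) := by
    rw [oddSum, oddSum, TensorProduct.map_add_right]
    rfl
  simp only [LinearMap.add_apply, LinearMap.sub_apply, LinearMap.comp_apply, map_add, map_sub,
    LinearEquiv.coe_coe, LinearMap.zero_apply] at a4 a6 b1 b3 ⊢
  rw [eq_sub_of_add_eq a5, map_sub, map_sub] at b1 b3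
  rw [b4, ← sub_eq_zero] 
  rw [← sub_eq_zero] at a1 a2 a3 a4 a6
  have := congrArg₂ (· + ·) (congrArg₂ (· - ·) (congrArg₂ (· - ·) a1 a2) a3)
    (congrArg₂ (· - ·) (congrArg₂ (· + ·) a4 (neg_eq_zero.2 a6)) (congrArg₂ (· + ·) b1 b3))
  simp only [add_zero, sub_zero] at this
  rw [← this]
  abel

end CoBV

/-! ### Membership of signed sums over splittings in a submodule. -/

section Membership

variable {k : Type*} [Field k] {X Y : Type*} [AddCommGroup Y] [Module k Y] (S : Submodule k Y)

theorem splitSum_mem {Φ : List X → List X → Y} {l : List X}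
    (h : ∀ u v, u ++ v = l → Φ u v ∈ S) : splitSum Φ l ∈ S := by
  induction l generalizing Φ with
  | nil => exact h [] [] rfl
  | cons x l ih => exact add_mem (h [] _ rfl) (ih fun u v e => h _ _ (by rw [← e]; rfl))

theorem onHead_mem {Φ : X → List X → Y} {l : List X} (h : ∀ x u, x :: u = l → Φ x u ∈ S) :
    onHead Φ l ∈ S := by
  cases l with
  | nil => exact zero_mem _
  | cons x l => exact h _ _ rfl

theorem onLast_mem {Φ : List X → X → Y} {l : List X} (h : ∀ u x, u ++ [x] = l → Φ u x ∈ S) :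
    onLast Φ l ∈ S := by
  induction l using List.reverseRecOn with
  | nil => exact zero_mem _
  | append_singleton l x => rw [onLast_append]; exact h _ _ rfl

end Membership

/-! ### Degrees of the combinatorial operations. -/

section Degrees

variable {k : Type*} [Field k] {A : Type*} [Ring A] [Algebra k A]
  {𝒜 : ℤ → Submodule k A} [GradedAlgebra 𝒜] {m : ℤ}
  {Y : Type*} [AddCommGroup Y] [Module k Y] (S : Submodule k Y)
  (F : OpenFrobenius 𝒜 m)

theorem bar_mem {G : List (Letter 𝒜) → Y} {l : List (Letter 𝒜)}
    (h : ∀ l', wd l' = wd l + 1 → G l' ∈ S) : bar F G l ∈ S := by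
  induction l generalizing G with
  | nil => exact zero_mem _
  | cons x l ih =>
    refine sub_mem (sub_mem (neg_mem (h _ ?_)) (S.smul_mem _ (onHead_mem S fun y l' e => h _ ?_)))
      (S.smul_mem _ (ih fun l' e => h _ ?_))
    · simp; ring
    · rw [← e]; simp; ring
    · simp [e]; ring

theorem cyc_mem {Ψ : Letter 𝒜 → List (Letter 𝒜) → Y} {a : Letter 𝒜} {l : List (Letter 𝒜)}
    (h : ∀ (a' : Letter 𝒜) l', a'.deg + wd l' = a.deg + wd l + 1 → Ψ a' l' ∈ S) :
    cyc F Ψ a l ∈ S := by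
  refine sub_mem (add_mem (add_mem (h _ _ ?_) (S.smul_mem _ (bar_mem S F fun l' e => h _ _ ?_)))
    (S.smul_mem _ (onHead_mem S fun x l' e => h _ _ ?_)))
    (onLast_mem S fun l' x e => S.smul_mem _ (h _ _ ?_))
  · simp; ring
  · rw [e]; ring
  · rw [← e]; simp; ring
  · rw [← e]; simp; ring

variable {F} (E : Casimir F)

theorem coprod_mem {Φ : Letter 𝒜 → List (Letter 𝒜) → Letter 𝒜 → List (Letter 𝒜) → Y}
    {a : Letter 𝒜} {l : List (Letter 𝒜)}
    (h : ∀ (p : Letter 𝒜) u (q : Letter 𝒜) v,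
      p.deg + wd u + (q.deg + wd v) = a.deg + wd l + m → Φ p u q v ∈ S) :
    coprod E Φ a l ∈ S :=
  splitSum_mem S fun u v e => sum_mem fun s _ => S.smul_mem _ (h _ _ _ _ (by
    rw [← e, wd_append, Letter.mul_deg, E.q_deg]; ring))

theorem ins_mem {Φ : List (Letter 𝒜) → Letter 𝒜 → List (Letter 𝒜) → Letter 𝒜 →
      List (Letter 𝒜) → Y} {l : List (Letter 𝒜)}
    (h : ∀ u (p : Letter 𝒜) w (q : Letter 𝒜) v,
      wd (u ++ p :: w) + (q.deg + wd v) = wd l + m - 1 → Φ u p w q v ∈ S) :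
    ins E Φ l ∈ S :=
  splitSum_mem S fun u r e => splitSum_mem S fun v w e' => sum_mem fun s _ =>
    S.smul_mem _ (h _ _ _ _ _ (by
      rw [← e, ← e', wd_append, wd_append, wd_append, wd_cons, E.q_deg]; ring))

theorem comm_mem {Ψ : Letter 𝒜 → List (Letter 𝒜) → Letter 𝒜 → List (Letter 𝒜) → Y}
    {a : Letter 𝒜} {l : List (Letter 𝒜)}
    (h : ∀ l' (q : Letter 𝒜) v, wd l' + (q.deg + wd v) = wd l + m - 1 → Ψ a l' q v ∈ S) :
    comm E Ψ a l ∈ S :=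
  neg_mem (S.smul_mem _ (ins_mem S E fun _ _ _ _ _ e => h _ _ _ e))

theorem rot_mem {G : List (Letter 𝒜) → Y} {a : Letter 𝒜} {l : List (Letter 𝒜)}
    (h : ∀ l', wd l' = a.deg + wd l - 1 → G l' ∈ S) : rot G a l ∈ S :=
  splitSum_mem S fun u v e => S.smul_mem _ (h _ (by
    rw [← e, wd_append, wd_append, wd_cons]; ring))

theorem rotIns_mem {G : List (Letter 𝒜) → Letter 𝒜 → List (Letter 𝒜) → Y} {a : Letter 𝒜}
    {l : List (Letter 𝒜)}
    (h : ∀ l' (q : Letter 𝒜) v, wd l' + (q.deg + wd v) = a.deg + wd l + m - 2 → G l' q v ∈ S) :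
    rotIns E G a l ∈ S :=
  splitSum_mem S fun r y e => S.smul_mem _ (ins_mem S E fun u p w q v e' => h _ _ _ (by
    rw [← e, wd_append, wd_append, wd_cons]; linarith))

theorem brace_mem {Θ : List (Letter 𝒜) → Letter 𝒜 → List (Letter 𝒜) → Letter 𝒜 →
      List (Letter 𝒜) → Y} {l : List (Letter 𝒜)}
    (h : ∀ l' (q' : Letter 𝒜) v' (q : Letter 𝒜) v,
      wd l' + (q'.deg + wd v') + (q.deg + wd v) = wd l + 2 * m - 2 → Θ l' q' v' q v ∈ S) :
    brace E Θ l ∈ S :=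
  ins_mem S E fun u p r q v e => S.smul_mem _ (ins_mem S E fun u' p' w' q' v' e' =>
    h _ _ _ _ _ (by
      simp only [wd_append, wd_cons] at e e' ⊢; linarith))

end Degrees

/-! ### Degrees of the operators on chains. -/

section Operators

variable {k : Type*} [Field k] {A : Type*} [Ring A] [Algebra k A]
  {𝒜 : ℤ → Submodule k A} [GradedAlgebra 𝒜] {m : ℤ}
  {Y : Type*} [AddCommGroup Y] [Module k Y] {𝒴 : ℤ → Submodule k Y}
  {F : OpenFrobenius 𝒜 m} (E : Casimir F)

theorem hasDeg_of_chain {e : ℤ} {f : Chain k A →ₗ[k] Y}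
    (h : ∀ (a : Letter 𝒜) l, f (chain a l) ∈ 𝒴 (a.deg + wd l - m + e)) :
    HasDeg (shift (chainGrading 𝒜) m) 𝒴 e f := fun n x hx =>
  map_mem_of_chain f (𝒴 (n + e)) (fun a l e' => by
    have := h a l
    rwa [e', add_sub_cancel_right] at this) hx

theorem chain_tmul_mem {n : ℤ} (p q : Letter 𝒜) (u v : List (Letter 𝒜))
    (h : p.deg + wd u + (q.deg + wd v) = n + 2 * m) : chain p u ⊗ₜ[k] chain q v ∈
      tensorGrading (shift (chainGrading 𝒜) m) (shift (chainGrading 𝒜) m) n := by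
  have := tmul_mem_tensorGrading _ _ (chain_mem_shift m p u) (chain_mem_shift m q v)
  rwa [show p.deg + wd u - m + (q.deg + wd v - m) = n by linarith] at this

theorem hasDeg_chainDiff :
    HasDeg (shift (chainGrading 𝒜) m) (shift (chainGrading 𝒜) m) 1 (chainDiff 𝒜 F.d) :=
  hasDeg_of_chain fun a l => by
    rw [chainDiff_chain]
    refine cyc_mem _ F fun a' l' e => ?_
    have := chain_mem_shift m a' l'
    rwa [show a'.deg + wd l' - m = a.deg + wd l - m + 1 by linarith] at this

theorem hasDeg_connes :
    HasDeg (shift (chainGrading 𝒜) m) (shift (chainGrading 𝒜) m) (-1) (connes 𝒜) :=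
  hasDeg_of_chain fun a l => by
    rw [connes_chain']
    refine rot_mem _ fun l' e => ?_
    have := chain_mem_shift m (1 : Letter 𝒜) l'
    rwa [show (1 : Letter 𝒜).deg + wd l' - m = a.deg + wd l - m + -1 by
      rw [Letter.one_deg]; linarith] at this

theorem hasDeg_shiftedCoproduct : HasDeg (shift (chainGrading 𝒜) m)
    (tensorGrading (shift (chainGrading 𝒜) m) (shift (chainGrading 𝒜) m)) 0
      (shiftedCoproduct F) := by
  obtain ⟨E⟩ := exists_casimir F
  refine hasDeg_of_chain fun a l => ?_
  rw [shiftedCoproduct_chain' E]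
  exact coprod_mem _ E fun p u q v e => chain_tmul_mem p q u v (by linarith)

theorem hasDeg_commHomotopy : HasDeg (shift (chainGrading 𝒜) m)
    (tensorGrading (shift (chainGrading 𝒜) m) (shift (chainGrading 𝒜) m)) (-1)
      (commHomotopy E) := by
  refine hasDeg_of_chain fun a l => ?_
  rw [commHomotopy_chain']
  exact comm_mem _ E fun u q v e => chain_tmul_mem a q u v (by linarith)

theorem rotationHomotopy_chain' (a : Letter 𝒜) (l : List (Letter 𝒜)) :
    rotationHomotopy E (chain a l) =
      rotIns E (fun u q v => chain (1 : Letter 𝒜) u ⊗ₜ[k] chain q v) a l :=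
  rotationHomotopy_chain E a l

theorem hasDeg_rotationHomotopy : HasDeg (shift (chainGrading 𝒜) m)
    (tensorGrading (shift (chainGrading 𝒜) m) (shift (chainGrading 𝒜) m)) (-2)
      (rotationHomotopy E) := by
  refine hasDeg_of_chain fun a l => ?_
  rw [rotationHomotopy_chain']
  exact rotIns_mem _ E fun u q v e => chain_tmul_mem 1 q u v (by
    rw [Letter.one_deg]; linarith)

theorem braceHomotopy_chain' (a : Letter 𝒜) (l : List (Letter 𝒜)) :
    braceHomotopy E (chain a l) = brace E (fun l q' v' q v =>
      chain a l ⊗ₜ[k] (chain q' v' ⊗ₜ[k] chain q v)) l :=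
  braceHomotopy_chain E a l

theorem hasDeg_braceHomotopy : HasDeg (shift (chainGrading 𝒜) m)
    (tensorGrading (shift (chainGrading 𝒜) m)
      (tensorGrading (shift (chainGrading 𝒜) m) (shift (chainGrading 𝒜) m))) (-2)
      (braceHomotopy E) := by
  refine hasDeg_of_chain fun a l => ?_
  rw [braceHomotopy_chain']
  refine brace_mem _ E fun u q' v' q v e => ?_
  have := tmul_mem_tensorGrading _ _ (chain_mem_shift m a u) (chain_tmul_mem (m := m) q' q v' v
    (n := q'.deg + wd v' + (q.deg + wd v) - 2 * m) (by ring))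
  rwa [show a.deg + wd u - m + (q'.deg + wd v' + (q.deg + wd v) - 2 * m) =
    a.deg + wd l - m + -2 by linarith] at this

end Operators

/-! ### The exchange of the first two factors through Koszul symmetries. -/

section Koszul

variable {k : Type*} [Field k] {X : Type*} [AddCommGroup X] [Module k X]
  {𝒳 : ℤ → Submodule k X} [DirectSum.Decomposition 𝒳]

/-- Moving a factor past the tensor product of two others. -/
theorem swap₁₂_eq_koszul : LinearMap.lTensor X (koszul 𝒳 𝒳) ∘ₗ
      (TensorProduct.assoc k X X X).toLinearMap ∘ₗ koszul 𝒳 (tensorGrading 𝒳 𝒳) = swap₁₂ 𝒳 := by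
  refine triple_hom_ext 𝒳 fun i x hx j y hy l z hz => ?_
  rw [LinearMap.comp_apply, LinearMap.comp_apply,
    koszul_tmul _ _ hx (tmul_mem_tensorGrading 𝒳 𝒳 hy hz), swap₁₂_tmul hx hy, map_smul, map_smul,
    LinearEquiv.coe_coe, TensorProduct.assoc_tmul, LinearMap.lTensor_tmul, koszul_tmul 𝒳 𝒳 hz hx,
    TensorProduct.tmul_smul, smul_smul, ← sg_add]
  exact sg_smul_congr (by push_cast; clear * -; grind [=_ intCast_mul_self])

theorem lTensor_koszul_assoc_tmul {i j : ℤ} {x : X} {t : X ⊗[k] X} (hx : x ∈ 𝒳 i)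
    (ht : t ∈ tensorGrading 𝒳 𝒳 j) :
    LinearMap.lTensor X (koszul 𝒳 𝒳) (TensorProduct.assoc k X X X (t ⊗ₜ x)) =
      sg k (i * j) • swap₁₂ 𝒳 (x ⊗ₜ t) := by
  rw [← swap₁₂_eq_koszul, LinearMap.comp_apply, LinearMap.comp_apply, koszul_tmul _ _ hx ht,
    map_smul, map_smul, smul_smul, sg_mul_self, one_smul]
  rfl

end Koszul

/-! ### Connes' operator against the coproduct, as operators on chains. -/

section Rotation

variable {k : Type*} [Field k] {A : Type*} [Ring A] [Algebra k A]
  {𝒜 : ℤ → Submodule k A} [GradedAlgebra 𝒜] {m : ℤ}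
  {Y Z : Type*} [AddCommGroup Y] [Module k Y] [AddCommGroup Z] [Module k Z]
  {F : OpenFrobenius 𝒜 m} (E : Casimir F)

theorem map_rot (f : Y →ₗ[k] Z) (G : List (Letter 𝒜) → Y) (a : Letter 𝒜)
    (l : List (Letter 𝒜)) : f (rot G a l) = rot (fun l' => f (G l')) a l := by
  simp only [rot, map_splitSum, map_smul]

theorem map_rotIns (f : Y →ₗ[k] Z) (G : List (Letter 𝒜) → Letter 𝒜 → List (Letter 𝒜) → Y)
    (a : Letter 𝒜) (l : List (Letter 𝒜)) :
    f (rotIns E G a l) = rotIns E (fun l' q v => f (G l' q v)) a l := by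
  simp only [rotIns, twistedRot, insAfter, map_splitSum, map_smul, map_ins]

theorem map_coprodRot (f : Y →ₗ[k] Z)
    (Ψ : Letter 𝒜 → List (Letter 𝒜) → Letter 𝒜 → List (Letter 𝒜) → Y) (a : Letter 𝒜)
    (l : List (Letter 𝒜)) :
    f (coprodRot E Ψ a l) = coprodRot E (fun p u q v => f (Ψ p u q v)) a l := by
  simp only [coprodRot, map_splitSum, map_sum, map_smul]

theorem map_brace (f : Y →ₗ[k] Z) (Θ : List (Letter 𝒜) → Letter 𝒜 → List (Letter 𝒜) →
      Letter 𝒜 → List (Letter 𝒜) → Y) (l : List (Letter 𝒜)) :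
    f (brace E Θ l) = brace E (fun l q' v' q v => f (Θ l q' v' q v)) l := by
  simp only [brace, insAfter, map_ins, map_smul]

theorem map_coprodSwap (f : Y →ₗ[k] Z)
    (Ψ : Letter 𝒜 → List (Letter 𝒜) → Letter 𝒜 → List (Letter 𝒜) → Y) (a : Letter 𝒜)
    (l : List (Letter 𝒜)) :
    f (coprodSwap E Ψ a l) = coprodSwap E (fun p u q v => f (Ψ p u q v)) a l := by
  simp only [coprodSwap, map_coprod, map_smul]

theorem map_comm_smul (f : Y →ₗ[k] Z)
    (σ : Letter 𝒜 → List (Letter 𝒜) → Letter 𝒜 → List (Letter 𝒜) → k)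
    (Ψ : Letter 𝒜 → List (Letter 𝒜) → Letter 𝒜 → List (Letter 𝒜) → Y) (a : Letter 𝒜)
    (l : List (Letter 𝒜)) : f (comm E (fun p u q v => σ p u q v • Ψ p u q v) a l) =
      comm E (fun p u q v => σ p u q v • f (Ψ p u q v)) a l := by
  simp only [map_comm, map_smul]

theorem chain_dL_one (u : List (Letter 𝒜)) : chain (F.dL (1 : Letter 𝒜)) u = 0 := by
  simp [chain, F.d_one]

/-- The terms of `θ B` in which the coefficient of the chain moves to the left factor. -/
theorem coprodRot_eq (a : Letter 𝒜) (l : List (Letter 𝒜)) :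
    (oddSum (shift (chainGrading 𝒜) m) (chainDiff 𝒜 F.d) (chainDiff 𝒜 F.d) ∘ₗ
        rotationHomotopy E - rotationHomotopy E ∘ₗ chainDiff 𝒜 F.d + commHomotopy E +
      LinearMap.rTensor (Chain k A) (connes 𝒜) ∘ₗ
        koszul (shift (chainGrading 𝒜) m) (shift (chainGrading 𝒜) m) ∘ₗ
        shiftedCoproduct F) (chain a l) =
      coprodRot E (fun p u q v => chain p u ⊗ₜ[k] chain q v) a l := by
  have e1 := map_rotIns E
    (oddSum (shift (chainGrading 𝒜) m) (chainDiff 𝒜 F.d) (chainDiff 𝒜 F.d))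
    (fun u q v => chain (1 : Letter 𝒜) u ⊗ₜ[k] chain q v) a l
  have e2 := map_cyc (F := F) (rotationHomotopy E) chain a l
  have e3 := map_coprodSwap E (LinearMap.rTensor (Chain k A) (connes 𝒜))
    (fun p u q v => chain p u ⊗ₜ[k] chain q v) a l
  have e4 : ∀ (p : Letter 𝒜) (u) (q : Letter 𝒜) (v),
      LinearMap.rTensor (Chain k A) (connes 𝒜) (chain p u ⊗ₜ[k] chain q v) =
        rot (fun l' => chain 1 l' ⊗ₜ[k] chain q v) p u := by
    intro p u q v
    rw [LinearMap.rTensor_tmul, connes_chain']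
    exact map_rot ((TensorProduct.mk k _ _).flip (chain q v)) _ p u
  have e5 := rotIns_tensorDiff E (Ψ := fun p u q v => chain p u ⊗ₜ[k] chain q v)
    (fun a u w v => GBilin.tmul (GLin.chain_word a u w) (GLin.chain_left v))
    (fun u q v => by rw [chain_dL_one, TensorProduct.zero_tmul]) a l
  simp only [oddSum_chainDiff] at e1
  simp only [rotationHomotopy_chain'] at e2
  simp only [e4] at e3
  rw [LinearMap.add_apply, LinearMap.add_apply, LinearMap.sub_apply, LinearMap.comp_apply,
    LinearMap.comp_apply, LinearMap.comp_apply, LinearMap.comp_apply, chainDiff_chain,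
    koszul_shiftedCoproduct_chain E, e3, e2, rotationHomotopy_chain', e1, e5, commHomotopy_chain']
  abel

/-- `rot_coprod` in operator form: `θ B = Q + τ Q`. -/
theorem shiftedCoproduct_connes (a : Letter 𝒜) (l : List (Letter 𝒜)) :
    shiftedCoproduct F (connes 𝒜 (chain a l)) =
      coprodRot E (fun p u q v => chain p u ⊗ₜ[k] chain q v) a l +
      koszul (shift (chainGrading 𝒜) m) (shift (chainGrading 𝒜) m)
        (coprodRot E (fun p u q v => chain p u ⊗ₜ[k] chain q v) a l) := by
  have e1 := map_coprodRot E (koszul (shift (chainGrading 𝒜) m) (shift (chainGrading 𝒜) m))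
    (fun p u q v => chain p u ⊗ₜ[k] chain q v) a l
  simp only [koszul_chain] at e1
  rw [e1, connes_chain', map_rot]
  simp only [shiftedCoproduct_chain' E]
  exact rot_coprod E gbilin_chain a l

end Rotation

/-! ### The strict coderivation identity, as operators on chains. -/

section Leibniz

variable {k : Type*} [Field k] {A : Type*} [Ring A] [Algebra k A]
  {𝒜 : ℤ → Submodule k A} [GradedAlgebra 𝒜] {m : ℤ}
  {Y Z : Type*} [AddCommGroup Y] [Module k Y] [AddCommGroup Z] [Module k Z]
  {F : OpenFrobenius 𝒜 m} (E : Casimir F)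

local notation "𝒞" => shift (chainGrading 𝒜) m
local notation "C" => Chain k A

theorem koszul_commHomotopy_chain (a : Letter 𝒜) (l : List (Letter 𝒜)) :
    koszul 𝒞 𝒞 (commHomotopy E (chain a l)) = comm E (fun p u q v =>
      sg k ((p.deg + wd u - m) * (q.deg + wd v - m)) • (chain q v ⊗ₜ[k] chain p u)) a l := by
  have e := map_comm E (koszul 𝒞 𝒞) (fun p u q v => chain p u ⊗ₜ[k] chain q v) a l
  simp only [koszul_chain] at e
  rw [commHomotopy_chain', e]

theorem lTensor_shiftedCoproduct_chain (p q : Letter 𝒜) (u v : List (Letter 𝒜)) :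
    LinearMap.lTensor C (shiftedCoproduct F) (chain p u ⊗ₜ[k] chain q v) =
      coprod E (fun p' u' q' v' => chain p u ⊗ₜ[k] (chain p' u' ⊗ₜ[k] chain q' v')) q v := by
  rw [LinearMap.lTensor_tmul, shiftedCoproduct_chain' E]
  exact map_coprod E (TensorProduct.mk k _ _ (chain p u)) _ q v

theorem swap₁₂_koszul_commHomotopy (p q : Letter 𝒜) (u v : List (Letter 𝒜)) :
    (swap₁₂ 𝒞 ∘ₗ TensorProduct.map (sgn 𝒞) (koszul 𝒞 𝒞 ∘ₗ commHomotopy E))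
        (chain p u ⊗ₜ[k] chain q v) = sg k (p.deg + wd u - m) • comm E (fun p' u' q' v' =>
          sg k ((p'.deg + wd u' - m) * (q'.deg + wd v' - m)) •
          sg k ((p.deg + wd u - m) * (q'.deg + wd v' - m)) •
            (chain q' v' ⊗ₜ[k] (chain p u ⊗ₜ[k] chain p' u'))) q v := by
  have e := map_comm_smul E (swap₁₂ 𝒞 ∘ₗ TensorProduct.mk k _ _ (chain p u))
    (fun p u q v => sg k ((p.deg + wd u - m) * (q.deg + wd v - m)))
    (fun p u q v => chain q v ⊗ₜ[k] chain p u) q v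
  have e' : ∀ (p' : Letter 𝒜) (u') (q' : Letter 𝒜) (v'),
      (swap₁₂ 𝒞 ∘ₗ TensorProduct.mk k _ _ (chain p u)) (chain q' v' ⊗ₜ[k] chain p' u') =
      sg k ((p.deg + wd u - m) * (q'.deg + wd v' - m)) •
            (chain q' v' ⊗ₜ[k] (chain p u ⊗ₜ[k] chain p' u')) := fun p' u' q' v' =>
    swap₁₂_tmul (chain_mem_shift m p u) (chain_mem_shift m q' v') _
  simp only [e'] at e
  rw [← e, LinearMap.comp_apply, map_sgn_tmul _ (chain_mem_shift m p u), map_smul,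
    LinearMap.comp_apply, koszul_commHomotopy_chain]
  rfl

theorem assoc_koszul_commHomotopy (p q : Letter 𝒜) (u v : List (Letter 𝒜)) :
    ((TensorProduct.assoc k C C C).toLinearMap ∘ₗ
        LinearMap.rTensor C (koszul 𝒞 𝒞 ∘ₗ commHomotopy E)) (chain p u ⊗ₜ[k] chain q v) =
      comm E (fun p' u' q' v' => sg k ((p'.deg + wd u' - m) * (q'.deg + wd v' - m)) •
          (chain q' v' ⊗ₜ[k] (chain p' u' ⊗ₜ[k] chain q v))) p u := by
  rw [LinearMap.comp_apply, LinearMap.rTensor_tmul, LinearMap.comp_apply,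
    koszul_commHomotopy_chain]
  exact map_comm_smul E ((TensorProduct.assoc k C C C).toLinearMap ∘ₗ
      (TensorProduct.mk k _ _).flip (chain q v))
    (fun p u q v => sg k ((p.deg + wd u - m) * (q.deg + wd v - m)))
    (fun p u q v => chain q v ⊗ₜ[k] chain p u) p u

theorem lTensor_koszul_commHomotopy_chain (a : Letter 𝒜) (l : List (Letter 𝒜)) :
    LinearMap.lTensor C (shiftedCoproduct F) (koszul 𝒞 𝒞 (commHomotopy E (chain a l))) =
      comm E (fun p u q v => sg k ((p.deg + wd u - m) * (q.deg + wd v - m)) •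
        coprod E (fun p' u' q' v' => chain q v ⊗ₜ[k] (chain p' u' ⊗ₜ[k] chain q' v')) p u) a l := by
  have e := map_comm_smul E (LinearMap.lTensor C (shiftedCoproduct F))
    (fun p u q v => sg k ((p.deg + wd u - m) * (q.deg + wd v - m)))
    (fun p u q v => chain q v ⊗ₜ[k] chain p u) a l
  simp only [lTensor_shiftedCoproduct_chain E] at e
  rw [koszul_commHomotopy_chain, e]

theorem map_shiftedCoproduct_chain (f : C ⊗[k] C →ₗ[k] Y) (a : Letter 𝒜) (l : List (Letter 𝒜)) :
    f (shiftedCoproduct F (chain a l)) =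
      coprod E (fun p u q v => f (chain p u ⊗ₜ[k] chain q v)) a l := by
  rw [shiftedCoproduct_chain' E, map_coprod]

/-- Applying `τ` puts the chain with the inserted letter on the right, so the following coproduct
only cuts that chain; hence `comm_coprod` applies and no homotopy is needed. -/
theorem lTensor_koszul_commHomotopy :
    LinearMap.lTensor C (shiftedCoproduct F) ∘ₗ koszul 𝒞 𝒞 ∘ₗ commHomotopy E =
      swap₁₂ 𝒞 ∘ₗ TensorProduct.map (sgn 𝒞) (koszul 𝒞 𝒞 ∘ₗ commHomotopy E) ∘ₗ
        shiftedCoproduct F +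
      (TensorProduct.assoc k C C C).toLinearMap ∘ₗ
        LinearMap.rTensor C (koszul 𝒞 𝒞 ∘ₗ commHomotopy E) ∘ₗ shiftedCoproduct F := by
  refine chain_ext (𝒜 := 𝒜) fun a l => (lTensor_koszul_commHomotopy_chain E a l).trans
    ((comm_coprod E (fun q' v' p u p' u' =>
      chain q' v' ⊗ₜ[k] (chain p u ⊗ₜ[k] chain p' u')) a l).trans ?_)
  have e2 := map_shiftedCoproduct_chain E
    (swap₁₂ 𝒞 ∘ₗ TensorProduct.map (sgn 𝒞) (koszul 𝒞 𝒞 ∘ₗ commHomotopy E)) a l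
  have e3 := map_shiftedCoproduct_chain E ((TensorProduct.assoc k C C C).toLinearMap ∘ₗ
    LinearMap.rTensor C (koszul 𝒞 𝒞 ∘ₗ commHomotopy E)) a l
  simp only [swap₁₂_koszul_commHomotopy] at e2
  simp only [assoc_koszul_commHomotopy] at e3
  exact (congrArg₂ (· + ·) e2 e3).symm

end Leibniz

/-! ### The double insertion, as an operator on chains. -/

section Brace

variable {k : Type*} [Field k] {A : Type*} [Ring A] [Algebra k A]
  {𝒜 : ℤ → Submodule k A} [GradedAlgebra 𝒜] {m : ℤ}
  {Y Z : Type*} [AddCommGroup Y] [Module k Y] [AddCommGroup Z] [Module k Z]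
  {F : OpenFrobenius 𝒜 m} (E : Casimir F)

local notation "𝒞" => shift (chainGrading 𝒜) m
local notation "C" => Chain k A

theorem oddSum_triple_chain (a q' q : Letter 𝒜) (l v' v : List (Letter 𝒜)) :
    oddSum 𝒞 (chainDiff 𝒜 F.d) (oddSum 𝒞 (chainDiff 𝒜 F.d) (chainDiff 𝒜 F.d))
        (chain a l ⊗ₜ[k] (chain q' v' ⊗ₜ[k] chain q v)) =
      tripleDiff F (fun a l q' v' q v => chain a l ⊗ₜ[k] (chain q' v' ⊗ₜ[k] chain q v))
        a l q' v' q v := by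
  have e1 := map_cyc (F := F) ((TensorProduct.mk k C (C ⊗[k] C)).flip
    (chain q' v' ⊗ₜ[k] chain q v)) chain a l
  have e2 := map_cyc (F := F) ((TensorProduct.mk k C (C ⊗[k] C) (chain a l)) ∘ₗ
    (TensorProduct.mk k C C).flip (chain q v)) chain q' v'
  have e3 := map_cyc (F := F) ((TensorProduct.mk k C (C ⊗[k] C) (chain a l)) ∘ₗ
    TensorProduct.mk k C C (chain q' v')) chain q v
  rw [oddSum_tmul _ _ (chain_mem_shift m a l), oddSum_chain, chainDiff_chain, chainDiff_chain,
    chainDiff_chain, TensorProduct.tmul_add, TensorProduct.tmul_smul]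
  exact congrArg₂ (· + ·) e1 (congrArg (_ • ·) (congrArg₂ (· + ·) e2 (congrArg (_ • ·) e3)))

theorem braceHomotopy_chainDiff (a : Letter 𝒜) (l : List (Letter 𝒜)) :
    oddSum 𝒞 (chainDiff 𝒜 F.d) (oddSum 𝒞 (chainDiff 𝒜 F.d) (chainDiff 𝒜 F.d))
        (braceHomotopy E (chain a l)) - braceHomotopy E (chainDiff 𝒜 F.d (chain a l)) =
      comm E (fun p u q v => coprodSwap E (fun q' v' q v =>
        chain p u ⊗ₜ[k] (chain q' v' ⊗ₜ[k] chain q v)) q v) a l -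
      coprodSwap E (fun p l q v => comm E (fun p l q' v' =>
        chain p l ⊗ₜ[k] (chain q' v' ⊗ₜ[k] chain q v)) p l) a l -
      coprod E (fun p u q' v' => comm E (fun p l q v =>
        sg k ((q.deg + wd v - m) * (q'.deg + wd v' - m)) •
        (chain p l ⊗ₜ[k] (chain q' v' ⊗ₜ[k] chain q v))) p u) a l := by
  have e1 := map_brace E (oddSum 𝒞 (chainDiff 𝒜 F.d)
    (oddSum 𝒞 (chainDiff 𝒜 F.d) (chainDiff 𝒜 F.d)))
    (fun l q' v' q v => chain a l ⊗ₜ[k] (chain q' v' ⊗ₜ[k] chain q v)) l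
  have e2 := map_cyc (F := F) (braceHomotopy E) chain a l
  simp only [oddSum_triple_chain] at e1
  simp only [braceHomotopy_chain'] at e2
  rw [chainDiff_chain, e2, braceHomotopy_chain', e1]
  exact tripleDiff_brace E
    (fun a u w v' q v => GBilin.tmul (GLin.chain_word a u w)
      ((GLin.chain_left v').tmul_left (chain q v)))
    (fun a u w q' v' v => GBilin.tmul (GLin.chain_word a u w)
      ((GLin.chain_left v).tmul_right (chain q' v')))
    (fun a l v' v => ⟨fun q' => ((GLin.chain_left v).tmul_right (chain q' v')).tmul_right
        (chain a l), fun q => ((GLin.chain_left v').tmul_left (chain q v)).tmul_right (chain a l)⟩)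
    (fun l v' q v => GBilin.tmul (GLin.chain_left l) ((GLin.chain_left v').tmul_left (chain q v)))
    (fun l q' v' v => GBilin.tmul (GLin.chain_left l)
      ((GLin.chain_left v).tmul_right (chain q' v'))) a l

/-- Exchanging the last two factors undoes the swap in `coprodSwap`. -/
theorem coprodSwap_chain (p q : Letter 𝒜) (u v : List (Letter 𝒜)) :
    LinearMap.lTensor C (koszul 𝒞 𝒞) (coprodSwap E (fun q' v' q v =>
        chain p u ⊗ₜ[k] (chain q' v' ⊗ₜ[k] chain q v)) q v) =
      LinearMap.lTensor C (shiftedCoproduct F) (chain p u ⊗ₜ[k] chain q v) := by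
  have e := map_coprodSwap E (TensorProduct.mk k C (C ⊗[k] C) (chain p u))
    (fun p u q v => chain p u ⊗ₜ[k] chain q v) q v
  rw [← koszul_shiftedCoproduct_chain E] at e
  refine (congrArg (LinearMap.lTensor C (koszul 𝒞 𝒞)) e.symm).trans ?_
  rw [TensorProduct.mk_apply, LinearMap.lTensor_tmul, LinearMap.lTensor_tmul]
  exact congrArg (chain p u ⊗ₜ[k] ·) (LinearMap.congr_fun koszul_koszul _)

/-- The exponent contains `-1` because `g` lowers the degree by one before the chain `p[u]` is moved
past its value. -/
theorem lTensor_koszul_comm_left (p q : Letter 𝒜) (u v : List (Letter 𝒜)) :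
    LinearMap.lTensor C (koszul 𝒞 𝒞) (comm E (fun p' l q' v' =>
        chain p' l ⊗ₜ[k] (chain q' v' ⊗ₜ[k] chain p u)) q v) =
      sg k ((p.deg + wd u - m) * (q.deg + wd v - m + -1)) •
        swap₁₂ 𝒞 (chain p u ⊗ₜ[k] commHomotopy E (chain q v)) := by
  have e : TensorProduct.assoc k C C C (commHomotopy E (chain q v) ⊗ₜ[k] chain p u) =
      comm E (fun p' l q' v' => chain p' l ⊗ₜ[k] (chain q' v' ⊗ₜ[k] chain p u)) q v := by
    rw [commHomotopy_chain']
    exact map_comm E ((TensorProduct.assoc k C C C).toLinearMap ∘ₗ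
      (TensorProduct.mk k _ _).flip (chain p u)) (fun p u q v => chain p u ⊗ₜ[k] chain q v) q v
  rw [← lTensor_koszul_assoc_tmul (chain_mem_shift m p u)
    (hasDeg_commHomotopy E (chain_mem_shift m q v)), e]

theorem lTensor_koszul_comm_right (p q : Letter 𝒜) (u v : List (Letter 𝒜)) :
    LinearMap.lTensor C (koszul 𝒞 𝒞) (comm E (fun p l q' v' =>
        sg k ((q'.deg + wd v' - m) * (q.deg + wd v - m)) •
        (chain p l ⊗ₜ[k] (chain q v ⊗ₜ[k] chain q' v'))) p u) =
      TensorProduct.assoc k C C C (commHomotopy E (chain p u) ⊗ₜ[k] chain q v) := by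
  have e := map_comm E ((TensorProduct.assoc k C C C).toLinearMap ∘ₗ
      (TensorProduct.mk k _ _).flip (chain q v)) (fun p u q v => chain p u ⊗ₜ[k] chain q v) p u
  rw [← commHomotopy_chain'] at e
  refine (map_comm_smul E (LinearMap.lTensor C (koszul 𝒞 𝒞))
    (fun _ _ q' v' => sg k ((q'.deg + wd v' - m) * (q.deg + wd v - m)))
    (fun p l q' v' => chain p l ⊗ₜ[k] (chain q v ⊗ₜ[k] chain q' v')) p u).trans (.trans ?_ e.symm)
  have e' : ∀ (p' : Letter 𝒜) (l) (q' : Letter 𝒜) (v'),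
      sg k ((q'.deg + wd v' - m) * (q.deg + wd v - m)) • LinearMap.lTensor C (koszul 𝒞 𝒞)
        (chain p' l ⊗ₜ[k] (chain q v ⊗ₜ[k] chain q' v')) =
      chain p' l ⊗ₜ[k] (chain q' v' ⊗ₜ[k] chain q v) := by
    intro p' l q' v'
    rw [LinearMap.lTensor_tmul, koszul_chain, TensorProduct.tmul_smul, smul_smul,
      mul_comm (q'.deg + wd v' - m), sg_mul_self, one_smul]
  simp only [e']
  rfl

/-- The double insertion lists the inner split-off chain before the outer one. Exchanging these
factors puts the three terms of `tripleDiff_brace` into the form required of `K`. -/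
theorem lTensor_koszul_braceHomotopy :
    oddSum 𝒞 (chainDiff 𝒜 F.d) (oddSum 𝒞 (chainDiff 𝒜 F.d) (chainDiff 𝒜 F.d)) ∘ₗ
        (LinearMap.lTensor C (koszul 𝒞 𝒞) ∘ₗ braceHomotopy E) -
      (LinearMap.lTensor C (koszul 𝒞 𝒞) ∘ₗ braceHomotopy E) ∘ₗ chainDiff 𝒜 F.d =
    LinearMap.lTensor C (shiftedCoproduct F) ∘ₗ commHomotopy E -
      (TensorProduct.assoc k C C C).toLinearMap ∘ₗ LinearMap.rTensor C (commHomotopy E) ∘ₗ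
        shiftedCoproduct F -
      swap₁₂ 𝒞 ∘ₗ TensorProduct.map (sgn 𝒞) (commHomotopy E) ∘ₗ shiftedCoproduct F := by
  refine chain_ext (𝒜 := 𝒜) fun a l => ?_
  have e0 := congrArg (LinearMap.lTensor C (koszul 𝒞 𝒞)) (braceHomotopy_chainDiff E a l)
  have e1 := LinearMap.congr_fun (lTensor_koszul_oddSum (𝒳 := 𝒞) (hasDeg_chainDiff (F := F)))
    (braceHomotopy E (chain a l))
  have e2 := map_comm E (LinearMap.lTensor C (koszul 𝒞 𝒞)) (fun p u q v =>
    coprodSwap E (fun q' v' q v => chain p u ⊗ₜ[k] (chain q' v' ⊗ₜ[k] chain q v)) q v) a l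
  have e3 := map_coprodSwap E (LinearMap.lTensor C (koszul 𝒞 𝒞)) (fun p l q v =>
    comm E (fun p l q' v' => chain p l ⊗ₜ[k] (chain q' v' ⊗ₜ[k] chain q v)) p l) a l
  have e4 := map_coprod E (LinearMap.lTensor C (koszul 𝒞 𝒞)) (fun p u q' v' =>
    comm E (fun p l q v => sg k ((q.deg + wd v - m) * (q'.deg + wd v' - m)) •
        (chain p l ⊗ₜ[k] (chain q' v' ⊗ₜ[k] chain q v))) p u) a l
  have e5 := map_shiftedCoproduct_chain E ((TensorProduct.assoc k C C C).toLinearMap ∘ₗ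
    LinearMap.rTensor C (commHomotopy E)) a l
  have e6 := map_shiftedCoproduct_chain E (swap₁₂ 𝒞 ∘ₗ
    TensorProduct.map (sgn 𝒞) (commHomotopy E)) a l
  have e7 := map_comm E (LinearMap.lTensor C (shiftedCoproduct F))
    (fun p u q v => chain p u ⊗ₜ[k] chain q v) a l
  have e8 : ∀ (p : Letter 𝒜) (u) (q : Letter 𝒜) (v),
      (swap₁₂ 𝒞 ∘ₗ TensorProduct.map (sgn 𝒞) (commHomotopy E)) (chain p u ⊗ₜ[k] chain q v) =
      sg k ((p.deg + wd u - m) * (q.deg + wd v - m)) •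
        sg k ((p.deg + wd u - m) * (q.deg + wd v - m + -1)) •
        swap₁₂ 𝒞 (chain p u ⊗ₜ[k] commHomotopy E (chain q v)) := by
    intro p u q v
    rw [LinearMap.comp_apply, map_sgn_tmul _ (chain_mem_shift m p u), map_smul, smul_smul,
      ← sg_add]
    refine congrArg (fun c : k => c • _) (sg_congr ?_)
    push_cast; clear * -; grind [=_ intCast_mul_self]
  simp only [coprodSwap_chain] at e2
  simp only [lTensor_koszul_comm_right] at e4
  simp only [e8] at e6
  rw [← commHomotopy_chain'] at e7
  rw [LinearMap.sub_apply, LinearMap.sub_apply, LinearMap.sub_apply, LinearMap.comp_apply,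
    LinearMap.comp_apply]
  refine (congrArg (· - LinearMap.lTensor C (koszul 𝒞 𝒞)
    (braceHomotopy E (chainDiff 𝒜 F.d (chain a l)))) e1).trans ?_
  rw [LinearMap.comp_apply, ← map_sub, e0, map_sub, map_sub, e2, e3, e4]
  rw [sub_right_comm]
  refine congrArg₂ (· - ·) (congrArg₂ (· - ·) e7.symm e5.symm) (Eq.trans ?_ e6.symm)
  rw [coprodSwap]
  simp only [lTensor_koszul_comm_left]

end Brace

/-! ### The homotopy coBV coalgebra. -/

section Main

variable {k : Type*} [Field k] {A : Type*} [Ring A] [Algebra k A]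
  {𝒜 : ℤ → Submodule k A} [GradedAlgebra 𝒜] {m : ℤ}

/-- The Hochschild chains of an open Frobenius algebra form a homotopy coBV coalgebra. -/
theorem isHomotopyCoBV_chain (F : OpenFrobenius 𝒜 m) :
    IsHomotopyCoBV (shift (chainGrading 𝒜) m) (chainDiff 𝒜 F.d) (shiftedCoproduct F)
      (connes 𝒜) := by
  obtain ⟨E⟩ := exists_casimir F
  have hD := hasDeg_chainDiff (F := F)
  have hB := hasDeg_connes (𝒜 := 𝒜) (m := m)
  have hθ := hasDeg_shiftedCoproduct (F := F)
  have hg := hasDeg_commHomotopy E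
  have hS := hasDeg_rotationHomotopy E
  have hH := (hS.add ((HasDeg.koszul.comp hS).congr (add_zero _))).add
    ((hB.rTensor.comp hg).congr (by norm_num))
  -- Here `Q` is by definition the operator that `coprodRot_eq` identifies with the terms of `θ B`
  -- having the coefficient on the left.
  have H_eq := coderivation_homotopy hD hB chainDiff_connes (commHomotopy_chainDiff E)
    (S := rotationHomotopy E) rfl (chain_ext (𝒜 := 𝒜) fun a l => by
      rw [LinearMap.comp_apply, LinearMap.add_apply, LinearMap.comp_apply, coprodRot_eq,
        shiftedCoproduct_connes E])
  refine
    { D_mem := hD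
      D_D := chainDiff_chainDiff
      θ_mem := fun n x hx => by simpa using hθ hx
      θ_D := shiftedCoproduct_chainDiff
      B_mem := hB
      B_B := connes_connes
      D_B := chainDiff_connes
      coassoc := shiftedCoproduct_coassoc
      cocomm := ⟨commHomotopy E, hg, commHomotopy_chainDiff E⟩
      coBV := ⟨_, ?_, coBV_homotopy hD hB hg hH chainDiff_connes shiftedCoproduct_chainDiff
        shiftedCoproduct_coassoc (commHomotopy_chainDiff E) H_eq (lTensor_koszul_braceHomotopy E)
        (lTensor_koszul_commHomotopy E)⟩ }
  have h1 := (hθ.lTensor (𝒴 := shift (chainGrading 𝒜) m)).comp hH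
  have h2 := HasDeg.assoc.comp (hH.rTensor.comp hθ)
  have h3 := HasDeg.swap₁₂.comp ((hH.lTensor (𝒴 := shift (chainGrading 𝒜) m)).comp hθ)
  have h4 := (HasDeg.koszul.lTensor (𝒴 := shift (chainGrading 𝒜) m)).comp (hasDeg_braceHomotopy E)
  have h5 := (hB.rTensor.add (hB.map_sgn.map_sgn)).comp (HasDeg.assoc.comp (hg.rTensor.comp hθ))
  exact ((((h1.congr (by norm_num)).sub (h2.congr (by norm_num))).sub (h3.congr (by norm_num))).add
    (h4.congr (by norm_num))).sub (h5.congr (by norm_num))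

end Main

/-! ### Functionals on tensor products and their supports. -/

section Pairing

variable {k : Type*} [Field k]
  {X : Type*} [AddCommGroup X] [Module k X] {Y : Type*} [AddCommGroup Y] [Module k Y]
  {X' : Type*} [AddCommGroup X'] [Module k X'] {Y' : Type*} [AddCommGroup Y'] [Module k Y']

/-- `(f ⊗ g)(x ⊗ y) = f x * g y`. -/
def pair (f : X →ₗ[k] k) (g : Y →ₗ[k] k) : X ⊗[k] Y →ₗ[k] k :=
  LinearMap.mul' k k ∘ₗ TensorProduct.map f g

theorem pair_tmul (f : X →ₗ[k] k) (g : Y →ₗ[k] k) (x : X) (y : Y) :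
    pair f g (x ⊗ₜ y) = f x * g y := rfl

theorem pair_add_left (f f' : X →ₗ[k] k) (g : Y →ₗ[k] k) :
    pair (f + f') g = pair f g + pair f' g :=
  TensorProduct.ext' fun x y => add_mul (f x) (f' x) (g y)

theorem pair_add_right (f : X →ₗ[k] k) (g g' : Y →ₗ[k] k) :
    pair f (g + g') = pair f g + pair f g' :=
  TensorProduct.ext' fun x y => mul_add (f x) (g y) (g' y)

theorem pair_smul_left (c : k) (f : X →ₗ[k] k) (g : Y →ₗ[k] k) :
    pair (c • f) g = c • pair f g :=
  TensorProduct.ext' fun x y => mul_assoc c (f x) (g y)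

theorem pair_smul_right (c : k) (f : X →ₗ[k] k) (g : Y →ₗ[k] k) :
    pair f (c • g) = c • pair f g :=
  TensorProduct.ext' fun x y => mul_left_comm (f x) c (g y)

theorem pair_zero_left (g : Y →ₗ[k] k) : pair (0 : X →ₗ[k] k) g = 0 :=
  TensorProduct.ext' fun _ y => zero_mul (g y)

theorem pair_zero_right (f : X →ₗ[k] k) : pair f (0 : Y →ₗ[k] k) = 0 :=
  TensorProduct.ext' fun x _ => mul_zero (f x)

theorem pair_map (f : X →ₗ[k] k) (g : Y →ₗ[k] k) (u : X' →ₗ[k] X) (v : Y' →ₗ[k] Y) :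
    pair f g ∘ₗ TensorProduct.map u v = pair (f ∘ₗ u) (g ∘ₗ v) :=
  TensorProduct.ext' fun _ _ => rfl

theorem pair_rTensor (f : X →ₗ[k] k) (g : Y →ₗ[k] k) (u : X' →ₗ[k] X) :
    pair f g ∘ₗ LinearMap.rTensor Y u = pair (f ∘ₗ u) g := pair_map f g u LinearMap.id

theorem pair_lTensor (f : X →ₗ[k] k) (g : Y →ₗ[k] k) (v : Y' →ₗ[k] Y) :
    pair f g ∘ₗ LinearMap.lTensor X v = pair f (g ∘ₗ v) := pair_map f g LinearMap.id v

theorem pair_assoc (f : X →ₗ[k] k) (g : Y →ₗ[k] k) (h : X' →ₗ[k] k) :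
    pair f (pair g h) ∘ₗ (TensorProduct.assoc k X Y X').toLinearMap = pair (pair f g) h :=
  TensorProduct.ext_threefold fun x y z => (mul_assoc (f x) (g y) (h z)).symm

variable {𝒳 : ℤ → Submodule k X} {𝒴 : ℤ → Submodule k Y}

/-- The functional `f` vanishes outside degree `n`. -/
def SupportedIn (𝒳 : ℤ → Submodule k X) (n : ℤ) (f : X →ₗ[k] k) : Prop :=
  ∀ j, j ≠ n → ∀ x ∈ 𝒳 j, f x = 0

namespace SupportedIn

theorem comp {p q e : ℤ} {f : Y →ₗ[k] k} {u : X →ₗ[k] Y} (hf : SupportedIn 𝒴 p f)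
    (hu : HasDeg 𝒳 𝒴 e u) (h : q + e = p) : SupportedIn 𝒳 q (f ∘ₗ u) := fun j hj _ hx =>
  hf (j + e) (fun h' => hj (by omega)) _ (hu hx)

theorem smul {p : ℤ} {f : X →ₗ[k] k} (hf : SupportedIn 𝒳 p f) (c : k) :
    SupportedIn 𝒳 p (c • f) := fun j hj x hx => by
  rw [LinearMap.smul_apply, hf j hj x hx, smul_zero]

theorem pair {p q : ℤ} {f : X →ₗ[k] k} {g : Y →ₗ[k] k} (hf : SupportedIn 𝒳 p f)
    (hg : SupportedIn 𝒴 q g) : SupportedIn (tensorGrading 𝒳 𝒴) (p + q) (pair f g) := by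
  intro n hn z hz
  have : tensorGrading 𝒳 𝒴 n ≤ LinearMap.ker (HochBV.pair f g) := by
    refine Submodule.span_le.2 ?_
    rintro _ ⟨i, j, rfl, x, hx, y, hy, rfl⟩
    rw [SetLike.mem_coe, LinearMap.mem_ker, pair_tmul]
    by_cases hi : i = p
    · rw [hg j (fun hj => hn (by rw [hi, hj])) y hy, mul_zero]
    · rw [hf i hi x hx, zero_mul]
  exact this hz

variable [DirectSum.Decomposition 𝒳] [DirectSum.Decomposition 𝒴]

/-- Support in a single degree turns the sign operator into a scalar; this is how Koszul signs on
chains become signs in the degrees of cochains. -/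
theorem comp_sgn {p : ℤ} {f : X →ₗ[k] k} (hf : SupportedIn 𝒳 p f) :
    f ∘ₗ sgn 𝒳 = sg k p • f := by
  refine hom_ext 𝒳 fun i x hx => ?_
  rw [LinearMap.comp_apply, sgn_of_mem 𝒳 hx, map_smul, LinearMap.smul_apply]
  by_cases hi : i = p
  · rw [hi]
  · rw [hf i hi x hx, smul_zero, smul_zero]

theorem pair_koszul {p q : ℤ} {f : Y →ₗ[k] k} {g : X →ₗ[k] k} (hf : SupportedIn 𝒴 p f)
    (hg : SupportedIn 𝒳 q g) :
    HochBV.pair f g ∘ₗ koszul 𝒳 𝒴 = sg k (p * q) • HochBV.pair g f := by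
  refine tensor_hom_ext 𝒳 𝒴 fun i x hx j y hy => ?_
  rw [LinearMap.comp_apply, koszul_tmul 𝒳 𝒴 hx hy, map_smul, LinearMap.smul_apply, pair_tmul,
    pair_tmul, mul_comm (g x)]
  by_cases hi : i = q
  · by_cases hj : j = p
    · rw [hi, hj, mul_comm q]
    · rw [hf j hj y hy, zero_mul, smul_zero, smul_zero]
  · rw [hg i hi x hx, mul_zero, smul_zero, smul_zero]

theorem pair_swap₁₂ {p q : ℤ} {f g : X →ₗ[k] k} (h : X →ₗ[k] k) (hf : SupportedIn 𝒳 p f)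
    (hg : SupportedIn 𝒳 q g) : HochBV.pair f (HochBV.pair g h) ∘ₗ swap₁₂ 𝒳 =
      sg k (p * q) • HochBV.pair g (HochBV.pair f h) := by
  rw [swap₁₂, ← LinearMap.comp_assoc, pair_assoc, ← LinearMap.comp_assoc, pair_rTensor,
    hf.pair_koszul hg, pair_smul_left, ← pair_assoc, LinearMap.smul_comp, LinearMap.comp_assoc,
    LinearEquiv.comp_symm, LinearMap.comp_id]

theorem pair_map_sgn {p : ℤ} {f : X →ₗ[k] k} (hf : SupportedIn 𝒳 p f) (g : Y →ₗ[k] k)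
    (v : Y' →ₗ[k] Y) :
    HochBV.pair f g ∘ₗ TensorProduct.map (sgn 𝒳) v = sg k p • HochBV.pair f (g ∘ₗ v) := by
  rw [pair_map, hf.comp_sgn, pair_smul_left]

theorem pair_oddSum {p : ℤ} {f : X →ₗ[k] k} (hf : SupportedIn 𝒳 p f) (g : Y →ₗ[k] k)
    (u : X →ₗ[k] X) (v : Y →ₗ[k] Y) : HochBV.pair f g ∘ₗ oddSum 𝒳 u v =
      HochBV.pair (f ∘ₗ u) g + sg k p • HochBV.pair f (g ∘ₗ v) := by
  rw [oddSum, LinearMap.comp_add, pair_rTensor, hf.pair_map_sgn]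

end SupportedIn

end Pairing

/-! ### The product of functionals dual to the coproduct. -/

section Product

variable {k : Type*} [Field k] {C : Type*} [AddCommGroup C] [Module k C]
  {𝒞 : ℤ → Submodule k C} [DirectSum.Decomposition 𝒞] {D B : C →ₗ[k] C}
  {θ : C →ₗ[k] C ⊗[k] C} {p q r : ℤ} {f g h : C →ₗ[k] k}

/-- The product of functionals dual to the coproduct. -/
def dualMul (θ : C →ₗ[k] C ⊗[k] C) (f g : C →ₗ[k] k) : C →ₗ[k] k := pair f g ∘ₗ θ

theorem dualMul_smul_left (c : k) (f g : C →ₗ[k] k) :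
    dualMul θ (c • f) g = c • dualMul θ f g := by
  rw [dualMul, pair_smul_left, LinearMap.smul_comp]; rfl

theorem dualMul_smul_right (c : k) (f g : C →ₗ[k] k) :
    dualMul θ f (c • g) = c • dualMul θ f g := by
  rw [dualMul, pair_smul_right, LinearMap.smul_comp]; rfl

theorem dualMul_add_left (f f' g : C →ₗ[k] k) :
    dualMul θ (f + f') g = dualMul θ f g + dualMul θ f' g := by
  rw [dualMul, pair_add_left, LinearMap.add_comp]; rfl

theorem dualMul_add_right (f g g' : C →ₗ[k] k) :
    dualMul θ f (g + g') = dualMul θ f g + dualMul θ f g' := by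
  rw [dualMul, pair_add_right, LinearMap.add_comp]; rfl

theorem dualMul_zero_left (g : C →ₗ[k] k) : dualMul θ 0 g = 0 := by
  rw [dualMul, pair_zero_left, LinearMap.zero_comp]

theorem dualMul_zero_right (f : C →ₗ[k] k) : dualMul θ f 0 = 0 := by
  rw [dualMul, pair_zero_right, LinearMap.zero_comp]

variable (hC : IsHomotopyCoBV 𝒞 D θ B)

include hC

theorem IsHomotopyCoBV.hasDeg_coproduct : HasDeg 𝒞 (tensorGrading 𝒞 𝒞) 0 θ := fun n x hx => by
  simpa using hC.θ_mem hx

theorem dualMul_supportedIn (hf : SupportedIn 𝒞 p f) (hg : SupportedIn 𝒞 q g) :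
    SupportedIn 𝒞 (p + q) (dualMul θ f g) :=
  (hf.pair hg).comp hC.hasDeg_coproduct (add_zero _)

theorem comp_B_supportedIn (hf : SupportedIn 𝒞 p f) : SupportedIn 𝒞 (p + 1) (f ∘ₗ B) :=
  hf.comp hC.B_mem (by ring)

theorem dualMul_comp_D (hf : SupportedIn 𝒞 p f) : dualMul θ f g ∘ₗ D =
    dualMul θ (f ∘ₗ D) g + sg k p • dualMul θ f (g ∘ₗ D) := by
  rw [dualMul, LinearMap.comp_assoc, hC.θ_D, ← LinearMap.comp_assoc, hf.pair_oddSum,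
    LinearMap.add_comp, LinearMap.smul_comp]
  rfl

theorem dualMul_cocycle (hf : SupportedIn 𝒞 p f) (hf' : f ∘ₗ D = 0) (hg' : g ∘ₗ D = 0) :
    dualMul θ f g ∘ₗ D = 0 := by
  rw [dualMul_comp_D hC hf, hf', hg', dualMul_zero_left, dualMul_zero_right, smul_zero,
    add_zero]

theorem dualMul_exact_left (hf : SupportedIn 𝒞 p f) (hg' : g ∘ₗ D = 0) :
    dualMul θ (f ∘ₗ D) g = dualMul θ f g ∘ₗ D := by
  rw [dualMul_comp_D hC hf, hg', dualMul_zero_right, smul_zero, add_zero]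

theorem dualMul_exact_right (hf : SupportedIn 𝒞 p f) (hf' : f ∘ₗ D = 0) :
    dualMul θ f (g ∘ₗ D) = (sg k p • dualMul θ f g) ∘ₗ D := by
  rw [LinearMap.smul_comp, dualMul_comp_D hC hf, hf', dualMul_zero_left, zero_add, smul_smul, sg_mul_self, one_smul]

theorem comp_B_comp_D (f : C →ₗ[k] k) : (f ∘ₗ B) ∘ₗ D = -((f ∘ₗ D) ∘ₗ B) := by
  rw [LinearMap.comp_assoc, LinearMap.comp_assoc, ← LinearMap.comp_neg,
    eq_neg_of_add_eq_zero_right hC.D_B]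

theorem comp_B_cocycle (hf' : f ∘ₗ D = 0) : (f ∘ₗ B) ∘ₗ D = 0 := by
  rw [comp_B_comp_D hC, hf', LinearMap.zero_comp, neg_zero]

theorem dualMul_dualMul_right (f g h : C →ₗ[k] k) :
    dualMul θ f (dualMul θ g h) = pair f (pair g h) ∘ₗ LinearMap.lTensor C θ ∘ₗ θ := by
  rw [dualMul, dualMul, ← LinearMap.comp_assoc, pair_lTensor]

theorem dualMul_assoc (f g h : C →ₗ[k] k) :
    dualMul θ (dualMul θ f g) h = dualMul θ f (dualMul θ g h) := by
  rw [dualMul_dualMul_right hC, ← hC.coassoc, dualMul, dualMul, ← LinearMap.comp_assoc, pair_assoc,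
    ← LinearMap.comp_assoc, pair_rTensor]

/-- Pair the cocommutativity homotopy with `f ⊗ g`: the part with the total differential on the
outside vanishes on cocycles, the other part is a coboundary. -/
theorem dualMul_comm (hf : SupportedIn 𝒞 p f) (hg : SupportedIn 𝒞 q g) (hf' : f ∘ₗ D = 0)
    (hg' : g ∘ₗ D = 0) : ∃ w, SupportedIn 𝒞 (p + q + 1) w ∧
      dualMul θ f g - sg k (p * q) • dualMul θ g f = w ∘ₗ D := by
  obtain ⟨u, hu, e⟩ := hC.cocomm
  refine ⟨pair f g ∘ₗ u, (hf.pair hg).comp (e := -1) hu (by ring), ?_⟩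
  have e' := congrArg (pair f g ∘ₗ ·) e
  simp only [LinearMap.comp_add, LinearMap.comp_sub] at e'
  rw [← LinearMap.comp_assoc u (oddSum 𝒞 D D), ← LinearMap.comp_assoc θ (koszul 𝒞 𝒞),
    hf.pair_oddSum, hf', hg', pair_zero_left, pair_zero_right, smul_zero, add_zero,
    LinearMap.zero_comp, add_zero, hf.pair_koszul hg, LinearMap.smul_comp] at e'
  exact e'.symm

theorem dualMul_seven_term (hf : SupportedIn 𝒞 p f) (hg : SupportedIn 𝒞 q g)
    (hh : SupportedIn 𝒞 r h) (hf' : f ∘ₗ D = 0) (hg' : g ∘ₗ D = 0) (hh' : h ∘ₗ D = 0) :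
    ∃ w, SupportedIn 𝒞 (p + q + r + 2) w ∧
      dualMul θ (dualMul θ f g) h ∘ₗ B - (dualMul θ (dualMul θ f g ∘ₗ B) h +
        sg k p • dualMul θ f (dualMul θ g h ∘ₗ B) +
        sg k (p * q + q) • dualMul θ g (dualMul θ f h ∘ₗ B) -
        (dualMul θ (dualMul θ (f ∘ₗ B) g) h + sg k p • dualMul θ (dualMul θ f (g ∘ₗ B)) h +
          sg k (p + q) • dualMul θ (dualMul θ f g) (h ∘ₗ B))) = w ∘ₗ D := by
  obtain ⟨u, hu, e⟩ := hC.coBV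
  -- On cocycles only the term `-u D` of the commutator survives, whence the minus sign.
  refine ⟨-(pair f (pair g h) ∘ₗ u), ?_, ?_⟩
  · rw [← neg_one_smul k]
    exact ((hf.pair (hg.pair hh)).comp (e := -2) hu (by ring)).smul _
  have e' := congrArg (pair f (pair g h) ∘ₗ ·) e
  simp only [LinearMap.comp_add, LinearMap.comp_sub] at e'
  have e1 : pair f (pair g h) ∘ₗ oddSum 𝒞 D (oddSum 𝒞 D D) = 0 := by
    rw [hf.pair_oddSum, hg.pair_oddSum, hf', hg', hh', pair_zero_left, pair_zero_left,
      pair_zero_right, smul_zero, add_zero, pair_zero_right, smul_zero, add_zero]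
  have e2 : pair f (pair g h) ∘ₗ LinearMap.lTensor C θ ∘ₗ θ ∘ₗ B =
      dualMul θ (dualMul θ f g) h ∘ₗ B := by
    rw [dualMul_assoc hC, dualMul_dualMul_right hC]; rfl
  have e3 : pair f (pair g h) ∘ₗ (TensorProduct.assoc k C C C).toLinearMap ∘ₗ
      LinearMap.rTensor C (θ ∘ₗ B) ∘ₗ θ = dualMul θ (dualMul θ f g ∘ₗ B) h := by
    rw [← LinearMap.comp_assoc, pair_assoc, ← LinearMap.comp_assoc, pair_rTensor]; rfl
  have e4 : pair f (pair g h) ∘ₗ TensorProduct.map (sgn 𝒞) (θ ∘ₗ B) ∘ₗ θ =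
      sg k p • dualMul θ f (dualMul θ g h ∘ₗ B) := by
    rw [← LinearMap.comp_assoc, hf.pair_map_sgn]; rfl
  have e5 : pair f (pair g h) ∘ₗ swap₁₂ 𝒞 ∘ₗ TensorProduct.map (sgn 𝒞) (θ ∘ₗ B) ∘ₗ θ =
      sg k (p * q + q) • dualMul θ g (dualMul θ f h ∘ₗ B) := by
    rw [← LinearMap.comp_assoc, hf.pair_swap₁₂ h hg, LinearMap.smul_comp, ← LinearMap.comp_assoc,
      hg.pair_map_sgn, LinearMap.smul_comp, smul_smul, ← sg_add]; rfl
  have e6 : pair f (pair g h) ∘ₗ oddSum 𝒞 B (oddSum 𝒞 B B) ∘ₗ LinearMap.lTensor C θ ∘ₗ θ =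
      dualMul θ (dualMul θ (f ∘ₗ B) g) h + sg k p • dualMul θ (dualMul θ f (g ∘ₗ B)) h +
          sg k (p + q) • dualMul θ (dualMul θ f g) (h ∘ₗ B) := by
    rw [dualMul_assoc hC, dualMul_assoc hC, dualMul_assoc hC, dualMul_dualMul_right hC,
      dualMul_dualMul_right hC, dualMul_dualMul_right hC, ← LinearMap.comp_assoc,
      hf.pair_oddSum, hg.pair_oddSum, pair_add_right, pair_smul_right, smul_add, smul_smul,
      ← sg_add, LinearMap.add_comp, LinearMap.add_comp, LinearMap.smul_comp, LinearMap.smul_comp,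
      add_assoc]
  rw [e2, e3, e4, e5, e6, ← LinearMap.comp_assoc, e1, LinearMap.zero_comp, zero_sub] at e'
  rw [LinearMap.neg_comp, ← e']
  rfl

end Product

section Lift

variable {R M N P : Type*} [CommRing R] [AddCommGroup M] [Module R M] [AddCommGroup N] [Module R N]
  [AddCommGroup P] [Module R P]

/-- A bilinear map that vanishes on two submodules, as a bilinear map on the quotients. -/
def liftQ₂ (S : Submodule R M) (T : Submodule R N) (β : M →ₗ[R] N →ₗ[R] P)
    (hS : ∀ x ∈ S, ∀ y, β x y = 0) (hT : ∀ x, ∀ y ∈ T, β x y = 0) : M ⧸ S →ₗ[R] N ⧸ T →ₗ[R] P :=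
  S.liftQ (T.liftQ β.flip fun y hy => LinearMap.ext fun x => hT x y hy).flip fun x hx => by
    refine LinearMap.ext fun y => ?_
    obtain ⟨y, rfl⟩ := Submodule.Quotient.mk_surjective _ y
    exact hS x hx y

end Lift

/-! ### The BV-algebra on cohomology. -/

section Cohomology

variable {k : Type*} [Field k] {C : Type*} [AddCommGroup C] [Module k C]
  {𝒞 : ℤ → Submodule k C} [DirectSum.Decomposition 𝒞] {m : ℤ} {D B : C →ₗ[k] C}
  {θ : C →ₗ[k] C ⊗[k] C} {p q r : ℤ}

/-- A cochain of degree `-p - m` lives in chain degree `p + m`, which is degree `p` after lowering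
by `m`. -/
theorem mem_cochains_iff {f : C →ₗ[k] k} :
    f ∈ cochains 𝒞 k (-p - m) ↔ SupportedIn (shift 𝒞 m) p f := by
  refine ⟨fun hf j hj x hx => hf (j + m) (by omega) x hx, fun hf j hj x hx => ?_⟩
  refine hf (j - m) (by omega) x ?_
  rwa [shift, sub_add_cancel]

theorem mem_cocycles_iff {f : C →ₗ[k] k} :
    f ∈ cocycles 𝒞 D k (-p - m) ↔ SupportedIn (shift 𝒞 m) p f ∧ f ∘ₗ D = 0 :=
  and_congr mem_cochains_iff Iff.rfl

theorem mem_coboundaries {f w : C →ₗ[k] k} (hw : SupportedIn (shift 𝒞 m) (p + 1) w)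
    (e : f = w ∘ₗ D) : f ∈ coboundaries 𝒞 D k (-p - m) := by
  refine ⟨w, ?_, e.symm⟩
  rw [SetLike.mem_coe, show -p - m - 1 = -(p + 1) - m by ring]
  exact mem_cochains_iff.2 hw

theorem exists_of_mem_coboundaries {f : C →ₗ[k] k} (hf : f ∈ coboundaries 𝒞 D k (-p - m)) :
    ∃ w, SupportedIn (shift 𝒞 m) (p + 1) w ∧ f = w ∘ₗ D := by
  obtain ⟨w, hw, e⟩ := hf
  rw [SetLike.mem_coe, show -p - m - 1 = -(p + 1) - m by ring] at hw
  exact ⟨w, mem_cochains_iff.1 hw, e.symm⟩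

theorem mk_eq_of_exact {x y : cocycles 𝒞 D k (-p - m)} {w : C →ₗ[k] k}
    (hw : SupportedIn (shift 𝒞 m) (p + 1) w) (e : (x : C →ₗ[k] k) - y = w ∘ₗ D) :
    (Submodule.Quotient.mk x : Cohomology 𝒞 D k (-p - m)) = Submodule.Quotient.mk y :=
  (Submodule.Quotient.eq _).2 (mem_coboundaries hw e)

theorem mk_eq_zero_of_exact {x : cocycles 𝒞 D k (-p - m)} {w : C →ₗ[k] k}
    (hw : SupportedIn (shift 𝒞 m) (p + 1) w) (e : (x : C →ₗ[k] k) = w ∘ₗ D) :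
    (Submodule.Quotient.mk x : Cohomology 𝒞 D k (-p - m)) = 0 :=
  (Submodule.Quotient.mk_eq_zero _).2 (mem_coboundaries hw e)

variable (hC : IsHomotopyCoBV (shift 𝒞 m) D θ B)

/-- The product of cocycles. -/
def mulCocycle (hC : IsHomotopyCoBV (shift 𝒞 m) D θ B) (h : p + q = r) :
    cocycles 𝒞 D k (-p - m) →ₗ[k] cocycles 𝒞 D k (-q - m) →ₗ[k] cocycles 𝒞 D k (-r - m) :=
  -- The exponent `p * q + m` is the sign by which the cup product of the given cochains differs
  -- from `dualMul` of the shifted coproduct.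
  LinearMap.mk₂ k (fun f g => ⟨sg k (p * q + m) • dualMul θ f g, by
      have hf := mem_cocycles_iff.1 f.2
      have hg := mem_cocycles_iff.1 g.2
      subst h
      exact Submodule.smul_mem _ _ (mem_cocycles_iff.2
        ⟨dualMul_supportedIn hC hf.1 hg.1, dualMul_cocycle hC hf.1 hf.2 hg.2⟩)⟩)
    (fun f f' g => Subtype.ext (by simp only [Submodule.coe_add, dualMul_add_left, smul_add]))
    (fun c f g => Subtype.ext (by
      simp only [Submodule.coe_smul, dualMul_smul_left, smul_smul, mul_comm]))
    (fun f g g' => Subtype.ext (by simp only [Submodule.coe_add, dualMul_add_right, smul_add]))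
    (fun c f g => Subtype.ext (by
      simp only [Submodule.coe_smul, dualMul_smul_right, smul_smul, mul_comm]))

theorem coe_mulCocycle (h : p + q = r) (f : cocycles 𝒞 D k (-p - m))
    (g : cocycles 𝒞 D k (-q - m)) : (mulCocycle hC h f g : C →ₗ[k] k) =
      sg k (p * q + m) • dualMul θ (f : C →ₗ[k] k) (g : C →ₗ[k] k) := rfl

/-- The dual of `B` on cocycles. -/
def deltaCocycle (hC : IsHomotopyCoBV (shift 𝒞 m) D θ B) (h : p + 1 = q) :
    cocycles 𝒞 D k (-p - m) →ₗ[k] cocycles 𝒞 D k (-q - m) :=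
  (sg k (p + m) • LinearMap.lcomp k k B).restrict (fun f hf => by
      have hf := mem_cocycles_iff.1 hf
      subst h
      exact Submodule.smul_mem _ _ (mem_cocycles_iff.2
        ⟨comp_B_supportedIn hC hf.1, comp_B_cocycle hC hf.2⟩))

theorem coe_deltaCocycle (h : p + 1 = q) (f : cocycles 𝒞 D k (-p - m)) :
    (deltaCocycle hC h f : C →ₗ[k] k) = sg k (p + m) • ((f : C →ₗ[k] k) ∘ₗ B) := rfl

/-- The product on cohomology. -/
def mulClass (hC : IsHomotopyCoBV (shift 𝒞 m) D θ B) (h : p + q = r) :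
    Cohomology 𝒞 D k (-p - m) →ₗ[k] Cohomology 𝒞 D k (-q - m) →ₗ[k] Cohomology 𝒞 D k (-r - m) :=
  liftQ₂ _ _ ((mulCocycle hC h).compr₂ (Submodule.mkQ _))
    (fun f hf g => by
      obtain ⟨w, hw, e⟩ := exists_of_mem_coboundaries hf
      have hg := mem_cocycles_iff.1 g.2
      subst h
      refine mk_eq_zero_of_exact (w := sg k (p * q + m) • dualMul θ w g) ?_ ?_
      · rw [show p + q + 1 = p + 1 + q by ring]
        exact (dualMul_supportedIn hC hw hg.1).smul _
      · rw [coe_mulCocycle, LinearMap.smul_comp, ← dualMul_exact_left hC hw hg.2]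
        exact congrArg (fun f => _ • dualMul θ f _) e)
    (fun f g hg => by
      obtain ⟨w, hw, e⟩ := exists_of_mem_coboundaries hg
      have hf := mem_cocycles_iff.1 f.2
      subst h
      refine mk_eq_zero_of_exact (w := sg k (p * q + m) • sg k p • dualMul θ f w) ?_ ?_
      · rw [add_assoc]
        exact ((dualMul_supportedIn hC hf.1 hw).smul _).smul _
      · rw [coe_mulCocycle, LinearMap.smul_comp, ← dualMul_exact_right hC hf.1 hf.2]
        exact congrArg (fun f => _ • dualMul θ _ f) e)

/-- The operator on cohomology induced by `B`. -/
def deltaClass (hC : IsHomotopyCoBV (shift 𝒞 m) D θ B) (h : p + 1 = q) :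
    Cohomology 𝒞 D k (-p - m) →ₗ[k] Cohomology 𝒞 D k (-q - m) :=
  Submodule.mapQ _ _ (deltaCocycle hC h) fun f hf => by
    obtain ⟨w, hw, e⟩ := exists_of_mem_coboundaries hf
    subst h
    refine mem_coboundaries (w := -(sg k (p + m) • (w ∘ₗ B))) ?_ ?_
    · intro j hj x hx
      rw [LinearMap.neg_apply, (comp_B_supportedIn hC hw).smul _ j hj x hx, neg_zero]
    · rw [LinearMap.neg_comp, LinearMap.smul_comp, comp_B_comp_D hC, smul_neg, neg_neg, ← e]
      rfl

theorem mulCocycle_seven_term (f : cocycles 𝒞 D k (-p - m)) (g : cocycles 𝒞 D k (-q - m))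
    (h : cocycles 𝒞 D k (-r - m)) : ∃ w, SupportedIn (shift 𝒞 m) (p + q + r + 1 + 1) w ∧
    (deltaCocycle hC (q := p + q + r + 1) rfl
        (mulCocycle hC rfl (mulCocycle hC rfl f g) h) : C →ₗ[k] k) -
      (mulCocycle hC (r := p + q + r + 1) (by omega) (deltaCocycle hC rfl (mulCocycle hC rfl f g)) h +
      sg k p • mulCocycle hC (by omega) f (deltaCocycle hC rfl (mulCocycle hC rfl g h)) +
      sg k ((p - 1) * q) • mulCocycle hC (by omega) g (deltaCocycle hC rfl (mulCocycle hC rfl f h)) -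
      mulCocycle hC (p := p + q + 1) (by omega) (mulCocycle hC (by omega) (deltaCocycle hC rfl f) g)
        h -
      sg k p • mulCocycle hC (p := p + q + 1) (by omega)
        (mulCocycle hC (by omega) f (deltaCocycle hC rfl g)) h -
      sg k (p + q) • mulCocycle hC (by omega) (mulCocycle hC rfl f g) (deltaCocycle hC rfl h) :
        cocycles 𝒞 D k (-(p + q + r + 1) - m)) = w ∘ₗ D := by
  have hf := mem_cocycles_iff.1 f.2
  have hg := mem_cocycles_iff.1 g.2
  have hh := mem_cocycles_iff.1 h.2
  obtain ⟨w, hw, e⟩ := dualMul_seven_term hC hf.1 hg.1 hh.1 hf.2 hg.2 hh.2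
  -- The total sign that two products and one `Δ` put on the leading term; modulo 2 it is common to
  -- all seven terms after their coefficients in the relation are taken into account.
  refine ⟨sg k (p * q + p * r + q * r + p + q + r + m) • w, ?_, ?_⟩
  · rw [add_assoc]
    exact hw.smul _
  rw [← sub_sub, ← sub_sub] at e
  simp only [Submodule.coe_add, Submodule.coe_sub, Submodule.coe_smul, coe_mulCocycle,
    coe_deltaCocycle, LinearMap.smul_comp, dualMul_smul_left, dualMul_smul_right, smul_smul,
    ← sg_add, ← e, smul_add, smul_sub]
  refine congrArg₂ (· - ·) (sg_smul_congr ?_) (congrArg₂ (· - ·) (congrArg₂ (· - ·)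
    (congrArg₂ (· - ·) (congrArg₂ (· + ·) (congrArg₂ (· + ·) (sg_smul_congr ?_) (sg_smul_congr ?_))
      (sg_smul_congr ?_)) (sg_smul_congr ?_)) (sg_smul_congr ?_)) (sg_smul_congr ?_)) <;>
  · push_cast
    clear * -
    grind

/-- The cohomology of the dual of a homotopy coBV coalgebra is a BV-algebra. -/
def cohomologyBVAlgebra (hC : IsHomotopyCoBV (shift 𝒞 m) D θ B) :
    BVAlgebra k (fun n => Cohomology 𝒞 D k (-n - m)) where
  mul h := mulClass hC h
  Δ h := deltaClass hC h
  mul_assoc := by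
    rintro p q r _ _ n rfl rfl rfl h₄ a b c
    obtain ⟨a, rfl⟩ := Submodule.Quotient.mk_surjective _ a
    obtain ⟨b, rfl⟩ := Submodule.Quotient.mk_surjective _ b
    obtain ⟨c, rfl⟩ := Submodule.Quotient.mk_surjective _ c
    refine congrArg Submodule.Quotient.mk (Subtype.ext
      (a1 := mulCocycle hC rfl (mulCocycle hC rfl a b) c)
      (a2 := mulCocycle hC h₄ a (mulCocycle hC rfl b c)) ?_)
    simp only [coe_mulCocycle, dualMul_smul_left, dualMul_smul_right, smul_smul, ← sg_add]
    rw [dualMul_assoc hC]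
    exact sg_smul_congr (by push_cast; ring)
  mul_comm := by
    rintro p q _ rfl h₂ a b
    obtain ⟨a, rfl⟩ := Submodule.Quotient.mk_surjective _ a
    obtain ⟨b, rfl⟩ := Submodule.Quotient.mk_surjective _ b
    have ha := mem_cocycles_iff.1 a.2
    have hb := mem_cocycles_iff.1 b.2
    obtain ⟨w, hw, e⟩ := dualMul_comm hC ha.1 hb.1 ha.2 hb.2
    refine mk_eq_of_exact (x := mulCocycle hC rfl a b) (y := sg k (p * q) • mulCocycle hC h₂ b a)
      (hw.smul (sg k (p * q + m))) ?_
    rw [Submodule.coe_smul, coe_mulCocycle, coe_mulCocycle, LinearMap.smul_comp, ← e, smul_sub,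
      smul_smul, smul_smul, ← sg_add, ← sg_add]
    exact congrArg₂ (· - ·) rfl (sg_smul_congr (by push_cast; ring))
  Δ_Δ := by
    rintro p _ _ rfl rfl a
    obtain ⟨a, rfl⟩ := Submodule.Quotient.mk_surjective _ a
    refine congrArg Submodule.Quotient.mk (Subtype.ext
      (a1 := deltaCocycle hC rfl (deltaCocycle hC rfl a)) (a2 := 0) ?_)
    rw [coe_deltaCocycle, coe_deltaCocycle, LinearMap.smul_comp, LinearMap.comp_assoc, hC.B_B,
      LinearMap.comp_zero, smul_zero, smul_zero]
    rfl
  seven_term := by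
    rintro p q r _ _ _ _ rfl rfl rfl rfl a b c
    obtain ⟨a, rfl⟩ := Submodule.Quotient.mk_surjective _ a
    obtain ⟨b, rfl⟩ := Submodule.Quotient.mk_surjective _ b
    obtain ⟨c, rfl⟩ := Submodule.Quotient.mk_surjective _ c
    obtain ⟨w, hw, e⟩ := mulCocycle_seven_term hC a b c
    exact mk_eq_of_exact hw e

end Cohomology

/-! ### Comparison with the cup product and the dual of Connes' operator. -/

section Signs

variable {k : Type*} [Field k] {A : Type*} [Ring A] [Algebra k A]
  {𝒜 : ℤ → Submodule k A} [GradedAlgebra 𝒜] {m : ℤ}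

theorem comp_sgn_pow {f : Chain k A →ₗ[k] k} {p : ℤ}
    (hf : SupportedIn (shift (chainGrading 𝒜) m) p f) :
    f ∘ₗ (sgn (chainGrading 𝒜) ^ m.natAbs) = sg k ((p + m) * m) • f := by
  refine hom_ext (chainGrading 𝒜) fun i x hx => ?_
  rw [LinearMap.comp_apply, sgn_pow_of_mem _ hx, map_smul, LinearMap.smul_apply,
    sg_mul_natAbs]
  by_cases h : i = p + m
  · rw [h]
  · have h0 : f x = 0 := hf (i - m) (fun e => h (by rw [← e]; ring)) x (by
      simpa only [shift, sub_add_cancel] using hx)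
    rw [h0, smul_zero, smul_zero]

/-- The cup product carries the exponent `p (q + m)` modulo 2. Passing from `θ` to `θ_m` adds `(p +
m) m`, since `f` lives in original degree `p + m`; the sum is `p * q + m`. -/
theorem cup_eq_dualMul (F : OpenFrobenius 𝒜 m) {p q : ℤ} {f : Chain k A →ₗ[k] k}
    (hf : SupportedIn (shift (chainGrading 𝒜) m) p f) (g : Chain k A →ₗ[k] k) :
    cup F (-p - m) (-q - m) f g = sg k (p * q + m) • dualMul (shiftedCoproduct F) f g := by
  rw [dualMul, shiftedCoproduct, ← LinearMap.comp_assoc, pair_rTensor, comp_sgn_pow hf,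
    pair_smul_left, LinearMap.smul_comp, smul_smul, ← sg_add]
  refine congrArg (fun c : k => c • _) (sg_congr ?_)
  push_cast
  clear * -
  grind [=_ intCast_mul_self]

theorem connesDual_eq (𝒜 : ℤ → Submodule k A) [GradedAlgebra 𝒜] (m p : ℤ)
    (f : Chain k A →ₗ[k] k) :
    connesDual 𝒜 (-p - m) f = sg k (p + m) • (f ∘ₗ connes 𝒜) := by
  rw [connesDual]
  refine congrArg (fun c : k => c • _) (sg_congr ?_)
  push_cast
  clear * -
  grind

end Signs

end HochBV

end

theorem mainTheorem4 {k : Type*} [Field k] {A : Type*} [Ring A] [Algebra k A]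
    (𝒜 : ℤ → Submodule k A) [GradedAlgebra 𝒜] (m : ℤ) (F : HochBV.OpenFrobenius 𝒜 m) :
    HochBV.IsHomotopyCoBV (HochBV.shift (HochBV.chainGrading 𝒜) m) (HochBV.chainDiff 𝒜 F.d)
      (HochBV.shiftedCoproduct F) (HochBV.connes 𝒜) ∧
    ∃ S : HochBV.BVAlgebra k (fun n => HochBV.HH F (-n - m)),
      (∀ (p q r : ℤ) (h : p + q = r) (f g : HochBV.Chain k A →ₗ[k] k)
        (hf : f ∈ HochBV.cocycles (HochBV.chainGrading 𝒜) (HochBV.chainDiff 𝒜 F.d) k (-p - m))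
        (hg : g ∈ HochBV.cocycles (HochBV.chainGrading 𝒜) (HochBV.chainDiff 𝒜 F.d) k (-q - m)),
        ∃ hfg : HochBV.cup F (-p - m) (-q - m) f g ∈
          HochBV.cocycles (HochBV.chainGrading 𝒜) (HochBV.chainDiff 𝒜 F.d) k (-r - m),
          S.mul h (HochBV.cls hf) (HochBV.cls hg) = HochBV.cls hfg) ∧
      (∀ (p q : ℤ) (h : p + 1 = q) (f : HochBV.Chain k A →ₗ[k] k)
        (hf : f ∈ HochBV.cocycles (HochBV.chainGrading 𝒜) (HochBV.chainDiff 𝒜 F.d) k (-p - m)),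
        ∃ hBf : HochBV.connesDual 𝒜 (-p - m) f ∈
          HochBV.cocycles (HochBV.chainGrading 𝒜) (HochBV.chainDiff 𝒜 F.d) k (-q - m),
          S.Δ h (HochBV.cls hf) = HochBV.cls hBf) := by
  refine ⟨HochBV.isHomotopyCoBV_chain F,
    HochBV.cohomologyBVAlgebra (HochBV.isHomotopyCoBV_chain F), ?_, ?_⟩
  · intro p q r h f g hf hg
    have e := HochBV.cup_eq_dualMul F (p := p) (q := q) (HochBV.mem_cocycles_iff.1 hf).1 g
    -- By the sign comparison the cup product is the cocycle product on the nose, so it is a cocycle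
    -- and represents the product of the classes.
    refine ⟨e ▸ (HochBV.mulCocycle (HochBV.isHomotopyCoBV_chain F) h ⟨f, hf⟩ ⟨g, hg⟩).2, ?_⟩
    exact congrArg Submodule.Quotient.mk (Subtype.ext e.symm)
  · intro p q h f hf
    have e := HochBV.connesDual_eq 𝒜 m p f
    refine ⟨e ▸ (HochBV.deltaCocycle (HochBV.isHomotopyCoBV_chain F) h ⟨f, hf⟩).2, ?_⟩
    exact congrArg Submodule.Quotient.mk (Subtype.ext e.symm)
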